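/- Let $n>2$ be an odd integer, $H=SO_0(n,1)$, and let $H_1=SO_0(n-1,1)\subset H$ be the subgroup fixing the last space-like basis vector $e_n$. For real $\mu$ let $H$ act on $C^\infty(S^{n-1})$ by $$\pi_\mu(h)F(u)=|cu+d|^{-\mu}F\big((au+b)(cu+d)^{-1}\big),\qquad h^{-1}=\begin{bmatrix}a&b\\c&d\end{bmatrix},$$ and pass to the non-compact picture by assigning to $F$ the function $$f(x)=\Big(\tfrac{2}{1+|x|^2}\Big)^{\mu}F\Big(\tfrac{1-|x|^2}{1+|x|^2},\tfrac{2x}{1+|x|^2}\Big),\quad x\in\mathbb R^{n-1};$$ these $f$ form $C^\infty_\mu(\mathbb R^{n-1})$. Put $$\|F\|_\mu^2=\int_{\mathbb R^{n-1}}|\mathcal Ff(\xi)|^2|\xi|^{n-1-2\mu}\,d\xi ,$$ where $\mathcal Ff$ is the Fourier transform of the tempered distribution $f$, restricted to $\mathbb R^{n-1}\setminus\{0\}$. Use the same notation for $H_1$, with $n-1$ in place of $n$. Let $j$ be an integer with $1\le j<\frac{n-2}{2}$. Then the following hold. 1. For $\mu=0$ the seminorm $\|\cdot\|_0$ on $C^\infty(S^{n-1})$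 is finite, vanishes exactly on the constants, and is $\pi_0(H)$-invariant. Let $\mathcal W_0$ be the completion of $C^\infty(S^{n-1})/\mathbb C$; it is a unitary representation of $H$. Likewise $\|\cdot\|_j$ is a finite, $\pi_j(H_1)$-invariant Hilbert norm on $C^\infty(S^{n-2})$. Let $\mathcal C_j$ be the completion; it is a unitary representation of $H_1$, the complementary series with parameter $j$. 2. There is an operator $\mathcal D_{0,j}:C^\infty_0(\mathbb R^{n-1})\to C^\infty_j(\mathbb R^{n-2})$ of the form $$\mathcal D_{0,j}f(y)=\Big(\sum_{2k\le j}C_k\,\partial_{n-1}^{\,j-2k}(\partial_1^2+\dots+\partial_{n-2}^2)^k f\Big)(y,0),\qquad C_k\in\mathbb C,\ C_0=1,$$ which intertwines the actions $\pi_0$ and $\pi_j$ of $H_1$. 3. Every operator as in 2 extends to a bounded $H_1$-equivariant operator from $\mathcal W_0$ onto $\mathcal C_j$. 4. $\mathcal C_j$ is a discrete component of $\mathcal W_0$ restricted to $H_1$: there is an $H_1$-equivariant linear isometry $\mathcal C_j\to\mathcal W_0$. -/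

import Mathlib

open scoped ContDiff Manifold FourierTransform SchwartzMap Matrix

namespace LorentzBranching

/-! ### The Lorentz group `SO₀(n,1)` and its subgroup `SO₀(n-1,1)` -/

/-- The Gram matrix `diag(1, …, 1, -1)` of the form of signature `(n,1)`. -/
abbrev form (n : ℕ) : Matrix (Fin n ⊕ Unit) (Fin n ⊕ Unit) ℝ :=
  LieAlgebra.Orthogonal.indefiniteDiagonal (Fin n) Unit ℝ

theorem form_mul_form (n : ℕ) : form n * form n = 1 := by
  ext i j
  simp only [form, LieAlgebra.Orthogonal.indefiniteDiagonal, Matrix.diagonal_mul_diagonal]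
  rcases i with i | i <;> rcases j with j | j <;> simp [Matrix.diagonal_apply, Matrix.one_apply]

theorem mul_form_transpose {n : ℕ} {g : Matrix (Fin n ⊕ Unit) (Fin n ⊕ Unit) ℝ}
    (h : gᵀ * form n * g = form n) : g * form n * gᵀ = form n := by
  have h1 : (form n * gᵀ * form n) * g = 1 := by
    rw [mul_assoc (form n), mul_assoc (form n), h, form_mul_form]
  have h2 : g * (form n * gᵀ * form n) = 1 := mul_eq_one_comm.mp h1
  calc g * form n * gᵀ = g * (form n * gᵀ * form n) * form n := by
        simp only [mul_assoc, form_mul_form, mul_one]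
    _ = form n := by rw [h2, one_mul]

theorem sum_sq_row {n : ℕ} {g : Matrix (Fin n ⊕ Unit) (Fin n ⊕ Unit) ℝ}
    (h : gᵀ * form n * g = form n) :
    ∑ i, g (.inr ()) (.inl i) ^ 2 = g (.inr ()) (.inr ()) ^ 2 - 1 := by
  have := congrFun (congrFun (mul_form_transpose h) (.inr ())) (.inr ())
  simp [form, LieAlgebra.Orthogonal.indefiniteDiagonal, Matrix.mul_apply,
    Matrix.diagonal_apply, Fintype.sum_sum_type] at this
  simp only [pow_two]
  linarith

theorem sum_sq_col {n : ℕ} {g : Matrix (Fin n ⊕ Unit) (Fin n ⊕ Unit) ℝ}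
    (h : gᵀ * form n * g = form n) :
    ∑ i, g (.inl i) (.inr ()) ^ 2 = g (.inr ()) (.inr ()) ^ 2 - 1 := by
  have := congrFun (congrFun h (.inr ())) (.inr ())
  simp [form, LieAlgebra.Orthogonal.indefiniteDiagonal, Matrix.mul_apply,
    Matrix.diagonal_apply, Fintype.sum_sum_type] at this
  simp only [pow_two]
  linarith

/-- `SO₀(n,1)`: the matrices of determinant one which preserve the form and the forward light
cone, that is, whose last diagonal entry is positive. -/
def SO0 (n : ℕ) : Subgroup (Matrix.SpecialLinearGroup (Fin n ⊕ Unit) ℝ) where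
  carrier := {g | g.1ᵀ * form n * g.1 = form n ∧ 0 < g.1 (.inr ()) (.inr ())}
  one_mem' := by simp
  mul_mem' := by
    rintro a b ⟨ha, ha'⟩ ⟨hb, hb'⟩
    refine ⟨?_, ?_⟩
    · rw [Matrix.SpecialLinearGroup.coe_mul, Matrix.transpose_mul]
      calc b.1ᵀ * a.1ᵀ * form n * (a.1 * b.1) = b.1ᵀ * (a.1ᵀ * form n * a.1) * b.1 := by
            simp only [mul_assoc]
        _ = form n := by rw [ha, hb]
    · rw [Matrix.SpecialLinearGroup.coe_mul, Matrix.mul_apply, Fintype.sum_sum_type]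
      have h1 := sum_sq_row ha
      have h2 := sum_sq_col hb
      have h3 := Finset.sum_mul_sq_le_sq_mul_sq Finset.univ
        (fun i => a.1 (.inr ()) (.inl i)) (fun i => b.1 (.inl i) (.inr ()))
      rw [h1, h2] at h3
      simp only [Finset.univ_unique, PUnit.default_eq_unit, Finset.sum_singleton]
      set s := ∑ i, a.1 (.inr ()) (.inl i) * b.1 (.inl i) (.inr ())
      set p := a.1 (.inr ()) (.inr ())
      set q := b.1 (.inr ()) (.inr ())
      have h4 : 0 ≤ p ^ 2 - 1 := h1 ▸ Finset.sum_nonneg fun i _ => sq_nonneg _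
      have h5 : 0 ≤ q ^ 2 - 1 := h2 ▸ Finset.sum_nonneg fun i _ => sq_nonneg _
      have h6 : s ^ 2 < (p * q) ^ 2 := by nlinarith
      have h7 := abs_lt_of_sq_lt_sq h6 (by positivity)
      linarith [(abs_lt.mp h7).1]
  inv_mem' := by
    rintro a ⟨ha, ha'⟩
    have h1 : (form n * a.1ᵀ * form n) * a.1 = 1 := by
      rw [mul_assoc (form n), mul_assoc (form n), ha, form_mul_form]
    have h2 : (a⁻¹).1 = form n * a.1ᵀ * form n := by
      have h3 : a.1 * (a⁻¹).1 = 1 := by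
        rw [← Matrix.SpecialLinearGroup.coe_mul, mul_inv_cancel, Matrix.SpecialLinearGroup.coe_one]
      calc (a⁻¹).1 = ((form n * a.1ᵀ * form n) * a.1) * (a⁻¹).1 := by rw [h1, one_mul]
        _ = _ := by rw [mul_assoc, h3, mul_one]
    refine ⟨?_, ?_⟩
    · have hJ : (form n)ᵀ = form n := by
        simp [form, LieAlgebra.Orthogonal.indefiniteDiagonal]
      rw [h2]
      simp only [Matrix.transpose_mul, Matrix.transpose_transpose, hJ]
      calc form n * (a.1 * form n) * form n * (form n * a.1ᵀ * form n)
          = form n * (a.1 * (form n * form n) * (form n * a.1ᵀ)) * form n := by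
            simp only [mul_assoc]
        _ = form n := by
            rw [form_mul_form, mul_one, ← mul_assoc a.1, mul_form_transpose ha, form_mul_form,
              one_mul]
    · rw [h2]
      simpa [form, LieAlgebra.Orthogonal.indefiniteDiagonal, Matrix.mul_apply,
        Matrix.diagonal_apply, Fintype.sum_sum_type] using ha'

/-- The reordering of coordinates which inserts one new space coordinate after the `n` old ones
and before the time coordinate. -/
def insertCoord (n : ℕ) : (Fin n ⊕ Unit) ⊕ Unit ≃ Fin (n + 1) ⊕ Unit where
  toFun
    | .inl (.inl i) => .inl i.castSucc
    | .inl (.inr _) => .inr ()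
    | .inr _ => .inl (Fin.last n)
  invFun
    | .inl i => Fin.lastCases (motive := fun _ => (Fin n ⊕ Unit) ⊕ Unit)
        (.inr ()) (fun i => .inl (.inl i)) i
    | .inr _ => .inl (.inr ())
  left_inv := by rintro ((i | i) | i) <;> simp
  right_inv := by
    rintro (i | i)
    · refine Fin.lastCases ?_ (fun i => ?_) i <;> simp
    · simp

/-- The matrix `g` extended by the identity on the new space coordinate. -/
def extendMatrix {n : ℕ} (g : Matrix (Fin n ⊕ Unit) (Fin n ⊕ Unit) ℝ) :
    Matrix (Fin (n + 1) ⊕ Unit) (Fin (n + 1) ⊕ Unit) ℝ :=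
  Matrix.reindex (insertCoord n) (insertCoord n) (Matrix.fromBlocks g 0 0 1)

theorem extendMatrix_mul {n : ℕ} (g h : Matrix (Fin n ⊕ Unit) (Fin n ⊕ Unit) ℝ) :
    extendMatrix (g * h) = extendMatrix g * extendMatrix h := by
  simp [extendMatrix, Matrix.fromBlocks_multiply]

theorem extendMatrix_one (n : ℕ) :
    extendMatrix (1 : Matrix (Fin n ⊕ Unit) (Fin n ⊕ Unit) ℝ) = 1 := by
  simp [extendMatrix]

theorem extendMatrix_form (n : ℕ) : extendMatrix (form n) = form (n + 1) := by
  ext i j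
  rcases i with i | i <;> rcases j with j | j
  · refine Fin.lastCases ?_ (fun i => ?_) i <;> refine Fin.lastCases ?_ (fun j => ?_) j <;>
      simp [extendMatrix, insertCoord, form, LieAlgebra.Orthogonal.indefiniteDiagonal,
        Matrix.diagonal_apply, Fin.ext_iff] <;> omega
  · refine Fin.lastCases ?_ (fun i => ?_) i <;>
      simp [extendMatrix, insertCoord, form, LieAlgebra.Orthogonal.indefiniteDiagonal]
  · refine Fin.lastCases ?_ (fun j => ?_) j <;>
      simp [extendMatrix, insertCoord, form, LieAlgebra.Orthogonal.indefiniteDiagonal]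
  · simp [extendMatrix, insertCoord, form, LieAlgebra.Orthogonal.indefiniteDiagonal]

/-- The inclusion `SO₀(n,1) → SO₀(n+1,1)` onto the subgroup which fixes the last space-like basis
vector. -/
def incl (n : ℕ) : SO0 n →* SO0 (n + 1) where
  toFun g := ⟨⟨extendMatrix g.1.1, by
      rw [extendMatrix, Matrix.det_reindex_self, Matrix.det_fromBlocks_zero₂₁, g.1.2]; simp⟩, by
      refine ⟨?_, ?_⟩
      · have : (extendMatrix g.1.1)ᵀ = extendMatrix (g.1.1ᵀ) := by
          simp [extendMatrix, Matrix.fromBlocks_transpose]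
        change (extendMatrix g.1.1)ᵀ * form (n + 1) * extendMatrix g.1.1 = form (n + 1)
        rw [this, ← extendMatrix_form, ← extendMatrix_mul, ← extendMatrix_mul, g.2.1]
      · simpa [extendMatrix, insertCoord] using g.2.2⟩
  map_one' := by
    apply Subtype.ext; apply Subtype.ext
    exact extendMatrix_one n
  map_mul' g h := by
    apply Subtype.ext; apply Subtype.ext
    exact extendMatrix_mul g.1.1 h.1.1

/-! ### Spherical principal series on the sphere -/

/-- The unit sphere `S^N` in `ℝ^(N+1)`. -/
abbrev Sph (N : ℕ) : Type := Metric.sphere (0 : EuclideanSpace ℝ (Fin (N + 1))) 1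

instance factFinrank (N : ℕ) :
    Fact (Module.finrank ℝ (EuclideanSpace ℝ (Fin (N + 1))) = N + 1) := ⟨by simp⟩

/-- The complex vector space `C^∞(S^N)`. -/
def SmoothSphere (N : ℕ) : Submodule ℂ (Sph N → ℂ) where
  carrier := {F | ContMDiff (𝓡 N) 𝓘(ℝ, ℂ) ∞ F}
  zero_mem' := contMDiff_const
  add_mem' hF hG := hF.add hG
  smul_mem' c F hF := by
    have h : ContDiff ℝ ∞ (fun z : ℂ => c * z) := contDiff_const.mul contDiff_id
    exact h.contMDiff.comp hF

/-- The constant functions in `C^∞(S^N)`. -/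
def constants (N : ℕ) : Submodule ℂ (SmoothSphere N) where
  carrier := {F | ∃ c : ℂ, ∀ u, F.1 u = c}
  zero_mem' := ⟨0, fun _ => rfl⟩
  add_mem' := by
    rintro F G ⟨c, hc⟩ ⟨d, hd⟩
    exact ⟨c + d, fun u => by simp [hc u, hd u]⟩
  smul_mem' := by
    rintro a F ⟨c, hc⟩
    exact ⟨a * c, fun u => by simp [hc u]⟩

/-- For `g` with blocks `a, b, c, d` the vector `g (u, 1) = (a u + b, c u + d)`. -/
def lift {N : ℕ} (g : SO0 (N + 1)) (u : EuclideanSpace ℝ (Fin (N + 1))) :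
    Fin (N + 1) ⊕ Unit → ℝ :=
  g.1.1 *ᵥ Sum.elim (fun i => u i) (fun _ => 1)

/-- The vector `a u + b`. -/
def num {N : ℕ} (g : SO0 (N + 1)) (u : EuclideanSpace ℝ (Fin (N + 1))) :
    EuclideanSpace ℝ (Fin (N + 1)) :=
  WithLp.toLp 2 fun i => lift g u (.inl i)

/-- The number `c u + d`. -/
def den {N : ℕ} (g : SO0 (N + 1)) (u : EuclideanSpace ℝ (Fin (N + 1))) : ℝ :=
  lift g u (.inr ())

theorem dotProduct_form {n : ℕ} (v : Fin n ⊕ Unit → ℝ) :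
    v ⬝ᵥ (form n *ᵥ v) = ∑ i, v (.inl i) ^ 2 - v (.inr ()) ^ 2 := by
  simp [form, LieAlgebra.Orthogonal.indefiniteDiagonal, Matrix.mulVec_diagonal, dotProduct,
    Fintype.sum_sum_type, pow_two, sub_eq_add_neg]

theorem norm_num_sq {N : ℕ} (g : SO0 (N + 1)) (u : Sph N) :
    ‖num g u.1‖ ^ 2 = den g u.1 ^ 2 := by
  have h1 := dotProduct_form (lift g u.1)
  have h2 : lift g u.1 ⬝ᵥ (form (N + 1) *ᵥ lift g u.1) = 0 := by
    have hu : ∑ i, (u.1 i) ^ 2 = 1 := by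
      have := EuclideanSpace.norm_sq_eq u.1
      rw [mem_sphere_zero_iff_norm.mp u.2] at this
      simpa using this.symm
    have h3 := dotProduct_form (n := N + 1) (Sum.elim (fun i => u.1 i) (fun _ => (1 : ℝ)))
    simp only [Sum.elim_inl, Sum.elim_inr, hu] at h3
    rw [← g.2.1] at h3
    rw [lift, Matrix.mulVec_mulVec, Matrix.dotProduct_mulVec, Matrix.vecMul_mulVec,
      ← Matrix.dotProduct_mulVec] at *
    simpa [mul_assoc] using h3
  rw [h2] at h1
  rw [EuclideanSpace.norm_sq_eq]
  simp only [num, den, Real.norm_eq_abs, sq_abs]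
  linarith

theorem den_pos {N : ℕ} (g : SO0 (N + 1)) (u : Sph N) : 0 < den g u.1 := by
  have h1 := sum_sq_row g.2.1
  have h2 := Finset.sum_mul_sq_le_sq_mul_sq Finset.univ
    (fun i => g.1.1 (.inr ()) (.inl i)) (fun i => u.1 i)
  have hu : ∑ i, (u.1 i) ^ 2 = 1 := by
    have := EuclideanSpace.norm_sq_eq u.1
    rw [mem_sphere_zero_iff_norm.mp u.2] at this
    simpa using this.symm
  rw [h1, hu, mul_one] at h2
  have h3 : den g u.1 = ∑ i, g.1.1 (.inr ()) (.inl i) * u.1 i + g.1.1 (.inr ()) (.inr ()) := by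
    simp [den, lift, Matrix.mulVec, dotProduct, Fintype.sum_sum_type]
  have h4 := g.2.2
  have h5 := abs_lt_of_sq_lt_sq (lt_of_le_of_lt h2 (sub_one_lt _)) h4.le
  rw [h3]
  linarith [(abs_lt.mp h5).1]

/-- The action `u ↦ (a u + b) (c u + d)⁻¹` of `SO₀(N+1,1)` on `S^N`. -/
noncomputable def moebius {N : ℕ} (g : SO0 (N + 1)) (u : Sph N) : Sph N :=
  ⟨(den g u.1)⁻¹ • num g u.1, by
    have h1 := norm_num_sq g u
    have h2 := den_pos g u
    have h3 : ‖num g u.1‖ = den g u.1 := by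
      rwa [sq_eq_sq₀ (norm_nonneg _) h2.le] at h1
    rw [mem_sphere_zero_iff_norm, norm_smul, h3, norm_inv, Real.norm_of_nonneg h2.le,
      inv_mul_cancel₀ h2.ne']⟩

theorem lift_mul {N : ℕ} (g h : SO0 (N + 1)) (u : Sph N) :
    lift (g * h) u.1 = den h u.1 • lift g (moebius h u).1 := by
  have hd := (den_pos h u).ne'
  have : Sum.elim (fun i => (moebius h u).1 i) (fun _ => (1 : ℝ)) =
      (den h u.1)⁻¹ • lift h u.1 := by
    ext i
    rcases i with i | i
    · simp [moebius, num]
    · exact (inv_mul_cancel₀ hd).symm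
  rw [lift, lift, this, Matrix.mulVec_smul, smul_smul, mul_inv_cancel₀ hd, one_smul, lift,
    Matrix.mulVec_mulVec]
  rfl

theorem den_mul {N : ℕ} (g h : SO0 (N + 1)) (u : Sph N) :
    den (g * h) u.1 = den g (moebius h u).1 * den h u.1 := by
  rw [den, lift_mul, Pi.smul_apply, smul_eq_mul, mul_comm]; rfl

theorem moebius_mul {N : ℕ} (g h : SO0 (N + 1)) (u : Sph N) :
    moebius (g * h) u = moebius g (moebius h u) := by
  have hd := (den_pos h u).ne'
  apply Subtype.ext
  ext i
  have h1 : num (g * h) u.1 i = den h u.1 * num g (moebius h u).1 i := by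
    simp [num, lift_mul]
  change (den (g * h) u.1)⁻¹ * num (g * h) u.1 i =
    (den g (moebius h u).1)⁻¹ * num g (moebius h u).1 i
  rw [h1, den_mul, mul_inv]
  field_simp

theorem lift_one {N : ℕ} (u : EuclideanSpace ℝ (Fin (N + 1))) :
    lift (1 : SO0 (N + 1)) u = Sum.elim (fun i => u i) (fun _ => 1) := by
  simp [lift]

theorem den_one {N : ℕ} (u : Sph N) : den (1 : SO0 (N + 1)) u.1 = 1 := by
  simp [den, lift_one]

theorem moebius_one {N : ℕ} (u : Sph N) : moebius (1 : SO0 (N + 1)) u = u := by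
  apply Subtype.ext
  ext i
  simp [moebius, den_one, num, lift_one]

theorem contDiff_lift {N : ℕ} (g : SO0 (N + 1)) (k : Fin (N + 1) ⊕ Unit) :
    ContDiff ℝ ∞ (fun u => lift g u k) := by
  have : (fun u => lift g u k) = fun u : EuclideanSpace ℝ (Fin (N + 1)) =>
      ∑ i, g.1.1 k (.inl i) * u i + g.1.1 k (.inr ()) := by
    ext u
    simp [lift, Matrix.mulVec, dotProduct, Fintype.sum_sum_type]
  rw [this]
  fun_prop

theorem contMDiff_den {N : ℕ} (g : SO0 (N + 1)) :
    ContMDiff (𝓡 N) 𝓘(ℝ, ℝ) ∞ (fun u : Sph N => den g u.1) :=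
  (contDiff_lift g (.inr ())).contMDiff.comp contMDiff_coe_sphere

theorem contMDiff_moebius {N : ℕ} (g : SO0 (N + 1)) :
    ContMDiff (𝓡 N) (𝓡 N) ∞ (moebius g : Sph N → Sph N) := by
  have h1 : ContMDiff (𝓡 N) 𝓘(ℝ, EuclideanSpace ℝ (Fin (N + 1))) ∞
      (fun u : Sph N => (den g u.1)⁻¹ • num g u.1) := by
    have hs : ContDiff ℝ ∞ (fun p : ℝ × EuclideanSpace ℝ (Fin (N + 1)) => p.1 • p.2) :=
      contDiff_fst.smul contDiff_snd
    refine hs.contMDiff.comp (ContMDiff.prodMk_space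
      (f := fun u : Sph N => (den g u.1)⁻¹) (g := fun u : Sph N => num g u.1) ?_ ?_)
    · intro u
      have h : ContDiffAt ℝ ∞ (fun t : ℝ => t⁻¹) (den g u.1) :=
        contDiffAt_inv ℝ (den_pos g u).ne'
      exact h.contMDiffAt.comp u (contMDiff_den g u)
    · have h : ContDiff ℝ ∞ (num g) := by
        rw [contDiff_euclidean]
        exact fun i => contDiff_lift g (.inl i)
      exact h.contMDiff.comp contMDiff_coe_sphere
  exact h1.codRestrict_sphere fun u => (moebius g u).2

/-- The spherical principal series `π_μ` of `SO₀(N+1,1)` on `C^∞(S^N)`: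
`(π_μ(h) F)(u) = |c u + d|^(-μ) F((a u + b) (c u + d)⁻¹)`, where `a, b, c, d` are the blocks
of `h⁻¹`. -/
noncomputable def principalSeries (N : ℕ) (μ : ℝ) :
    Representation ℂ (SO0 (N + 1)) (SmoothSphere N) where
  toFun h :=
    { toFun := fun F => ⟨fun u => ((|den h⁻¹ u.1| ^ (-μ) : ℝ) : ℂ) * F.1 (moebius h⁻¹ u), by
        have h1 : ContMDiff (𝓡 N) 𝓘(ℝ, ℂ) ∞
            (fun u : Sph N => ((|den h⁻¹ u.1| ^ (-μ) : ℝ) : ℂ)) := by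
          intro u
          have hp := den_pos h⁻¹ u
          have h2 : ContDiffAt ℝ ∞ (fun t : ℝ => ((|t| ^ (-μ) : ℝ) : ℂ)) (den h⁻¹ u.1) :=
            Complex.ofRealCLM.contDiff.contDiffAt.comp _
              ((contDiffAt_abs hp.ne').rpow_const_of_ne (abs_pos.mpr hp.ne').ne')
          exact h2.contMDiffAt.comp u (contMDiff_den h⁻¹ u)
        have h3 : ContMDiff (𝓡 N) 𝓘(ℝ, ℂ) ∞ F.1 := F.2
        have h4 : ContDiff ℝ ∞ (fun p : ℂ × ℂ => p.1 * p.2) := contDiff_fst.mul contDiff_snd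
        exact h4.contMDiff.comp (h1.prodMk_space (h3.comp (contMDiff_moebius h⁻¹)))⟩
      map_add' := fun F G => by
        apply Subtype.ext; funext u
        simp [mul_add]
      map_smul' := fun a F => by
        apply Subtype.ext; funext u
        simp [mul_left_comm] }
  map_one' := by
    apply LinearMap.ext; intro F; apply Subtype.ext; funext u
    simp [den_one, moebius_one]
  map_mul' g h := by
    apply LinearMap.ext; intro F; apply Subtype.ext; funext u
    simp [den_mul, moebius_mul, abs_mul, Real.mul_rpow (abs_nonneg _) (abs_nonneg _)]
    ring

/-! ### The non-compact picture -/

/-- The conformal coordinate `ℝ^N → S^N`,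
`x ↦ ((1 - |x|²) / (1 + |x|²), 2 x / (1 + |x|²))`, which omits the point `-e₁`. -/
noncomputable def cayley {N : ℕ} (x : EuclideanSpace ℝ (Fin N)) : Sph N :=
  ⟨WithLp.toLp 2 (Fin.cons ((1 - ‖x‖ ^ 2) / (1 + ‖x‖ ^ 2)) fun i => 2 * x i / (1 + ‖x‖ ^ 2)), by
    have h : (0 : ℝ) < 1 + ‖x‖ ^ 2 := by positivity
    have hx : ∑ i, x i ^ 2 = ‖x‖ ^ 2 := by
      rw [EuclideanSpace.norm_sq_eq]; simp
    rw [mem_sphere_zero_iff_norm, ← sq_eq_sq₀ (norm_nonneg _) zero_le_one,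
      EuclideanSpace.norm_sq_eq, Fin.sum_univ_succ]
    simp only [Fin.cons_zero, Fin.cons_succ, Real.norm_eq_abs, sq_abs, div_pow, mul_pow,
      ← Finset.sum_div, ← Finset.mul_sum, hx]
    field_simp
    ring⟩

/-- The function on `ℝ^N` which represents `F ∈ C^∞(S^N)` in the non-compact picture of `π_μ`:
`f(x) = (2 / (1 + |x|²))^μ F(cayley x)`. These functions form the space `C^∞_μ(ℝ^N)`. -/
noncomputable def noncompact {N : ℕ} (μ : ℝ) (F : SmoothSphere N)
    (x : EuclideanSpace ℝ (Fin N)) : ℂ :=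
  (((2 / (1 + ‖x‖ ^ 2)) ^ μ : ℝ) : ℂ) * F.1 (cayley x)

/-! ### The Hilbert spaces -/

/-- The Hilbert space of (classes of) functions `g` on `ℝ^N` with norm
`‖g‖² = ∫ |g(ξ)|² |ξ|^(N-2μ) dξ`. -/
abbrev WeightedL2 (N : ℕ) (μ : ℝ) : Type :=
  MeasureTheory.Lp (α := EuclideanSpace ℝ (Fin N)) ℂ 2
    (MeasureTheory.volume.withDensity fun ξ => ENNReal.ofReal (‖ξ‖ ^ ((N : ℝ) - 2 * μ)))

/-- The tempered distribution given by the (bounded) function `f` has a Fourier transform which,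
on the complement of the origin, is the function `g`. -/
def IsFourierTransformOffZero {N : ℕ} (f g : EuclideanSpace ℝ (Fin N) → ℂ) : Prop :=
  ∀ φ : 𝓢(EuclideanSpace ℝ (Fin N), ℂ), (0 : EuclideanSpace ℝ (Fin N)) ∉ tsupport φ →
    ∫ x, f x * (𝓕 φ) x = ∫ ξ, g ξ * φ ξ

/-- `ι` and `U` present the weighted `L²`-space as the Hilbert space completion of `C^∞(S^N)`,
modulo the functions of norm zero, for the norm
`‖F‖_μ² = ∫ |𝓕 f(ξ)|² |ξ|^(N-2μ) dξ`, `f = noncompact μ F`,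
with `U` the unitary representation of `SO₀(N+1,1)` which extends `π_μ`. -/
structure IsUnitaryCompletion (N : ℕ) (μ : ℝ) (ι : SmoothSphere N →ₗ[ℂ] WeightedL2 N μ)
    (U : SO0 (N + 1) →* (WeightedL2 N μ ≃ₗᵢ[ℂ] WeightedL2 N μ)) : Prop where
  fourier : ∀ F, IsFourierTransformOffZero (noncompact μ F) (ι F)
  dense : DenseRange ι
  extends_action : ∀ h F, U h (ι F) = ι (principalSeries N μ h F)
  continuous : ∀ v, Continuous fun h => U h v

/-! ### The intertwining differential operators -/

/-- The partial derivative `∂_i f`. -/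
noncomputable def pderiv {N : ℕ} (i : Fin N) (f : EuclideanSpace ℝ (Fin N) → ℂ) :
    EuclideanSpace ℝ (Fin N) → ℂ :=
  fun x => fderiv ℝ f x (EuclideanSpace.single i 1)

/-- The Laplacian `∂_1² + ⋯ + ∂_m²` in the first `m` of `m + 1` variables. -/
noncomputable def tangentialLaplacian {m : ℕ} (f : EuclideanSpace ℝ (Fin (m + 1)) → ℂ) :
    EuclideanSpace ℝ (Fin (m + 1)) → ℂ :=
  fun x => ∑ i : Fin m, pderiv i.castSucc (pderiv i.castSucc f) x

/-- The operator `f ↦ (∑_{2k ≤ j} C_k ∂_{m+1}^{j-2k} (∂_1² + ⋯ + ∂_m²)^k f)(y, 0)`. -/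
noncomputable def normalOperator {m : ℕ} (C : ℕ → ℂ) (j : ℕ)
    (f : EuclideanSpace ℝ (Fin (m + 1)) → ℂ) (y : EuclideanSpace ℝ (Fin m)) : ℂ :=
  ∑ k ∈ Finset.range (j / 2 + 1),
    C k * ((pderiv (Fin.last m))^[j - 2 * k] (tangentialLaplacian^[k] f))
      (WithLp.toLp 2 (Fin.snoc (fun i => y i) 0))

/-- `D`, written on the spheres, is an operator `𝒟_{μ,j} : C^∞_μ(ℝ^(m+1)) → C^∞_{μ+j}(ℝ^m)` of the
form `normalOperator C j` with `C 0 = 1` which intertwines the actions `π_μ` and `π_{μ+j}` of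
`SO₀(m+1,1)`, the subgroup of `SO₀(m+2,1)` that fixes the last space-like basis vector. -/
structure IsIntertwiningDiffOp (m : ℕ) (μ : ℝ) (j : ℕ)
    (D : SmoothSphere (m + 1) →ₗ[ℂ] SmoothSphere m) : Prop where
  expression : ∃ C : ℕ → ℂ, C 0 = 1 ∧
    ∀ F, noncompact (μ + j) (D F) = normalOperator C j (noncompact μ F)
  intertwines : ∀ (h : SO0 (m + 1)) (F : SmoothSphere (m + 1)),
    D (principalSeries (m + 1) μ (incl (m + 1) h) F) = principalSeries m (μ + j) h (D F)

end LorentzBranching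

open scoped ContDiff Manifold FourierTransform SchwartzMap Matrix

namespace LorentzBranching

open MeasureTheory

/-! ### Duality in the weighted `L²`-spaces -/

/-! Everything on the Hilbert space side is done by duality. A function on the sphere is not Fourier
transformed directly; it is paired with densities of weight `N - μ`, required to have total mass
zero if `μ = 0`. For such a density `g` the integral of `|𝓕 g|² |ξ|^(-(N-2μ))` is, up to a positive
constant, the Riesz energy of `g` with kernel `Γ(μ)|x-y|^(-2μ)`, or `-log |x-y|²` if `μ = 0`. This
is proved by writing kernel and weight as superpositions of Gaussians (`dualEnergy_fourier`). A
conformal map `T` satisfies `|Tx-Ty|² = ρ(x)ρ(y)|x-y|²`, so pullback of densities preserves the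
energy; for the logarithm the additive terms `log ρ` are killed by the vanishing mass. The
potentials of densities are dense in the weighted `L²`-space, so pullback extends to a contraction
there, and its adjoint restricts to `π_μ` on the elements representing functions on the sphere
(`Represents`). Contractions that form a group are unitary. The kernel of the completion map is
found by pairing `F` with a positive multiple of its own non-compact picture.

The differential operator is built in the ambient Lorentz space. Extend `F` to a function
homogeneous of degree zero near the forward light cone and apply `∑ C_k ∂_s^(j-2k) □^k`, where `s`
is the normal coordinate and `□` the wave operator in the other ones. At cone points with `x_s = 0`
the result depends only on the values on the cone precisely because the recursion for `diffCoeff`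
cancels the commutators with the quadratic form (`sum_diffCoeff_eq_zero`,
`normalFun_eq_of_eqOn_cone`); oddness keeps its denominators nonzero. Since `H₁` acts linearly,
fixes `e_s` and preserves `□`, intertwining is immediate, and homogeneity of degree `-j` produces
the weight `j`. Evaluating on the affine slice `coneHeight = 1`, with an extension constant along a
null direction, gives the normal operator on `ℝ^(m+1)`.

For boundedness, restriction to the hyperplane becomes, on the Fourier side, integration over the
normal frequency against a polynomial symbol `P`. By homogeneity the integral of `|P|² |ξ|^(-(m+1))`
over a normal line is a constant times `|η|^(-(m-2j))`, exactly the dual weight of `C_j`, and the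
constant is finite because `2j < m` and nonzero because `C_0 = 1` (`symbolMass`). Hence
multiplication by the conjugate symbol is a multiple of an isometry from `C_j` into `W_0`. Its
adjoint is onto and extends the differential operator (`symbolAdjoint_apply`), and equivariance
passes from the adjoint to the isometry. -/

/-- The measure `|ξ|^(N-2μ) dξ`. -/
noncomputable abbrev weightMeasure (N : ℕ) (μ : ℝ) : Measure (EuclideanSpace ℝ (Fin N)) :=
  volume.withDensity fun ξ => ENNReal.ofReal (‖ξ‖ ^ ((N : ℝ) - 2 * μ))

theorem measurable_weight (N : ℕ) (a : ℝ) :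
    Measurable fun ξ : EuclideanSpace ℝ (Fin N) => ENNReal.ofReal (‖ξ‖ ^ a) := by
  fun_prop

theorem ae_ne_zero {N : ℕ} (hN : 1 ≤ N) : ∀ᵐ ξ : EuclideanSpace ℝ (Fin N), ξ ≠ 0 := by
  have : Nonempty (Fin N) := ⟨⟨0, hN⟩⟩
  have : Nontrivial (EuclideanSpace ℝ (Fin N)) := inferInstance
  exact Measure.ae_ne volume 0

/-- The weight can only vanish at the origin, a null set in positive dimension. With the converse
below, almost everywhere statements pass freely between the two measures. -/
theorem volume_absolutelyContinuous_weight {N : ℕ} (hN : 1 ≤ N) (μ : ℝ) :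
    (volume : Measure (EuclideanSpace ℝ (Fin N))) ≪ weightMeasure N μ := by
  refine withDensity_absolutelyContinuous' (measurable_weight N _).aemeasurable ?_
  filter_upwards [ae_ne_zero hN] with ξ hξ
  have : 0 < ‖ξ‖ ^ ((N : ℝ) - 2 * μ) := Real.rpow_pos_of_pos (norm_pos_iff.mpr hξ) _
  simpa using this

theorem weight_absolutelyContinuous (N : ℕ) (μ : ℝ) :
    weightMeasure N μ ≪ (volume : Measure (EuclideanSpace ℝ (Fin N))) :=
  withDensity_absolutelyContinuous _ _

/-- The square of the norm dual to the one of `WeightedL2 N μ`. -/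
noncomputable def dualEnergy {N : ℕ} (μ : ℝ) (φ : EuclideanSpace ℝ (Fin N) → ℂ) : ENNReal :=
  ∫⁻ ξ, ‖φ ξ‖ₑ ^ 2 * ENNReal.ofReal (‖ξ‖ ^ (-((N : ℝ) - 2 * μ)))

/-- The function which represents the pairing with `φ` in `WeightedL2 N μ`. -/
noncomputable def dualFun {N : ℕ} (μ : ℝ) (φ : EuclideanSpace ℝ (Fin N) → ℂ)
    (ξ : EuclideanSpace ℝ (Fin N)) : ℂ :=
  ((‖ξ‖ ^ (-((N : ℝ) - 2 * μ)) : ℝ) : ℂ) * φ ξ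

theorem enorm_sq_dualFun {N : ℕ} (μ : ℝ) (φ : EuclideanSpace ℝ (Fin N) → ℂ)
    {ξ : EuclideanSpace ℝ (Fin N)} (hξ : ξ ≠ 0) :
    ENNReal.ofReal (‖ξ‖ ^ ((N : ℝ) - 2 * μ)) * ‖dualFun μ φ ξ‖ₑ ^ 2 =
      ‖φ ξ‖ₑ ^ 2 * ENNReal.ofReal (‖ξ‖ ^ (-((N : ℝ) - 2 * μ))) := by
  have h0 : 0 < ‖ξ‖ := norm_pos_iff.mpr hξ
  have h1 : (0 : ℝ) ≤ ‖ξ‖ ^ (-((N : ℝ) - 2 * μ)) := by positivity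
  have h2 : ‖((‖ξ‖ ^ (-((N : ℝ) - 2 * μ)) : ℝ) : ℂ)‖ₑ
      = ENNReal.ofReal (‖ξ‖ ^ (-((N : ℝ) - 2 * μ))) := by
    rw [← ofReal_norm, Complex.norm_real, Real.norm_of_nonneg h1]
  rw [dualFun, enorm_mul, h2, mul_pow, pow_two (ENNReal.ofReal _), ← mul_assoc, ← mul_assoc,
    ← ENNReal.ofReal_mul (by positivity), ← Real.rpow_add h0, add_neg_cancel, Real.rpow_zero,
    ENNReal.ofReal_one, one_mul, mul_comm]

theorem eLpNorm_sq_weight {N : ℕ} (hN : 1 ≤ N) (μ : ℝ) {φ : EuclideanSpace ℝ (Fin N) → ℂ}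
    (hφ : AEStronglyMeasurable φ volume) :
    eLpNorm (dualFun μ φ) 2 (weightMeasure N μ) ^ 2 = dualEnergy μ φ := by
  have hd : AEStronglyMeasurable (dualFun μ φ) volume := by
    refine AEStronglyMeasurable.mul ?_ hφ
    exact (by fun_prop : Measurable fun ξ : EuclideanSpace ℝ (Fin N) =>
      ((‖ξ‖ ^ (-((N : ℝ) - 2 * μ)) : ℝ) : ℂ)).aestronglyMeasurable
  have := eLpNorm_nnreal_pow_eq_lintegral (f := dualFun μ φ) (p := 2)
    (μ := weightMeasure N μ) (by norm_num)
  norm_num at this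
  rw [this, weightMeasure, lintegral_withDensity_eq_lintegral_mul₀' (by fun_prop)
    ((hd.enorm.pow_const 2).mono_ac (weight_absolutelyContinuous N μ)), dualEnergy]
  refine lintegral_congr_ae ?_
  filter_upwards [ae_ne_zero hN] with ξ hξ
  exact enorm_sq_dualFun μ φ hξ

theorem memLp_dualFun {N : ℕ} (hN : 1 ≤ N) {μ : ℝ} {φ : EuclideanSpace ℝ (Fin N) → ℂ}
    (hφ : AEStronglyMeasurable φ volume) (hE : dualEnergy μ φ < ⊤) :
    MemLp (dualFun μ φ) 2 (weightMeasure N μ) := by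
  refine ⟨?_, ?_⟩
  · refine AEStronglyMeasurable.mono_ac (weight_absolutelyContinuous N μ)
      (AEStronglyMeasurable.mul ?_ hφ)
    exact (by fun_prop : Measurable fun ξ : EuclideanSpace ℝ (Fin N) =>
      ((‖ξ‖ ^ (-((N : ℝ) - 2 * μ)) : ℝ) : ℂ)).aestronglyMeasurable
  · rw [← eLpNorm_sq_weight hN μ hφ] at hE
    by_contra h
    rw [not_lt_top_iff.mp h] at hE
    simp at hE

open Classical in
/-- The element of `WeightedL2 N μ` which represents the pairing with `φ`; it is zero if the
pairing is not bounded. -/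
noncomputable def dualElt {N : ℕ} (μ : ℝ) (φ : EuclideanSpace ℝ (Fin N) → ℂ) : WeightedL2 N μ :=
  if h : MemLp (dualFun μ φ) 2 (weightMeasure N μ) then h.toLp else 0

theorem coeFn_dualElt {N : ℕ} (hN : 1 ≤ N) {μ : ℝ} {φ : EuclideanSpace ℝ (Fin N) → ℂ}
    (hφ : AEStronglyMeasurable φ volume) (hE : dualEnergy μ φ < ⊤) :
    dualElt μ φ =ᵐ[volume] dualFun μ φ := by
  have h := memLp_dualFun hN hφ hE
  rw [dualElt, dif_pos h]
  exact (volume_absolutelyContinuous_weight hN μ).ae_eq h.coeFn_toLp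

theorem norm_dualElt_sq {N : ℕ} (hN : 1 ≤ N) {μ : ℝ} {φ : EuclideanSpace ℝ (Fin N) → ℂ}
    (hφ : AEStronglyMeasurable φ volume) (hE : dualEnergy μ φ < ⊤) :
    ‖dualElt μ φ‖ ^ 2 = (dualEnergy μ φ).toReal := by
  have h := memLp_dualFun hN hφ hE
  rw [dualElt, dif_pos h, Lp.norm_toLp, ← eLpNorm_sq_weight hN μ hφ, ENNReal.toReal_pow]

theorem integral_weight {N : ℕ} (μ : ℝ) (f : EuclideanSpace ℝ (Fin N) → ℂ) :
    ∫ ξ, f ξ ∂(weightMeasure N μ) = ∫ ξ, ((‖ξ‖ ^ ((N : ℝ) - 2 * μ) : ℝ) : ℂ) * f ξ := by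
  rw [weightMeasure, integral_withDensity_eq_integral_toReal_smul (measurable_weight N _)
    (by simp)]
  congr 1 with ξ
  rw [ENNReal.toReal_ofReal (by positivity), Complex.real_smul]

theorem integrable_weight {N : ℕ} (μ : ℝ) {f : EuclideanSpace ℝ (Fin N) → ℂ} :
    Integrable f (weightMeasure N μ) ↔
      Integrable fun ξ => ((‖ξ‖ ^ ((N : ℝ) - 2 * μ) : ℝ) : ℂ) * f ξ := by
  rw [weightMeasure, integrable_withDensity_iff_integrable_smul' (measurable_weight N _)
    (by simp)]
  refine integrable_congr (Filter.Eventually.of_forall fun ξ => ?_)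
  simp only
  rw [ENNReal.toReal_ofReal (by positivity), Complex.real_smul]

theorem weight_mul_inner_dualFun {N : ℕ} (μ : ℝ) (φ : EuclideanSpace ℝ (Fin N) → ℂ) (z : ℂ)
    {ξ : EuclideanSpace ℝ (Fin N)} (hξ : ξ ≠ 0) :
    ((‖ξ‖ ^ ((N : ℝ) - 2 * μ) : ℝ) : ℂ) * inner ℂ (dualFun μ φ ξ) z =
      (starRingEnd ℂ) (φ ξ) * z := by
  have h0 : 0 < ‖ξ‖ := norm_pos_iff.mpr hξ
  have h1 : ((‖ξ‖ ^ ((N : ℝ) - 2 * μ) : ℝ) : ℂ) * ((‖ξ‖ ^ (-((N : ℝ) - 2 * μ)) : ℝ) : ℂ) = 1 := by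
    rw [← Complex.ofReal_mul, ← Real.rpow_add h0]; simp
  rw [dualFun, RCLike.inner_apply, map_mul, Complex.conj_ofReal]
  linear_combination (z * (starRingEnd ℂ) (φ ξ)) * h1

theorem integrable_dual_mul {N : ℕ} (hN : 1 ≤ N) {μ : ℝ} {φ : EuclideanSpace ℝ (Fin N) → ℂ}
    (hφ : AEStronglyMeasurable φ volume) (hE : dualEnergy μ φ < ⊤) (k : WeightedL2 N μ) :
    Integrable fun ξ => (starRingEnd ℂ) (φ ξ) * k ξ := by
  have h := L2.integrable_inner (𝕜 := ℂ) (dualElt μ φ) k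
  rw [integrable_weight] at h
  refine h.congr ?_
  filter_upwards [ae_ne_zero hN, coeFn_dualElt hN hφ hE] with ξ hξ h2
  rw [h2, weight_mul_inner_dualFun μ φ _ hξ]

theorem inner_dualElt {N : ℕ} (hN : 1 ≤ N) {μ : ℝ} {φ : EuclideanSpace ℝ (Fin N) → ℂ}
    (hφ : AEStronglyMeasurable φ volume) (hE : dualEnergy μ φ < ⊤) (k : WeightedL2 N μ) :
    inner ℂ (dualElt μ φ) k = ∫ ξ, (starRingEnd ℂ) (φ ξ) * k ξ := by
  rw [L2.inner_def, integral_weight]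
  refine integral_congr_ae ?_
  filter_upwards [ae_ne_zero hN, coeFn_dualElt hN hφ hE] with ξ hξ h2
  rw [h2, weight_mul_inner_dualFun μ φ _ hξ]

/-- The possibly singular weight is only seen outside a ball around the origin, and there the
Schwartz decay absorbs any power. -/
theorem dualEnergy_lt_top_of_notMem_tsupport {N : ℕ} (μ : ℝ)
    {φ : 𝓢(EuclideanSpace ℝ (Fin N), ℂ)} (h0 : (0 : EuclideanSpace ℝ (Fin N)) ∉ tsupport φ) :
    dualEnergy μ φ < ⊤ := by
  obtain ⟨r, hr, hr'⟩ := Metric.isOpen_iff.mp (isClosed_tsupport φ).isOpen_compl 0 h0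
  set a := -((N : ℝ) - 2 * μ)
  -- The exponent `a` may have either sign. Splitting off `‖ξ‖ ^ n` leaves the nonpositive power `a
  -- - n`, bounded by its value at `r`, and an integer power controlled by a Schwartz seminorm.
  obtain ⟨n, hn⟩ := exists_nat_ge (max a 0)
  have hbound : ∀ ξ : EuclideanSpace ℝ (Fin N), ‖φ ξ‖ ^ 2 * ‖ξ‖ ^ a ≤
      (r ^ (a - n)) * ((SchwartzMap.seminorm ℝ n 0 φ) * ‖φ ξ‖) := by
    intro ξ
    by_cases hξ : ‖ξ‖ < r
    · have : φ ξ = 0 := by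
        by_contra hne
        exact hr' (by simpa using hξ) (subset_tsupport _ hne)
      simp [this]
    · push Not at hξ
      have hpos : 0 < ‖ξ‖ := hr.trans_le hξ
      have h1 : ‖ξ‖ ^ a = ‖ξ‖ ^ (a - n) * ‖ξ‖ ^ n := by
        rw [← Real.rpow_natCast, ← Real.rpow_add hpos]; ring_nf
      have h2 : ‖ξ‖ ^ (a - n) ≤ r ^ (a - n) :=
        Real.rpow_le_rpow_of_nonpos hr hξ (by linarith [le_max_left a 0])
      have h3 := SchwartzMap.norm_pow_mul_le_seminorm ℝ φ n ξ
      calc ‖φ ξ‖ ^ 2 * ‖ξ‖ ^ a = ‖ξ‖ ^ (a - n) * ((‖ξ‖ ^ n * ‖φ ξ‖) * ‖φ ξ‖) := by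
            rw [h1]; ring
        _ ≤ _ := by gcongr
  have hint : Integrable fun ξ => (r ^ (a - n)) * ((SchwartzMap.seminorm ℝ n 0 φ) * ‖φ ξ‖) :=
    ((φ.integrable.norm).const_mul _).const_mul _
  refine lt_of_le_of_lt (lintegral_mono fun ξ => ?_) hint.lintegral_lt_top
  have h4 : ‖φ ξ‖ₑ ^ 2 = ENNReal.ofReal (‖φ ξ‖ ^ 2) := by
    rw [ENNReal.ofReal_pow (norm_nonneg _), ofReal_norm]
  simp only
  rw [h4, ← ENNReal.ofReal_mul (by positivity)]
  exact ENNReal.ofReal_le_ofReal (hbound ξ)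

/-- The indicator of `K` has finite dual energy, since the inverse weight is continuous on `K`; its
pairing with `k` is therefore integrable. -/
theorem integrableOn_of_isCompact {N : ℕ} (hN : 1 ≤ N) {μ : ℝ} (k : WeightedL2 N μ)
    {K : Set (EuclideanSpace ℝ (Fin N))} (hK : IsCompact K) (h0 : 0 ∉ K) :
    IntegrableOn k K := by
  set χ : EuclideanSpace ℝ (Fin N) → ℂ := K.indicator fun _ => 1
  have hχ : AEStronglyMeasurable χ volume :=
    (aestronglyMeasurable_const).indicator hK.measurableSet
  have hc : ContinuousOn (fun ξ : EuclideanSpace ℝ (Fin N) => ‖ξ‖ ^ (-((N : ℝ) - 2 * μ))) K :=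
    continuous_norm.continuousOn.rpow_const fun ξ hξ =>
      Or.inl (norm_ne_zero_iff.mpr fun h => h0 (h ▸ hξ))
  have hE : dualEnergy μ χ < ⊤ := by
    have h1 := (hc.integrableOn_compact (μ := volume) hK).lintegral_lt_top
    refine lt_of_le_of_lt (le_of_eq ?_) h1
    rw [dualEnergy, ← lintegral_indicator hK.measurableSet]
    congr 1 with ξ
    by_cases hξ : ξ ∈ K <;> simp [χ, hξ]
  have h2 := integrable_dual_mul hN hχ hE k
  rw [← integrable_indicator_iff hK.measurableSet]
  refine h2.congr (Filter.Eventually.of_forall fun ξ => ?_)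
  by_cases hξ : ξ ∈ K <;> simp [χ, hξ]

/-- An element of `WeightedL2 N μ` is determined by its integrals against the test functions
supported off the origin. -/
theorem eq_zero_of_integral_eq_zero {N : ℕ} (hN : 1 ≤ N) {μ : ℝ} (k : WeightedL2 N μ)
    (h : ∀ φ : 𝓢(EuclideanSpace ℝ (Fin N), ℂ), HasCompactSupport φ →
      (0 : EuclideanSpace ℝ (Fin N)) ∉ tsupport φ → ∫ ξ, k ξ * φ ξ = 0) : k = 0 := by
  -- The fundamental lemma of the calculus of variations is used on the punctured space only; the
  -- origin is null and may be ignored.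
  have hk : LocallyIntegrableOn k {0}ᶜ (volume : Measure (EuclideanSpace ℝ (Fin N))) := by
    intro x hx
    have hx' : 0 < ‖x‖ := norm_pos_iff.mpr hx
    refine ⟨Metric.closedBall x (‖x‖ / 2), nhdsWithin_le_nhds
      (Metric.closedBall_mem_nhds x (by positivity)),
      integrableOn_of_isCompact hN k (isCompact_closedBall _ _) ?_⟩
    simp only [Metric.mem_closedBall, dist_zero_left, not_le]
    linarith
  have h1 := isOpen_compl_singleton.ae_eq_zero_of_integral_contMDiff_smul_eq_zero
    (I := 𝓘(ℝ, EuclideanSpace ℝ (Fin N))) hk fun g hg hgc hgs => ?_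
  · rw [Lp.eq_zero_iff_ae_eq_zero]
    refine (weight_absolutelyContinuous N μ).ae_le ?_
    filter_upwards [h1, ae_ne_zero hN] with ξ h2 h3
    exact h2 h3
  · have hgC : HasCompactSupport fun ξ => (g ξ : ℂ) := hgc.comp_left Complex.ofReal_zero
    have hsm : ContDiff ℝ ∞ fun ξ => (g ξ : ℂ) := Complex.ofRealCLM.contDiff.comp hg.contDiff
    have hsub : tsupport (fun ξ => (g ξ : ℂ)) ⊆ tsupport g :=
      closure_mono fun x hx => by
        rw [Function.mem_support] at hx ⊢
        exact fun h => hx (by simp [h])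
    have h2 := h (hgC.toSchwartzMap hsm) hgC fun h0 => hgs (hsub h0) rfl
    rw [← h2]
    refine integral_congr_ae (Filter.Eventually.of_forall fun ξ => ?_)
    simp [mul_comm]

/-! ### Conformal maps -/

/-- A similarity with ratio `c` maps the unit ball onto the ball of radius `c`; comparing volumes
gives the determinant. -/
theorem abs_det_of_norm_map {E : Type*} [NormedAddCommGroup E] [InnerProductSpace ℝ E]
    [FiniteDimensional ℝ E] [MeasurableSpace E] [BorelSpace E]
    (A : E →L[ℝ] E) {c : ℝ} (hc : 0 < c)
    (hA : ∀ v, ‖A v‖ = c * ‖v‖) : |A.det| = c ^ Module.finrank ℝ E := by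
  have h1 : A '' Metric.ball 0 1 = Metric.ball 0 c := by
    have hinj : Function.Injective (A : E →ₗ[ℝ] E) := by
      rw [injective_iff_map_eq_zero]
      intro v hv
      have := hA v
      rw [show A v = 0 from hv, norm_zero] at this
      exact norm_eq_zero.mp ((mul_eq_zero.mp this.symm).resolve_left hc.ne')
    have hsurj := LinearMap.surjective_of_injective hinj
    ext y
    constructor
    · rintro ⟨x, hx, rfl⟩
      rw [mem_ball_zero_iff] at hx ⊢
      rw [hA]; nlinarith
    · intro hy
      obtain ⟨x, rfl⟩ := hsurj y
      refine ⟨x, ?_, rfl⟩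
      rw [mem_ball_zero_iff] at hy ⊢
      have hy' : ‖A x‖ < c := hy
      rw [hA] at hy'
      by_contra h
      push Not at h
      nlinarith
  have h2 := Measure.addHaar_image_continuousLinearMap (volume : Measure E) A (Metric.ball 0 1)
  rw [h1, Measure.addHaar_ball_of_pos _ _ hc] at h2
  have h3 := (ENNReal.mul_left_inj (Metric.measure_ball_pos volume (0 : E) one_pos).ne'
    measure_ball_lt_top.ne).mp h2
  rw [ENNReal.ofReal_eq_ofReal_iff (by positivity) (abs_nonneg _)] at h3
  exact h3.symm

/-- The two-point identity at `y = x + t v`, divided by `t²`, becomes the square of a difference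
quotient; continuity of `ρ` at `x` gives the limit. -/
theorem norm_fderiv_of_conformal {E : Type*} [NormedAddCommGroup E] [InnerProductSpace ℝ E]
    {T : E → E} {A : E →L[ℝ] E} {ρ : E → ℝ} {s : Set E} {x : E} (hs : s ∈ nhds x)
    (hT : HasFDerivAt T A x) (hρ : ContinuousAt ρ x) (hpos : 0 < ρ x)
    (h : ∀ y ∈ s, ‖T y - T x‖ ^ 2 = ρ y * ρ x * ‖y - x‖ ^ 2) (v : E) :
    ‖A v‖ = ρ x * ‖v‖ := by
  have h1 : Filter.Tendsto (fun t : ℝ => t⁻¹ • (T (x + t • v) - T x)) (nhdsWithin 0 {0}ᶜ)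
      (nhds (A v)) := by
    have := (hT.hasLineDerivAt v).tendsto_slope_zero
    simpa using this
  have h2 := (h1.norm.pow 2)
  have hcont : Filter.Tendsto (fun t : ℝ => x + t • v) (nhdsWithin 0 {0}ᶜ) (nhds x) := by
    have : Filter.Tendsto (fun t : ℝ => x + t • v) (nhds 0) (nhds (x + (0 : ℝ) • v)) := by
      apply Continuous.tendsto; fun_prop
    rw [zero_smul, add_zero] at this
    exact this.mono_left nhdsWithin_le_nhds
  have h3 : Filter.Tendsto (fun t : ℝ => ρ (x + t • v) * ρ x * ‖v‖ ^ 2) (nhdsWithin 0 {0}ᶜ)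
      (nhds (ρ x * ρ x * ‖v‖ ^ 2)) :=
    ((hρ.tendsto.comp hcont).mul_const _).mul_const _
  have h4 : (fun t : ℝ => ‖t⁻¹ • (T (x + t • v) - T x)‖ ^ 2) =ᶠ[nhdsWithin 0 {0}ᶜ]
      fun t : ℝ => ρ (x + t • v) * ρ x * ‖v‖ ^ 2 := by
    filter_upwards [hcont hs, self_mem_nhdsWithin] with t ht ht0
    have ht0' : t ≠ 0 := ht0
    rw [norm_smul, mul_pow, h _ ht, add_sub_cancel_left, norm_smul, norm_inv, inv_pow,
      Real.norm_eq_abs, mul_pow, sq_abs]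
    field_simp
  have h5 := tendsto_nhds_unique (h2.congr' h4) h3
  have h6 : ‖A v‖ ^ 2 = (ρ x * ‖v‖) ^ 2 := by rw [h5]; ring
  exact (sq_eq_sq₀ (norm_nonneg _) (by positivity)).mp h6

/-! ### Stereographic coordinates -/

theorem cayley_zero {N : ℕ} (x : EuclideanSpace ℝ (Fin N)) :
    (cayley x).1 0 = (1 - ‖x‖ ^ 2) / (1 + ‖x‖ ^ 2) := rfl

theorem cayley_succ {N : ℕ} (x : EuclideanSpace ℝ (Fin N)) (i : Fin N) :
    (cayley x).1 i.succ = 2 * x i / (1 + ‖x‖ ^ 2) := rfl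

theorem one_add_norm_sq_pos {N : ℕ} (x : EuclideanSpace ℝ (Fin N)) : 0 < 1 + ‖x‖ ^ 2 := by
  positivity

theorem one_add_cayley_zero {N : ℕ} (x : EuclideanSpace ℝ (Fin N)) :
    1 + (cayley x).1 0 = 2 / (1 + ‖x‖ ^ 2) := by
  have := (one_add_norm_sq_pos x).ne'
  rw [cayley_zero]; field_simp; ring

theorem sum_sq_sphere {N : ℕ} (u : Sph N) : ∑ i, u.1 i ^ 2 = 1 := by
  have := EuclideanSpace.norm_sq_eq u.1
  rw [mem_sphere_zero_iff_norm.mp u.2] at this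
  simpa using this.symm

theorem sum_sq_eq_norm {N : ℕ} (x : EuclideanSpace ℝ (Fin N)) : ∑ i, x i ^ 2 = ‖x‖ ^ 2 := by
  rw [EuclideanSpace.norm_sq_eq]; simp

/-- The inverse of the conformal coordinate `cayley`. -/
noncomputable def stereo {N : ℕ} (u : EuclideanSpace ℝ (Fin (N + 1))) : EuclideanSpace ℝ (Fin N) :=
  WithLp.toLp 2 fun i => u i.succ / (1 + u 0)

theorem stereo_cayley {N : ℕ} (x : EuclideanSpace ℝ (Fin N)) : stereo (cayley x).1 = x := by
  have := (one_add_norm_sq_pos x).ne'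
  ext i
  simp only [stereo, one_add_cayley_zero, cayley_succ]
  field_simp

theorem norm_stereo_sq {N : ℕ} (u : Sph N) (hu : u.1 0 ≠ -1) :
    1 + ‖stereo u.1‖ ^ 2 = 2 / (1 + u.1 0) := by
  have h0 : 1 + u.1 0 ≠ 0 := fun h => hu (by linarith)
  have h1 := sum_sq_sphere u
  rw [Fin.sum_univ_succ] at h1
  rw [← sum_sq_eq_norm]
  simp only [stereo, div_pow, ← Finset.sum_div]
  rw [show ∑ i : Fin N, u.1 i.succ ^ 2 = 1 - u.1 0 ^ 2 by linarith]
  field_simp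
  ring

theorem cayley_stereo {N : ℕ} (u : Sph N) (hu : u.1 0 ≠ -1) : cayley (stereo u.1) = u := by
  have h0 : 1 + u.1 0 ≠ 0 := fun h => hu (by linarith)
  have h1 := norm_stereo_sq u hu
  apply Subtype.ext
  ext i
  refine Fin.cases ?_ (fun i => ?_) i
  · rw [cayley_zero, h1, show 1 - ‖stereo u.1‖ ^ 2 = 2 - 2 / (1 + u.1 0) by rw [← h1]; ring]
    field_simp; ring
  · rw [cayley_succ, h1]
    simp only [stereo]
    field_simp

theorem cayley_zero_ne {N : ℕ} (x : EuclideanSpace ℝ (Fin N)) : (cayley x).1 0 ≠ -1 := by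
  intro h
  have h1 := one_add_cayley_zero x
  have h2 : 0 < 2 / (1 + ‖x‖ ^ 2) := by positivity
  rw [h] at h1; linarith

/-- The pole `-e₁`, the only point of the sphere which `cayley` omits. -/
theorem eq_of_zero_eq_neg_one {N : ℕ} {u v : Sph N} (hu : u.1 0 = -1) (hv : v.1 0 = -1) :
    u = v := by
  have key : ∀ w : Sph N, w.1 0 = -1 → ∀ i : Fin N, w.1 i.succ = 0 := by
    intro w hw i
    have h1 := sum_sq_sphere w
    rw [Fin.sum_univ_succ, hw] at h1
    have h2 : ∑ i : Fin N, w.1 i.succ ^ 2 = 0 := by linarith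
    rw [Finset.sum_eq_zero_iff_of_nonneg fun i _ => sq_nonneg _] at h2
    exact pow_eq_zero_iff (two_ne_zero) |>.mp (h2 i (Finset.mem_univ i))
  apply Subtype.ext
  ext i
  refine Fin.cases (hu.trans hv.symm) (fun i => ?_) i
  rw [key u hu, key v hv]

theorem norm_sub_sq_sphere {N : ℕ} (u v : Sph N) :
    ‖u.1 - v.1‖ ^ 2 = 2 - 2 * ∑ i, u.1 i * v.1 i := by
  rw [← sum_sq_eq_norm]
  have h1 := sum_sq_sphere u
  have h2 := sum_sq_sphere v
  calc ∑ i, (u.1 - v.1) i ^ 2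
      = ∑ i, u.1 i ^ 2 + ∑ i, v.1 i ^ 2 - 2 * ∑ i, u.1 i * v.1 i := by
        rw [Finset.mul_sum, ← Finset.sum_add_distrib, ← Finset.sum_sub_distrib]
        refine Finset.sum_congr rfl fun i _ => ?_
        simp only [PiLp.sub_apply]; ring
    _ = _ := by rw [h1, h2]; ring

/-- This is conformality in two-point form: the factor splits into one factor for each point. That
splitting is what later makes the Riesz kernels covariant. -/
theorem norm_cayley_sub_sq {N : ℕ} (x y : EuclideanSpace ℝ (Fin N)) :
    ‖(cayley x).1 - (cayley y).1‖ ^ 2 =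
      2 / (1 + ‖x‖ ^ 2) * (2 / (1 + ‖y‖ ^ 2)) * ‖x - y‖ ^ 2 := by
  have hx := (one_add_norm_sq_pos x).ne'
  have hy := (one_add_norm_sq_pos y).ne'
  have h1 : ‖x - y‖ ^ 2 = ‖x‖ ^ 2 + ‖y‖ ^ 2 - 2 * ∑ i, x i * y i := by
    rw [← sum_sq_eq_norm, ← sum_sq_eq_norm, ← sum_sq_eq_norm, Finset.mul_sum,
      ← Finset.sum_add_distrib, ← Finset.sum_sub_distrib]
    refine Finset.sum_congr rfl fun i _ => ?_
    simp only [PiLp.sub_apply]; ring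
  have h2 : ∑ i : Fin N, (cayley x).1 i.succ * (cayley y).1 i.succ =
      4 / ((1 + ‖x‖ ^ 2) * (1 + ‖y‖ ^ 2)) * ∑ i, x i * y i := by
    rw [Finset.mul_sum]
    refine Finset.sum_congr rfl fun i _ => ?_
    rw [cayley_succ, cayley_succ]; field_simp; ring
  rw [norm_sub_sq_sphere, Fin.sum_univ_succ, h2, h1, cayley_zero, cayley_zero]
  field_simp
  ring

theorem contDiff_cayley_coe {N : ℕ} :
    ContDiff ℝ ∞ fun x : EuclideanSpace ℝ (Fin N) => (cayley x).1 := by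
  rw [contDiff_euclidean]
  intro i
  have hn : ContDiff ℝ ∞ fun x : EuclideanSpace ℝ (Fin N) => ‖x‖ ^ 2 := contDiff_norm_sq ℝ
  refine Fin.cases ?_ (fun i => ?_) i
  · simp only [cayley_zero]
    exact (contDiff_const.sub hn).div (contDiff_const.add hn) fun x => (one_add_norm_sq_pos x).ne'
  · simp only [cayley_succ]
    refine ContDiff.div ?_ (contDiff_const.add hn) fun x => (one_add_norm_sq_pos x).ne'
    fun_prop

theorem continuous_cayley {N : ℕ} : Continuous (cayley (N := N)) :=
  Continuous.subtype_mk contDiff_cayley_coe.continuous _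

theorem contDiffAt_stereo {N : ℕ} {u : EuclideanSpace ℝ (Fin (N + 1))} (hu : u 0 ≠ -1) :
    ContDiffAt ℝ ∞ (stereo (N := N)) u := by
  rw [contDiffAt_euclidean]
  intro i
  refine ContDiffAt.div ?_ ?_ fun h => hu (by linarith)
  · fun_prop
  · fun_prop

theorem measurable_stereo {N : ℕ} : Measurable (stereo (N := N)) := by
  refine (WithLp.measurable_toLp 2 _).comp (measurable_pi_lambda _ fun i => ?_)
  fun_prop

/-! ### The conformal action in stereographic coordinates -/

theorem sum_mul_num {N : ℕ} (g : SO0 (N + 1)) (u v : Sph N) :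
    ∑ i, num g u.1 i * num g v.1 i - den g u.1 * den g v.1 = ∑ i, u.1 i * v.1 i - 1 := by
  have bil : ∀ a b : Fin (N + 1) ⊕ Unit → ℝ, a ⬝ᵥ (form (N + 1) *ᵥ b) =
      ∑ i, a (.inl i) * b (.inl i) - a (.inr ()) * b (.inr ()) := by
    intro a b
    simp [form, LieAlgebra.Orthogonal.indefiniteDiagonal, Matrix.mulVec_diagonal, dotProduct,
      Fintype.sum_sum_type, sub_eq_add_neg]
  have h1 := bil (lift g u.1) (lift g v.1)
  have h2 := bil (Sum.elim (fun i => u.1 i) (fun _ => (1 : ℝ)))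
    (Sum.elim (fun i => v.1 i) (fun _ => (1 : ℝ)))
  simp only [Sum.elim_inl, Sum.elim_inr] at h2
  have h3 : lift g u.1 ⬝ᵥ (form (N + 1) *ᵥ lift g v.1) =
      (Sum.elim (fun i => u.1 i) (fun _ => (1 : ℝ))) ⬝ᵥ (form (N + 1) *ᵥ
        (Sum.elim (fun i => v.1 i) (fun _ => (1 : ℝ)))) := by
    conv_rhs => rw [← g.2.1]
    rw [lift, lift, Matrix.mulVec_mulVec, Matrix.dotProduct_mulVec, Matrix.vecMul_mulVec,
      ← Matrix.dotProduct_mulVec, mul_assoc]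
  rw [h1, h2] at h3
  simpa [num, den] using h3

/-- For unit vectors `u · v - 1 = -|u - v|² / 2` is the Lorentz product of the null vectors `(u, 1)`
and `(v, 1)`, which `g` preserves. Rescaling the images back to time one introduces the two
denominators. -/
theorem norm_moebius_sub_sq {N : ℕ} (g : SO0 (N + 1)) (u v : Sph N) :
    den g u.1 * den g v.1 * ‖(moebius g u).1 - (moebius g v).1‖ ^ 2 = ‖u.1 - v.1‖ ^ 2 := by
  have hu := (den_pos g u).ne'
  have hv := (den_pos g v).ne'
  rw [norm_sub_sq_sphere, norm_sub_sq_sphere]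
  have h1 : ∑ i, (moebius g u).1 i * (moebius g v).1 i =
      (den g u.1)⁻¹ * (den g v.1)⁻¹ * ∑ i, num g u.1 i * num g v.1 i := by
    rw [Finset.mul_sum]
    refine Finset.sum_congr rfl fun i _ => ?_
    simp only [moebius, PiLp.smul_apply, smul_eq_mul]; ring
  have h2 := sum_mul_num g u v
  rw [h1, show ∑ i, num g u.1 i * num g v.1 i =
    ∑ i, u.1 i * v.1 i - 1 + den g u.1 * den g v.1 by linarith]
  field_simp
  ring

theorem moebius_inv_moebius {N : ℕ} (g : SO0 (N + 1)) (u : Sph N) :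
    moebius g⁻¹ (moebius g u) = u := by
  rw [← moebius_mul, inv_mul_cancel, moebius_one]

theorem moebius_moebius_inv {N : ℕ} (g : SO0 (N + 1)) (u : Sph N) :
    moebius g (moebius g⁻¹ u) = u := by
  rw [← moebius_mul, mul_inv_cancel, moebius_one]

theorem continuous_moebius {N : ℕ} (g : SO0 (N + 1)) : Continuous (moebius (N := N) g) :=
  (contMDiff_moebius g).continuous

theorem continuous_den {N : ℕ} (g : SO0 (N + 1)) : Continuous fun u : Sph N => den g u.1 :=
  (contMDiff_den g).continuous

/-- The transformation `u ↦ (a u + b) (c u + d)⁻¹` in stereographic coordinates. -/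
noncomputable def flatMoebius {N : ℕ} (g : SO0 (N + 1)) (x : EuclideanSpace ℝ (Fin N)) :
    EuclideanSpace ℝ (Fin N) :=
  stereo (moebius g (cayley x)).1

/-- The domain of `flatMoebius g`. -/
def flatDomain {N : ℕ} (g : SO0 (N + 1)) : Set (EuclideanSpace ℝ (Fin N)) :=
  {x | (moebius g (cayley x)).1 0 ≠ -1}

theorem cayley_flatMoebius {N : ℕ} {g : SO0 (N + 1)} {x : EuclideanSpace ℝ (Fin N)}
    (hx : x ∈ flatDomain g) : cayley (flatMoebius g x) = moebius g (cayley x) :=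
  cayley_stereo _ hx

theorem isOpen_flatDomain {N : ℕ} (g : SO0 (N + 1)) : IsOpen (flatDomain g) := by
  have : Continuous fun x : EuclideanSpace ℝ (Fin N) => (moebius g (cayley x)).1 0 := by
    have h := continuous_subtype_val.comp ((continuous_moebius g).comp continuous_cayley)
    exact (EuclideanSpace.proj (𝕜 := ℝ) (0 : Fin (N + 1))).continuous.comp h
  exact isOpen_compl_singleton.preimage this

/-- Only the preimage of the omitted pole is excluded, and the action on the sphere is injective. -/
theorem subsingleton_compl_flatDomain {N : ℕ} (g : SO0 (N + 1)) :
    (flatDomain g)ᶜ.Subsingleton := by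
  intro x hx y hy
  simp only [flatDomain, Set.mem_compl_iff, Set.mem_ofPred_eq, not_not] at hx hy
  have h1 := congrArg (moebius g⁻¹) (eq_of_zero_eq_neg_one hx hy)
  rw [moebius_inv_moebius, moebius_inv_moebius] at h1
  rw [← stereo_cayley x, h1, stereo_cayley]

/-- The conformal factor of `flatMoebius g`. -/
noncomputable def flatFactor {N : ℕ} (g : SO0 (N + 1)) (x : EuclideanSpace ℝ (Fin N)) : ℝ :=
  (1 + ‖flatMoebius g x‖ ^ 2) / ((1 + ‖x‖ ^ 2) * den g (cayley x).1)

theorem flatFactor_pos {N : ℕ} (g : SO0 (N + 1)) (x : EuclideanSpace ℝ (Fin N)) :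
    0 < flatFactor g x :=
  div_pos (one_add_norm_sq_pos _) (mul_pos (one_add_norm_sq_pos _) (den_pos _ _))

theorem norm_flatMoebius_sub_sq {N : ℕ} {g : SO0 (N + 1)} {x y : EuclideanSpace ℝ (Fin N)}
    (hx : x ∈ flatDomain g) (hy : y ∈ flatDomain g) :
    ‖flatMoebius g x - flatMoebius g y‖ ^ 2 =
      flatFactor g x * flatFactor g y * ‖x - y‖ ^ 2 := by
  have h1 := norm_cayley_sub_sq (flatMoebius g x) (flatMoebius g y)
  rw [cayley_flatMoebius hx, cayley_flatMoebius hy] at h1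
  have h2 := norm_moebius_sub_sq g (cayley x) (cayley y)
  rw [h1, norm_cayley_sub_sq] at h2
  have a1 := (one_add_norm_sq_pos x).ne'
  have a2 := (one_add_norm_sq_pos y).ne'
  have a3 := (one_add_norm_sq_pos (flatMoebius g x)).ne'
  have a4 := (one_add_norm_sq_pos (flatMoebius g y)).ne'
  have a5 := (den_pos g (cayley x)).ne'
  have a6 := (den_pos g (cayley y)).ne'
  rw [flatFactor, flatFactor]
  field_simp at h2 ⊢
  linarith

theorem contDiffAt_flatMoebius {N : ℕ} {g : SO0 (N + 1)} {x : EuclideanSpace ℝ (Fin N)}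
    (hx : x ∈ flatDomain g) : ContDiffAt ℝ ∞ (flatMoebius g) x := by
  have h1 : ContDiff ℝ ∞ fun x : EuclideanSpace ℝ (Fin N) => (moebius g (cayley x)).1 := by
    have hn : ContDiff ℝ ∞ (num (N := N) g) := by
      rw [contDiff_euclidean]
      exact fun i => contDiff_lift g (.inl i)
    exact ((contDiff_lift g (.inr ())).comp contDiff_cayley_coe).inv
      (fun x => (den_pos g (cayley x)).ne') |>.smul (hn.comp contDiff_cayley_coe)
  exact (contDiffAt_stereo hx).comp x h1.contDiffAt

theorem injOn_flatMoebius {N : ℕ} (g : SO0 (N + 1)) :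
    Set.InjOn (flatMoebius g) (flatDomain (N := N) g) := by
  intro x hx y hy hxy
  have h := norm_flatMoebius_sub_sq hx hy
  rw [hxy, sub_self, norm_zero] at h
  have h2 : ‖x - y‖ ^ 2 = 0 := by
    have := mul_pos (flatFactor_pos g x) (flatFactor_pos g y)
    have h3 : flatFactor g x * flatFactor g y * ‖x - y‖ ^ 2 = 0 := by rw [← h]; ring
    exact (mul_eq_zero.mp h3).resolve_left this.ne'
  exact sub_eq_zero.mp (norm_eq_zero.mp (pow_eq_zero_iff two_ne_zero |>.mp h2))

/-- The two-point identity makes the derivative a similarity with ratio `flatFactor g x`, whence its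
determinant. -/
theorem abs_det_fderiv_flatMoebius {N : ℕ} {g : SO0 (N + 1)} {x : EuclideanSpace ℝ (Fin N)}
    (hx : x ∈ flatDomain g) : |(fderiv ℝ (flatMoebius g) x).det| = flatFactor g x ^ N := by
  have hd := (contDiffAt_flatMoebius hx).differentiableAt (by simp)
  have hc : ContinuousAt (flatFactor g) x := by
    refine ContinuousAt.div ?_ ?_ (mul_pos (one_add_norm_sq_pos _) (den_pos _ _)).ne'
    · exact continuousAt_const.add (hd.continuousAt.norm.pow 2)
    · exact (continuousAt_const.add (continuousAt_id.norm.pow 2)).mul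
        ((continuous_den g).comp continuous_cayley).continuousAt
  rw [abs_det_of_norm_map _ (flatFactor_pos g x) (norm_fderiv_of_conformal
    ((isOpen_flatDomain g).mem_nhds hx) hd.hasFDerivAt hc (flatFactor_pos g x)
    fun y hy => norm_flatMoebius_sub_sq hy hx)]
  simp

/-- The map of the inverse group element supplies a preimage wherever it is defined, so the image
misses at most one point. -/
theorem compl_image_flatMoebius {N : ℕ} (g : SO0 (N + 1)) :
    (flatMoebius g '' flatDomain g)ᶜ ⊆ (flatDomain (N := N) g⁻¹)ᶜ := by
  intro y hy hy'
  refine hy ⟨flatMoebius g⁻¹ y, ?_, ?_⟩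
  · change (moebius g (cayley (flatMoebius g⁻¹ y))).1 0 ≠ -1
    rw [cayley_flatMoebius hy', moebius_moebius_inv]
    exact cayley_zero_ne y
  · rw [flatMoebius, cayley_flatMoebius hy', moebius_moebius_inv, stereo_cayley]

theorem ae_mem_flatDomain {N : ℕ} (hN : 1 ≤ N) (g : SO0 (N + 1)) :
    (flatDomain (N := N) g)ᶜ =ᵐ[volume] (∅ : Set (EuclideanSpace ℝ (Fin N))) := by
  have : Nonempty (Fin N) := ⟨⟨0, hN⟩⟩
  have : Nontrivial (EuclideanSpace ℝ (Fin N)) := inferInstance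
  exact ae_eq_empty.mpr ((subsingleton_compl_flatDomain g).measure_zero _)

/-! ### The conformally covariant measure on the sphere -/

/-- The density `2 / (1 + |x|²)` of the spherical metric. -/
noncomputable def sphDensity {N : ℕ} (x : EuclideanSpace ℝ (Fin N)) : ℝ := 2 / (1 + ‖x‖ ^ 2)

theorem sphDensity_pos {N : ℕ} (x : EuclideanSpace ℝ (Fin N)) : 0 < sphDensity x :=
  div_pos two_pos (one_add_norm_sq_pos x)

theorem continuous_sphDensity {N : ℕ} : Continuous (sphDensity (N := N)) :=
  Continuous.div continuous_const (by fun_prop) fun x => (one_add_norm_sq_pos x).ne'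

theorem flatFactor_eq {N : ℕ} (g : SO0 (N + 1)) (x : EuclideanSpace ℝ (Fin N)) :
    flatFactor g x * sphDensity (flatMoebius g x) = sphDensity x * (den g (cayley x).1)⁻¹ := by
  have a1 := (one_add_norm_sq_pos x).ne'
  have a3 := (one_add_norm_sq_pos (flatMoebius g x)).ne'
  have a5 := (den_pos g (cayley x)).ne'
  rw [flatFactor, sphDensity, sphDensity]
  field_simp

theorem restrict_flatDomain {N : ℕ} (hN : 1 ≤ N) (g : SO0 (N + 1)) :
    (volume : Measure (EuclideanSpace ℝ (Fin N))).restrict (flatDomain g) = volume :=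
  Measure.restrict_eq_self_of_ae_mem
    (mem_ae_iff.mpr (ae_eq_empty.mp (ae_mem_flatDomain hN g)) : flatDomain g ∈ ae volume)

theorem restrict_image_flatMoebius {N : ℕ} (hN : 1 ≤ N) (g : SO0 (N + 1)) :
    (volume : Measure (EuclideanSpace ℝ (Fin N))).restrict (flatMoebius g '' flatDomain g) =
      volume :=
  Measure.restrict_eq_self_of_ae_mem
    (mem_ae_iff.mpr (measure_mono_null (compl_image_flatMoebius g)
      (ae_eq_empty.mp (ae_mem_flatDomain hN g⁻¹))) : flatMoebius g '' flatDomain g ∈ ae volume)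

theorem hasFDerivWithinAt_flatMoebius {N : ℕ} (g : SO0 (N + 1)) :
    ∀ x ∈ flatDomain (N := N) g, HasFDerivWithinAt (flatMoebius g) (fderiv ℝ (flatMoebius g) x)
      (flatDomain g) x := fun _ hx =>
  ((contDiffAt_flatMoebius hx).differentiableAt (by simp)).hasFDerivAt.hasFDerivWithinAt

/-- Change of variables between two sets of full measure. No integrability of `Φ` is needed, which
later allows the energies to be transformed without estimates when `μ ≠ 0`. -/
theorem integral_flatMoebius {N : ℕ} (hN : 1 ≤ N) (g : SO0 (N + 1))
    (Φ : EuclideanSpace ℝ (Fin N) → ℂ) :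
    ∫ x, ((flatFactor g x ^ N : ℝ) : ℂ) * Φ (flatMoebius g x) = ∫ x, Φ x := by
  have h1 := integral_image_eq_integral_abs_det_fderiv_smul volume
    (isOpen_flatDomain g).measurableSet (hasFDerivWithinAt_flatMoebius g) (injOn_flatMoebius g) Φ
  rw [restrict_image_flatMoebius hN] at h1
  rw [h1]
  conv_lhs => rw [← restrict_flatDomain hN g]
  refine setIntegral_congr_fun (isOpen_flatDomain g).measurableSet fun x hx => ?_
  simp only [abs_det_fderiv_flatMoebius hx, Complex.real_smul]

theorem integrable_flatMoebius {N : ℕ} (hN : 1 ≤ N) (g : SO0 (N + 1))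
    {Φ : EuclideanSpace ℝ (Fin N) → ℂ} (hΦ : Integrable Φ) :
    Integrable fun x => ((flatFactor g x ^ N : ℝ) : ℂ) * Φ (flatMoebius g x) := by
  have h1 := (integrableOn_image_iff_integrableOn_abs_det_fderiv_smul volume
    (isOpen_flatDomain g).measurableSet (hasFDerivWithinAt_flatMoebius g)
    (injOn_flatMoebius g) Φ).mp hΦ.integrableOn
  rw [← restrict_flatDomain hN g]
  refine (integrableOn_congr_fun (fun x hx => ?_) (isOpen_flatDomain g).measurableSet).mp h1
  simp only [abs_det_fderiv_flatMoebius hx, Complex.real_smul]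

theorem ae_mem_flatDomain' {N : ℕ} (hN : 1 ≤ N) (g : SO0 (N + 1)) :
    ∀ᵐ x : EuclideanSpace ℝ (Fin N), x ∈ flatDomain g :=
  mem_ae_iff.mpr (ae_eq_empty.mp (ae_mem_flatDomain hN g))

theorem integrable_one_add_rpow {N : ℕ} {r : ℝ} (hr : (N : ℝ) < 2 * r) :
    Integrable fun x : EuclideanSpace ℝ (Fin N) => (1 + ‖x‖ ^ 2) ^ (-r) := by
  have := integrable_rpow_neg_one_add_norm_sq (E := EuclideanSpace ℝ (Fin N)) (μ := volume)
    (r := 2 * r) (by simpa using hr)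
  refine this.congr (Filter.Eventually.of_forall fun x => ?_)
  simp only; congr 1; ring

theorem sphDensity_rpow {N : ℕ} (x : EuclideanSpace ℝ (Fin N)) (r : ℝ) :
    sphDensity x ^ r = 2 ^ r * (1 + ‖x‖ ^ 2) ^ (-r) := by
  rw [sphDensity, Real.div_rpow two_pos.le (one_add_norm_sq_pos x).le,
    Real.rpow_neg (one_add_norm_sq_pos x).le, div_eq_mul_inv]

theorem integrable_sphDensity_rpow {N : ℕ} {r : ℝ} (hr : (N : ℝ) < 2 * r) :
    Integrable fun x : EuclideanSpace ℝ (Fin N) => sphDensity x ^ r := by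
  simp only [sphDensity_rpow]
  exact (integrable_one_add_rpow hr).const_mul _

/-! ### Gaussian regularization of the energy -/

section Gaussian

variable {V : Type*} [NormedAddCommGroup V] [InnerProductSpace ℝ V] [MeasurableSpace V]
  [BorelSpace V] [FiniteDimensional ℝ V]

theorem integral_fourier_mul_flip {f h : V → ℂ} (hf : Integrable f) (hh : Integrable h) :
    ∫ ξ, 𝓕 f ξ * h ξ = ∫ x, f x * 𝓕 h x := by
  have := VectorFourier.integral_fourierIntegral_smul_eq_flip (L := innerₗ V) (μ := volume)
    (ν := volume) Real.continuous_fourierChar continuous_inner hf hh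
  simp only [smul_eq_mul, flip_innerₗ] at this
  exact this

theorem conj_fourier (f : V → ℂ) (ξ : V) :
    (starRingEnd ℂ) (𝓕 f ξ) = 𝓕 (fun x => (starRingEnd ℂ) (f x)) (-ξ) := by
  rw [Real.fourier_eq', Real.fourier_eq', ← integral_conj]
  refine integral_congr_ae (Filter.Eventually.of_forall fun v => ?_)
  simp only [smul_eq_mul, map_mul, ← Complex.exp_conj]
  congr 2
  simp only [map_mul, Complex.conj_ofReal, Complex.conj_I, inner_neg_right]
  push_cast; ring

theorem continuous_fourier {f : V → ℂ} (hf : Integrable f) : Continuous (𝓕 f) :=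
  VectorFourier.fourierIntegral_continuous Real.continuous_fourierChar
    (L := innerₗ V) continuous_inner hf

theorem norm_fourier_le (f : V → ℂ) (ξ : V) : ‖𝓕 f ξ‖ ≤ ∫ x, ‖f x‖ :=
  VectorFourier.norm_fourierIntegral_le_integral_norm _ _ _ _ _

theorem integrable_gaussian_mul_character {b : ℝ} (hb : 0 < b) (y : V) :
    Integrable fun v : V =>
      Complex.exp (-(b : ℂ) * ‖v‖ ^ 2 + 2 * Real.pi * Complex.I * (inner ℝ y v : ℝ)) := by
  have h := GaussianFourier.integrable_cexp_neg_mul_sq_norm_add (V := V) (b := (b : ℂ))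
    (by simpa using hb) (2 * Real.pi * Complex.I) y
  exact h

/-- The multiplication formula is used twice: it moves the transform from `g` to `conj (𝓕 g)` times
the Gaussian, and then from `conj g` to a Gaussian times a character, whose transform is explicit.
Integrability of `g` suffices. -/
theorem integral_norm_sq_fourier_mul_gaussian {g : V → ℂ} (hg : Integrable g) {b : ℝ}
    (hb : 0 < b) :
    ∫ ξ, ((‖𝓕 g ξ‖ ^ 2 * Real.exp (-b * ‖ξ‖ ^ 2) : ℝ) : ℂ) =
      (((Real.pi / b) ^ ((Module.finrank ℝ V : ℝ) / 2) : ℝ) : ℂ) *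
        ∫ y, g y * ∫ x, (starRingEnd ℂ) (g x) *
          (Real.exp (-(Real.pi ^ 2 / b) * ‖y - x‖ ^ 2) : ℂ) := by
  have hgc : Integrable fun x => (starRingEnd ℂ) (g x) :=
    (LinearIsometryEquiv.integrable_comp_iff Complex.conjLIE).mpr hg
  have hgauss : Integrable fun ξ : V => (Real.exp (-b * ‖ξ‖ ^ 2) : ℂ) := by
    have := integrable_gaussian_mul_character hb (0 : V)
    refine this.congr (Filter.Eventually.of_forall fun v => ?_)
    simp
  set k : V → ℂ := fun ξ => (starRingEnd ℂ) (𝓕 g ξ) * (Real.exp (-b * ‖ξ‖ ^ 2) : ℂ)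
  have hk : Integrable k := by
    refine hgauss.bdd_mul (c := ∫ x, ‖g x‖) ?_ (Filter.Eventually.of_forall fun ξ => ?_)
    · exact (Complex.continuous_conj.comp (continuous_fourier hg)).aestronglyMeasurable
    · rw [RCLike.norm_conj]; exact norm_fourier_le g ξ
  have h1 : ∫ ξ, ((‖𝓕 g ξ‖ ^ 2 * Real.exp (-b * ‖ξ‖ ^ 2) : ℝ) : ℂ) = ∫ ξ, 𝓕 g ξ * k ξ := by
    refine integral_congr_ae (Filter.Eventually.of_forall fun ξ => ?_)
    simp only [k]
    rw [← mul_assoc, Complex.mul_conj, Complex.normSq_eq_norm_sq]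
    push_cast; ring
  rw [h1, integral_fourier_mul_flip hg hk, ← integral_const_mul]
  refine integral_congr_ae (Filter.Eventually.of_forall fun y => ?_)
  simp only
  rw [mul_left_comm]
  congr 1
  -- The reflection `ξ ↦ -ξ` turns `conj (𝓕 g)` into the transform of `conj g` and reverses the
  -- character.
  have h2 : 𝓕 k y = ∫ ξ, 𝓕 (fun x => (starRingEnd ℂ) (g x)) ξ *
      Complex.exp (-(b : ℂ) * ‖ξ‖ ^ 2 + 2 * Real.pi * Complex.I * (inner ℝ y ξ : ℝ)) := by
    rw [Real.fourier_eq', ← integral_neg_eq_self]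
    refine integral_congr_ae (Filter.Eventually.of_forall fun ξ => ?_)
    simp only [k, conj_fourier, neg_neg, norm_neg, smul_eq_mul, inner_neg_left]
    rw [Complex.exp_add, Complex.ofReal_exp, real_inner_comm ξ y]
    push_cast
    rw [show -2 * (Real.pi : ℂ) * -(inner ℝ ξ y : ℝ) * Complex.I =
      2 * Real.pi * Complex.I * (inner ℝ ξ y : ℝ) by ring]
    ring
  rw [h2, integral_fourier_mul_flip hgc (integrable_gaussian_mul_character hb y),
    ← integral_const_mul]
  refine integral_congr_ae (Filter.Eventually.of_forall fun x => ?_)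
  simp only
  rw [fourier_gaussian_innerProductSpace' (by simpa using hb), mul_left_comm]
  congr 2
  · rw [Complex.ofReal_cpow (by positivity)]; push_cast; rfl
  · rw [Complex.ofReal_exp]; congr 1; push_cast; ring

end Gaussian

/-! ### The Riesz kernels as superpositions of Gaussians -/

/-- The kernel `Γ(μ) r^(-2μ)`, with `-log r²` as its regularization for `μ = 0`. -/
noncomputable def rieszKernel (μ r : ℝ) : ℝ :=
  if μ = 0 then -Real.log (r ^ 2) else Real.Gamma μ * (r ^ 2) ^ (-μ)

/-- The counterterm `e^(-s)`, which is only needed for `μ = 0`. -/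
noncomputable def counterterm (μ s : ℝ) : ℝ := if μ = 0 then Real.exp (-s) else 0

/-- The integrand of the Gaussian representation of `rieszKernel`. -/
noncomputable def rieszIntegrand (μ r s : ℝ) : ℝ :=
  s ^ (μ - 1) * (Real.exp (-s * r ^ 2) - counterterm μ s)

theorem abs_exp_sub_exp_le {a b : ℝ} (ha : 0 ≤ a) (hb : 0 ≤ b) :
    |Real.exp (-a) - Real.exp (-b)| ≤ |a - b| := by
  wlog h : a ≤ b generalizing a b
  · rw [abs_sub_comm, abs_sub_comm a b]; exact this hb ha (le_of_not_ge h)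
  have h1 : Real.exp (-b) ≤ Real.exp (-a) := Real.exp_le_exp.mpr (by linarith)
  rw [abs_of_nonneg (by linarith), abs_sub_comm, abs_of_nonneg (by linarith)]
  have h2 := Real.add_one_le_exp (-(b - a))
  have h3 : Real.exp (-b) = Real.exp (-a) * Real.exp (-(b - a)) := by
    rw [← Real.exp_add]; ring_nf
  have h4 : Real.exp (-a) ≤ 1 := Real.exp_le_one_iff.mpr (by linarith)
  have h5 := Real.exp_pos (-a)
  nlinarith

/-- For `μ = 0` the counterterm cancels the singularity `s⁻¹` at the origin, since the difference of
exponentials is `O(s)`. For `μ > 0` this is the integrand of the Gamma function. -/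
theorem integrableOn_rieszIntegrand {μ r : ℝ} (hμ : 0 ≤ μ) (hr : 0 < r) :
    IntegrableOn (rieszIntegrand μ r) (Set.Ioi 0) := by
  rcases hμ.eq_or_lt with rfl | hμ
  · have hmeas : Measurable (rieszIntegrand 0 r) := by
      unfold rieszIntegrand counterterm; simp only [if_true]; fun_prop
    have hr2 : 0 < r ^ 2 := by positivity
    rw [← Set.Ioc_union_Ioi_eq_Ioi zero_le_one]
    refine IntegrableOn.union ?_ ?_
    · refine Measure.integrableOn_of_bounded (M := |r ^ 2 - 1|) (by simp) hmeas.aestronglyMeasurable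
        ?_
      refine (ae_restrict_iff' measurableSet_Ioc).mpr (Filter.Eventually.of_forall fun s hs => ?_)
      have hs0 : 0 < s := hs.1
      simp only [rieszIntegrand, counterterm, if_true, zero_sub, Real.rpow_neg_one]
      rw [norm_mul, norm_inv, Real.norm_of_nonneg hs0.le, Real.norm_eq_abs, neg_mul]
      have := abs_exp_sub_exp_le (a := s * r ^ 2) (b := s) (by positivity) hs0.le
      rw [show s * r ^ 2 - s = s * (r ^ 2 - 1) by ring, abs_mul, abs_of_pos hs0] at this
      rw [inv_mul_le_iff₀ hs0]
      exact this
    · have h1 : IntegrableOn (fun s : ℝ => Real.exp (-r ^ 2 * s) + Real.exp (-1 * s))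
          (Set.Ioi 1) :=
        (exp_neg_integrableOn_Ioi 1 hr2).add (exp_neg_integrableOn_Ioi 1 one_pos)
      refine h1.mono' hmeas.aestronglyMeasurable ?_
      refine (ae_restrict_iff' measurableSet_Ioi).mpr (Filter.Eventually.of_forall fun s hs => ?_)
      have hs1 : 1 < s := hs
      have hs0 : 0 < s := one_pos.trans hs1
      simp only [rieszIntegrand, counterterm, if_true, zero_sub, Real.rpow_neg_one]
      rw [norm_mul, norm_inv, Real.norm_of_nonneg hs0.le, inv_mul_le_iff₀ hs0]
      have h2 : ‖Real.exp (-s * r ^ 2) - Real.exp (-s)‖ ≤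
          Real.exp (-s * r ^ 2) + Real.exp (-s) := by
        refine (norm_sub_le _ _).trans_eq ?_
        simp [Real.abs_exp]
      have h3 : -s * r ^ 2 = -r ^ 2 * s := by ring
      have h4 : -s = -1 * s := by ring
      rw [h3, h4] at h2
      rw [h3, h4]
      refine h2.trans (le_mul_of_one_le_left (by positivity) hs1.le)
  · have h := integrableOn_rpow_mul_exp_neg_mul_rpow (p := 1) (s := μ - 1) (b := r ^ 2)
      (by linarith) one_pos (by positivity)
    refine h.congr_fun (fun s _ => ?_) measurableSet_Ioi
    simp only [rieszIntegrand, counterterm, if_neg hμ.ne', Real.rpow_one, sub_zero]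
    congr 2; ring

/-- Frullani's integral for `μ = 0`, a rescaled Gamma integral for `μ > 0`. -/
theorem integral_rieszIntegrand {μ r : ℝ} (hμ : 0 ≤ μ) (hr : 0 < r) :
    ∫ s in Set.Ioi 0, rieszIntegrand μ r s = rieszKernel μ r := by
  have hr2 : 0 < r ^ 2 := by positivity
  have hint := integrableOn_rieszIntegrand hμ hr
  rcases hμ.eq_or_lt with rfl | hμ
  · have h1 : ∀ s, rieszIntegrand 0 r s =
        s⁻¹ • (Real.exp (-(r ^ 2 * s)) - Real.exp (-(1 * s))) := by
      intro s
      simp only [rieszIntegrand, counterterm, if_true, zero_sub, Real.rpow_neg_one, smul_eq_mul]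
      ring_nf
    have hc : Continuous fun s : ℝ => Real.exp (-s) := by fun_prop
    simp only [h1]
    rw [Frullani.integral_Ioi_eq (f := fun s => Real.exp (-s)) (L := 1) (R := 0)
      (hc.locallyIntegrable.locallyIntegrableOn _) hr2 one_pos ?_ ?_ ?_]
    · simp [rieszKernel]
    · have := hc.tendsto 0
      simp only [neg_zero, Real.exp_zero] at this
      exact this.mono_left nhdsWithin_le_nhds
    · exact Real.tendsto_exp_neg_atTop_nhds_zero
    · exact hint.congr_fun (fun s _ => h1 s) measurableSet_Ioi
  · have h := Real.integral_rpow_mul_exp_neg_mul_Ioi hμ hr2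
    rw [rieszKernel, if_neg hμ.ne', Real.rpow_neg hr2.le, ← Real.inv_rpow hr2.le, mul_comm,
      ← one_div, ← h]
    refine setIntegral_congr_fun measurableSet_Ioi fun s _ => ?_
    simp only [rieszIntegrand, counterterm, if_neg hμ.ne', sub_zero]
    congr 2; ring

/-- The integrand has constant sign in `s`, decided for `μ = 0` by whether `r ≤ 1`. Hence
integrability of the kernel alone will justify Fubini for the triple integral. -/
theorem integral_abs_rieszIntegrand {μ r : ℝ} (hμ : 0 ≤ μ) (hr : 0 < r) :
    ∫ s in Set.Ioi 0, |rieszIntegrand μ r s| = |rieszKernel μ r| := by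
  rw [← integral_rieszIntegrand hμ hr]
  have hsign : (∀ s ∈ Set.Ioi (0 : ℝ), 0 ≤ rieszIntegrand μ r s) ∨
      ∀ s ∈ Set.Ioi (0 : ℝ), rieszIntegrand μ r s ≤ 0 := by
    by_cases h0 : μ = 0
    · simp only [rieszIntegrand, counterterm, if_pos h0]
      rcases le_total (r ^ 2) 1 with h | h
      · left; intro s hs
        have hs0 : 0 < s := hs
        refine mul_nonneg (by positivity) (sub_nonneg.mpr (Real.exp_le_exp.mpr (by nlinarith)))
      · right; intro s hs
        have hs0 : 0 < s := hs
        refine mul_nonpos_of_nonneg_of_nonpos (by positivity)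
          (sub_nonpos.mpr (Real.exp_le_exp.mpr (by nlinarith)))
    · left; intro s hs
      have hs0 : 0 < s := hs
      simp only [rieszIntegrand, counterterm, if_neg h0, sub_zero]
      positivity
  rcases hsign with h | h
  · rw [setIntegral_congr_fun measurableSet_Ioi fun s hs => abs_of_nonneg (h s hs),
      abs_of_nonneg (setIntegral_nonneg measurableSet_Ioi h)]
  · rw [setIntegral_congr_fun measurableSet_Ioi fun s hs => abs_of_nonpos (h s hs),
      integral_neg, abs_of_nonpos (setIntegral_nonpos measurableSet_Ioi h)]

/-- The constant which relates the dual energy to the Riesz kernel. -/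
noncomputable def energyConst (N : ℕ) (μ : ℝ) : ℝ :=
  Real.pi ^ ((N : ℝ) / 2) * ((1 / Real.pi ^ 2) ^ ((N : ℝ) / 2 - μ) * Real.Gamma ((N : ℝ) / 2 - μ))

theorem energyConst_pos {N : ℕ} {μ : ℝ} (h : μ < (N : ℝ) / 2) : 0 < energyConst N μ := by
  have : 0 < Real.Gamma ((N : ℝ) / 2 - μ) := Real.Gamma_pos_of_pos (by linarith)
  unfold energyConst
  positivity

/-- The substitution `t = 1 / s` turns this into a Gamma integral with exponent `a = N / 2 - μ`;
convergence is the condition `a > 0`. -/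
theorem lintegral_gaussian_weight {N : ℕ} {μ : ℝ} (h : μ < (N : ℝ) / 2)
    {ξ : EuclideanSpace ℝ (Fin N)} (hξ : ξ ≠ 0) :
    ∫⁻ s in Set.Ioi (0 : ℝ), ENNReal.ofReal (s ^ (μ - 1) *
      ((Real.pi / s) ^ ((N : ℝ) / 2) * Real.exp (-(Real.pi ^ 2 / s) * ‖ξ‖ ^ 2))) =
      ENNReal.ofReal (energyConst N μ) * ENNReal.ofReal (‖ξ‖ ^ (-((N : ℝ) - 2 * μ))) := by
  set a := (N : ℝ) / 2 - μ with ha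
  have ha0 : 0 < a := by rw [ha]; linarith
  have hn : 0 < ‖ξ‖ := norm_pos_iff.mpr hξ
  set r := Real.pi ^ 2 * ‖ξ‖ ^ 2 with hr
  have hr0 : 0 < r := by positivity
  set G : ℝ → ℝ := fun t => t ^ (a - 1) * Real.exp (-(r * t))
  have hG : IntegrableOn G (Set.Ioi 0) := by
    refine (integrableOn_rpow_mul_exp_neg_mul_rpow (p := 1) (s := a - 1) (b := r)
      (by linarith) one_pos hr0).congr_fun (fun s _ => ?_) measurableSet_Ioi
    simp only [G, Real.rpow_one, neg_mul]
  have h1 : ∀ s ∈ Set.Ioi (0 : ℝ), s ^ (μ - 1) *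
      ((Real.pi / s) ^ ((N : ℝ) / 2) * Real.exp (-(Real.pi ^ 2 / s) * ‖ξ‖ ^ 2)) =
      Real.pi ^ ((N : ℝ) / 2) * ((|(-1 : ℝ)| * s ^ ((-1 : ℝ) - 1)) • G (s ^ (-1 : ℝ))) := by
    intro s hs
    have hs0 : 0 < s := hs
    simp only [G, abs_neg, abs_one, one_mul, smul_eq_mul]
    rw [Real.div_rpow Real.pi_pos.le hs0.le, ← Real.rpow_mul hs0.le, div_eq_mul_inv,
      ← Real.rpow_neg hs0.le, ← mul_assoc (s ^ ((-1 : ℝ) - 1)), ← Real.rpow_add hs0]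
    have h2 : s ^ (-1 - 1 + -1 * (a - 1)) = s ^ (μ - 1) * s ^ (-((N : ℝ) / 2)) := by
      rw [← Real.rpow_add hs0, ha]; congr 1; ring
    have h3 : -(r * s ^ (-1 : ℝ)) = -(Real.pi ^ 2 / s) * ‖ξ‖ ^ 2 := by
      rw [Real.rpow_neg_one, hr]; field_simp
    rw [h2, h3]; ring
  have hint : IntegrableOn (fun s => (|(-1 : ℝ)| * s ^ ((-1 : ℝ) - 1)) • G (s ^ (-1 : ℝ)))
      (Set.Ioi 0) := (integrableOn_Ioi_comp_rpow_iff G (by norm_num)).mpr hG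
  rw [setLIntegral_congr_fun measurableSet_Ioi fun s hs => by rw [h1 s hs],
    ← ofReal_integral_eq_lintegral_ofReal (hint.const_mul _)
      ((ae_restrict_iff' measurableSet_Ioi).mpr (Filter.Eventually.of_forall fun s hs => by
        have hs0 : 0 < s := hs
        simp only [G, smul_eq_mul]; positivity)),
    integral_const_mul, integral_comp_rpow_Ioi G (by norm_num),
    Real.integral_rpow_mul_exp_neg_mul_Ioi ha0 hr0, ← ENNReal.ofReal_mul (energyConst_pos h).le]
  congr 1
  have h4 : (1 / r) ^ a = (1 / Real.pi ^ 2) ^ a * ‖ξ‖ ^ (-((N : ℝ) - 2 * μ)) := by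
    rw [hr, one_div, mul_inv, Real.mul_rpow (by positivity) (by positivity), one_div,
      Real.inv_rpow (by positivity : (0 : ℝ) ≤ ‖ξ‖ ^ 2), ← Real.rpow_natCast ‖ξ‖ 2,
      ← Real.rpow_mul hn.le, ← Real.rpow_neg hn.le]
    congr 2
    rw [ha]; push_cast; ring
  rw [h4, energyConst, ← ha]; ring

/-! ### The dual energy as a double integral -/

theorem measurable_rieszIntegrand (μ : ℝ) :
    Measurable fun p : ℝ × ℝ => rieszIntegrand μ p.1 p.2 := by
  unfold rieszIntegrand counterterm
  by_cases h : μ = 0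
  · simp only [if_pos h]; fun_prop
  · simp only [if_neg h]; fun_prop

theorem measurable_rieszKernel (μ : ℝ) : Measurable (rieszKernel μ) := by
  unfold rieszKernel
  by_cases h : μ = 0
  · simp only [if_pos h]; fun_prop
  · simp only [if_neg h]; fun_prop

theorem ae_prod_ne {N : ℕ} (hN : 1 ≤ N) :
    ∀ᵐ p : EuclideanSpace ℝ (Fin N) × EuclideanSpace ℝ (Fin N), p.1 ≠ p.2 := by
  have : Nonempty (Fin N) := ⟨⟨0, hN⟩⟩
  have : Nontrivial (EuclideanSpace ℝ (Fin N)) := inferInstance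
  have hm : MeasurableSet {p : EuclideanSpace ℝ (Fin N) × EuclideanSpace ℝ (Fin N) | p.1 = p.2} :=
    (isClosed_eq continuous_fst continuous_snd).measurableSet
  have h := (Measure.measure_prod_null (μ := (volume : Measure (EuclideanSpace ℝ (Fin N))))
    (ν := volume) hm).mpr (Filter.Eventually.of_forall fun x => by
      have : (Prod.mk x ⁻¹' {p : EuclideanSpace ℝ (Fin N) × EuclideanSpace ℝ (Fin N) |
          p.1 = p.2}) = {x} := by
        ext y; simp [eq_comm]
      simp [this])
  rw [ae_iff]
  simpa [Measure.volume_eq_prod] using h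

/-- The energy form of the Riesz kernel. -/
noncomputable def rieszEnergy {N : ℕ} (μ : ℝ) (g : EuclideanSpace ℝ (Fin N) → ℂ) : ℂ :=
  ∫ x, g x * ∫ y, (starRingEnd ℂ) (g y) * (rieszKernel μ ‖x - y‖ : ℂ)

/-- Integrate the Gaussian identity against `s^(μ-1) ds`. On the side of the variables `x, y` Fubini
reassembles the Riesz kernel; on the Fourier side Tonelli reassembles the power of `‖ξ‖`. In
particular the energy is seen to be nonnegative, with no finiteness assumed beforehand. -/
theorem dualEnergy_fourier {N : ℕ} (hN : 1 ≤ N) {μ : ℝ} (hμ : 0 ≤ μ) (hμN : μ < (N : ℝ) / 2)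
    {g : EuclideanSpace ℝ (Fin N) → ℂ} (hg : Integrable g) (h0 : μ = 0 → ∫ x, g x = 0)
    (hK : Integrable (fun p : EuclideanSpace ℝ (Fin N) × EuclideanSpace ℝ (Fin N) =>
      (g p.1 * (starRingEnd ℂ) (g p.2)) * (rieszKernel μ ‖p.1 - p.2‖ : ℂ))
      (volume.prod volume)) :
    ENNReal.ofReal (energyConst N μ) * dualEnergy μ (𝓕 g) =
      ENNReal.ofReal (rieszEnergy μ g).re := by
  have hgc : Integrable fun x => (starRingEnd ℂ) (g x) :=
    (LinearIsometryEquiv.integrable_comp_iff Complex.conjLIE).mpr hg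
  have hgg : Integrable (fun p : EuclideanSpace ℝ (Fin N) × EuclideanSpace ℝ (Fin N) =>
      g p.1 * (starRingEnd ℂ) (g p.2)) (volume.prod volume) := hg.mul_prod hgc
  -- the full integrand
  set H : (EuclideanSpace ℝ (Fin N) × EuclideanSpace ℝ (Fin N)) × ℝ → ℂ := fun q =>
    (g q.1.1 * (starRingEnd ℂ) (g q.1.2)) * (rieszIntegrand μ ‖q.1.1 - q.1.2‖ q.2 : ℂ)
  have hHm : AEStronglyMeasurable H
      ((volume.prod volume).prod (volume.restrict (Set.Ioi (0 : ℝ)))) := by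
    refine AEStronglyMeasurable.mul hgg.aestronglyMeasurable.comp_fst ?_
    exact (Complex.measurable_ofReal.comp ((measurable_rieszIntegrand μ).comp
      (((measurable_fst.comp measurable_fst).sub
        (measurable_snd.comp measurable_fst)).norm.prodMk measurable_snd))).aestronglyMeasurable
  have hH : Integrable H ((volume.prod volume).prod (volume.restrict (Set.Ioi (0 : ℝ)))) := by
    rw [integrable_prod_iff hHm]
    refine ⟨?_, ?_⟩
    · filter_upwards [ae_prod_ne hN] with p hp
      exact (Complex.ofRealCLM.integrable_comp (integrableOn_rieszIntegrand hμ
        (norm_pos_iff.mpr (sub_ne_zero.mpr hp))).integrable).const_mul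
          (g p.1 * (starRingEnd ℂ) (g p.2))
    · refine hK.norm.congr ?_
      filter_upwards [ae_prod_ne hN] with p hp
      simp only [H, norm_mul, Complex.norm_real, integral_const_mul, Real.norm_eq_abs]
      rw [integral_abs_rieszIntegrand hμ (norm_pos_iff.mpr (sub_ne_zero.mpr hp))]
  -- the Gaussian energies
  set A : ℝ → ℝ := fun s => (Real.pi / s) ^ ((N : ℝ) / 2) *
    ∫ ξ, ‖𝓕 g ξ‖ ^ 2 * Real.exp (-(Real.pi ^ 2 / s) * ‖ξ‖ ^ 2)
  have hA : ∀ s ∈ Set.Ioi (0 : ℝ), ∫ p, H (p, s) ∂(volume.prod volume) =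
      ((s ^ (μ - 1) * A s : ℝ) : ℂ) := by
    intro s hs
    have hs0 : 0 < s := hs
    -- The width `π² / s` on the Fourier side corresponds to the kernel `exp (-s |x - y|²)`.
    have hb : 0 < Real.pi ^ 2 / s := by positivity
    have h1 := integral_norm_sq_fourier_mul_gaussian hg hb
    have h2 : Integrable (fun p : EuclideanSpace ℝ (Fin N) × EuclideanSpace ℝ (Fin N) =>
        g p.1 * (starRingEnd ℂ) (g p.2) * (Real.exp (-s * ‖p.1 - p.2‖ ^ 2) : ℂ))
        (volume.prod volume) := by
      refine hgg.mul_bdd (c := 1) ?_ (Filter.Eventually.of_forall fun p => ?_)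
      · exact (by fun_prop : Continuous fun p : EuclideanSpace ℝ (Fin N) ×
          EuclideanSpace ℝ (Fin N) =>
            (Real.exp (-s * ‖p.1 - p.2‖ ^ 2) : ℂ)).aestronglyMeasurable
      · rw [Complex.norm_real, Real.norm_eq_abs, Real.abs_exp, Real.exp_le_one_iff]
        have := mul_nonneg hs0.le (sq_nonneg ‖p.1 - p.2‖)
        linarith
    -- The counterterm does not depend on `x` and `y`, so it contributes a multiple of `|∫ g|²`,
    -- which vanishes when it is present at all.
    have h3 : ∫ p, g p.1 * (starRingEnd ℂ) (g p.2) * (counterterm μ s : ℂ)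
        ∂((volume : Measure (EuclideanSpace ℝ (Fin N))).prod volume) = 0 := by
      rw [integral_mul_const, integral_prod_mul g fun y => (starRingEnd ℂ) (g y)]
      by_cases hm : μ = 0
      · rw [h0 hm]; simp
      · simp [counterterm, hm]
    have h4 : ∫ p, H (p, s) ∂(volume.prod volume) = ((s ^ (μ - 1) : ℝ) : ℂ) *
        ∫ p, g p.1 * (starRingEnd ℂ) (g p.2) * (Real.exp (-s * ‖p.1 - p.2‖ ^ 2) : ℂ)
          ∂((volume : Measure (EuclideanSpace ℝ (Fin N))).prod volume) := by
      conv_rhs => rw [← sub_zero (integral _ _), ← h3]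
      rw [← integral_sub h2 (hgg.mul_const _), ← integral_const_mul]
      congr 1 with p
      simp only [H, rieszIntegrand]
      push_cast; ring
    rw [h4, integral_prod _ h2]
    simp only [mul_assoc (g _), integral_const_mul]
    have h5 : Real.pi / (Real.pi ^ 2 / s) = (Real.pi / s)⁻¹ := by
      field_simp
    have h6 : Real.pi ^ 2 / (Real.pi ^ 2 / s) = s := by field_simp
    rw [h5, h6, finrank_euclideanSpace_fin, Real.inv_rpow (by positivity)] at h1
    rw [integral_complex_ofReal] at h1
    simp only [A]
    push_cast
    rw [h1]
    have h7 : (((Real.pi / s) ^ ((N : ℝ) / 2) : ℝ) : ℂ) ≠ 0 := by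
      exact_mod_cast (by positivity : (Real.pi / s) ^ ((N : ℝ) / 2) ≠ 0)
    push_cast
    rw [mul_inv_cancel_left₀ h7]
  -- integration over the parameter
  have hint : Integrable (fun s => s ^ (μ - 1) * A s) (volume.restrict (Set.Ioi 0)) := by
    have := (hH.integral_prod_right).re
    refine this.congr ((ae_restrict_iff' measurableSet_Ioi).mpr
      (Filter.Eventually.of_forall fun s hs => ?_))
    simp only
    rw [hA s hs]; exact RCLike.ofReal_re (K := ℂ) _
  have hRe : ∫ s in Set.Ioi 0, s ^ (μ - 1) * A s = (rieszEnergy μ g).re := by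
    have h1 : ((∫ s in Set.Ioi 0, s ^ (μ - 1) * A s : ℝ) : ℂ) = rieszEnergy μ g := by
      rw [← integral_complex_ofReal,
        ← setIntegral_congr_fun measurableSet_Ioi hA,
        ← integral_prod_symm _ hH, integral_prod _ hH, rieszEnergy]
      have h2 : ∀ᵐ p ∂((volume : Measure (EuclideanSpace ℝ (Fin N))).prod volume),
          ∫ s in Set.Ioi 0, H (p, s) =
            g p.1 * (starRingEnd ℂ) (g p.2) * (rieszKernel μ ‖p.1 - p.2‖ : ℂ) := by
        filter_upwards [ae_prod_ne hN] with p hp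
        simp only [H, integral_const_mul]
        rw [integral_complex_ofReal,
          integral_rieszIntegrand hμ (norm_pos_iff.mpr (sub_ne_zero.mpr hp))]
      rw [integral_congr_ae h2, integral_prod _ hK]
      simp only [mul_assoc (g _), integral_const_mul]
    rw [← h1, Complex.ofReal_re]
  have hA0 : ∀ s ∈ Set.Ioi (0 : ℝ), 0 ≤ A s := fun s hs =>
    mul_nonneg (by have hs0 : 0 < s := hs; positivity)
      (integral_nonneg fun ξ => by positivity)
  rw [← hRe, ofReal_integral_eq_lintegral_ofReal hint
    ((ae_restrict_iff' measurableSet_Ioi).mpr (Filter.Eventually.of_forall fun s hs =>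
      mul_nonneg (by have hs0 : 0 < s := hs; positivity) (hA0 s hs)))]
  -- Tonelli
  have hFc := continuous_fourier hg
  have hA' : ∀ s ∈ Set.Ioi (0 : ℝ), ENNReal.ofReal (s ^ (μ - 1) * A s) =
      ∫⁻ ξ, ‖𝓕 g ξ‖ₑ ^ 2 * ENNReal.ofReal (s ^ (μ - 1) *
        ((Real.pi / s) ^ ((N : ℝ) / 2) * Real.exp (-(Real.pi ^ 2 / s) * ‖ξ‖ ^ 2))) := by
    intro s hs
    have hs0 : 0 < s := hs
    have hb : 0 < Real.pi ^ 2 / s := by positivity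
    have hgauss : Integrable fun ξ : EuclideanSpace ℝ (Fin N) =>
        Real.exp (-(Real.pi ^ 2 / s) * ‖ξ‖ ^ 2) := by
      have := (integrable_gaussian_mul_character hb (0 : EuclideanSpace ℝ (Fin N))).re
      refine this.congr (Filter.Eventually.of_forall fun v => ?_)
      simp only [inner_zero_left, Complex.ofReal_zero, mul_zero, add_zero]
      rw [show (-((Real.pi ^ 2 / s : ℝ) : ℂ) * (‖v‖ : ℂ) ^ 2) =
        ((-(Real.pi ^ 2 / s) * ‖v‖ ^ 2 : ℝ) : ℂ) by push_cast; ring, ← Complex.ofReal_exp]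
      exact RCLike.ofReal_re (K := ℂ) _
    have hi : Integrable fun ξ : EuclideanSpace ℝ (Fin N) =>
        ‖𝓕 g ξ‖ ^ 2 * Real.exp (-(Real.pi ^ 2 / s) * ‖ξ‖ ^ 2) := by
      refine hgauss.bdd_mul (c := (∫ x, ‖g x‖) ^ 2) (hFc.norm.pow 2).aestronglyMeasurable
        (Filter.Eventually.of_forall fun ξ => ?_)
      rw [norm_pow, norm_norm]
      gcongr
      exact norm_fourier_le g ξ
    simp only [A]
    rw [← integral_const_mul, ← integral_const_mul, ofReal_integral_eq_lintegral_ofReal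
      ((hi.const_mul _).const_mul _) (Filter.Eventually.of_forall fun ξ => by positivity)]
    refine lintegral_congr fun ξ => ?_
    rw [← ofReal_norm, ← ENNReal.ofReal_pow (norm_nonneg _),
      ← ENNReal.ofReal_mul (by positivity)]
    congr 1; ring
  rw [setLIntegral_congr_fun measurableSet_Ioi hA', lintegral_lintegral_swap ?_, dualEnergy,
    ← lintegral_const_mul' _ _ ENNReal.ofReal_ne_top]
  · refine lintegral_congr_ae ?_
    filter_upwards [ae_ne_zero hN] with ξ hξ
    rw [lintegral_const_mul' _ _ (by simp), lintegral_gaussian_weight hμN hξ]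
    ring
  · simp only [Function.uncurry_def]
    refine AEMeasurable.fun_mul ?_ ?_
    · exact ((hFc.measurable.comp measurable_snd).enorm.pow_const 2).aemeasurable
    · refine Measurable.aemeasurable (Measurable.ennreal_ofReal ?_)
      fun_prop

/-! ### Integrability of the Riesz kernels -/

/-- The singularity on the diagonal is integrable because `b < N`. The growth at infinity is split
into a product over the two points, so that each density pays for its own factor; for the logarithm
the price `e = 1/2` is affordable as `N ≥ 2`. -/
theorem exists_rieszKernel_bound {N : ℕ} (hN : 2 ≤ N) {μ : ℝ} (hμ : 0 ≤ μ)
    (hμN : μ < (N : ℝ) / 2) :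
    ∃ A b B e : ℝ, 0 ≤ A ∧ b < N ∧ 0 ≤ B ∧ (N : ℝ) < 2 * (N - μ - e) ∧ 0 ≤ e ∧
      ∀ x y : EuclideanSpace ℝ (Fin N), |rieszKernel μ ‖x - y‖| ≤
        A * (Metric.ball 0 1).indicator (fun z => ‖z‖ ^ (-b)) (x - y) +
          B * ((1 + ‖x‖ ^ 2) ^ e * (1 + ‖y‖ ^ 2) ^ e) := by
  have hN' : (2 : ℝ) ≤ N := by exact_mod_cast hN
  rcases hμ.eq_or_lt with rfl | hμ
  -- Here `log r² = 2 log r`, with `|log r| ≤ 1 / r` for `r < 1` and `|log r| ≤ r` otherwise. With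
  -- the square roots `X, Y ≥ 1` of `1 + ‖x‖²` and `1 + ‖y‖²`, the bound `‖x - y‖ ≤ X + Y ≤ 2 X Y`
  -- accounts for the constant `4`.
  · refine ⟨2, 1, 4, 1 / 2, by norm_num, by linarith, by norm_num, by linarith, by norm_num,
      fun x y => ?_⟩
    simp only [rieszKernel, if_true, abs_neg, Real.log_pow]
    push_cast
    rw [abs_mul, abs_two]
    by_cases h : ‖x - y‖ < 1
    · rw [Set.indicator_of_mem (by simpa using h)]
      have h1 : |Real.log ‖x - y‖| ≤ ‖x - y‖ ^ (-1 : ℝ) := by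
        rcases (norm_nonneg (x - y)).eq_or_lt with h0 | h0
        · rw [← h0]; simp
        · rw [abs_of_neg (Real.log_neg h0 h), ← Real.log_inv, Real.rpow_neg_one]
          have := Real.log_le_sub_one_of_pos (inv_pos.mpr h0)
          linarith
      have h2 : 0 ≤ 4 * ((1 + ‖x‖ ^ 2) ^ (1 / 2 : ℝ) * (1 + ‖y‖ ^ 2) ^ (1 / 2 : ℝ)) := by
        positivity
      linarith
    · rw [Set.indicator_of_notMem (by simpa using h), mul_zero, zero_add]
      push Not at h
      have h1 : |Real.log ‖x - y‖| ≤ ‖x - y‖ := by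
        rw [abs_of_nonneg (Real.log_nonneg h)]
        have := Real.log_le_sub_one_of_pos (one_pos.trans_le h)
        linarith
      have h2 : ∀ z : EuclideanSpace ℝ (Fin N), ‖z‖ ≤ (1 + ‖z‖ ^ 2) ^ (1 / 2 : ℝ) ∧
          1 ≤ (1 + ‖z‖ ^ 2) ^ (1 / 2 : ℝ) := by
        intro z
        rw [← Real.sqrt_eq_rpow]
        refine ⟨Real.le_sqrt_of_sq_le (by linarith), ?_⟩
        rw [Real.one_le_sqrt]; nlinarith [sq_nonneg ‖z‖]
      have h3 := norm_sub_le x y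
      obtain ⟨hx1, hx2⟩ := h2 x
      obtain ⟨hy1, hy2⟩ := h2 y
      nlinarith
  · have hΓ := Real.Gamma_pos_of_pos hμ
    refine ⟨Real.Gamma μ, 2 * μ, Real.Gamma μ, 0, hΓ.le, by linarith, hΓ.le, by linarith, le_rfl,
      fun x y => ?_⟩
    simp only [rieszKernel, if_neg hμ.ne', Real.rpow_zero, mul_one]
    rw [abs_of_nonneg (by positivity)]
    by_cases h : ‖x - y‖ < 1
    · rw [Set.indicator_of_mem (by simpa using h)]
      have : (‖x - y‖ ^ 2) ^ (-μ) = ‖x - y‖ ^ (-(2 * μ)) := by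
        rw [← Real.rpow_natCast, ← Real.rpow_mul (norm_nonneg _)]; congr 1; push_cast; ring
      rw [this]; linarith
    · rw [Set.indicator_of_notMem (by simpa using h), mul_zero, zero_add]
      push Not at h
      refine mul_le_of_le_one_right hΓ.le (Real.rpow_le_one_of_one_le_of_nonpos ?_ (by linarith))
      nlinarith

theorem integrable_ball_rpow {N : ℕ} (hN : 1 ≤ N) {b : ℝ} (hb : b < N) :
    Integrable ((Metric.ball 0 1).indicator
      fun z : EuclideanSpace ℝ (Fin N) => ‖z‖ ^ (-b)) := by
  rw [integrable_indicator_iff measurableSet_ball]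
  refine integrableOn_ball_of_norm_le_rpow (by simpa using hN) (C := 1) (α := b) (by simpa using hb)
    (Filter.Eventually.of_forall fun z => ?_) ?_
  · rw [one_mul, Real.norm_of_nonneg (by positivity)]
  · exact (by fun_prop : Measurable fun z : EuclideanSpace ℝ (Fin N) =>
      ‖z‖ ^ (-b)).aestronglyMeasurable

/-- The functions on `ℝ^N` of the same order of decay as a bounded density of weight `N - μ`. -/
def HasDensityDecay {N : ℕ} (μ : ℝ) (g : EuclideanSpace ℝ (Fin N) → ℂ) : Prop :=
  Measurable g ∧ ∃ C, 0 ≤ C ∧ ∀ x, ‖g x‖ ≤ C * (1 + ‖x‖ ^ 2) ^ (-((N : ℝ) - μ))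

theorem HasDensityDecay.integrable {N : ℕ} {μ : ℝ} (hμN : μ < (N : ℝ) / 2)
    {g : EuclideanSpace ℝ (Fin N) → ℂ} (hg : HasDensityDecay μ g) : Integrable g := by
  obtain ⟨hm, C, -, hC⟩ := hg
  exact ((integrable_one_add_rpow (r := (N : ℝ) - μ) (by linarith)).const_mul C).mono'
    hm.aestronglyMeasurable (Filter.Eventually.of_forall hC)

theorem one_add_rpow_le_one {N : ℕ} (x : EuclideanSpace ℝ (Fin N)) {r : ℝ} (hr : 0 ≤ r) :
    (1 + ‖x‖ ^ 2) ^ (-r) ≤ 1 :=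
  Real.rpow_le_one_of_one_le_of_nonpos (by nlinarith [sq_nonneg ‖x‖]) (by linarith)

theorem HasDensityDecay.conj {N : ℕ} {μ : ℝ} {g : EuclideanSpace ℝ (Fin N) → ℂ}
    (hg : HasDensityDecay μ g) : HasDensityDecay μ fun x => (starRingEnd ℂ) (g x) := by
  obtain ⟨hm, C, h0, hC⟩ := hg
  exact ⟨Complex.continuous_conj.measurable.comp hm, C, h0, fun x => by
    rw [RCLike.norm_conj]; exact hC x⟩

theorem HasDensityDecay.integrable_mul_kernel {N : ℕ} (hN : 2 ≤ N) {μ : ℝ} (hμ : 0 ≤ μ)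
    (hμN : μ < (N : ℝ) / 2) {g : EuclideanSpace ℝ (Fin N) → ℂ} (hg : HasDensityDecay μ g)
    (x : EuclideanSpace ℝ (Fin N)) :
    Integrable fun y => g y * (rieszKernel μ ‖x - y‖ : ℂ) := by
  obtain ⟨A, b, B, e, hA, hb, hB, he, he0, hK⟩ := exists_rieszKernel_bound hN hμ hμN
  obtain ⟨hm, C, hC0, hC⟩ := hg
  have hN' : (0 : ℝ) ≤ N := by positivity
  have h1 := ((integrable_ball_rpow (by omega) hb).comp_sub_left x).const_mul A
  have h2 := (integrable_one_add_rpow (N := N) he).const_mul (B * (1 + ‖x‖ ^ 2) ^ e)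
  refine ((h1.add h2).const_mul C).mono' ?_ (Filter.Eventually.of_forall fun y => ?_)
  · exact (hm.mul (Complex.measurable_ofReal.comp ((measurable_rieszKernel μ).comp
      (by fun_prop)))).aestronglyMeasurable
  · rw [norm_mul, Complex.norm_real, Real.norm_eq_abs]
    have hk0 : 0 ≤ (Metric.ball 0 1).indicator
      (fun z : EuclideanSpace ℝ (Fin N) => ‖z‖ ^ (-b)) (x - y) :=
      Set.indicator_nonneg (fun _ _ => by positivity) _
    have hy := one_add_norm_sq_pos y
    have h3 : (1 + ‖y‖ ^ 2) ^ (-((N : ℝ) - μ)) * (1 + ‖y‖ ^ 2) ^ e =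
        (1 + ‖y‖ ^ 2) ^ (-((N : ℝ) - μ - e)) := by
      rw [← Real.rpow_add hy]; congr 1; ring
    have h4 := one_add_rpow_le_one y (r := (N : ℝ) - μ) (by linarith)
    have h5 : (0 : ℝ) ≤ (1 + ‖y‖ ^ 2) ^ (-((N : ℝ) - μ)) := by positivity
    calc ‖g y‖ * |rieszKernel μ ‖x - y‖| ≤ (C * (1 + ‖y‖ ^ 2) ^ (-((N : ℝ) - μ))) *
          (A * (Metric.ball 0 1).indicator (fun z => ‖z‖ ^ (-b)) (x - y) +
          B * ((1 + ‖x‖ ^ 2) ^ e * (1 + ‖y‖ ^ 2) ^ e)) :=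
          mul_le_mul (hC y) (hK x y) (abs_nonneg _) (by positivity)
      _ = C * ((1 + ‖y‖ ^ 2) ^ (-((N : ℝ) - μ)) *
          (A * (Metric.ball 0 1).indicator (fun z => ‖z‖ ^ (-b)) (x - y)) +
          B * (1 + ‖x‖ ^ 2) ^ e * (1 + ‖y‖ ^ 2) ^ (-((N : ℝ) - μ - e))) := by
          rw [← h3]; ring
      _ ≤ _ := by
          exact mul_le_mul_of_nonneg_left
            (add_le_add (mul_le_of_le_one_left (mul_nonneg hA hk0) h4) le_rfl) hC0

/-- The part near the diagonal is dominated by the integrand of a convolution of two integrable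
functions, the rest by a product of integrable functions of the separate variables. -/
theorem HasDensityDecay.integrable_prod_kernel {N : ℕ} (hN : 2 ≤ N) {μ : ℝ} (hμ : 0 ≤ μ)
    (hμN : μ < (N : ℝ) / 2) {g k : EuclideanSpace ℝ (Fin N) → ℂ} (hg : HasDensityDecay μ g)
    (hk : HasDensityDecay μ k) :
    Integrable (fun p : EuclideanSpace ℝ (Fin N) × EuclideanSpace ℝ (Fin N) =>
      (g p.1 * k p.2) * (rieszKernel μ ‖p.1 - p.2‖ : ℂ)) (volume.prod volume) := by
  obtain ⟨A, b, B, e, hA, hb, hB, he, he0, hK⟩ := exists_rieszKernel_bound hN hμ hμN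
  obtain ⟨hm, C, hC0, hC⟩ := hg
  obtain ⟨hm', C', hC0', hC'⟩ := hk
  have hN' : (0 : ℝ) ≤ N := by positivity
  have h1 := Integrable.convolution_integrand (μ := volume) (ContinuousLinearMap.mul ℝ ℝ)
    (integrable_one_add_rpow (N := N) (r := (N : ℝ) - μ) (by linarith))
    (integrable_ball_rpow (N := N) (by omega) hb)
  have h2 := (integrable_one_add_rpow (N := N) he).mul_prod (integrable_one_add_rpow (N := N) he)
  refine (((h1.const_mul A).add (h2.const_mul B)).const_mul (C * C')).mono' ?_
    (Filter.Eventually.of_forall fun p => ?_)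
  · exact (((hm.comp measurable_fst).mul (hm'.comp measurable_snd)).mul
      (Complex.measurable_ofReal.comp ((measurable_rieszKernel μ).comp
      (by fun_prop)))).aestronglyMeasurable
  · obtain ⟨x, y⟩ := p
    simp only [Pi.add_apply, ContinuousLinearMap.mul_apply']
    rw [norm_mul, norm_mul, Complex.norm_real, Real.norm_eq_abs]
    have hk0 : 0 ≤ (Metric.ball 0 1).indicator
      (fun z : EuclideanSpace ℝ (Fin N) => ‖z‖ ^ (-b)) (x - y) :=
      Set.indicator_nonneg (fun _ _ => by positivity) _
    have h3 : ∀ y : EuclideanSpace ℝ (Fin N), (1 + ‖y‖ ^ 2) ^ (-((N : ℝ) - μ)) *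
        (1 + ‖y‖ ^ 2) ^ e = (1 + ‖y‖ ^ 2) ^ (-((N : ℝ) - μ - e)) := by
      intro y
      rw [← Real.rpow_add (one_add_norm_sq_pos y)]; congr 1; ring
    have h4 := one_add_rpow_le_one x (r := (N : ℝ) - μ) (by linarith)
    calc ‖g x‖ * ‖k y‖ * |rieszKernel μ ‖x - y‖| ≤
          (C * (1 + ‖x‖ ^ 2) ^ (-((N : ℝ) - μ))) * (C' * (1 + ‖y‖ ^ 2) ^ (-((N : ℝ) - μ))) *
          (A * (Metric.ball 0 1).indicator (fun z => ‖z‖ ^ (-b)) (x - y) +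
          B * ((1 + ‖x‖ ^ 2) ^ e * (1 + ‖y‖ ^ 2) ^ e)) :=
          mul_le_mul (mul_le_mul (hC x) (hC' y) (norm_nonneg _) (by positivity)) (hK x y)
            (abs_nonneg _) (by positivity)
      _ = C * C' * ((1 + ‖x‖ ^ 2) ^ (-((N : ℝ) - μ)) * (A * ((1 + ‖y‖ ^ 2) ^ (-((N : ℝ) - μ)) *
          (Metric.ball 0 1).indicator (fun z => ‖z‖ ^ (-b)) (x - y))) +
          B * ((1 + ‖x‖ ^ 2) ^ (-((N : ℝ) - μ - e)) * (1 + ‖y‖ ^ 2) ^ (-((N : ℝ) - μ - e)))) := by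
          rw [← h3 x, ← h3 y]; ring
      _ ≤ _ := by
          exact mul_le_mul_of_nonneg_left (add_le_add (mul_le_of_le_one_left
            (mul_nonneg hA (mul_nonneg (by positivity) hk0)) h4) le_rfl) (by positivity)

/-! ### Conformal invariance of the energy -/

theorem rieszKernel_flatMoebius {N : ℕ} {μ : ℝ} {g : SO0 (N + 1)}
    {x y : EuclideanSpace ℝ (Fin N)} (hμ : μ ≠ 0) (hx : x ∈ flatDomain g) (hy : y ∈ flatDomain g) :
    rieszKernel μ ‖x - y‖ =
      flatFactor g x ^ μ * flatFactor g y ^ μ * rieszKernel μ ‖flatMoebius g x - flatMoebius g y‖ := by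
  have h1 := flatFactor_pos g x
  have h2 := flatFactor_pos g y
  rw [rieszKernel, if_neg hμ, rieszKernel, if_neg hμ, norm_flatMoebius_sub_sq hx hy,
    Real.mul_rpow (by positivity) (by positivity), Real.mul_rpow h1.le h2.le,
    Real.rpow_neg h1.le, Real.rpow_neg h2.le]
  have h3 := (Real.rpow_pos_of_pos h1 μ).ne'
  have h4 := (Real.rpow_pos_of_pos h2 μ).ne'
  field_simp

/-- The logarithm turns the multiplicative conformal factor into a sum of functions of one variable
each; these are harmless for densities of mass zero. -/
theorem rieszKernel_zero_flatMoebius {N : ℕ} {g : SO0 (N + 1)}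
    {x y : EuclideanSpace ℝ (Fin N)} (hx : x ∈ flatDomain g) (hy : y ∈ flatDomain g) (hxy : x ≠ y) :
    rieszKernel 0 ‖x - y‖ = rieszKernel 0 ‖flatMoebius g x - flatMoebius g y‖ +
      (Real.log (flatFactor g x) + Real.log (flatFactor g y)) := by
  have h1 := flatFactor_pos g x
  have h2 := flatFactor_pos g y
  have h3 : 0 < ‖x - y‖ := norm_pos_iff.mpr (sub_ne_zero.mpr hxy)
  rw [rieszKernel, if_pos rfl, rieszKernel, if_pos rfl, norm_flatMoebius_sub_sq hx hy,
    Real.log_mul (by positivity) (by positivity), Real.log_mul h1.ne' h2.ne']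
  ring

/-- The pullback of a density of weight `N - μ`. -/
noncomputable def flatPullback {N : ℕ} (μ : ℝ) (h : SO0 (N + 1))
    (g : EuclideanSpace ℝ (Fin N) → ℂ) (x : EuclideanSpace ℝ (Fin N)) : ℂ :=
  ((flatFactor h x ^ ((N : ℝ) - μ) : ℝ) : ℂ) * g (flatMoebius h x)

/-- In each variable the exponent `N - μ` of the density and the exponent `μ` from the kernel add up
to the Jacobian `flatFactor ^ N`. -/
theorem rieszEnergy_flatPullback_of_ne_zero {N : ℕ} (hN : 1 ≤ N) {μ : ℝ} (hμ : μ ≠ 0)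
    (h : SO0 (N + 1)) (g : EuclideanSpace ℝ (Fin N) → ℂ) :
    rieszEnergy μ (flatPullback μ h g) = rieszEnergy μ g := by
  have hpow : ∀ x : EuclideanSpace ℝ (Fin N), ((flatFactor h x ^ ((N : ℝ) - μ) : ℝ) : ℂ) *
      ((flatFactor h x ^ μ : ℝ) : ℂ) = ((flatFactor h x ^ N : ℝ) : ℂ) := by
    intro x
    rw [← Complex.ofReal_mul, ← Real.rpow_add (flatFactor_pos h x), sub_add_cancel,
      Real.rpow_natCast]
  rw [rieszEnergy, rieszEnergy, ← integral_flatMoebius hN h (fun x => g x * _)]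
  refine integral_congr_ae ?_
  filter_upwards [ae_mem_flatDomain' hN h] with x hx
  have inner : ∫ y, (starRingEnd ℂ) (flatPullback μ h g y) * (rieszKernel μ ‖x - y‖ : ℂ) =
      ((flatFactor h x ^ μ : ℝ) : ℂ) *
        ∫ y, (starRingEnd ℂ) (g y) * (rieszKernel μ ‖flatMoebius h x - y‖ : ℂ) := by
    rw [← integral_flatMoebius hN h (fun y => (starRingEnd ℂ) (g y) * _), ← integral_const_mul]
    refine integral_congr_ae ?_
    filter_upwards [ae_mem_flatDomain' hN h] with y hy
    rw [flatPullback, rieszKernel_flatMoebius hμ hx hy, map_mul, Complex.conj_ofReal, ← hpow y]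
    push_cast
    ring
  rw [inner, flatPullback, ← hpow x]
  ring

/-- The two logarithmic terms each integrate to zero against a density of mass zero in the other
variable. Splitting the integrals requires integrability, which is where the decay of both `g` and
its pullback is used. -/
theorem rieszEnergy_flatPullback_zero {N : ℕ} (hN : 2 ≤ N) (h : SO0 (N + 1))
    {g g' : EuclideanSpace ℝ (Fin N) → ℂ} (hg : HasDensityDecay 0 g)
    (hg' : HasDensityDecay 0 g') (hgg' : g' =ᵐ[volume] flatPullback 0 h g) (h0 : ∫ x, g x = 0) :
    rieszEnergy 0 (flatPullback 0 h g) = rieszEnergy 0 g := by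
  have hN1 : 1 ≤ N := by omega
  have hN2 : (0 : ℝ) < (N : ℝ) / 2 := by
    have : (2 : ℝ) ≤ N := by exact_mod_cast hN
    linarith
  have hpb : ∀ y, flatPullback 0 h g y = ((flatFactor h y ^ N : ℝ) : ℂ) * g (flatMoebius h y) := by
    intro y; rw [flatPullback, sub_zero, Real.rpow_natCast]
  have hc0 : ∫ x, (starRingEnd ℂ) (g x) = 0 := by rw [integral_conj, h0, map_zero]
  set pot : EuclideanSpace ℝ (Fin N) → ℂ := fun x =>
    ∫ y, (starRingEnd ℂ) (g y) * (rieszKernel 0 ‖x - y‖ : ℂ)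
  set q : EuclideanSpace ℝ (Fin N) → ℂ := fun y =>
    ((flatFactor h y ^ N : ℝ) : ℂ) * (starRingEnd ℂ) (g (flatMoebius h y))
  have hq : Integrable q := integrable_flatMoebius hN1 h (hg.conj.integrable hN2)
  have hq0 : ∫ y, q y = 0 := by
    rw [← hc0, ← integral_flatMoebius hN1 h fun y => (starRingEnd ℂ) (g y)]
  have hqpb : ∀ y, (starRingEnd ℂ) (flatPullback 0 h g y) = q y := by
    intro y; rw [hpb, map_mul, Complex.conj_ofReal]
  have hne : ∀ x : EuclideanSpace ℝ (Fin N), ∀ᵐ y, y ≠ x := by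
    intro x
    have : Nonempty (Fin N) := ⟨⟨0, hN1⟩⟩
    have : Nontrivial (EuclideanSpace ℝ (Fin N)) := inferInstance
    exact Measure.ae_ne volume x
  -- the inner integrals
  set L : ℂ := ∫ y, q y * (Real.log (flatFactor h y) : ℂ)
  have inner : ∀ x ∈ flatDomain h, ∫ y, (starRingEnd ℂ) (flatPullback 0 h g y) *
      (rieszKernel 0 ‖x - y‖ : ℂ) = pot (flatMoebius h x) + L := by
    intro x hx
    have i1 : Integrable fun y => q y *
        (rieszKernel 0 ‖flatMoebius h x - flatMoebius h y‖ : ℂ) := by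
      have := integrable_flatMoebius hN1 h
        (hg.conj.integrable_mul_kernel hN le_rfl hN2 (flatMoebius h x))
      refine this.congr (Filter.Eventually.of_forall fun y => ?_)
      simp only [q]; ring
    have i2 : Integrable fun y => q y * (rieszKernel 0 ‖x - y‖ : ℂ) := by
      have := hg'.conj.integrable_mul_kernel hN le_rfl hN2 x
      refine this.congr ?_
      filter_upwards [hgg'] with y hy
      rw [hy, hqpb]
    have split : ∀ᵐ y, q y * (rieszKernel 0 ‖x - y‖ : ℂ) = q y *
        (rieszKernel 0 ‖flatMoebius h x - flatMoebius h y‖ : ℂ) +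
        (q y * (Real.log (flatFactor h x) : ℂ) + q y * (Real.log (flatFactor h y) : ℂ)) := by
      filter_upwards [ae_mem_flatDomain' hN1 h, hne x] with y hy hyx
      rw [rieszKernel_zero_flatMoebius hx hy hyx.symm]
      push_cast; ring
    -- Integrability of the logarithmic term is read off from the other terms of the identity, so no
    -- estimate of `flatFactor` is needed.
    have i3 : Integrable fun y => q y * (Real.log (flatFactor h y) : ℂ) := by
      refine ((i2.sub i1).sub (hq.mul_const (Real.log (flatFactor h x) : ℂ))).congr ?_
      filter_upwards [split] with y hy
      simp only [Pi.sub_apply]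
      rw [hy]; ring
    simp only [hqpb]
    have i4 : Integrable fun y => q y * (Real.log (flatFactor h x) : ℂ) +
      q y * (Real.log (flatFactor h y) : ℂ) := (hq.mul_const _).add i3
    rw [integral_congr_ae split, integral_add i1 i4, integral_add (hq.mul_const _) i3, integral_mul_const, hq0, zero_mul, zero_add]
    congr 1
    simp only [pot]
    rw [← integral_flatMoebius hN1 h fun y => (starRingEnd ℂ) (g y) * _]
    refine integral_congr_ae (Filter.Eventually.of_forall fun y => ?_)
    simp only [q]; ring
  have hpot : Integrable fun x => g x * pot x := by
    have := (hg.integrable_prod_kernel hN le_rfl hN2 hg.conj).integral_prod_left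
    refine this.congr (Filter.Eventually.of_forall fun x => ?_)
    simp only [mul_assoc (g x), integral_const_mul, pot]
  have hpot' := integrable_flatMoebius hN1 h hpot
  rw [rieszEnergy, rieszEnergy]
  have outer : ∀ᵐ x, flatPullback 0 h g x * ∫ y, (starRingEnd ℂ) (flatPullback 0 h g y) *
      (rieszKernel 0 ‖x - y‖ : ℂ) =
      ((flatFactor h x ^ N : ℝ) : ℂ) * (g (flatMoebius h x) * pot (flatMoebius h x)) +
      (((flatFactor h x ^ N : ℝ) : ℂ) * g (flatMoebius h x)) * L := by
    filter_upwards [ae_mem_flatDomain' hN1 h] with x hx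
    rw [inner x hx, hpb]; ring
  rw [integral_congr_ae outer, integral_add hpot'
    ((integrable_flatMoebius hN1 h (hg.integrable hN2)).mul_const L), integral_mul_const,
    integral_flatMoebius hN1 h (fun x => g x * pot x), integral_flatMoebius hN1 h g, h0, zero_mul, add_zero]

/-! ### Smooth functions on the sphere -/

theorem restrict_mem_smoothSphere {N : ℕ} {f : EuclideanSpace ℝ (Fin (N + 1)) → ℂ}
    (hf : ContDiff ℝ ∞ f) : (fun u : Sph N => f u.1) ∈ SmoothSphere N :=
  hf.contMDiff.comp contMDiff_coe_sphere

theorem mul_mem_smoothSphere {N : ℕ} {F G : Sph N → ℂ} (hF : F ∈ SmoothSphere N)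
    (hG : G ∈ SmoothSphere N) : (fun u => F u * G u) ∈ SmoothSphere N := by
  have h4 : ContDiff ℝ ∞ (fun p : ℂ × ℂ => p.1 * p.2) := contDiff_fst.mul contDiff_snd
  have hF' : ContMDiff (𝓡 N) 𝓘(ℝ, ℂ) ∞ F := hF
  have hG' : ContMDiff (𝓡 N) 𝓘(ℝ, ℂ) ∞ G := hG
  exact h4.contMDiff.comp (hF'.prodMk_space hG')

theorem continuous_smoothSphere {N : ℕ} (F : SmoothSphere N) : Continuous F.1 := by
  have h : ContMDiff (𝓡 N) 𝓘(ℝ, ℂ) ∞ F.1 := F.2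
  exact h.continuous

theorem exists_bound_smoothSphere {N : ℕ} (F : SmoothSphere N) : ∃ C, ∀ u, ‖F.1 u‖ ≤ C := by
  obtain ⟨C, hC⟩ := (isCompact_univ (X := Sph N)).exists_bound_of_continuousOn
    (continuous_smoothSphere F).continuousOn
  exact ⟨C, fun u => hC u (Set.mem_univ u)⟩

/-- A smooth function on the sphere composed with a smooth map into the sphere. -/
theorem contDiff_comp_sphere {N : ℕ} {E : Type*} [NormedAddCommGroup E] [NormedSpace ℝ E]
    (F : SmoothSphere N) {γ : E → EuclideanSpace ℝ (Fin (N + 1))} (hγ : ContDiff ℝ ∞ γ)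
    (h : ∀ x, γ x ∈ Metric.sphere (0 : EuclideanSpace ℝ (Fin (N + 1))) 1) :
    ContDiff ℝ ∞ fun x => F.1 ⟨γ x, h x⟩ := by
  have hF : ContMDiff (𝓡 N) 𝓘(ℝ, ℂ) ∞ F.1 := F.2
  exact (hF.comp (hγ.contMDiff.codRestrict_sphere h)).contDiff

theorem contDiff_comp_cayley {N : ℕ} (F : SmoothSphere N) :
    ContDiff ℝ ∞ fun x : EuclideanSpace ℝ (Fin N) => F.1 (cayley x) :=
  contDiff_comp_sphere F contDiff_cayley_coe fun x => (cayley x).2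

theorem sphDensity_eq_rpow {N : ℕ} (μ : ℝ) (x : EuclideanSpace ℝ (Fin N)) :
    (2 / (1 + ‖x‖ ^ 2)) ^ μ = sphDensity x ^ μ := rfl

theorem contDiff_noncompact {N : ℕ} (μ : ℝ) (F : SmoothSphere N) :
    ContDiff ℝ ∞ (noncompact μ F) := by
  have h1 : ContDiff ℝ ∞ fun x : EuclideanSpace ℝ (Fin N) => (2 / (1 + ‖x‖ ^ 2)) ^ μ := by
    refine ContDiff.rpow_const_of_ne ?_ fun x => (sphDensity_pos x).ne'
    exact contDiff_const.div (contDiff_const.add (contDiff_norm_sq ℝ))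
      fun x => (one_add_norm_sq_pos x).ne'
  exact (Complex.ofRealCLM.contDiff.comp h1).mul (contDiff_comp_cayley F)

open Classical in
/-- The extension of a function on the sphere which is constant on rays. -/
noncomputable def radialExt {N : ℕ} (F : Sph N → ℂ) (x : EuclideanSpace ℝ (Fin (N + 1))) : ℂ :=
  if h : x = 0 then 0 else F ⟨‖x‖⁻¹ • x, by
    rw [mem_sphere_zero_iff_norm, norm_smul, norm_inv, norm_norm,
      inv_mul_cancel₀ (norm_ne_zero_iff.mpr h)]⟩

theorem radialExt_smul {N : ℕ} (F : Sph N → ℂ) {c : ℝ} (hc : 0 < c) (u : Sph N) :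
    radialExt F (c • u.1) = F u := by
  have h1 : ‖u.1‖ = 1 := mem_sphere_zero_iff_norm.mp u.2
  have h2 : c • u.1 ≠ 0 := by
    rw [← norm_ne_zero_iff, norm_smul, h1, mul_one, norm_ne_zero_iff]; exact hc.ne'
  rw [radialExt, dif_neg h2]
  congr 1
  apply Subtype.ext
  simp only [norm_smul, h1, mul_one, Real.norm_of_nonneg hc.le, smul_smul,
    inv_mul_cancel₀ hc.ne', one_smul]

theorem radialExt_coe {N : ℕ} (F : Sph N → ℂ) (u : Sph N) : radialExt F u.1 = F u := by
  simpa using radialExt_smul F one_pos u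

theorem radialExt_pos_smul {N : ℕ} (F : Sph N → ℂ) {c : ℝ} (hc : 0 < c)
    (x : EuclideanSpace ℝ (Fin (N + 1))) : radialExt F (c • x) = radialExt F x := by
  by_cases hx : x = 0
  · simp [hx]
  · have hn : 0 < ‖x‖ := norm_pos_iff.mpr hx
    set u : Sph N := ⟨‖x‖⁻¹ • x, by
      rw [mem_sphere_zero_iff_norm, norm_smul, norm_inv, norm_norm, inv_mul_cancel₀ hn.ne']⟩
    have hxu : x = ‖x‖ • u.1 := by simp [u, smul_smul, hn.ne']
    rw [hxu, smul_smul, radialExt_smul F (by positivity), radialExt_smul F hn]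

theorem contDiffAt_radialExt {N : ℕ} (F : SmoothSphere N) {x : EuclideanSpace ℝ (Fin (N + 1))}
    (hx : x ≠ 0) : ContDiffAt ℝ ∞ (radialExt F.1) x := by
  have hn : 0 < ‖x‖ := norm_pos_iff.mpr hx
  -- a smooth map without zeros which is the identity near `x`
  let b : ContDiffBump x := ⟨‖x‖ / 4, ‖x‖ / 2, by positivity, by linarith⟩
  set ψ : EuclideanSpace ℝ (Fin (N + 1)) → EuclideanSpace ℝ (Fin (N + 1)) :=
    fun y => x + b y • (y - x)
  -- Where the bump is active, `ψ y` differs from `x` by less than half the norm of `x`; elsewhere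
  -- it equals `x`.
  have hψ0 : ∀ y, ψ y ≠ 0 := by
    intro y hy
    have h1 : b y • (y - x) = -x := by
      have : x + b y • (y - x) = 0 := hy
      exact (neg_eq_of_add_eq_zero_right this).symm
    have h2 : ‖b y • (y - x)‖ = ‖x‖ := by rw [h1, norm_neg]
    rw [norm_smul, Real.norm_of_nonneg b.nonneg] at h2
    by_cases hd : dist y x < ‖x‖ / 2
    · rw [dist_eq_norm] at hd
      nlinarith [b.le_one (x := y), b.nonneg (x := y), norm_nonneg (y - x)]
    · rw [b.zero_of_le_dist (not_lt.mp hd), zero_mul] at h2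
      exact hn.ne h2
  have hψ : ContDiff ℝ ∞ ψ := contDiff_const.add (b.contDiff.smul (contDiff_id.sub contDiff_const))
  have h1 := contDiff_comp_sphere F (γ := fun y => ‖ψ y‖⁻¹ • ψ y)
    (((hψ.norm ℝ hψ0).inv fun y => (norm_pos_iff.mpr (hψ0 y)).ne').smul hψ) fun y => by
      rw [mem_sphere_zero_iff_norm, norm_smul, norm_inv, norm_norm,
        inv_mul_cancel₀ (norm_ne_zero_iff.mpr (hψ0 y))]
  refine h1.contDiffAt.congr_of_eventuallyEq ?_
  filter_upwards [b.eventuallyEq_one] with y hy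
  have h2 : ψ y = y := by simp [ψ, hy]
  have h3 : y ≠ 0 := h2 ▸ hψ0 y
  rw [radialExt, dif_neg h3]
  exact congrArg F.1 (Subtype.ext (by simp only [h2]))

/-- Smooth functions with compact support in the non-compact picture. -/
theorem exists_noncompact_eq {N : ℕ} (μ : ℝ) {f : EuclideanSpace ℝ (Fin N) → ℂ}
    (hf : ContDiff ℝ ∞ f) (hc : HasCompactSupport f) :
    ∃ F : SmoothSphere N, noncompact μ F = f := by
  obtain ⟨R, hR⟩ := hc.isCompact.isBounded.subset_closedBall 0
  set R' := max R 1
  have hR' : 1 ≤ R' := le_max_right _ _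
  have hfR : ∀ x, R' < ‖x‖ → f x = 0 := by
    intro x hx
    by_contra h
    have := hR (subset_tsupport _ h)
    rw [mem_closedBall_zero_iff] at this
    exact absurd (this.trans (le_max_left R 1)) (not_le.mpr hx)
  -- the divided function
  set f' : EuclideanSpace ℝ (Fin N) → ℂ := fun x => ((sphDensity x ^ (-μ) : ℝ) : ℂ) * f x
  have hf' : ContDiff ℝ ∞ f' := by
    refine ContDiff.mul (Complex.ofRealCLM.contDiff.comp ?_) hf
    refine ContDiff.rpow_const_of_ne ?_ fun x => (sphDensity_pos x).ne'
    exact contDiff_const.div (contDiff_const.add (contDiff_norm_sq ℝ))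
      fun x => (one_add_norm_sq_pos x).ne'
  -- For `‖x‖ ≤ R'` one has `1 + u 0 = 2 / (1 + ‖x‖²) ≥ 2 δ`, where the cutoff is `1`; it vanishes
  -- for `1 + u 0 ≤ δ`, that is, near the pole.
  set δ : ℝ := 1 / (1 + R' ^ 2)
  have hδ : 0 < δ := by positivity
  set Ψ : EuclideanSpace ℝ (Fin (N + 1)) → ℂ := fun u =>
    ((Real.smoothTransition ((1 + u 0) / δ - 1) : ℝ) : ℂ) * f' (stereo u)
  have hΨ : ContDiff ℝ ∞ Ψ := by
    rw [contDiff_iff_contDiffAt]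
    intro u
    by_cases hu : 1 + u 0 < δ
    · have hev : Ψ =ᶠ[nhds u] fun _ => 0 := by
        have ho : IsOpen {v : EuclideanSpace ℝ (Fin (N + 1)) | 1 + v 0 < δ} :=
          isOpen_lt (by fun_prop) continuous_const
        filter_upwards [ho.mem_nhds hu] with v hv
        have hv' : 1 + v 0 < δ := hv
        have : (1 + v 0) / δ - 1 ≤ 0 := by
          rw [sub_nonpos, div_le_one hδ]; exact hv'.le
        simp [Ψ, Real.smoothTransition.zero_of_nonpos this]
      exact contDiffAt_const.congr_of_eventuallyEq hev
    · have hu0 : u 0 ≠ -1 := by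
        intro h; rw [h] at hu; exact hu (by simpa using hδ)
      refine ContDiffAt.mul ?_ (hf'.contDiffAt.comp u (contDiffAt_stereo hu0))
      refine Complex.ofRealCLM.contDiff.contDiffAt.comp u ?_
      refine Real.smoothTransition.contDiff.contDiffAt.comp u ?_
      fun_prop
  refine ⟨⟨_, restrict_mem_smoothSphere hΨ⟩, ?_⟩
  funext x
  simp only [noncompact, Ψ, sphDensity_eq_rpow, stereo_cayley, one_add_cayley_zero, f']
  by_cases hx : R' < ‖x‖
  · rw [hfR x hx]; simp
  · push Not at hx
    have h1 : 1 ≤ 2 / (1 + ‖x‖ ^ 2) / δ - 1 := by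
      have h2 : 1 + ‖x‖ ^ 2 ≤ 1 + R' ^ 2 := by gcongr
      have h3 : 2 / (1 + ‖x‖ ^ 2) / δ = 2 * ((1 + R' ^ 2) / (1 + ‖x‖ ^ 2)) := by
        simp only [δ]; field_simp
      have h4 : 1 ≤ (1 + R' ^ 2) / (1 + ‖x‖ ^ 2) := by
        rwa [le_div_iff₀ (one_add_norm_sq_pos x), one_mul]
      rw [h3]; linarith
    rw [Real.smoothTransition.one_of_one_le h1, Complex.ofReal_one, one_mul, ← mul_assoc,
      ← Complex.ofReal_mul, ← Real.rpow_add (sphDensity_pos x), add_neg_cancel, Real.rpow_zero,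
      Complex.ofReal_one, one_mul]

/-! ### Densities and their potentials -/

theorem dualElt_add {N : ℕ} (hN : 1 ≤ N) {μ : ℝ} {φ ψ : EuclideanSpace ℝ (Fin N) → ℂ}
    (hφ : AEStronglyMeasurable φ volume) (hψ : AEStronglyMeasurable ψ volume)
    (hE : dualEnergy μ φ < ⊤) (hE' : dualEnergy μ ψ < ⊤) :
    dualElt μ (φ + ψ) = dualElt μ φ + dualElt μ ψ := by
  have h1 := memLp_dualFun hN hφ hE
  have h2 := memLp_dualFun hN hψ hE'
  have h3 : dualFun μ (φ + ψ) = dualFun μ φ + dualFun μ ψ := by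
    funext ξ; simp [dualFun, mul_add]
  have h4 : MemLp (dualFun μ (φ + ψ)) 2 (weightMeasure N μ) := h3 ▸ h1.add h2
  rw [dualElt, dualElt, dualElt, dif_pos h1, dif_pos h2, dif_pos h4, ← MemLp.toLp_add h1 h2]
  exact MemLp.toLp_congr _ _ (by rw [h3])

theorem dualElt_smul {N : ℕ} (hN : 1 ≤ N) {μ : ℝ} {φ : EuclideanSpace ℝ (Fin N) → ℂ}
    (hφ : AEStronglyMeasurable φ volume) (hE : dualEnergy μ φ < ⊤) (c : ℂ) :
    dualElt μ (c • φ) = c • dualElt μ φ := by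
  have h1 := memLp_dualFun hN hφ hE
  have h3 : dualFun μ (c • φ) = c • dualFun μ φ := by
    funext ξ; simp [dualFun, mul_left_comm]
  have h4 : MemLp (dualFun μ (c • φ)) 2 (weightMeasure N μ) := h3 ▸ h1.const_smul c
  rw [dualElt, dualElt, dif_pos h1, dif_pos h4, ← MemLp.toLp_const_smul c h1]
  exact MemLp.toLp_congr _ _ (by rw [h3])

/-- The parameters of the complementary series, including the end point `0`. -/
structure IsComplementary (N : ℕ) (μ : ℝ) : Prop where
  two_le : 2 ≤ N
  nonneg : 0 ≤ μ
  lt_half : μ < (N : ℝ) / 2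

theorem IsComplementary.one_le {N : ℕ} {μ : ℝ} (H : IsComplementary N μ) : 1 ≤ N :=
  one_le_two.trans H.two_le

/-- The densities of weight `N - μ`, with total mass zero in case `μ = 0`. -/
def densities (N : ℕ) (μ : ℝ) : Submodule ℂ (EuclideanSpace ℝ (Fin N) → ℂ) where
  carrier := {g | HasDensityDecay μ g ∧ Integrable g ∧ (μ = 0 → ∫ x, g x = 0)}
  zero_mem' := ⟨⟨measurable_const, 0, le_rfl, by simp⟩, integrable_zero _ _ _, by simp⟩
  add_mem' := by
    rintro f g ⟨⟨hm, C, hC0, hC⟩, hi, h0⟩ ⟨⟨hm', C', hC0', hC'⟩, hi', h0'⟩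
    refine ⟨⟨hm.add hm', C + C', by positivity, fun x => ?_⟩, hi.add hi', fun h => ?_⟩
    · rw [add_mul]
      exact (norm_add_le _ _).trans (add_le_add (hC x) (hC' x))
    · simp only [Pi.add_apply]
      rw [integral_add hi hi', h0 h, h0' h, add_zero]
  smul_mem' := by
    rintro c f ⟨⟨hm, C, hC0, hC⟩, hi, h0⟩
    refine ⟨⟨hm.const_smul c, ‖c‖ * C, by positivity, fun x => ?_⟩, hi.smul c, fun h => ?_⟩
    · rw [Pi.smul_apply, norm_smul, mul_assoc]
      exact mul_le_mul_of_nonneg_left (hC x) (norm_nonneg _)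
    · simp only [Pi.smul_apply]
      rw [integral_smul, h0 h, smul_zero]

theorem mem_densities {N : ℕ} {μ : ℝ} (H : IsComplementary N μ)
    {g : EuclideanSpace ℝ (Fin N) → ℂ} (hg : HasDensityDecay μ g)
    (h0 : μ = 0 → ∫ x, g x = 0) : g ∈ densities N μ :=
  ⟨hg, hg.integrable H.lt_half, h0⟩

theorem energyConst_mul_dualEnergy {N : ℕ} {μ : ℝ} (H : IsComplementary N μ)
    {g : EuclideanSpace ℝ (Fin N) → ℂ} (hg : g ∈ densities N μ) :
    ENNReal.ofReal (energyConst N μ) * dualEnergy μ (𝓕 g) =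
      ENNReal.ofReal (rieszEnergy μ g).re :=
  dualEnergy_fourier H.one_le H.nonneg H.lt_half hg.2.1 hg.2.2
    (hg.1.integrable_prod_kernel H.two_le H.nonneg H.lt_half hg.1.conj)

/-- The Riesz energy is a number, so the right side of the energy formula is finite, and the
constant on the left is positive. -/
theorem dualEnergy_fourier_lt_top {N : ℕ} {μ : ℝ} (H : IsComplementary N μ)
    {g : EuclideanSpace ℝ (Fin N) → ℂ} (hg : g ∈ densities N μ) : dualEnergy μ (𝓕 g) < ⊤ := by
  have h := energyConst_mul_dualEnergy H hg
  have hc := energyConst_pos H.lt_half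
  by_contra h'
  rw [not_lt, top_le_iff] at h'
  rw [h', ENNReal.mul_top (by simpa using hc)] at h
  exact ENNReal.ofReal_ne_top h.symm

/-- The Riesz potential of a density. -/
noncomputable def potential {N : ℕ} {μ : ℝ} (H : IsComplementary N μ) :
    densities N μ →ₗ[ℂ] WeightedL2 N μ where
  toFun g := dualElt μ (𝓕 g.1)
  map_add' f g := by
    rw [← dualElt_add H.one_le (continuous_fourier f.2.2.1).aestronglyMeasurable
      (continuous_fourier g.2.2.1).aestronglyMeasurable (dualEnergy_fourier_lt_top H f.2)
      (dualEnergy_fourier_lt_top H g.2)]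
    congr 1
    funext ξ
    simp only [Pi.add_apply, Real.fourier_eq, Submodule.coe_add, smul_add]
    exact integral_add ((Real.fourierIntegral_convergent_iff ξ).2 f.2.2.1)
      ((Real.fourierIntegral_convergent_iff ξ).2 g.2.2.1)
  map_smul' c g := by
    rw [RingHom.id_apply, ← dualElt_smul H.one_le
      (continuous_fourier g.2.2.1).aestronglyMeasurable (dualEnergy_fourier_lt_top H g.2)]
    congr 1
    funext ξ
    simp only [Pi.smul_apply, Real.fourier_eq, Submodule.coe_smul, ← integral_smul]
    exact integral_congr_ae (Filter.Eventually.of_forall fun v => smul_comm _ _ _)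

theorem inner_potential {N : ℕ} {μ : ℝ} (H : IsComplementary N μ) (g : densities N μ)
    (k : WeightedL2 N μ) :
    inner ℂ (potential H g) k = ∫ ξ, (starRingEnd ℂ) (𝓕 g.1 ξ) * k ξ :=
  inner_dualElt H.one_le (continuous_fourier g.2.2.1).aestronglyMeasurable
    (dualEnergy_fourier_lt_top H g.2) k

theorem norm_potential_eq {N : ℕ} {μ : ℝ} (H : IsComplementary N μ) {f g : densities N μ}
    (h : rieszEnergy μ f.1 = rieszEnergy μ g.1) : ‖potential H f‖ = ‖potential H g‖ := by
  rw [← sq_eq_sq₀ (norm_nonneg _) (norm_nonneg _)]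
  change ‖dualElt μ (𝓕 f.1)‖ ^ 2 = ‖dualElt μ (𝓕 g.1)‖ ^ 2
  rw [norm_dualElt_sq H.one_le (continuous_fourier f.2.2.1).aestronglyMeasurable
    (dualEnergy_fourier_lt_top H f.2), norm_dualElt_sq H.one_le
    (continuous_fourier g.2.2.1).aestronglyMeasurable (dualEnergy_fourier_lt_top H g.2)]
  have hc := energyConst_pos H.lt_half
  have h1 := energyConst_mul_dualEnergy H f.2
  rw [h, ← energyConst_mul_dualEnergy H g.2] at h1
  rw [(ENNReal.mul_right_inj (by simpa using hc) ENNReal.ofReal_ne_top).mp h1]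

/-! ### The action on densities -/

theorem measurable_flatMoebius {N : ℕ} (h : SO0 (N + 1)) :
    Measurable (flatMoebius (N := N) h) :=
  measurable_stereo.comp (continuous_subtype_val.comp
    ((continuous_moebius h).comp continuous_cayley)).measurable

theorem measurable_flatFactor {N : ℕ} (h : SO0 (N + 1)) :
    Measurable (flatFactor (N := N) h) := by
  have h1 := measurable_flatMoebius h
  have h2 : Measurable fun x : EuclideanSpace ℝ (Fin N) => den h (cayley x).1 :=
    ((continuous_den h).comp continuous_cayley).measurable
  unfold flatFactor
  fun_prop

theorem exists_le_den {N : ℕ} (h : SO0 (N + 1)) : ∃ c, 0 < c ∧ ∀ u : Sph N, c ≤ den h u.1 := by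
  have hne : (Set.univ : Set (Sph N)).Nonempty := ⟨cayley 0, Set.mem_univ _⟩
  obtain ⟨u, -, hu⟩ := isCompact_univ.exists_isMinOn hne (continuous_den h).continuousOn
  exact ⟨den h u.1, den_pos h u, fun v => hu (Set.mem_univ v)⟩

/-- In terms of `sphDensity` the decay is that of a bounded function times `sphDensity ^ (N - μ)`.
The identity `flatFactor_eq` transports this power at the cost of `den`, bounded below by
compactness of the sphere. -/
theorem HasDensityDecay.flatPullback {N : ℕ} {μ : ℝ} (hμ : μ ≤ N)
    {g : EuclideanSpace ℝ (Fin N) → ℂ} (hg : HasDensityDecay μ g) (h : SO0 (N + 1)) :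
    HasDensityDecay μ (flatPullback μ h g) := by
  obtain ⟨hm, C, hC0, hC⟩ := hg
  obtain ⟨c, hc, hc'⟩ := exists_le_den h
  refine ⟨(Complex.measurable_ofReal.comp ((measurable_flatFactor h).pow_const _)).mul
    (hm.comp (measurable_flatMoebius h)), C * c⁻¹ ^ ((N : ℝ) - μ), by positivity, fun x => ?_⟩
  have hf := flatFactor_pos h x
  have hs := sphDensity_pos x
  have hd := den_pos h (cayley x)
  rw [LorentzBranching.flatPullback, norm_mul, Complex.norm_real, Real.norm_of_nonneg (by positivity)]
  have h2 : ∀ y : EuclideanSpace ℝ (Fin N), (1 + ‖y‖ ^ 2) ^ (-((N : ℝ) - μ)) =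
      (2 ^ ((N : ℝ) - μ))⁻¹ * sphDensity y ^ ((N : ℝ) - μ) := by
    intro y
    rw [sphDensity_rpow, ← mul_assoc, inv_mul_cancel₀ (by positivity), one_mul]
  calc flatFactor h x ^ ((N : ℝ) - μ) * ‖g (flatMoebius h x)‖ ≤
        flatFactor h x ^ ((N : ℝ) - μ) *
          (C * ((2 ^ ((N : ℝ) - μ))⁻¹ * sphDensity (flatMoebius h x) ^ ((N : ℝ) - μ))) := by
        rw [← h2]; gcongr; exact hC _
    _ = C * ((2 ^ ((N : ℝ) - μ))⁻¹ * (flatFactor h x * sphDensity (flatMoebius h x)) ^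
          ((N : ℝ) - μ)) := by
        rw [Real.mul_rpow hf.le (sphDensity_pos _).le]; ring
    _ = C * ((2 ^ ((N : ℝ) - μ))⁻¹ * (sphDensity x ^ ((N : ℝ) - μ) *
          ((den h (cayley x).1)⁻¹) ^ ((N : ℝ) - μ))) := by
        rw [flatFactor_eq, Real.mul_rpow hs.le (by positivity)]
    _ ≤ C * ((2 ^ ((N : ℝ) - μ))⁻¹ * (sphDensity x ^ ((N : ℝ) - μ) * c⁻¹ ^ ((N : ℝ) - μ))) := by
        have : (den h (cayley x).1)⁻¹ ≤ c⁻¹ := by gcongr; exact hc' _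
        have h5 := sub_nonneg.mpr hμ
        gcongr
    _ = _ := by rw [h2]; ring

theorem IsComplementary.le {N : ℕ} {μ : ℝ} (H : IsComplementary N μ) : μ ≤ N := by
  have h1 := H.lt_half
  have h2 := H.nonneg
  linarith

theorem flatPullback_mem_densities {N : ℕ} {μ : ℝ} (H : IsComplementary N μ) (h : SO0 (N + 1))
    {g : EuclideanSpace ℝ (Fin N) → ℂ} (hg : g ∈ densities N μ) :
    flatPullback μ h g ∈ densities N μ := by
  refine mem_densities H (hg.1.flatPullback H.le h) fun h0 => ?_
  have h1 := integral_flatMoebius H.one_le h g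
  rw [hg.2.2 h0] at h1
  rw [← h1]
  congr 1 with x
  rw [flatPullback, h0, sub_zero, Real.rpow_natCast]

/-- The pullback of densities. -/
noncomputable def pullback {N : ℕ} {μ : ℝ} (H : IsComplementary N μ) (h : SO0 (N + 1)) :
    densities N μ →ₗ[ℂ] densities N μ where
  toFun g := ⟨flatPullback μ h g.1, flatPullback_mem_densities H h g.2⟩
  map_add' f g := by
    apply Subtype.ext; funext x
    simp [flatPullback, mul_add]
  map_smul' c g := by
    apply Subtype.ext; funext x
    simp [flatPullback, mul_left_comm]

/-- This is the source of unitarity: conformal invariance of the Riesz energy, read through the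
energy formula. -/
theorem norm_potential_pullback {N : ℕ} {μ : ℝ} (H : IsComplementary N μ) (h : SO0 (N + 1))
    (g : densities N μ) : ‖potential H (pullback H h g)‖ = ‖potential H g‖ := by
  refine norm_potential_eq H ?_
  change rieszEnergy μ (flatPullback μ h g.1) = rieszEnergy μ g.1
  by_cases hμ : μ = 0
  · subst hμ
    exact rieszEnergy_flatPullback_zero H.two_le h g.2.1 (g.2.1.flatPullback H.le h)
      (Filter.EventuallyEq.refl _ _) (g.2.2.2 rfl)
  · exact rieszEnergy_flatPullback_of_ne_zero H.one_le hμ h g.1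

/-! ### Densities obtained from Schwartz functions vanishing near the origin -/

theorem exists_schwartz_rpow_bound {N : ℕ} (f : 𝓢(EuclideanSpace ℝ (Fin N), ℂ)) (r : ℝ) :
    ∃ C, 0 ≤ C ∧ ∀ x, ‖f x‖ ≤ C * (1 + ‖x‖ ^ 2) ^ (-r) := by
  obtain ⟨n, hn⟩ := exists_nat_ge r
  have hb := SchwartzMap.one_add_le_sup_seminorm_apply (𝕜 := ℝ) (m := (2 * n, 0)) (k := 2 * n)
    (n := 0) le_rfl le_rfl f
  set C := 2 ^ (2 * n, 0).1 * (Finset.Iic (2 * n, 0)).sup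
    (fun m => SchwartzMap.seminorm ℝ m.1 m.2) f
  have hC0 : 0 ≤ C := le_trans (by positivity) (hb 0)
  refine ⟨C, hC0, fun x => ?_⟩
  have h1 := one_add_norm_sq_pos x
  have h2 := hb x
  rw [norm_iteratedFDeriv_zero] at h2
  have h3 : (1 + ‖x‖ ^ 2) ^ r ≤ (1 + ‖x‖) ^ (2 * n) := by
    calc (1 + ‖x‖ ^ 2) ^ r ≤ (1 + ‖x‖ ^ 2) ^ (n : ℝ) :=
          Real.rpow_le_rpow_of_exponent_le (by nlinarith [sq_nonneg ‖x‖]) hn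
      _ = (1 + ‖x‖ ^ 2) ^ n := Real.rpow_natCast _ _
      _ ≤ ((1 + ‖x‖) ^ 2) ^ n := by gcongr; nlinarith [norm_nonneg x]
      _ = _ := by rw [← pow_mul]
  rw [Real.rpow_neg h1.le, ← div_eq_mul_inv, le_div_iff₀ (by positivity), mul_comm]
  exact (mul_le_mul_of_nonneg_right h3 (norm_nonneg _)).trans h2

theorem fourier_conj_fourier {N : ℕ} (φ : 𝓢(EuclideanSpace ℝ (Fin N), ℂ))
    (ξ : EuclideanSpace ℝ (Fin N)) :
    (starRingEnd ℂ) (𝓕 (fun x : EuclideanSpace ℝ (Fin N) => (starRingEnd ℂ) ((𝓕 φ) x)) ξ) = φ ξ := by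
  rw [conj_fourier]
  simp only [Complex.conj_conj]
  rw [← Real.fourierInv_eq_fourier_neg]
  have h : (𝓕⁻ (𝓕 φ : 𝓢(EuclideanSpace ℝ (Fin N), ℂ)) : 𝓢(EuclideanSpace ℝ (Fin N), ℂ)) ξ = φ ξ := by
    rw [FourierTransform.fourierInv_fourier_eq (F := 𝓢(EuclideanSpace ℝ (Fin N), ℂ)) φ]
  rwa [SchwartzMap.fourierInv_coe] at h

/-- By Fourier inversion the total mass is the conjugate of `φ 0`, so vanishing at the origin is
what the condition for `μ = 0` asks. -/
theorem conj_fourier_mem_densities {N : ℕ} {μ : ℝ} (H : IsComplementary N μ)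
    {φ : 𝓢(EuclideanSpace ℝ (Fin N), ℂ)} (h0 : φ 0 = 0) :
    (fun x : EuclideanSpace ℝ (Fin N) => (starRingEnd ℂ) ((𝓕 φ) x)) ∈ densities N μ := by
  refine mem_densities H (HasDensityDecay.conj ⟨(𝓕 φ).continuous.measurable,
    exists_schwartz_rpow_bound _ _⟩) fun _ => ?_
  have h1 := fourier_conj_fourier φ 0
  rw [h0] at h1
  have h2 := congrArg (starRingEnd ℂ) h1
  rw [Complex.conj_conj, map_zero, Real.fourier_eq] at h2
  simpa using h2

/-- The density with potential dual to the function `φ`. -/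
noncomputable def testDensity {N : ℕ} {μ : ℝ} (H : IsComplementary N μ)
    {φ : 𝓢(EuclideanSpace ℝ (Fin N), ℂ)} (h0 : (0 : EuclideanSpace ℝ (Fin N)) ∉ tsupport φ) :
    densities N μ :=
  ⟨_, conj_fourier_mem_densities H (image_eq_zero_of_notMem_tsupport h0)⟩

theorem inner_potential_testDensity {N : ℕ} {μ : ℝ} (H : IsComplementary N μ)
    {φ : 𝓢(EuclideanSpace ℝ (Fin N), ℂ)} (h0 : (0 : EuclideanSpace ℝ (Fin N)) ∉ tsupport φ)
    (k : WeightedL2 N μ) : inner ℂ (potential H (testDensity H h0)) k = ∫ ξ, k ξ * φ ξ := by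
  rw [inner_potential]
  congr 1 with ξ
  change (starRingEnd ℂ) (𝓕 (fun x : EuclideanSpace ℝ (Fin N) => (starRingEnd ℂ) ((𝓕 φ) x)) ξ) * k ξ = _
  rw [fourier_conj_fourier, mul_comm]

/-- Among the potentials are those of the test densities, whose pairings are integrals against
arbitrary test functions supported off the origin. -/
theorem eq_of_inner_potential {N : ℕ} {μ : ℝ} (H : IsComplementary N μ) {k l : WeightedL2 N μ}
    (h : ∀ g, inner ℂ (potential H g) k = inner ℂ (potential H g) l) : k = l := by
  rw [← sub_eq_zero]
  refine eq_zero_of_integral_eq_zero H.one_le _ fun φ _ h0 => ?_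
  rw [← inner_potential_testDensity H h0, inner_sub_right, h, sub_self]

theorem denseRange_potential {N : ℕ} {μ : ℝ} (H : IsComplementary N μ) :
    DenseRange (potential H) := by
  have h : (LinearMap.range (potential H)).topologicalClosure = ⊤ := by
    rw [Submodule.topologicalClosure_eq_top_iff, Submodule.eq_bot_iff]
    intro k hk
    refine eq_of_inner_potential H fun g => ?_
    rw [inner_zero_right]
    exact hk _ ⟨g, rfl⟩
  rw [DenseRange, ← LinearMap.coe_range]
  exact Submodule.dense_iff_topologicalClosure_eq_top.mpr h

/-! ### Uniqueness theorems for the Fourier transform -/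

section
variable {V : Type*} [NormedAddCommGroup V] [InnerProductSpace ℝ V] [FiniteDimensional ℝ V]
  [MeasurableSpace V] [BorelSpace V]

theorem ae_eq_zero_of_fourier_eq_zero {q : V → ℂ} (hq : Integrable q) (h : ∀ y, 𝓕 q y = 0) :
    ∀ᵐ x, q x = 0 := by
  refine ae_eq_zero_of_integral_contDiff_smul_eq_zero hq.locallyIntegrable fun g hg hc => ?_
  have hg' : ContDiff ℝ ∞ fun x => (g x : ℂ) := Complex.ofRealCLM.contDiff.comp hg
  have hc' : HasCompactSupport fun x => (g x : ℂ) := hc.comp_left Complex.ofReal_zero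
  set θ : 𝓢(V, ℂ) := hc'.toSchwartzMap hg'
  set ψ : 𝓢(V, ℂ) := 𝓕⁻ θ
  have h1 := integral_fourier_mul_flip hq ψ.integrable
  simp only [h, zero_mul, integral_zero] at h1
  have h2 : 𝓕 (ψ : V → ℂ) = θ := by
    rw [← SchwartzMap.fourier_coe, FourierTransform.fourier_fourierInv_eq]
  rw [h2] at h1
  rw [h1]
  refine integral_congr_ae (Filter.Eventually.of_forall fun x => ?_)
  change (g x) • q x = q x * (g x : ℂ)
  rw [Complex.real_smul, mul_comm]

theorem fourier_translate (f : V → ℂ) (y ξ : V) :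
    𝓕 (fun x => f (x - y)) ξ = (Real.fourierChar (-inner ℝ ξ y) : ℂ) * 𝓕 f ξ := by
  rw [Real.fourier_eq, Real.fourier_eq, ← integral_add_right_eq_self _ y, ← integral_const_mul]
  refine integral_congr_ae (Filter.Eventually.of_forall fun v => ?_)
  simp only [add_sub_cancel_right, Circle.smul_def, smul_eq_mul, inner_add_left, neg_add,
    AddChar.map_add_eq_mul, Circle.coe_mul, real_inner_comm y ξ]
  ring

theorem fourier_modulate (f : V → ℂ) (z ξ : V) :
    𝓕 (fun x => (Real.fourierChar (inner ℝ x z) : ℂ) * f x) ξ = 𝓕 f (ξ - z) := by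
  rw [Real.fourier_eq, Real.fourier_eq]
  refine integral_congr_ae (Filter.Eventually.of_forall fun v => ?_)
  have h : -inner ℝ v (ξ - z) = -inner ℝ v ξ + inner ℝ v z := by rw [inner_sub_right]; ring
  simp only [Circle.smul_def, smul_eq_mul, h, AddChar.map_add_eq_mul, Circle.coe_mul]
  ring

/-- A function of moderate growth vanishes if it annihilates the Fourier transforms of the smooth
functions with compact support. -/
theorem ae_eq_zero_of_integral_mul_fourier {κ : V → ℂ}
    (hκ : ∀ ψ : 𝓢(V, ℂ), Integrable fun ξ => κ ξ * ψ ξ)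
    (h : ∀ f : V → ℂ, ContDiff ℝ ∞ f → HasCompactSupport f → ∫ ξ, κ ξ * 𝓕 f ξ = 0) :
    ∀ᵐ ξ, κ ξ = 0 := by
  have step : ∀ f : V → ℂ, ContDiff ℝ ∞ f → HasCompactSupport f →
      ∀ᵐ ξ, κ ξ * 𝓕 f ξ = 0 := by
    intro f hf hc
    have hS := hκ (𝓕 (hc.toSchwartzMap hf))
    rw [SchwartzMap.fourier_coe] at hS
    have hS' : Integrable fun ξ => κ ξ * 𝓕 f ξ := hS
    -- The transform of `κ * 𝓕 f` at `y` is the pairing of `κ` with the transform of a translate of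
    -- `f`, which vanishes by assumption.
    refine ae_eq_zero_of_fourier_eq_zero hS' fun y => ?_
    have h1 : ContDiff ℝ ∞ fun x => f (x - y) := hf.comp (contDiff_id.sub contDiff_const)
    have h2 : HasCompactSupport fun x => f (x - y) :=
      hc.comp_homeomorph (Homeomorph.subRight y)
    rw [← h _ h1 h2, Real.fourier_eq]
    refine integral_congr_ae (Filter.Eventually.of_forall fun ξ => ?_)
    simp only [fourier_translate, Circle.smul_def, smul_eq_mul]
    ring
  let b : ContDiffBump (0 : V) := ⟨1, 2, one_pos, one_lt_two⟩
  set f : V → ℂ := fun x => (b x : ℂ)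
  have hf : ContDiff ℝ ∞ f := Complex.ofRealCLM.contDiff.comp b.contDiff
  have hc : HasCompactSupport f := b.hasCompactSupport.comp_left Complex.ofReal_zero
  have hi : Integrable f := (hf.continuous).integrable_of_hasCompactSupport hc
  have h0 : 𝓕 f 0 ≠ 0 := by
    rw [Real.fourier_eq]
    simp only [inner_zero_right, neg_zero, AddChar.map_zero_eq_one, one_smul, f]
    rw [integral_complex_ofReal]
    exact_mod_cast b.integral_pos.ne'
  obtain ⟨r, hr, hr'⟩ := Metric.continuousAt_iff.mp (continuous_fourier hi).continuousAt
    ‖𝓕 f 0‖ (norm_pos_iff.mpr h0)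
  -- Modulating `f` shifts its transform. Countably many shifts of a ball on which `𝓕 f` has no zero
  -- cover the space.
  have hall : ∀ n : ℕ, ∀ᵐ ξ, κ ξ * 𝓕 f (ξ - TopologicalSpace.denseSeq V n) = 0 := by
    intro n
    set z := TopologicalSpace.denseSeq V n
    have hm : ContDiff ℝ ∞ fun x : V => (Real.fourierChar (inner ℝ x z) : ℂ) * f x := by
      refine ContDiff.mul ?_ hf
      have : (fun x : V => (Real.fourierChar (inner ℝ x z) : ℂ)) =
          fun x : V => Complex.exp ((Complex.ofRealCLM (2 * Real.pi * inner ℝ x z)) * Complex.I) := by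
        funext x; simp [Real.fourierChar_apply]
      rw [this]
      exact ((Complex.ofRealCLM.contDiff.comp
        (contDiff_const.mul (contDiff_id.inner ℝ contDiff_const))).mul contDiff_const).cexp
    filter_upwards [step _ hm hc.mul_left] with ξ hξ
    rwa [fourier_modulate] at hξ
  filter_upwards [ae_all_iff.mpr hall] with ξ hξ
  obtain ⟨n, hn⟩ := (TopologicalSpace.denseRange_denseSeq V).exists_dist_lt ξ hr
  refine (mul_eq_zero.mp (hξ n)).resolve_right fun h1 => ?_
  have h2 := hr' (x := ξ - TopologicalSpace.denseSeq V n) (by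
    rwa [dist_zero_right, ← dist_eq_norm])
  rw [h1, dist_eq_norm, zero_sub, norm_neg] at h2
  exact lt_irrefl _ h2

end

/-! ### Strongly continuous unitary representations -/

/-- The Lipschitz bound is uniform in `h`, so limits in `w` are uniform limits of continuous
functions. -/
theorem isClosed_setOf_continuous {E G F : Type*} [PseudoMetricSpace E] [TopologicalSpace G]
    [PseudoMetricSpace F] (Ψ : E → G → F) {C : ℝ}
    (hΨ : ∀ w w' h, dist (Ψ w h) (Ψ w' h) ≤ C * dist w w') :
    IsClosed {w | Continuous (Ψ w)} := by
  refine isClosed_of_closure_subset fun w hw => ?_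
  refine continuous_of_uniform_approx_of_continuous fun u hu => ?_
  obtain ⟨ε, hε, hεu⟩ := Metric.mem_uniformity_dist.mp hu
  obtain ⟨w', hw', hd⟩ := Metric.mem_closure_iff.mp hw (ε / (|C| + 1)) (by positivity)
  refine ⟨Ψ w', hw', fun y => hεu ?_⟩
  have h1 : dist w w' * (|C| + 1) < ε := by rwa [lt_div_iff₀ (by positivity)] at hd
  have h2 := hΨ w w' y
  have h3 : C * dist w w' ≤ |C| * dist w w' := by gcongr; exact le_abs_self C
  linarith [dist_nonneg (x := w) (y := w')]

/-- For unitary operators weak continuity implies strong continuity, as `‖U x v - U x₀ v‖² = 2 ‖v‖²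
- 2 Re ⟨U x₀ v, U x v⟩`. Weak continuity in turn only has to be tested on dense families. -/
theorem continuous_of_continuous_matrixCoeff {E G A B : Type*} [NormedAddCommGroup E]
    [InnerProductSpace ℂ E] [TopologicalSpace G] (U : G → (E ≃ₗᵢ[ℂ] E)) {a : A → E} {b : B → E}
    (ha : DenseRange a) (hb : DenseRange b)
    (h : ∀ i j, Continuous fun x => inner ℂ (a i) (U x (b j))) (v : E) :
    Continuous fun x => U x v := by
  have h1 : ∀ j w, Continuous fun x => inner ℂ w (U x (b j)) := by
    intro j w
    refine ha.induction_on (p := fun w => Continuous fun x => inner ℂ w (U x (b j))) w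
      (isClosed_setOf_continuous (fun w x => inner ℂ w (U x (b j))) (C := ‖b j‖) ?_) fun i => h i j
    intro w w' x
    rw [dist_eq_norm, dist_eq_norm, ← inner_sub_left, mul_comm]
    exact (norm_inner_le_norm _ _).trans_eq (by rw [LinearIsometryEquiv.norm_map])
  refine hb.induction_on (p := fun v => Continuous fun x => U x v) v
    (isClosed_setOf_continuous (fun v x => U x v) (C := 1) ?_) fun j => ?_
  · intro w w' x
    rw [one_mul, (U x).dist_map]
  · rw [continuous_iff_continuousAt]
    intro x₀
    rw [ContinuousAt, tendsto_iff_norm_sub_tendsto_zero]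
    have h2 : ∀ x, ‖U x (b j) - U x₀ (b j)‖ =
        √(2 * ‖b j‖ ^ 2 - 2 * (inner ℂ (U x₀ (b j)) (U x (b j))).re) := by
      intro x
      have := norm_sub_sq (𝕜 := ℂ) (U x (b j)) (U x₀ (b j))
      rw [← Real.sqrt_sq (norm_nonneg (U x (b j) - U x₀ (b j))), this]
      simp only [LinearIsometryEquiv.norm_map]
      rw [inner_re_symm, RCLike.re_eq_complex_re]
      congr 1
      ring
    simp only [h2]
    have h3 : Continuous fun x => √(2 * ‖b j‖ ^ 2 - 2 * (inner ℂ (U x₀ (b j)) (U x (b j))).re) :=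
      (continuous_const.sub (continuous_const.mul (Complex.continuous_re.comp
        (h1 j (U x₀ (b j)))))).sqrt
    have h4 := h3.tendsto x₀
    have h5 : (inner ℂ (U x₀ (b j)) (U x₀ (b j))).re = ‖b j‖ ^ 2 := by
      rw [inner_self_eq_norm_sq_to_K, LinearIsometryEquiv.norm_map]
      norm_cast
    rw [h5, sub_self, Real.sqrt_zero] at h4
    exact h4

/-- The inverse of each operator is again a contraction of the family, so each of them preserves the
norm. -/
theorem exists_unitary_of_contraction {E G : Type*} [NormedAddCommGroup E]
    [InnerProductSpace ℂ E] [Group G] (W : G → (E →L[ℂ] E)) (h1 : ∀ v, W 1 v = v)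
    (hmul : ∀ g h v, W (g * h) v = W g (W h v)) (hn : ∀ g v, ‖W g v‖ ≤ ‖v‖) :
    ∃ U : G →* (E ≃ₗᵢ[ℂ] E), ∀ g v, U g v = W g v := by
  have hinv : ∀ g v, W g⁻¹ (W g v) = v := fun g v => by rw [← hmul, inv_mul_cancel, h1]
  have hinv' : ∀ g v, W g (W g⁻¹ v) = v := fun g v => by rw [← hmul, mul_inv_cancel, h1]
  have hnorm : ∀ g v, ‖W g v‖ = ‖v‖ := fun g v =>
    le_antisymm (hn g v) (by simpa only [hinv] using hn g⁻¹ (W g v))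
  refine ⟨⟨⟨fun g => ⟨⟨(W g).toLinearMap, W g⁻¹, hinv g, hinv' g⟩, hnorm g⟩, ?_⟩, ?_⟩,
    fun g v => rfl⟩
  · exact LinearIsometryEquiv.ext fun v => h1 v
  · exact fun g h => LinearIsometryEquiv.ext fun v => hmul g h v

/-! ### Pairing of densities with functions -/

theorem continuous_noncompact {N : ℕ} (μ : ℝ) (F : SmoothSphere N) :
    Continuous (noncompact μ F) := (contDiff_noncompact μ F).continuous

theorem sphDensity_le_two {N : ℕ} (x : EuclideanSpace ℝ (Fin N)) : sphDensity x ≤ 2 := by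
  rw [sphDensity, div_le_iff₀ (one_add_norm_sq_pos x)]
  nlinarith [sq_nonneg ‖x‖]

theorem norm_noncompact_le {N : ℕ} {μ : ℝ} (hμ : 0 ≤ μ) {F : SmoothSphere N} {C : ℝ}
    (hC : ∀ u, ‖F.1 u‖ ≤ C) (x : EuclideanSpace ℝ (Fin N)) : ‖noncompact μ F x‖ ≤ 2 ^ μ * C := by
  have h := sphDensity_pos x
  rw [noncompact, sphDensity_eq_rpow, norm_mul, Complex.norm_real,
    Real.norm_of_nonneg (by positivity)]
  have := sphDensity_le_two x
  gcongr
  exact hC _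

theorem exists_norm_noncompact_le {N : ℕ} {μ : ℝ} (hμ : 0 ≤ μ) (F : SmoothSphere N) :
    ∃ C, ∀ x, ‖noncompact μ F x‖ ≤ C := by
  obtain ⟨C, hC⟩ := exists_bound_smoothSphere F
  exact ⟨_, norm_noncompact_le hμ hC⟩

theorem noncompact_add {N : ℕ} (μ : ℝ) (F G : SmoothSphere N) :
    noncompact μ (F + G) = noncompact μ F + noncompact μ G := by
  funext x; simp [noncompact, mul_add]

theorem noncompact_smul {N : ℕ} (μ : ℝ) (c : ℂ) (F : SmoothSphere N) :
    noncompact μ (c • F) = c • noncompact μ F := by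
  funext x; simp [noncompact, mul_left_comm]

theorem integrable_conj_mul_noncompact {N : ℕ} {μ : ℝ} (hμ : 0 ≤ μ) (g : densities N μ)
    (F : SmoothSphere N) : Integrable fun x => (starRingEnd ℂ) (g.1 x) * noncompact μ F x := by
  obtain ⟨C, hC⟩ := exists_norm_noncompact_le hμ F
  have h : Integrable fun x => (starRingEnd ℂ) (g.1 x) :=
    (LinearIsometryEquiv.integrable_comp_iff Complex.conjLIE).mpr g.2.2.1
  exact h.mul_bdd (continuous_noncompact μ F).aestronglyMeasurable
    (Filter.Eventually.of_forall hC)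

/-- The element `k` represents `F` in the dual of the space of potentials. -/
def Represents {N : ℕ} {μ : ℝ} (H : IsComplementary N μ) (F : SmoothSphere N)
    (k : WeightedL2 N μ) : Prop :=
  ∀ g : densities N μ, inner ℂ (potential H g) k =
    ∫ x, (starRingEnd ℂ) (g.1 x) * noncompact μ F x

theorem Represents.unique {N : ℕ} {μ : ℝ} {H : IsComplementary N μ} {F : SmoothSphere N}
    {k l : WeightedL2 N μ} (hk : Represents H F k) (hl : Represents H F l) : k = l :=
  eq_of_inner_potential H fun g => by rw [hk g, hl g]

theorem Represents.add {N : ℕ} {μ : ℝ} {H : IsComplementary N μ} {F G : SmoothSphere N}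
    {k l : WeightedL2 N μ} (hk : Represents H F k) (hl : Represents H G l) :
    Represents H (F + G) (k + l) := by
  intro g
  rw [inner_add_right, hk g, hl g, ← integral_add (integrable_conj_mul_noncompact H.nonneg g F)
    (integrable_conj_mul_noncompact H.nonneg g G)]
  simp only [noncompact_add, Pi.add_apply, mul_add]

theorem Represents.smul {N : ℕ} {μ : ℝ} {H : IsComplementary N μ} {F : SmoothSphere N}
    {k : WeightedL2 N μ} (hk : Represents H F k) (c : ℂ) : Represents H (c • F) (c • k) := by
  intro g
  rw [inner_smul_right, hk g, ← integral_const_mul]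
  simp only [noncompact_smul, Pi.smul_apply, smul_eq_mul, mul_left_comm]

/-- The power of the spherical density built into `noncompact` combines with the denominator cocycle
into a pure power of the flat conformal factor. -/
theorem noncompact_principalSeries {N : ℕ} (μ : ℝ) (h : SO0 (N + 1)) (F : SmoothSphere N)
    {y : EuclideanSpace ℝ (Fin N)} (hy : y ∈ flatDomain h) :
    noncompact μ (principalSeries N μ h F) (flatMoebius h y) =
      ((flatFactor h y ^ (-μ) : ℝ) : ℂ) * noncompact μ F y := by
  have hf := flatFactor_pos h y
  have hd := den_pos h (cayley y)
  have hs := sphDensity_pos y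
  have hs' := sphDensity_pos (flatMoebius h y)
  have h1 : den h⁻¹ (moebius h (cayley y)).1 = (den h (cayley y).1)⁻¹ := by
    have h2 := den_mul h⁻¹ h (cayley y)
    rw [inv_mul_cancel, den_one] at h2
    exact eq_inv_of_mul_eq_one_left h2.symm
  have h3 : (principalSeries N μ h F).1 (cayley (flatMoebius h y)) =
      ((den h (cayley y).1 ^ μ : ℝ) : ℂ) * F.1 (cayley y) := by
    change ((|den h⁻¹ (cayley (flatMoebius h y)).1| ^ (-μ) : ℝ) : ℂ) *
      F.1 (moebius h⁻¹ (cayley (flatMoebius h y))) = _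
    rw [cayley_flatMoebius hy, moebius_inv_moebius, h1, abs_of_pos (inv_pos.mpr hd),
      Real.inv_rpow hd.le, Real.rpow_neg hd.le, inv_inv]
  have h4 : sphDensity (flatMoebius h y) = (flatFactor h y)⁻¹ * sphDensity y *
      (den h (cayley y).1)⁻¹ := by
    rw [mul_assoc, ← flatFactor_eq, ← mul_assoc, inv_mul_cancel₀ hf.ne', one_mul]
  rw [noncompact, noncompact, h3, sphDensity_eq_rpow, sphDensity_eq_rpow, h4, ← mul_assoc,
    ← mul_assoc, ← Complex.ofReal_mul, ← Complex.ofReal_mul]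
  congr 2
  rw [Real.mul_rpow (by positivity) (by positivity), Real.mul_rpow (by positivity) hs.le,
    Real.inv_rpow hd.le, Real.inv_rpow hf.le, Real.rpow_neg hf.le]
  have := (Real.rpow_pos_of_pos hd μ).ne'
  field_simp

/-- The exponent `-μ` of the function and the Jacobian exponent `N` give the exponent `N - μ` of the
density: the two weights are dual. -/
theorem integral_pullback {N : ℕ} {μ : ℝ} (H : IsComplementary N μ) (h : SO0 (N + 1))
    (g : densities N μ) (F : SmoothSphere N) :
    ∫ x, (starRingEnd ℂ) ((pullback H h g).1 x) * noncompact μ F x =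
      ∫ x, (starRingEnd ℂ) (g.1 x) * noncompact μ (principalSeries N μ h F) x := by
  rw [← integral_flatMoebius H.one_le h fun x =>
    (starRingEnd ℂ) (g.1 x) * noncompact μ (principalSeries N μ h F) x]
  refine integral_congr_ae ?_
  filter_upwards [ae_mem_flatDomain' H.one_le h] with y hy
  rw [noncompact_principalSeries μ h F hy]
  change (starRingEnd ℂ) (((flatFactor h y ^ ((N : ℝ) - μ) : ℝ) : ℂ) * g.1 (flatMoebius h y)) *
    noncompact μ F y = _
  rw [map_mul, Complex.conj_ofReal, sub_eq_add_neg, Real.rpow_add (flatFactor_pos h y),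
    Real.rpow_natCast]
  push_cast
  ring

/-- The contragredient of the action on densities. -/
noncomputable def contragredient {N : ℕ} {μ : ℝ} (H : IsComplementary N μ) (h : SO0 (N + 1)) :
    WeightedL2 N μ →L[ℂ] WeightedL2 N μ :=
  ContinuousLinearMap.adjoint ((potential H ∘ₗ pullback H h).extendOfNorm (potential H))

/-- Pullback preserves norms of potentials, so its extension has norm at most one, and passing to
the adjoint does not change the norm. -/
theorem norm_contragredient_le {N : ℕ} {μ : ℝ} (H : IsComplementary N μ) (h : SO0 (N + 1))
    (k : WeightedL2 N μ) : ‖contragredient H h k‖ ≤ ‖k‖ := by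
  have h1 := LinearMap.opNorm_extendOfNorm_le (f := potential H ∘ₗ pullback H h)
    (denseRange_potential H) zero_le_one
    fun g => by rw [one_mul]; exact (norm_potential_pullback H h g).le
  refine (ContinuousLinearMap.le_opNorm _ _).trans ?_
  rw [contragredient, LinearIsometryEquiv.norm_map]
  exact mul_le_of_le_one_left (norm_nonneg _) h1

theorem inner_contragredient {N : ℕ} {μ : ℝ} (H : IsComplementary N μ) (h : SO0 (N + 1))
    (g : densities N μ) (k : WeightedL2 N μ) :
    inner ℂ (potential H g) (contragredient H h k) =
      inner ℂ (potential H (pullback H h g)) k := by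
  rw [contragredient, ContinuousLinearMap.adjoint_inner_right,
    LinearMap.extendOfNorm_eq (denseRange_potential H)
      ⟨1, fun g => by rw [one_mul]; exact (norm_potential_pullback H h g).le⟩]
  rfl

theorem Represents.contragredient {N : ℕ} {μ : ℝ} {H : IsComplementary N μ} {F : SmoothSphere N}
    {k : WeightedL2 N μ} (hk : Represents H F k) (h : SO0 (N + 1)) :
    Represents H (principalSeries N μ h F) (contragredient H h k) := by
  intro g
  rw [inner_contragredient, hk, integral_pullback]

/-! ### Existence of representing elements -/

theorem memLp_schwartz_weight {N : ℕ} {μ : ℝ} (H : IsComplementary N μ)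
    (ψ : 𝓢(EuclideanSpace ℝ (Fin N), ℂ)) : MemLp ψ 2 (weightMeasure N μ) := by
  have hm : AEStronglyMeasurable ψ (weightMeasure N μ) := ψ.continuous.aestronglyMeasurable
  rw [memLp_two_iff_integrable_sq_norm hm]
  have h1 : Integrable (fun ξ => ((‖ψ ξ‖ ^ 2 : ℝ) : ℂ)) (weightMeasure N μ) := by
    rw [integrable_weight]
    obtain ⟨C, hC0, hC⟩ := exists_schwartz_rpow_bound ψ (N : ℝ)
    have hN : (2 : ℝ) ≤ N := by exact_mod_cast H.two_le
    have hlt := H.lt_half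
    have hnn := H.nonneg
    refine ((integrable_one_add_rpow (N := N) (r := (N : ℝ) + N / 2 + μ)
      (by linarith)).const_mul (C ^ 2)).mono' ?_ (Filter.Eventually.of_forall fun ξ => ?_)
    · refine AEStronglyMeasurable.mul ?_ ?_
      · exact (by fun_prop : Measurable fun ξ : EuclideanSpace ℝ (Fin N) =>
          ((‖ξ‖ ^ ((N : ℝ) - 2 * μ) : ℝ) : ℂ)).aestronglyMeasurable
      · exact (Complex.continuous_ofReal.comp (ψ.continuous.norm.pow 2)).aestronglyMeasurable
    · have hp := one_add_norm_sq_pos ξ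
      rw [← Complex.ofReal_mul, Complex.norm_real, Real.norm_of_nonneg (by positivity)]
      have h2 : ‖ξ‖ ^ ((N : ℝ) - 2 * μ) ≤ (1 + ‖ξ‖ ^ 2) ^ ((N : ℝ) / 2 - μ) := by
        calc ‖ξ‖ ^ ((N : ℝ) - 2 * μ) = (‖ξ‖ ^ 2) ^ ((N : ℝ) / 2 - μ) := by
              rw [← Real.rpow_natCast, ← Real.rpow_mul (norm_nonneg _)]
              congr 1; push_cast; ring
          _ ≤ _ := Real.rpow_le_rpow (by positivity) (by linarith) (by linarith)
      calc ‖ξ‖ ^ ((N : ℝ) - 2 * μ) * ‖ψ ξ‖ ^ 2 ≤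
            (1 + ‖ξ‖ ^ 2) ^ ((N : ℝ) / 2 - μ) * (C * (1 + ‖ξ‖ ^ 2) ^ (-(N : ℝ))) ^ 2 := by
            gcongr; exact hC ξ
        _ = C ^ 2 * ((1 + ‖ξ‖ ^ 2) ^ ((N : ℝ) / 2 - μ) * ((1 + ‖ξ‖ ^ 2) ^ (-(N : ℝ)) *
              (1 + ‖ξ‖ ^ 2) ^ (-(N : ℝ)))) := by ring
        _ = _ := by
            rw [← Real.rpow_add hp, ← Real.rpow_add hp]
            congr 2; ring
  exact_mod_cast h1.re

/-- Here the non-compact picture is a Schwartz function, so its Fourier transform lies in the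
weighted space itself and the multiplication formula verifies the pairing. -/
theorem exists_represents_of_hasCompactSupport {N : ℕ} {μ : ℝ} (H : IsComplementary N μ)
    (F : SmoothSphere N) (hc : HasCompactSupport (noncompact μ F)) :
    ∃ k, Represents H F k ∧ k =ᵐ[volume] 𝓕 (noncompact μ F) := by
  set f : 𝓢(EuclideanSpace ℝ (Fin N), ℂ) := hc.toSchwartzMap (contDiff_noncompact μ F)
  have hf : (f : EuclideanSpace ℝ (Fin N) → ℂ) = noncompact μ F := rfl
  have hM := memLp_schwartz_weight H (𝓕 f)
  have he : ((𝓕 f : 𝓢(EuclideanSpace ℝ (Fin N), ℂ)) : EuclideanSpace ℝ (Fin N) → ℂ) = 𝓕 (noncompact μ F) := SchwartzMap.fourier_coe f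
  set k : WeightedL2 N μ := hM.toLp
  have hae : k =ᵐ[volume] 𝓕 (noncompact μ F) :=
    ((volume_absolutelyContinuous_weight H.one_le μ).ae_eq hM.coeFn_toLp).trans (by rw [he])
  refine ⟨k, fun g => ?_, hae⟩
  rw [inner_potential]
  have hg : Integrable fun x => (starRingEnd ℂ) (g.1 x) :=
    (LinearIsometryEquiv.integrable_comp_iff Complex.conjLIE).mpr g.2.2.1
  have hψ : Integrable fun ξ => 𝓕 (noncompact μ F) (-ξ) := by
    have := (𝓕 f).integrable (μ := volume)
    rw [he] at this
    exact this.comp_neg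
  calc ∫ ξ, (starRingEnd ℂ) (𝓕 g.1 ξ) * k ξ
      = ∫ ξ, 𝓕 (fun x => (starRingEnd ℂ) (g.1 x)) (-ξ) * 𝓕 (noncompact μ F) ξ := by
        refine integral_congr_ae ?_
        filter_upwards [hae] with ξ hξ
        rw [hξ, conj_fourier]
    _ = ∫ ξ, 𝓕 (fun x => (starRingEnd ℂ) (g.1 x)) ξ * 𝓕 (noncompact μ F) (-ξ) := by
        rw [← integral_neg_eq_self (fun ξ => 𝓕 (fun x => (starRingEnd ℂ) (g.1 x)) ξ *
          𝓕 (noncompact μ F) (-ξ)) volume]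
        simp only [neg_neg]
    _ = ∫ x, (starRingEnd ℂ) (g.1 x) * 𝓕 (fun ξ => 𝓕 (noncompact μ F) (-ξ)) x :=
        integral_fourier_mul_flip hg hψ
    _ = _ := by
        congr 1 with x
        congr 1
        have h1 : (𝓕 (𝓕⁻ f : 𝓢(EuclideanSpace ℝ (Fin N), ℂ)) :
          𝓢(EuclideanSpace ℝ (Fin N), ℂ)) x = f x := by
          rw [FourierTransform.fourier_fourierInv_eq (F := 𝓢(EuclideanSpace ℝ (Fin N), ℂ)) f]
        rw [SchwartzMap.fourier_coe, SchwartzMap.fourierInv_coe] at h1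
        rw [← hf, ← h1]
        refine congrFun (congrArg 𝓕 (funext fun ξ => ?_)) x
        rw [Real.fourierInv_eq_fourier_neg]

/-- The half turn `diag(-1, -1, 1, …, 1)`, which moves the omitted point `-e₁` to `e₁`. -/
noncomputable def halfTurn (N : ℕ) (hN : 1 ≤ N) : SO0 (N + 1) :=
  ⟨⟨Matrix.diagonal (Sum.elim (fun i : Fin (N + 1) => if i.val < 2 then (-1 : ℝ) else 1)
      fun _ => 1), by
      obtain ⟨n, rfl⟩ := Nat.exists_eq_add_of_le' hN
      rw [Matrix.det_diagonal, Fintype.prod_sum_type, Fin.prod_univ_succ, Fin.prod_univ_succ]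
      simp⟩, by
    refine ⟨?_, ?_⟩
    · change (Matrix.diagonal _)ᵀ * form (N + 1) * Matrix.diagonal _ = form (N + 1)
      rw [form, LieAlgebra.Orthogonal.indefiniteDiagonal, Matrix.diagonal_transpose,
        Matrix.diagonal_mul_diagonal, Matrix.diagonal_mul_diagonal]
      congr 1
      funext i
      rcases i with i | i
      · simp only [Sum.elim_inl]; split_ifs <;> norm_num
      · simp
    · simp⟩

theorem den_halfTurn {N : ℕ} (hN : 1 ≤ N) (u : Sph N) : den (halfTurn N hN) u.1 = 1 := by
  simp [den, lift, halfTurn, Matrix.mulVec_diagonal]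

theorem moebius_halfTurn_zero {N : ℕ} (hN : 1 ≤ N) (u : Sph N) :
    (moebius (halfTurn N hN) u).1 0 = -u.1 0 := by
  simp only [moebius, den_halfTurn, inv_one, one_smul]
  simp [num, lift, halfTurn, Matrix.mulVec_diagonal]

theorem hasCompactSupport_noncompact {N : ℕ} (μ : ℝ) (F : SmoothSphere N)
    (hF : ∀ u : Sph N, u.1 0 ≤ -(1 / 2) → F.1 u = 0) : HasCompactSupport (noncompact μ F) := by
  refine HasCompactSupport.intro (isCompact_closedBall 0 2) fun x hx => ?_
  rw [mem_closedBall_zero_iff, not_le] at hx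
  rw [noncompact, hF, mul_zero]
  rw [cayley_zero, div_le_iff₀ (one_add_norm_sq_pos x)]
  nlinarith

/-- Functions vanishing near the omitted pole are covered by the compactly supported case. A
function vanishing near the opposite point is carried to such a one by the half turn and brought
back by the contragredient. -/
theorem exists_represents {N : ℕ} {μ : ℝ} (H : IsComplementary N μ) (F : SmoothSphere N) :
    ∃ k, Represents H F k := by
  -- This cutoff is `0` for `u 0 ≤ -1/2` and `1` for `u 0 ≥ 1/2`; after the half turn the
  -- complementary part also vanishes where `u 0 ≤ -1/2`.
  set χ : EuclideanSpace ℝ (Fin (N + 1)) → ℂ := fun u => (Real.smoothTransition (u 0 + 1 / 2) : ℂ)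
  have hχ : ContDiff ℝ ∞ χ := by
    refine Complex.ofRealCLM.contDiff.comp (Real.smoothTransition.contDiff.comp ?_)
    fun_prop
  set F₁ : SmoothSphere N := ⟨_, mul_mem_smoothSphere (restrict_mem_smoothSphere hχ) F.2⟩
  have hF₁ : ∀ u : Sph N, F₁.1 u = χ u.1 * F.1 u := fun u => rfl
  obtain ⟨k₁, hk₁, -⟩ := exists_represents_of_hasCompactSupport H F₁
    (hasCompactSupport_noncompact μ F₁ fun u hu => by
      rw [hF₁]; simp only [χ]
      rw [Real.smoothTransition.zero_of_nonpos (by linarith), Complex.ofReal_zero, zero_mul])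
  set w := halfTurn N H.one_le
  obtain ⟨k₂, hk₂, -⟩ := exists_represents_of_hasCompactSupport H
    (principalSeries N μ w⁻¹ (F - F₁)) (hasCompactSupport_noncompact μ _ fun u hu => by
      change ((|den w⁻¹⁻¹ u.1| ^ (-μ) : ℝ) : ℂ) * (F - F₁).1 (moebius w⁻¹⁻¹ u) = 0
      rw [inv_inv]
      have h1 : (F - F₁).1 (moebius w u) = F.1 (moebius w u) - F₁.1 (moebius w u) := rfl
      rw [h1, hF₁]; simp only [χ]
      rw [moebius_halfTurn_zero, Real.smoothTransition.one_of_one_le (by linarith),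
        Complex.ofReal_one, one_mul, sub_self, mul_zero])
  have h := hk₁.add (hk₂.contragredient w)
  rw [← Module.End.mul_apply, ← map_mul, mul_inv_cancel, map_one, Module.End.one_apply,
    add_sub_cancel] at h
  exact ⟨_, h⟩

/-! ### The unitary completions -/

/-- The map from `C^∞(S^N)` to its completion. -/
noncomputable def completion {N : ℕ} {μ : ℝ} (H : IsComplementary N μ) :
    SmoothSphere N →ₗ[ℂ] WeightedL2 N μ where
  toFun F := (exists_represents H F).choose
  map_add' F G := (exists_represents H (F + G)).choose_spec.unique
    ((exists_represents H F).choose_spec.add (exists_represents H G).choose_spec)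
  map_smul' c F := (exists_represents H (c • F)).choose_spec.unique
    ((exists_represents H F).choose_spec.smul c)

theorem represents_completion {N : ℕ} {μ : ℝ} (H : IsComplementary N μ) (F : SmoothSphere N) :
    Represents H F (completion H F) := (exists_represents H F).choose_spec

/-- The test density of `φ` has the conjugate of `𝓕 φ` as its density and `φ` as its Fourier
pairing, so the representing property is the required identity. -/
theorem isFourierTransform_completion {N : ℕ} {μ : ℝ} (H : IsComplementary N μ)
    (F : SmoothSphere N) : IsFourierTransformOffZero (noncompact μ F) (completion H F) := by
  intro φ h0
  rw [← inner_potential_testDensity H h0, represents_completion H F]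
  refine integral_congr_ae (Filter.Eventually.of_forall fun x => ?_)
  simp only [testDensity, Complex.conj_conj, mul_comm]

theorem integrable_weight_mul_schwartz {N : ℕ} {μ : ℝ} (H : IsComplementary N μ)
    (k : WeightedL2 N μ) (ψ : 𝓢(EuclideanSpace ℝ (Fin N), ℂ)) :
    Integrable fun ξ => ((‖ξ‖ ^ ((N : ℝ) - 2 * μ) : ℝ) : ℂ) * (starRingEnd ℂ) (k ξ) * ψ ξ := by
  have h := L2.integrable_inner (𝕜 := ℂ) k (memLp_schwartz_weight H ψ).toLp
  rw [integrable_weight] at h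
  refine h.congr ?_
  filter_upwards [(volume_absolutelyContinuous_weight H.one_le μ).ae_eq
    (memLp_schwartz_weight H ψ).coeFn_toLp] with ξ hξ
  rw [hξ, RCLike.inner_apply]
  ring

/-- For `k` orthogonal to the range, the weight times `conj k` annihilates the transforms of all
smooth functions with compact support, since these occur as non-compact pictures. -/
theorem denseRange_completion {N : ℕ} {μ : ℝ} (H : IsComplementary N μ) :
    DenseRange (completion H) := by
  have h : (LinearMap.range (completion H)).topologicalClosure = ⊤ := by
    rw [Submodule.topologicalClosure_eq_top_iff, Submodule.eq_bot_iff]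
    intro k hk
    have h1 := ae_eq_zero_of_integral_mul_fourier (integrable_weight_mul_schwartz H k) ?_
    · refine Lp.ext ?_
      have h2 : ∀ᵐ ξ, k ξ = 0 := by
        filter_upwards [h1, ae_ne_zero H.one_le] with ξ hξ h0
        have : ((‖ξ‖ ^ ((N : ℝ) - 2 * μ) : ℝ) : ℂ) ≠ 0 := by
          exact_mod_cast (Real.rpow_pos_of_pos (norm_pos_iff.mpr h0) _).ne'
        simpa using (mul_eq_zero.mp hξ).resolve_left this
      filter_upwards [(weight_absolutelyContinuous N μ).ae_le h2, Lp.coeFn_zero (E := ℂ) (p := 2)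
        (μ := weightMeasure N μ)] with ξ hξ h0
      rw [hξ, h0]; rfl
    · intro f hf hc
      obtain ⟨F, hF⟩ := exists_noncompact_eq μ hf hc
      obtain ⟨l, hl, hl'⟩ := exists_represents_of_hasCompactSupport H F (hF ▸ hc)
      have h2 : inner ℂ k (completion H F) = 0 := by
        rw [← inner_conj_symm, hk _ ⟨F, rfl⟩, map_zero]
      rw [(represents_completion H F).unique hl, L2.inner_def, integral_weight] at h2
      rw [← h2]
      refine integral_congr_ae ?_
      filter_upwards [hl'] with ξ hξ
      rw [hξ, hF, RCLike.inner_apply]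
      ring
  rw [DenseRange, ← LinearMap.coe_range]
  exact Submodule.dense_iff_topologicalClosure_eq_top.mpr h

/-! ### Strong continuity and construction of the unitary representation -/

theorem continuous_matrixEntry {N : ℕ} (k l : Fin (N + 1) ⊕ Unit) :
    Continuous fun g : SO0 (N + 1) => g.1.1 k l := by
  have h1 : Continuous fun g : Matrix.SpecialLinearGroup (Fin (N + 1) ⊕ Unit) ℝ => g.1 :=
    continuous_induced_dom
  exact (continuous_apply_apply k l).comp (h1.comp continuous_subtype_val)

/-- Dominated convergence with a parameter in the group needs countable neighbourhood bases. -/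
instance firstCountableTopology_SO0 (N : ℕ) : FirstCountableTopology (SO0 (N + 1)) := by
  have h0 : FirstCountableTopology (Matrix (Fin (N + 1) ⊕ Unit) (Fin (N + 1) ⊕ Unit) ℝ) :=
    inferInstanceAs (FirstCountableTopology (Fin (N + 1) ⊕ Unit → Fin (N + 1) ⊕ Unit → ℝ))
  have h1 : FirstCountableTopology (Matrix.SpecialLinearGroup (Fin (N + 1) ⊕ Unit) ℝ) :=
    TopologicalSpace.firstCountableTopology_induced _ _ Subtype.val
  exact TopologicalSpace.firstCountableTopology_induced _ _ Subtype.val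

theorem continuous_lift_uncurry {N : ℕ} (k : Fin (N + 1) ⊕ Unit) :
    Continuous fun p : SO0 (N + 1) × Sph N => lift p.1 p.2.1 k := by
  have h1 : (fun p : SO0 (N + 1) × Sph N => lift p.1 p.2.1 k) = fun p =>
      ∑ i, p.1.1.1 k (.inl i) * p.2.1 i + p.1.1.1 k (.inr ()) := by
    funext p
    simp [lift, Matrix.mulVec, dotProduct, Fintype.sum_sum_type]
  have h2 : ∀ l, Continuous fun p : SO0 (N + 1) × Sph N => p.1.1.1 k l := fun l =>
    (continuous_matrixEntry k l).comp continuous_fst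
  have h3 : ∀ i, Continuous fun p : SO0 (N + 1) × Sph N => p.2.1 i := fun i =>
    (EuclideanSpace.proj (𝕜 := ℝ) i).continuous.comp (continuous_subtype_val.comp continuous_snd)
  rw [h1]
  fun_prop

theorem continuous_moebius_uncurry {N : ℕ} :
    Continuous fun p : SO0 (N + 1) × Sph N => moebius p.1 p.2 := by
  refine Continuous.subtype_mk ?_ _
  refine Continuous.smul ((continuous_lift_uncurry (.inr ())).inv₀ fun p => (den_pos p.1 p.2).ne') ?_
  exact (PiLp.continuous_toLp 2 _).comp
    (continuous_pi fun i => continuous_lift_uncurry (.inl i))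

theorem continuous_principalSeries {N : ℕ} (μ : ℝ) (F : SmoothSphere N) :
    Continuous fun p : SO0 (N + 1) × Sph N => (principalSeries N μ p.1 F).1 p.2 := by
  have h0 : Continuous fun p : SO0 (N + 1) × Sph N => (p.1⁻¹, p.2) :=
    (continuous_inv.comp continuous_fst).prodMk continuous_snd
  have h1 := (continuous_lift_uncurry (N := N) (.inr ())).comp h0
  have h2 := (continuous_smoothSphere F).comp (continuous_moebius_uncurry.comp h0)
  refine Continuous.mul (Complex.continuous_ofReal.comp ?_) h2
  exact h1.abs.rpow_const fun p => Or.inl (abs_pos.mpr (den_pos p.1⁻¹ p.2).ne').ne'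

/-- By compactness of the sphere `h ↦ π_μ(h) F` is continuous for the sup norm, so near `h₀` a
constant multiple of `‖g‖` dominates. -/
theorem continuous_integral_principalSeries {N : ℕ} {μ : ℝ} (H : IsComplementary N μ)
    (g : densities N μ) (F : SmoothSphere N) : Continuous fun h => ∫ x,
      (starRingEnd ℂ) (g.1 x) * noncompact μ (principalSeries N μ h F) x := by
  have hΦ := continuous_principalSeries μ F
  set Ψ := ContinuousMap.curry ⟨_, hΦ⟩
  rw [continuous_iff_continuousAt]
  intro h₀
  have hev : ∀ᶠ h in nhds h₀, ‖Ψ h‖ < ‖Ψ h₀‖ + 1 :=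
    (Ψ.continuous.norm.tendsto h₀).eventually_lt_const (lt_add_one _)
  refine continuousAt_of_dominated (bound := fun x => ‖g.1 x‖ * (2 ^ μ * (‖Ψ h₀‖ + 1)))
    (Filter.Eventually.of_forall fun h =>
      (integrable_conj_mul_noncompact H.nonneg g _).aestronglyMeasurable) ?_
    (g.2.2.1.norm.mul_const _) (Filter.Eventually.of_forall fun x => ?_)
  · filter_upwards [hev] with h hh
    refine Filter.Eventually.of_forall fun x => ?_
    rw [norm_mul, RCLike.norm_conj]
    gcongr
    exact norm_noncompact_le H.nonneg (fun u => ((Ψ h).norm_coe_le_norm u).trans hh.le) x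
  · refine ContinuousAt.mul continuousAt_const (ContinuousAt.mul continuousAt_const ?_)
    exact (hΦ.comp (continuous_id.prodMk continuous_const)).continuousAt

/-- On the dense image of the sphere functions the contragredient is `π_μ`, so the group law holds
there and extends by continuity. -/
theorem exists_isUnitaryCompletion {N : ℕ} {μ : ℝ} (H : IsComplementary N μ) :
    ∃ U, IsUnitaryCompletion N μ (completion H) U := by
  have key : ∀ h F, contragredient H h (completion H F) =
      completion H (principalSeries N μ h F) := fun h F =>
    ((represents_completion H F).contragredient h).unique (represents_completion H _)
  obtain ⟨U, hU⟩ := exists_unitary_of_contraction (contragredient H) (fun v => by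
      refine (denseRange_completion H).induction_on (p := fun v => contragredient H 1 v = v) v
        (isClosed_eq (by fun_prop) (by fun_prop)) fun F => ?_
      rw [key, map_one, Module.End.one_apply])
    (fun g h v => by
      refine (denseRange_completion H).induction_on (p := fun v => contragredient H (g * h) v =
        contragredient H g (contragredient H h v)) v
        (isClosed_eq (by fun_prop) (by fun_prop)) fun F => ?_
      rw [key, key, key, map_mul, Module.End.mul_apply])
    (norm_contragredient_le H)
  refine ⟨U, isFourierTransform_completion H, denseRange_completion H, fun h F => ?_, ?_⟩
  · rw [hU, key]
  · refine continuous_of_continuous_matrixCoeff (fun h => U h) (denseRange_potential H)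
      (denseRange_completion H) fun g F => ?_
    simp only [hU, key, fun h => represents_completion H (principalSeries N μ h F) g]
    exact continuous_integral_principalSeries H g F

/-! ### The kernel of the completion map -/

/-- A sphere of positive dimension is connected, hence has no isolated points, and the value at the
omitted pole follows by continuity. -/
theorem eq_of_eq_on_cayley {N : ℕ} (hN : 1 ≤ N) {F : SmoothSphere N} {c : ℂ}
    (h : ∀ x, F.1 (cayley x) = c) (u : Sph N) : F.1 u = c := by
  have h1 : ∀ v : Sph N, v.1 0 ≠ -1 → F.1 v = c := fun v hv => by
    rw [← cayley_stereo v hv, h]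
  by_cases hu : u.1 0 = -1
  · have hconn : ConnectedSpace (Sph N) := by
      rw [← isConnected_iff_connectedSpace]
      refine isConnected_sphere ?_ 0 zero_le_one
      rw [← Module.finrank_eq_rank, finrank_euclideanSpace_fin]
      exact_mod_cast (by omega : 1 < N + 1)
    have hnt : Nontrivial (Sph N) := ⟨u, cayley 0, fun h => cayley_zero_ne (0 : EuclideanSpace ℝ (Fin N)) (h ▸ hu)⟩
    have hd : Dense ({u}ᶜ : Set (Sph N)) := dense_compl_singleton u
    have := Continuous.ext_on hd (continuous_smoothSphere F) continuous_const
      (g := fun _ => c) fun v hv => h1 v fun hv' => hv (eq_of_zero_eq_neg_one hv' hu)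
    exact congrFun this u
  · exact h1 u hu

theorem hasDensityDecay_sphDensity_mul {N : ℕ} {μ : ℝ} (F : SmoothSphere N) :
    HasDensityDecay μ fun x => ((sphDensity x ^ ((N : ℝ) - 2 * μ) : ℝ) : ℂ) * noncompact μ F x := by
  obtain ⟨C, hC⟩ := exists_bound_smoothSphere F
  have hC0 : 0 ≤ C := (norm_nonneg _).trans (hC (cayley 0))
  refine ⟨?_, C * 2 ^ ((N : ℝ) - μ), by positivity, fun x => ?_⟩
  · exact (Complex.measurable_ofReal.comp (continuous_sphDensity.measurable.pow_const _)).mul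
      (continuous_noncompact μ F).measurable
  · have hs := sphDensity_pos x
    simp only [noncompact, sphDensity_eq_rpow]
    rw [← mul_assoc, ← Complex.ofReal_mul, ← Real.rpow_add hs,
      show (N : ℝ) - 2 * μ + μ = N - μ by ring, norm_mul, Complex.norm_real,
      Real.norm_of_nonneg (by positivity), mul_comm, mul_assoc, ← sphDensity_rpow]
    gcongr
    exact hC _

/-- Pairing with the density `sphDensity ^ (N - 2μ)` times the non-compact picture `f` of `F` itself
gives a weighted integral of `|f|²`. For `μ = 0` this density is admissible only if its mass
vanishes, which is the role of `h0`. -/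
theorem eq_zero_of_completion_eq_zero {N : ℕ} {μ : ℝ} (H : IsComplementary N μ)
    {F : SmoothSphere N} (hF : completion H F = 0)
    (h0 : μ = 0 → ∫ x, ((sphDensity x ^ N : ℝ) : ℂ) * F.1 (cayley x) = 0) (u : Sph N) :
    F.1 u = 0 := by
  set g : densities N μ := ⟨_, mem_densities H (hasDensityDecay_sphDensity_mul F) fun hμ => by
    rw [← h0 hμ]
    subst hμ
    refine integral_congr_ae (Filter.Eventually.of_forall fun x => ?_)
    simp [noncompact]⟩
  have h1 := represents_completion H F g
  rw [hF, inner_zero_right] at h1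
  have h2 : ∀ x, (starRingEnd ℂ) (g.1 x) * noncompact μ F x =
      ((sphDensity x ^ ((N : ℝ) - 2 * μ) * ‖noncompact μ F x‖ ^ 2 : ℝ) : ℂ) := by
    intro x
    change (starRingEnd ℂ) (((sphDensity x ^ ((N : ℝ) - 2 * μ) : ℝ) : ℂ) * noncompact μ F x) * _ = _
    rw [map_mul, Complex.conj_ofReal, mul_assoc, Complex.conj_mul']
    push_cast; ring
  have h3 := integrable_conj_mul_noncompact H.nonneg g F
  simp only [h2] at h1 h3
  rw [integral_complex_ofReal] at h1
  have h4 : Integrable fun x => sphDensity x ^ ((N : ℝ) - 2 * μ) * ‖noncompact μ F x‖ ^ 2 := by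
    exact_mod_cast h3.re
  have h5 : ∀ x, 0 ≤ sphDensity x ^ ((N : ℝ) - 2 * μ) * ‖noncompact μ F x‖ ^ 2 := fun x => by
    have := sphDensity_pos x
    positivity
  have h6 := (integral_eq_zero_iff_of_nonneg h5 h4).mp (by exact_mod_cast h1.symm)
  have hcont : Continuous fun x : EuclideanSpace ℝ (Fin N) =>
      sphDensity x ^ ((N : ℝ) - 2 * μ) * ‖noncompact μ F x‖ ^ 2 :=
    (continuous_sphDensity.rpow_const fun x => Or.inl (sphDensity_pos x).ne').mul
      ((continuous_noncompact μ F).norm.pow 2)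
  have h7 := (hcont.ae_eq_iff_eq volume continuous_const).mp h6
  refine eq_of_eq_on_cayley H.one_le (fun x => ?_) u
  have h8 : sphDensity x ^ ((N : ℝ) - 2 * μ) * ‖noncompact μ F x‖ ^ 2 = 0 := congrFun h7 x
  have hs := sphDensity_pos x
  have h9 : noncompact μ F x = 0 := by
    simpa using (mul_eq_zero.mp h8).resolve_left (Real.rpow_pos_of_pos hs _).ne'
  rw [noncompact, sphDensity_eq_rpow] at h9
  refine (mul_eq_zero.mp h9).resolve_left ?_
  exact_mod_cast (Real.rpow_pos_of_pos hs _).ne'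

theorem injective_completion {N : ℕ} {μ : ℝ} (H : IsComplementary N μ) (hμ : μ ≠ 0) :
    Function.Injective (completion H) := by
  rw [injective_iff_map_eq_zero]
  intro F hF
  apply Subtype.ext; funext u
  exact eq_zero_of_completion_eq_zero H hF (fun h => absurd h hμ) u

/-- Constants pair to zero with densities of mass zero. Conversely, subtracting from `F` its mean
for the measure `sphDensity ^ N dx` makes `F` itself an admissible density. -/
theorem ker_completion {N : ℕ} (H : IsComplementary N 0) :
    LinearMap.ker (completion H) = constants N := by
  have hconst : ∀ F ∈ constants N, completion H F = 0 := by
    rintro F ⟨c, hc⟩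
    refine (represents_completion H F).unique fun g => ?_
    have h1 : ∀ x, noncompact 0 F x = c := fun x => by simp [noncompact, hc]
    simp only [h1]
    rw [inner_zero_right, integral_mul_const, integral_conj, g.2.2.2 rfl, map_zero, zero_mul]
  refine le_antisymm (fun F hF => ?_) hconst
  rw [LinearMap.mem_ker] at hF
  have hN : (2 : ℝ) ≤ N := by exact_mod_cast H.two_le
  have hi : Integrable fun x : EuclideanSpace ℝ (Fin N) => sphDensity x ^ N := by
    have := integrable_sphDensity_rpow (N := N) (r := (N : ℝ)) (by linarith)
    simpa only [Real.rpow_natCast] using this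
  have hi' : Integrable fun x : EuclideanSpace ℝ (Fin N) => ((sphDensity x ^ N : ℝ) : ℂ) :=
    hi.ofReal
  obtain ⟨C, hC⟩ := exists_bound_smoothSphere F
  have hcont : Continuous fun x : EuclideanSpace ℝ (Fin N) => F.1 (cayley x) :=
    (contDiff_comp_cayley F).continuous
  have hi2 : Integrable fun x : EuclideanSpace ℝ (Fin N) =>
      ((sphDensity x ^ N : ℝ) : ℂ) * F.1 (cayley x) :=
    hi'.mul_bdd hcont.aestronglyMeasurable (Filter.Eventually.of_forall fun x => hC _)
  set V : ℝ := ∫ x : EuclideanSpace ℝ (Fin N), sphDensity x ^ N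
  have hV : 0 < V := by
    refine (integral_pos_iff_support_of_nonneg (fun x => ?_) hi).mpr ?_
    · have := sphDensity_pos x
      simp only [Pi.zero_apply]; positivity
    · have : Function.support (fun x : EuclideanSpace ℝ (Fin N) => sphDensity x ^ N) = Set.univ :=
        Set.eq_univ_of_forall fun x => (pow_pos (sphDensity_pos x) N).ne'
      rw [this]
      exact isOpen_univ.measure_pos volume Set.univ_nonempty
  set c : ℂ := (∫ x : EuclideanSpace ℝ (Fin N), ((sphDensity x ^ N : ℝ) : ℂ) * F.1 (cayley x)) / V
  set K : SmoothSphere N := ⟨fun _ => c, contMDiff_const⟩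
  have hK : completion H K = 0 := hconst K ⟨c, fun _ => rfl⟩
  have h1 := eq_zero_of_completion_eq_zero H (F := F - K) (by rw [map_sub, hF, hK, sub_zero]) fun _ => by
    have h2 : ∀ x : EuclideanSpace ℝ (Fin N), ((sphDensity x ^ N : ℝ) : ℂ) * (F - K).1 (cayley x) =
        ((sphDensity x ^ N : ℝ) : ℂ) * F.1 (cayley x) - ((sphDensity x ^ N : ℝ) : ℂ) * c := fun x => by
      rw [← mul_sub]; rfl
    simp only [h2]
    rw [integral_sub hi2 (hi'.mul_const c), integral_mul_const, integral_complex_ofReal,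
      mul_div_cancel₀ _ (by exact_mod_cast hV.ne'), sub_self]
  refine ⟨c, fun u => ?_⟩
  have h3 : F.1 u - c = 0 := h1 u
  exact sub_eq_zero.mp h3

/-! ### Differential operators in the ambient space -/

section
variable {ι : Type*} [Fintype ι] [DecidableEq ι]

/-- The partial derivative with respect to the coordinate `i`. -/
noncomputable def partialDeriv (i : ι) (f : (ι → ℝ) → ℂ) : (ι → ℝ) → ℂ :=
  fun x => fderiv ℝ f x (Pi.single i 1)

theorem contDiff_partialDeriv (i : ι) {f : (ι → ℝ) → ℂ} (hf : ContDiff ℝ ∞ f) :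
    ContDiff ℝ ∞ (partialDeriv i f) :=
  (hf.fderiv_right (m := ∞) (by simp)).clm_apply contDiff_const

theorem contDiffOn_partialDeriv (i : ι) {f : (ι → ℝ) → ℂ} {s : Set (ι → ℝ)} (hs : IsOpen s)
    (hf : ContDiffOn ℝ ∞ f s) : ContDiffOn ℝ ∞ (partialDeriv i f) s :=
  (hf.fderiv_of_isOpen hs (m := ∞) (by simp)).clm_apply contDiffOn_const

theorem partialDeriv_congr (i : ι) {f g : (ι → ℝ) → ℂ} {x : ι → ℝ} (h : f =ᶠ[nhds x] g) :
    partialDeriv i f =ᶠ[nhds x] partialDeriv i g := by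
  filter_upwards [h.fderiv (𝕜 := ℝ)] with y hy
  rw [partialDeriv, partialDeriv, hy]

variable (ι) in
/-- The space of smooth functions on `ℝ^ι`. -/
def SmoothFun : Submodule ℂ ((ι → ℝ) → ℂ) where
  carrier := {f | ContDiff ℝ ∞ f}
  zero_mem' := (contDiff_const : ContDiff ℝ ∞ fun _ : ι → ℝ => (0 : ℂ))
  add_mem' {f g} (hf : ContDiff ℝ ∞ f) (hg : ContDiff ℝ ∞ g) := hf.add hg
  smul_mem' _ f (hf : ContDiff ℝ ∞ f) := contDiff_const.mul hf

theorem contDiff_smoothFun (f : SmoothFun ι) : ContDiff ℝ ∞ f.1 := f.2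

theorem differentiable_smoothFun (f : SmoothFun ι) : Differentiable ℝ f.1 :=
  (contDiff_smoothFun f).differentiable (by simp)

/-- Partial derivatives as endomorphisms of the space of smooth functions. -/
noncomputable def derivOp (i : ι) : Module.End ℂ (SmoothFun ι) where
  toFun f := ⟨partialDeriv i f.1, contDiff_partialDeriv i (contDiff_smoothFun f)⟩
  map_add' f g := by
    apply Subtype.ext; funext x
    change fderiv ℝ (f.1 + g.1) x _ = fderiv ℝ f.1 x _ + fderiv ℝ g.1 x _
    rw [fderiv_add (differentiable_smoothFun f x) (differentiable_smoothFun g x)]; rfl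
  map_smul' c f := by
    apply Subtype.ext; funext x
    change fderiv ℝ (c • f.1) x _ = c • fderiv ℝ f.1 x _
    rw [fderiv_const_smul (differentiable_smoothFun f x)]; rfl

/-- Multiplication by the coordinates. -/
noncomputable def coordOp (i : ι) : Module.End ℂ (SmoothFun ι) where
  toFun f := ⟨fun x => (x i : ℂ) * f.1 x,
    (Complex.ofRealCLM.contDiff.comp (contDiff_apply ℝ ℝ i)).mul (contDiff_smoothFun f)⟩
  map_add' f g := by
    apply Subtype.ext; funext x
    change (x i : ℂ) * (f.1 x + g.1 x) = x i * f.1 x + x i * g.1 x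
    ring
  map_smul' c f := by
    apply Subtype.ext; funext x
    change (x i : ℂ) * (c * f.1 x) = c * (x i * f.1 x)
    ring

theorem derivOp_coe (i : ι) (f : SmoothFun ι) : (derivOp i f).1 = partialDeriv i f.1 := rfl

theorem coordOp_apply (i : ι) (f : SmoothFun ι) (x : ι → ℝ) :
    (coordOp i f).1 x = x i * f.1 x := rfl

theorem derivOp_comm (i k : ι) : (derivOp i : Module.End ℂ (SmoothFun ι)) * derivOp k =
    derivOp k * derivOp i := by
  ext f x
  have hf := contDiff_smoothFun f
  have h1 : DifferentiableAt ℝ (fderiv ℝ f.1) x :=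
    ((hf.fderiv_right (m := ∞) (by simp)).differentiable (by simp)).differentiableAt
  have h2 : ∀ i k : ι, partialDeriv i (partialDeriv k f.1) x =
      fderiv ℝ (fderiv ℝ f.1) x (Pi.single i 1) (Pi.single k 1) := by
    intro i k
    change fderiv ℝ (fun y => fderiv ℝ f.1 y (Pi.single k 1)) x (Pi.single i 1) = _
    rw [fderiv_clm_apply h1 (differentiableAt_const _)]
    simp
  change partialDeriv i (partialDeriv k f.1) x = partialDeriv k (partialDeriv i f.1) x
  rw [h2, h2]
  exact (hf.contDiffAt.isSymmSndFDerivAt (by simp [minSmoothness_of_isRCLikeNormedField]; exact WithTop.coe_le_coe.mpr le_top)) _ _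

theorem coordOp_comm (i k : ι) : (coordOp i : Module.End ℂ (SmoothFun ι)) * coordOp k =
    coordOp k * coordOp i := by
  ext f x
  change (x i : ℂ) * (x k * f.1 x) = x k * (x i * f.1 x)
  ring

theorem derivOp_mul_coordOp (i k : ι) : (derivOp i : Module.End ℂ (SmoothFun ι)) * coordOp k =
    coordOp k * derivOp i + if i = k then 1 else 0 := by
  ext f x
  have hf := differentiable_smoothFun f x
  have h1 : HasFDerivAt (fun y : ι → ℝ => (y k : ℂ))
      (Complex.ofRealCLM.comp (ContinuousLinearMap.proj k)) x :=
    Complex.ofRealCLM.hasFDerivAt.comp x (ContinuousLinearMap.proj (R := ℝ) (φ := fun _ : ι => ℝ) k).hasFDerivAt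
  have h2 := (h1.mul hf.hasFDerivAt).fderiv
  change fderiv ℝ (fun y => (y k : ℂ) * f.1 y) x (Pi.single i 1) = _
  rw [show (fun y => (y k : ℂ) * f.1 y) = (fun y : ι → ℝ => (y k : ℂ)) * f.1 from rfl, h2]
  by_cases hik : i = k
  · subst hik
    rw [if_pos rfl]
    change _ = (x i : ℂ) * fderiv ℝ f.1 x (Pi.single i 1) + f.1 x
    simp
  · rw [if_neg hik]
    change _ = (x k : ℂ) * fderiv ℝ f.1 x (Pi.single i 1) + 0
    simp [Pi.single_eq_of_ne (Ne.symm hik)]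

/-- The quadratic form with diagonal coefficients `η`, as a multiplication operator. -/
noncomputable def quadOp (η : ι → ℂ) : Module.End ℂ (SmoothFun ι) :=
  ∑ i, η i • (coordOp i * coordOp i)

/-- The wave operator with diagonal coefficients `η`. -/
noncomputable def waveOp (η : ι → ℂ) : Module.End ℂ (SmoothFun ι) :=
  ∑ i, η i • (derivOp i * derivOp i)

/-- The Euler operator with weights `w`. -/
noncomputable def eulerOp (w : ι → ℂ) : Module.End ℂ (SmoothFun ι) :=
  ∑ i, w i • (coordOp i * derivOp i)

theorem derivOp_mul_sq (i k : ι) :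
    (derivOp i : Module.End ℂ (SmoothFun ι)) * (coordOp k * coordOp k) =
      coordOp k * coordOp k * derivOp i + if i = k then (2 : ℂ) • coordOp k else 0 := by
  rw [← mul_assoc, derivOp_mul_coordOp, add_mul, mul_assoc, derivOp_mul_coordOp, mul_add]
  split_ifs
  · rw [one_mul, mul_one, mul_assoc]; module
  · simp [mul_assoc]

theorem derivOp_mul_quadOp (η : ι → ℂ) (i : ι) :
    derivOp i * quadOp η = quadOp η * derivOp i + (2 * η i) • coordOp i := by
  simp only [quadOp, Finset.mul_sum, Finset.sum_mul, mul_smul_comm, derivOp_mul_sq, smul_add,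
    Finset.sum_add_distrib, smul_mul_assoc, smul_ite, smul_zero, Finset.sum_ite_eq,
    Finset.mem_univ, if_true]
  module

theorem derivOp_sq_mul_quadOp (η : ι → ℂ) (i : ι) :
    derivOp i * derivOp i * quadOp η = quadOp η * (derivOp i * derivOp i) +
      η i • ((4 : ℂ) • (coordOp i * derivOp i) + (2 : ℂ) • 1) := by
  rw [mul_assoc, derivOp_mul_quadOp, mul_add, ← mul_assoc, derivOp_mul_quadOp, add_mul, mul_assoc,
    mul_smul_comm, smul_mul_assoc, derivOp_mul_coordOp, if_pos rfl]
  module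

/-- This is the `sl₂`-relation between the quadratic form and the wave operator. The second
coefficient family is kept separate because the wave operator will omit the normal direction. -/
theorem waveOp_mul_quadOp (η θ : ι → ℂ) :
    waveOp θ * quadOp η = quadOp η * waveOp θ +
      ((4 : ℂ) • eulerOp (fun i => θ i * η i) + (2 * ∑ i, θ i * η i) • 1) := by
  have h : ∀ i, θ i • (derivOp i * derivOp i) * quadOp η =
      quadOp η * (θ i • (derivOp i * derivOp i)) +
        ((4 : ℂ) • ((θ i * η i) • (coordOp i * derivOp i)) + (2 * (θ i * η i)) • 1) := by
    intro i
    rw [smul_mul_assoc, derivOp_sq_mul_quadOp, mul_smul_comm]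
    module
  rw [waveOp, Finset.sum_mul, Finset.sum_congr rfl fun i _ => h i, Finset.sum_add_distrib,
    Finset.mul_sum, Finset.sum_add_distrib, eulerOp, Finset.smul_sum, ← Finset.sum_smul,
    Finset.mul_sum]

theorem derivOp_mul_eulerOp (w : ι → ℂ) (i : ι) :
    derivOp i * eulerOp w = eulerOp w * derivOp i + w i • derivOp i := by
  have h : ∀ k, (derivOp i : Module.End ℂ (SmoothFun ι)) * (coordOp k * derivOp k) =
      coordOp k * derivOp k * derivOp i + if i = k then derivOp k else 0 := by
    intro k
    rw [← mul_assoc, derivOp_mul_coordOp, add_mul, mul_assoc, derivOp_comm i k, ← mul_assoc]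
    split_ifs <;> simp
  simp only [eulerOp, Finset.mul_sum, Finset.sum_mul, mul_smul_comm, smul_mul_assoc, h, smul_add,
    Finset.sum_add_distrib, smul_ite, smul_zero, Finset.sum_ite_eq, Finset.mem_univ, if_true]

/-- The hypothesis says that `w` equals one wherever `θ` is nonzero, so it covers both the full
Euler operator and the one without the normal direction. -/
theorem waveOp_mul_eulerOp {θ w : ι → ℂ} (hw : ∀ i, θ i * w i = θ i) :
    waveOp θ * eulerOp w = eulerOp w * waveOp θ + (2 : ℂ) • waveOp θ := by
  have h : ∀ i : ι, θ i • (derivOp i * derivOp i) * eulerOp w =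
      eulerOp w * (θ i • (derivOp i * derivOp i)) + (2 : ℂ) • (θ i • (derivOp i * derivOp i)) := by
    intro i
    rw [smul_mul_assoc, mul_assoc, derivOp_mul_eulerOp, mul_add, ← mul_assoc, derivOp_mul_eulerOp,
      add_mul, mul_smul_comm, mul_smul_comm, smul_mul_assoc, mul_assoc]
    rw [smul_add, smul_add, smul_smul, hw]
    module
  rw [waveOp, Finset.sum_mul, Finset.sum_congr rfl fun i _ => h i, Finset.sum_add_distrib,
    Finset.mul_sum, Finset.smul_sum]

end

/-! ### Commutation relations -/

section
variable {R : Type*} [Ring R] [Algebra ℂ R]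

theorem pow_mul_of_commutator {L Q A : R} {c : ℂ} (h1 : L * Q = Q * L + ((4 : ℂ) • A + c • 1))
    (h2 : L * A = A * L + (2 : ℂ) • L) (k : ℕ) :
    L ^ (k + 1) * Q = Q * L ^ (k + 1) +
      ((k : ℂ) + 1) • ((4 : ℂ) • (A * L ^ k) + (4 * k + c) • L ^ k) := by
  induction k with
  | zero => simp [h1]
  | succ k ih =>
    have e1 : L * Q * L ^ (k + 1) = Q * L ^ (k + 2) + ((4 : ℂ) • (A * L ^ (k + 1)) + c • L ^ (k + 1)) := by
      rw [h1, add_mul, add_mul, smul_mul_assoc, smul_mul_assoc, one_mul, mul_assoc, ← pow_succ']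
    have e2 : L * (A * L ^ k) = A * L ^ (k + 1) + (2 : ℂ) • L ^ (k + 1) := by
      rw [← mul_assoc, h2, add_mul, smul_mul_assoc, mul_assoc, ← pow_succ']
    rw [pow_succ' L (k + 1), mul_assoc, ih, mul_add, ← mul_assoc, e1, mul_smul_comm, mul_add,
      mul_smul_comm, mul_smul_comm, e2, ← pow_succ', ← pow_succ']
    push_cast
    module

/-- The truncated exponents `p - 1` and `p - 2` are harmless: where truncation occurs the
coefficient `p` or `p (p - 1)` is zero. -/
theorem pow_mul_of_commutator' {d Q s : R} (h1 : d * Q = Q * d + (2 : ℂ) • s)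
    (h2 : d * s = s * d + 1) (p : ℕ) :
    d ^ p * Q = Q * d ^ p + ((2 * p : ℂ) • (s * d ^ (p - 1)) +
      ((p : ℂ) * (p - 1)) • d ^ (p - 2)) := by
  induction p with
  | zero => simp
  | succ p ih =>
    have e1 : d * Q * d ^ p = Q * d ^ (p + 1) + (2 : ℂ) • (s * d ^ p) := by
      rw [h1, add_mul, smul_mul_assoc, mul_assoc, ← pow_succ']
    rw [pow_succ', mul_assoc, ih, mul_add, ← mul_assoc, e1, mul_add, mul_smul_comm, mul_smul_comm,
      ← mul_assoc, h2, add_mul, one_mul, mul_assoc]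
    rcases p with _ | p
    · simp [pow_succ']
    · have e2 : ((p + 1 : ℕ) : ℂ) * (((p + 1 : ℕ) : ℂ) - 1) = 0 ∨ d * d ^ (p + 1 - 2) = d ^ p := by
        rcases p with _ | p
        · left; simp
        · right; rw [← pow_succ']; rfl
      have e3 : (((p + 1 : ℕ) : ℂ) * (((p + 1 : ℕ) : ℂ) - 1)) • (d * d ^ (p + 1 - 2)) =
          (((p + 1 : ℕ) : ℂ) * (((p + 1 : ℕ) : ℂ) - 1)) • d ^ p := by
        rcases e2 with e2 | e2 <;> rw [e2]
        simp
      rw [e3]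
      simp only [Nat.add_sub_cancel, ← pow_succ', show p + 1 + 1 - 2 = p by omega]
      push_cast
      module

theorem pow_mul_of_commutator_eigen {E d : R} {a : ℂ} (h : d * E = E * d + a • d) (p : ℕ) :
    d ^ p * E = E * d ^ p + (p * a) • d ^ p := by
  induction p with
  | zero => simp
  | succ p ih =>
    rw [pow_succ', mul_assoc, ih, mul_add, ← mul_assoc, h, add_mul, mul_smul_comm, smul_mul_assoc,
      mul_assoc, ← pow_succ']
    push_cast
    module

end

/-! ### The conformally covariant combination of normal derivatives -/

/-- The coefficients of the intertwining operator of order `j` for the boundary dimension `m`. -/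
noncomputable def diffCoeff (m j : ℕ) : ℕ → ℂ
  | 0 => 1
  | k + 1 => -(diffCoeff m j k * (((j : ℂ) - 2 * k) * ((j : ℂ) - 2 * k - 1))) /
      (2 * (k + 1) * ((m : ℂ) + 2 * k + 2 - 2 * j))

/-- For odd `m` the factor `m + 2k + 2 - 2j` is odd, hence nonzero. This is the only use of the
parity of the dimension. -/
theorem diffCoeff_succ {m j : ℕ} (hm : Odd m) (k : ℕ) :
    diffCoeff m j (k + 1) * (2 * (k + 1) * ((m : ℂ) + 2 * k + 2 - 2 * j)) =
      -(diffCoeff m j k * (((j : ℂ) - 2 * k) * ((j : ℂ) - 2 * k - 1))) := by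
  have h1 : (2 * ((k : ℂ) + 1)) ≠ 0 := by
    have : (k : ℂ) + 1 ≠ 0 := by exact_mod_cast Nat.succ_ne_zero k
    simpa using this
  have h2 : (m : ℂ) + 2 * k + 2 - 2 * j ≠ 0 := by
    intro h
    have h3 : ((m : ℤ) + 2 * k + 2 - 2 * j : ℤ) = 0 := by exact_mod_cast h
    obtain ⟨r, rfl⟩ := hm
    push_cast at h3
    omega
  rw [diffCoeff, div_mul_cancel₀ _ (mul_ne_zero h1 h2)]

section
variable {ι : Type*} [Fintype ι] [DecidableEq ι]

theorem eulerOp_one_eq (s : ι) : eulerOp (fun _ : ι => 1) =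
    eulerOp (fun i => if i = s then 0 else 1) + coordOp s * derivOp s := by
  have h : ∀ i, (1 : ℂ) • ((coordOp i : Module.End ℂ (SmoothFun ι)) * derivOp i) =
      (if i = s then (0 : ℂ) else 1) • (coordOp i * derivOp i) +
        if i = s then coordOp i * derivOp i else 0 := by
    intro i
    split_ifs <;> simp
  rw [eulerOp, Finset.sum_congr rfl fun i _ => h i, Finset.sum_add_distrib, eulerOp,
    Finset.sum_ite_eq' Finset.univ s, if_pos (Finset.mem_univ s)]

/-- The combination of normal derivatives annihilates the multiples of the quadratic form, at the
points of the cone on the hyperplane `x_s = 0`. -/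
theorem sum_diffCoeff_eq_zero {m j : ℕ} (hm : Odd m) {s : ι} {η : ι → ℂ}
    (hη : ∀ i, η i * η i = 1) (hs : η s = 1) (hcard : Fintype.card ι = m + 3)
    (φ : SmoothFun ι →ₗ[ℂ] ℂ) (hQ : ∀ f, φ (quadOp η f) = 0) (hS : ∀ f, φ (coordOp s f) = 0)
    (g : SmoothFun ι) (hg : ∀ a b : ℕ, φ ((derivOp s ^ a * waveOp (fun i => if i = s then 0 else η i) ^ b)
      (eulerOp (fun _ => 1) g + (2 : ℂ) • g)) = 0) :
    ∑ k ∈ Finset.range (j / 2 + 1), diffCoeff m j k *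
      φ ((derivOp s ^ (j - 2 * k) * waveOp (fun i => if i = s then 0 else η i) ^ k)
        (quadOp η g)) = 0 := by
  set L : Module.End ℂ (SmoothFun ι) := waveOp (fun i => if i = s then 0 else η i)
  set d : Module.End ℂ (SmoothFun ι) := derivOp s
  set Q : Module.End ℂ (SmoothFun ι) := quadOp η
  set S : Module.End ℂ (SmoothFun ι) := coordOp s
  set E : Module.End ℂ (SmoothFun ι) := eulerOp fun _ => 1
  set A : Module.End ℂ (SmoothFun ι) := eulerOp fun i => if i = s then 0 else 1
  have hw : ∀ i, (if i = s then 0 else η i) * η i = if i = s then 0 else 1 := by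
    intro i; split_ifs <;> simp [hη]
  have hsum : ∑ i, (if i = s then (0 : ℂ) else η i) * η i = m + 2 := by
    simp only [hw]
    have h1 : ∀ i, (if i = s then (0 : ℂ) else 1) = 1 - if i = s then 1 else 0 := by
      intro i; split_ifs <;> simp
    simp only [h1, Finset.sum_sub_distrib, Finset.sum_const, Finset.card_univ, hcard,
      Finset.sum_ite_eq', Finset.mem_univ, if_true, nsmul_eq_mul]
    push_cast; ring
  have hLQ : L * Q = Q * L + ((4 : ℂ) • A + (2 * ((m : ℂ) + 2)) • 1) := by
    have := waveOp_mul_quadOp η (fun i => if i = s then 0 else η i)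
    rw [hsum] at this
    simpa only [hw] using this
  have hLA : L * A = A * L + (2 : ℂ) • L :=
    waveOp_mul_eulerOp fun i => by split_ifs <;> simp
  have hdQ : d * Q = Q * d + (2 : ℂ) • S := by
    have := derivOp_mul_quadOp η s
    rwa [hs, mul_one] at this
  have hdS : d * S = S * d + 1 := by
    have := derivOp_mul_coordOp s s
    rwa [if_pos rfl] at this
  have hdA : d * A = A * d := by
    have := derivOp_mul_eulerOp (fun i => if i = s then (0 : ℂ) else 1) s
    simpa using this
  have hdE : d * E = E * d + (1 : ℂ) • d := derivOp_mul_eulerOp _ s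
  have hLE : L * E = E * L + (2 : ℂ) • L := waveOp_mul_eulerOp fun i => mul_one _
  have hEA : E = A + S * d := eulerOp_one_eq s
  -- evaluation of the Euler operator
  have hA : ∀ a b : ℕ, φ ((d ^ a * (A * L ^ b)) g) = -((a : ℂ) + 2 * b + 2) * φ ((d ^ a * L ^ b) g) := by
    intro a b
    have h1 := pow_mul_of_commutator_eigen (R := Module.End ℂ (SmoothFun ι)) hdE a
    have h2 := pow_mul_of_commutator_eigen (R := Module.End ℂ (SmoothFun ι)) hLE b
    -- Write `E = A + S d`. Moving `E` to the left through `d ^ a * L ^ b` costs `a + 2b`, the part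
    -- with `S` dies under `φ`, and on `g` the Euler operator acts as `-2`; this determines the
    -- value of `A`.
    have h3 : d ^ a * L ^ b * E = d ^ a * (A * L ^ b) + S * (d * (d ^ a * L ^ b)) +
        ((a : ℂ) + 2 * b) • (d ^ a * L ^ b) := by
      have hcomm : d ^ a * A = A * d ^ a := (Commute.pow_left hdA a).eq
      rw [mul_assoc, h2, mul_add, ← mul_assoc, h1, add_mul, ← mul_assoc (d ^ a) A, hcomm, hEA]
      simp only [add_mul, mul_smul_comm, smul_mul_assoc, mul_assoc, mul_one]
      module
    have h4 := hg a b
    rw [map_add, ← Module.End.mul_apply, h3] at h4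
    simp only [LinearMap.add_apply, map_add, Module.End.mul_apply, hS, LinearMap.smul_apply,
      map_smul, smul_eq_mul] at h4 ⊢
    linear_combination h4
  -- the value of each term
  have hdp : ∀ (p : ℕ) (f : SmoothFun ι), φ ((d ^ p) (Q f)) =
      (p : ℂ) * (p - 1) * φ ((d ^ (p - 2)) f) := by
    intro p f
    have h1 := pow_mul_of_commutator' (R := Module.End ℂ (SmoothFun ι)) hdQ hdS p
    rw [← Module.End.mul_apply, h1]
    simp only [LinearMap.add_apply, Module.End.mul_apply, LinearMap.smul_apply, map_add, map_smul,
      hQ, hS, smul_eq_mul]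
    ring
  have hterm : ∀ p k : ℕ, φ ((d ^ p * L ^ (k + 1)) (Q g)) =
      (p : ℂ) * (p - 1) * φ ((d ^ (p - 2) * L ^ (k + 1)) g) +
        ((k : ℂ) + 1) * (-(4 * ((p : ℂ) + 2 * k + 2)) + (4 * k + 2 * (m + 2))) *
          φ ((d ^ p * L ^ k) g) := by
    intro p k
    have h1 := pow_mul_of_commutator (R := Module.End ℂ (SmoothFun ι)) hLQ hLA k
    rw [← Module.End.mul_apply, mul_assoc, h1, mul_add, LinearMap.add_apply, map_add]
    have h2 : φ ((d ^ p * (Q * L ^ (k + 1))) g) =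
        (p : ℂ) * (p - 1) * φ ((d ^ (p - 2) * L ^ (k + 1)) g) := hdp p _
    rw [h2, mul_smul_comm, mul_add, mul_smul_comm, mul_smul_comm]
    simp only [LinearMap.add_apply, LinearMap.smul_apply, map_add, map_smul, smul_eq_mul, hA]
    ring
  -- The sum telescopes. With `p = j - 2(k+1)` the second coefficient in `hterm` is `2 (k+1)(m + 2k
  -- + 2 - 2j)`, the denominator in the recursion, so each new term replaces the previous remainder
  -- by the next one.
  have key : ∀ n, 2 * n ≤ j → ∑ k ∈ Finset.range (n + 1), diffCoeff m j k *
      φ ((d ^ (j - 2 * k) * L ^ k) (Q g)) =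
      diffCoeff m j n * (((j : ℂ) - 2 * n) * ((j : ℂ) - 2 * n - 1)) *
        φ ((d ^ (j - 2 * n - 2) * L ^ n) g) := by
    intro n
    induction n with
    | zero =>
      intro _
      have h1 := hdp j g
      simp only [zero_add, Finset.sum_range_one, mul_zero, Nat.sub_zero, pow_zero, mul_one,
        Nat.cast_zero, sub_zero]
      rw [h1]; ring
    | succ n ih =>
      intro hn
      rw [Finset.sum_range_succ, ih (by omega), hterm, show j - 2 * n - 2 = j - 2 * (n + 1) by omega]
      have h1 : ((j - 2 * (n + 1) : ℕ) : ℂ) = (j : ℂ) - 2 * (n + 1) := by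
        rw [Nat.cast_sub hn]; push_cast; ring
      rw [h1]
      have h2 := diffCoeff_succ (j := j) hm n
      push_cast
      linear_combination φ ((d ^ (j - 2 * (n + 1)) * L ^ n) g) * h2
  rw [key (j / 2) (by omega)]
  -- The number `j - 2 ⌊j/2⌋` is `0` or `1`, so the last remainder vanishes.
  have h0 : ((j : ℂ) - 2 * (j / 2 : ℕ)) * ((j : ℂ) - 2 * (j / 2 : ℕ) - 1) = 0 := by
    rcases Nat.even_or_odd' j with ⟨r, rfl | rfl⟩
    · rw [show 2 * r / 2 = r by omega]; push_cast; ring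
    · rw [show (2 * r + 1) / 2 = r by omega]; push_cast; ring
  rw [h0, mul_zero, zero_mul]

end

/-! ### Division by the quadratic form -/

/-- The integral is the value at `0` of a convolution with the indicator of `(0, 1]`; the bump makes
the second factor compactly supported without changing it where it matters, so smoothness of
convolutions with parameters applies. -/
theorem contDiffOn_parametric_integral {E : Type*} [NormedAddCommGroup E] [NormedSpace ℝ E]
    {h : E → ℝ → ℂ} {s : Set E} (hs : IsOpen s)
    (hh : ContDiffOn ℝ ∞ (fun p : E × ℝ => h p.1 p.2) (s ×ˢ Set.univ)) :
    ContDiffOn ℝ ∞ (fun x => ∫ θ in (0 : ℝ)..1, h x θ) s := by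
  let b : ContDiffBump (0 : ℝ) := ⟨2, 3, two_pos, by norm_num⟩
  set f : ℝ → ℝ := (Set.Ioc 0 1).indicator fun _ => 1
  set g : E → ℝ → ℂ := fun p x => b x • h p (-x)
  have hf : LocallyIntegrable f volume := by
    refine Integrable.locallyIntegrable ?_
    exact (integrable_indicator_iff measurableSet_Ioc).mpr (integrableOn_const (by simp))
  have hg : ContDiffOn ℝ ∞ (fun p : E × ℝ => g p.1 p.2) (s ×ˢ Set.univ) := by
    refine ContDiffOn.smul (b.contDiff.comp contDiff_snd).contDiffOn ?_
    refine hh.comp (contDiff_fst.prodMk contDiff_snd.neg).contDiffOn fun p hp => ?_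
    exact ⟨hp.1, Set.mem_univ _⟩
  have h1 := contDiffOn_convolution_right_with_param (μ := volume) (ContinuousLinearMap.lsmul ℝ ℝ)
    (f := f) (g := g) hs (isCompact_closedBall (0 : ℝ) 3) (fun p x _ hx => by
      have : b x = 0 := b.zero_of_le_dist (not_le.mp hx).le
      simp [g, this]) hf hg
  refine (h1.comp (contDiff_id.prodMk contDiff_const).contDiffOn
    (f := fun x : E => (x, (0 : ℝ))) fun x hx => ⟨hx, Set.mem_univ _⟩).congr fun x hx => ?_
  rw [intervalIntegral.integral_of_le zero_le_one, ← integral_indicator measurableSet_Ioc]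
  simp only [Function.comp, convolution, ContinuousLinearMap.lsmul_apply]
  refine integral_congr_ae (Filter.Eventually.of_forall fun t => ?_)
  simp only [f, g, zero_sub, neg_neg]
  by_cases ht : t ∈ Set.Ioc (0 : ℝ) 1
  · have : b (-t) = 1 := b.one_of_mem_closedBall (by
      rw [mem_closedBall_zero_iff, norm_neg, Real.norm_eq_abs, abs_of_pos ht.1]
      exact ht.2.trans one_le_two)
    simp [ht, this]
  · simp [ht]

section
variable {ι : Type*} [Fintype ι] [DecidableEq ι]

/-- A function which is smooth near a point coincides there with a function which is smooth
everywhere. -/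
theorem exists_smoothFun_eventuallyEq {f : (ι → ℝ) → ℂ} {s : Set (ι → ℝ)} (hs : IsOpen s)
    (hf : ContDiffOn ℝ ∞ f s) {x : ι → ℝ} (hx : x ∈ s) :
    ∃ g : SmoothFun ι, g.1 =ᶠ[nhds x] f ∧ ∀ y, (y ∈ s → f y = 0) → g.1 y = 0 := by
  obtain ⟨r, hr, hrs⟩ := Metric.isOpen_iff.mp hs x hx
  let b : ContDiffBump x := ⟨r / 4, r / 2, by positivity, by linarith⟩
  have hzero : ∀ y, y ∉ Metric.ball x r → ∀ᶠ z in nhds y, b z = 0 := by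
    intro y hy
    have : r / 2 < dist y x := by
      have : r ≤ dist y x := by simpa using hy
      linarith
    filter_upwards [(isOpen_lt continuous_const (continuous_id.dist continuous_const)).mem_nhds this]
      with z hz
    exact b.zero_of_le_dist (le_of_lt hz)
  refine ⟨⟨fun y => (b y : ℂ) * f y, ?_⟩, ?_, ?_⟩
  · change ContDiff ℝ ∞ fun y => (b y : ℂ) * f y
    rw [contDiff_iff_contDiffAt]
    intro y
    by_cases hy : y ∈ Metric.ball x r
    · exact (Complex.ofRealCLM.contDiff.comp b.contDiff).contDiffAt.mul
        (hf.contDiffAt (hs.mem_nhds (hrs hy)))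
    · refine (contDiffAt_const (c := (0 : ℂ))).congr_of_eventuallyEq ?_
      filter_upwards [hzero y hy] with z hz
      rw [hz]; simp
  · filter_upwards [b.eventuallyEq_one] with y hy
    change (b y : ℂ) * f y = f y
    rw [hy]; simp
  · intro y hy
    change (b y : ℂ) * f y = 0
    by_cases hy' : y ∈ Metric.ball x r
    · rw [hy (hrs hy'), mul_zero]
    · rw [(hzero y hy').self_of_nhds]; simp

end

/-- The quadratic form `|x|² - t²`. -/
def quadForm {n : ℕ} (x : Fin n ⊕ Unit → ℝ) : ℝ := ∑ i, x (.inl i) ^ 2 - x (.inr ()) ^ 2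

/-- The coefficients of the quadratic form. -/
def signs (n : ℕ) : Fin n ⊕ Unit → ℂ := Sum.elim (fun _ => 1) fun _ => -1

theorem signs_mul_signs (n : ℕ) (i : Fin n ⊕ Unit) : signs n i * signs n i = 1 := by
  rcases i with i | i <;> simp [signs]

theorem quadOp_apply {n : ℕ} (f : SmoothFun (Fin n ⊕ Unit)) (x : Fin n ⊕ Unit → ℝ) :
    (quadOp (signs n) f).1 x = quadForm x * f.1 x := by
  have h : (quadOp (signs n) f).1 = ∑ i, signs n i • (coordOp i (coordOp i f)).1 := by
    rw [quadOp, LinearMap.sum_apply, AddSubmonoidClass.coe_finsetSum]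
    rfl
  rw [h, Finset.sum_apply, Fintype.sum_sum_type]
  simp only [Pi.smul_apply, coordOp_apply, signs, Sum.elim_inl, Sum.elim_inr, quadForm,
    Finset.univ_unique, Finset.sum_singleton, smul_eq_mul]
  push_cast
  rw [sub_mul, Finset.sum_mul]
  simp only [one_mul, PUnit.default_eq_unit, pow_two, mul_assoc]
  ring

/-- A smooth function which vanishes on the forward light cone is a multiple of the quadratic
form. -/
theorem exists_eq_quadOp {n : ℕ} (f : SmoothFun (Fin n ⊕ Unit))
    (hf : ∀ x, quadForm x = 0 → 0 < x (.inr ()) → f.1 x = 0) {x₀ : Fin n ⊕ Unit → ℝ}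
    (h0 : quadForm x₀ = 0) (ht : 0 < x₀ (.inr ())) :
    ∃ g : SmoothFun (Fin n ⊕ Unit), f.1 =ᶠ[nhds x₀] (quadOp (signs n) g).1 := by
  set t : Fin n ⊕ Unit := .inr ()
  set S : (Fin n ⊕ Unit → ℝ) → ℝ := fun x => ∑ i, x (.inl i) ^ 2
  have hS : ContDiff ℝ ∞ S := by
    refine ContDiff.sum fun i _ => ?_
    exact (contDiff_apply ℝ ℝ (Sum.inl i : Fin n ⊕ Unit)).pow 2
  set r : (Fin n ⊕ Unit → ℝ) → ℝ := fun x => √(S x)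
  set U : Set (Fin n ⊕ Unit → ℝ) := {x | 0 < S x}
  have hU : IsOpen U := isOpen_lt continuous_const hS.continuous
  have hr : ContDiffOn ℝ ∞ r U := fun x hx =>
    ((Real.contDiffAt_sqrt (ne_of_gt hx)).comp x hS.contDiffAt).contDiffWithinAt
  -- This is Hadamard's lemma along vertical segments: at `θ = 0` the path is on the cone, where `f`
  -- vanishes, and at `θ = 1` it is at `x`. Hence `f` is `t - r` times an average of `∂_t f`.
  set γ : (Fin n ⊕ Unit → ℝ) → ℝ → (Fin n ⊕ Unit → ℝ) := fun x θ =>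
    x + (r x + θ * (x t - r x) - x t) • Pi.single t 1
  have hγ : ContDiffOn ℝ ∞ (fun p : (Fin n ⊕ Unit → ℝ) × ℝ => γ p.1 p.2) (U ×ˢ Set.univ) := by
    have h1 : ContDiffOn ℝ ∞ (fun p : (Fin n ⊕ Unit → ℝ) × ℝ => r p.1) (U ×ˢ Set.univ) :=
      hr.comp contDiff_fst.contDiffOn fun p hp => hp.1
    have h2 : ContDiffOn ℝ ∞ (fun p : (Fin n ⊕ Unit → ℝ) × ℝ => p.1 t) (U ×ˢ Set.univ) :=
      ((contDiff_apply ℝ ℝ t).comp contDiff_fst).contDiffOn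
    exact contDiff_fst.contDiffOn.add (((h1.add (contDiff_snd.contDiffOn.mul (h2.sub h1))).sub
      h2).smul contDiffOn_const)
  set I : (Fin n ⊕ Unit → ℝ) → ℂ := fun x => ∫ θ in (0 : ℝ)..1, partialDeriv t f.1 (γ x θ)
  have hI : ContDiffOn ℝ ∞ I U := contDiffOn_parametric_integral hU
    ((contDiff_partialDeriv t (contDiff_smoothFun f)).comp_contDiffOn hγ)
  have hFTC : ∀ x ∈ U, f.1 x = ((x t - r x : ℝ) : ℂ) * I x := by
    intro x hx
    have hrx : 0 < r x := Real.sqrt_pos.mpr hx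
    have hd : ∀ θ : ℝ, HasDerivAt (fun θ => f.1 (γ x θ))
        (((x t - r x : ℝ) : ℂ) * partialDeriv t f.1 (γ x θ)) θ := by
      intro θ
      have h1 : HasDerivAt (γ x) ((x t - r x) • Pi.single t 1) θ := by
        have h2 : HasDerivAt (fun θ : ℝ => r x + θ * (x t - r x) - x t) (x t - r x) θ := by
          simpa using (((hasDerivAt_id θ).mul_const (x t - r x)).const_add (r x)).sub_const (x t)
        exact (h2.smul_const (Pi.single t (1 : ℝ) : Fin n ⊕ Unit → ℝ)).const_add x
      have h3 := ((differentiable_smoothFun f) (γ x θ)).hasFDerivAt.comp_hasDerivAt θ h1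
      rw [map_smul, Complex.real_smul] at h3
      exact h3
    have hcont : Continuous fun θ => ((x t - r x : ℝ) : ℂ) * partialDeriv t f.1 (γ x θ) := by
      refine continuous_const.mul
        ((contDiff_partialDeriv t (contDiff_smoothFun f)).continuous.comp ?_)
      change Continuous fun θ : ℝ => x + (r x + θ * (x t - r x) - x t) • Pi.single t 1
      fun_prop
    have h4 := intervalIntegral.integral_eq_sub_of_hasDerivAt (fun θ _ => hd θ)
      (hcont.intervalIntegrable 0 1)
    rw [intervalIntegral.integral_const_mul] at h4
    have h5 : γ x 1 = x := by simp [γ]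
    have h6 : f.1 (γ x 0) = 0 := by
      have ht' : γ x 0 t = r x := by simp [γ]
      have hi : ∀ i, γ x 0 (.inl i) = x (.inl i) := by intro i; simp [γ, t]
      refine hf _ ?_ (by rw [ht']; exact hrx)
      rw [quadForm]
      simp only [hi]
      change S x - γ x 0 t ^ 2 = 0
      rw [ht', Real.sq_sqrt (le_of_lt hx), sub_self]
    rw [h5, h6, sub_zero] at h4
    exact h4.symm
  have hx₀ : x₀ ∈ U := by
    have h1 : S x₀ = x₀ t ^ 2 := sub_eq_zero.mp h0
    change 0 < S x₀
    rw [h1]; positivity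
  -- On this neighbourhood `t + r > 0`, and the form factors as `-(t - r)(t + r)`, so division by it
  -- only requires dividing by `t + r`.
  set W : Set (Fin n ⊕ Unit → ℝ) := U ∩ {x | 0 < x t}
  have hW : IsOpen W := hU.inter (isOpen_lt continuous_const (continuous_apply t))
  have hpos : ∀ x ∈ W, 0 < r x + x t := fun x hx => add_pos (Real.sqrt_pos.mpr hx.1) hx.2
  have hg : ContDiffOn ℝ ∞ (fun x => -(((r x + x t)⁻¹ : ℝ) : ℂ) * I x) W := by
    refine ContDiffOn.mul (ContDiffOn.neg ?_) (hI.mono Set.inter_subset_left)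
    refine Complex.ofRealCLM.contDiff.comp_contDiffOn (ContDiffOn.inv ?_ fun x hx => (hpos x hx).ne')
    exact (hr.mono Set.inter_subset_left).add (contDiff_apply ℝ ℝ t).contDiffOn
  obtain ⟨g, hg', -⟩ := exists_smoothFun_eventuallyEq hW hg (x := x₀) ⟨hx₀, ht⟩
  refine ⟨g, ?_⟩
  filter_upwards [hg', hW.mem_nhds ⟨hx₀, ht⟩] with x hx hxW
  rw [quadOp_apply, hx, hFTC x hxW.1]
  have h1 := (hpos x hxW).ne'
  have h2 : quadForm x = -((x t - r x) * (r x + x t)) := by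
    have : S x = r x ^ 2 := (Real.sq_sqrt (le_of_lt hxW.1)).symm
    change S x - x t ^ 2 = _
    rw [this]; ring
  rw [h2, ← mul_assoc]
  congr 1
  rw [← Complex.ofReal_neg, ← Complex.ofReal_mul]
  congr 1
  field_simp

/-! ### Locality, homogeneity and dependence on the values on the cone -/

section
variable {ι : Type*} [Fintype ι] [DecidableEq ι]

/-- The wave operator with coefficients `θ` on arbitrary functions. -/
noncomputable def waveFun (θ : ι → ℂ) (f : (ι → ℝ) → ℂ) : (ι → ℝ) → ℂ :=
  fun x => ∑ i, θ i * partialDeriv i (partialDeriv i f) x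

/-- The combination `∑ C_k ∂_s^(j-2k) □^k` on arbitrary functions. -/
noncomputable def normalFun (s : ι) (θ : ι → ℂ) (C : ℕ → ℂ) (j : ℕ) (f : (ι → ℝ) → ℂ) :
    (ι → ℝ) → ℂ :=
  fun x => ∑ k ∈ Finset.range (j / 2 + 1), C k *
    ((partialDeriv s)^[j - 2 * k] ((waveFun θ)^[k] f)) x

theorem waveFun_congr (θ : ι → ℂ) {f g : (ι → ℝ) → ℂ} {x : ι → ℝ} (h : f =ᶠ[nhds x] g) :
    waveFun θ f =ᶠ[nhds x] waveFun θ g := by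
  have h1 : ∀ᶠ y in nhds x, ∀ i, partialDeriv i (partialDeriv i f) y =
      partialDeriv i (partialDeriv i g) y :=
    Filter.eventually_all.mpr fun i => partialDeriv_congr i (partialDeriv_congr i h)
  filter_upwards [h1] with y hy
  simp only [waveFun, hy]

theorem iterate_eventuallyEq {T : ((ι → ℝ) → ℂ) → (ι → ℝ) → ℂ} {x : ι → ℝ}
    (hT : ∀ f g, f =ᶠ[nhds x] g → T f =ᶠ[nhds x] T g) (k : ℕ) {f g : (ι → ℝ) → ℂ}
    (h : f =ᶠ[nhds x] g) : T^[k] f =ᶠ[nhds x] T^[k] g := by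
  induction k with
  | zero => exact h
  | succ k ih => simpa only [Function.iterate_succ_apply'] using hT _ _ ih

/-- Locality allows germs to be replaced by globally smooth functions, on which the operator algebra
above is available. -/
theorem normalFun_congr (s : ι) (θ : ι → ℂ) (C : ℕ → ℂ) (j : ℕ) {f g : (ι → ℝ) → ℂ} {x : ι → ℝ}
    (h : f =ᶠ[nhds x] g) : normalFun s θ C j f =ᶠ[nhds x] normalFun s θ C j g := by
  have h1 : ∀ᶠ y in nhds x, ∀ k ∈ Finset.range (j / 2 + 1),
      ((partialDeriv s)^[j - 2 * k] ((waveFun θ)^[k] f)) y =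
      ((partialDeriv s)^[j - 2 * k] ((waveFun θ)^[k] g)) y :=
    (Finset.eventually_all _).mpr fun k _ => iterate_eventuallyEq (fun _ _ => partialDeriv_congr s) _
      (iterate_eventuallyEq (fun _ _ => waveFun_congr θ) k h)
  filter_upwards [h1] with y hy
  exact Finset.sum_congr rfl fun k hk => by rw [hy k hk]

theorem waveOp_coe (θ : ι → ℂ) (f : SmoothFun ι) : (waveOp θ f).1 = waveFun θ f.1 := by
  have h : (waveOp θ f).1 = ∑ i, θ i • (derivOp i (derivOp i f)).1 := by
    rw [waveOp, LinearMap.sum_apply, AddSubmonoidClass.coe_finsetSum]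
    rfl
  rw [h]
  funext x
  rw [Finset.sum_apply]
  rfl

theorem pow_coe {T : Module.End ℂ (SmoothFun ι)} {T' : ((ι → ℝ) → ℂ) → (ι → ℝ) → ℂ}
    (h : ∀ f, (T f).1 = T' f.1) (k : ℕ) (f : SmoothFun ι) : ((T ^ k) f).1 = T'^[k] f.1 := by
  induction k with
  | zero => rfl
  | succ k ih => rw [pow_succ', Module.End.mul_apply, h, ih, Function.iterate_succ_apply']

theorem derivOp_pow_mul_waveOp_pow_coe (s : ι) (θ : ι → ℂ) (p k : ℕ) (f : SmoothFun ι) :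
    ((derivOp s ^ p * waveOp θ ^ k) f).1 = (partialDeriv s)^[p] ((waveFun θ)^[k] f.1) := by
  rw [Module.End.mul_apply, pow_coe (derivOp_coe s), pow_coe (waveOp_coe θ)]

theorem normalFun_coe (s : ι) (θ : ι → ℂ) (C : ℕ → ℂ) (j : ℕ) (f : SmoothFun ι) (x : ι → ℝ) :
    normalFun s θ C j f.1 x = ∑ k ∈ Finset.range (j / 2 + 1), C k *
      ((derivOp s ^ (j - 2 * k) * waveOp θ ^ k) f).1 x := by
  simp only [derivOp_pow_mul_waveOp_pow_coe, normalFun]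

theorem contDiffOn_waveFun (θ : ι → ℂ) {f : (ι → ℝ) → ℂ} {u : Set (ι → ℝ)} (hu : IsOpen u)
    (hf : ContDiffOn ℝ ∞ f u) : ContDiffOn ℝ ∞ (waveFun θ f) u :=
  ContDiffOn.sum fun i _ => contDiffOn_const.mul
    (contDiffOn_partialDeriv i hu (contDiffOn_partialDeriv i hu hf))

theorem contDiffOn_normalFun (s : ι) (θ : ι → ℂ) (C : ℕ → ℂ) (j : ℕ) {f : (ι → ℝ) → ℂ}
    {u : Set (ι → ℝ)} (hu : IsOpen u) (hf : ContDiffOn ℝ ∞ f u) :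
    ContDiffOn ℝ ∞ (normalFun s θ C j f) u := by
  refine ContDiffOn.sum fun k _ => contDiffOn_const.mul ?_
  have h1 : ∀ {T : ((ι → ℝ) → ℂ) → (ι → ℝ) → ℂ}, (∀ f, ContDiffOn ℝ ∞ f u → ContDiffOn ℝ ∞ (T f) u) →
      ∀ (k : ℕ) f, ContDiffOn ℝ ∞ f u → ContDiffOn ℝ ∞ (T^[k] f) u := by
    intro T hT k
    induction k with
    | zero => exact fun f hf => hf
    | succ k ih =>
      intro f hf
      rw [Function.iterate_succ_apply']
      exact hT _ (ih f hf)
  exact h1 (fun f => contDiffOn_partialDeriv s hu) _ _ (h1 (fun f => contDiffOn_waveFun θ hu) k f hf)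

/-- Positive homogeneity of degree `-a`. -/
def IsHomogeneousNeg (a : ℕ) (f : (ι → ℝ) → ℂ) : Prop :=
  ∀ c : ℝ, 0 < c → ∀ x, f x = (c : ℂ) ^ a * f (c • x)

theorem IsHomogeneousNeg.partialDeriv {a : ℕ} {f : (ι → ℝ) → ℂ} (hf : IsHomogeneousNeg a f)
    (i : ι) : IsHomogeneousNeg (a + 1) (partialDeriv i f) := by
  intro c hc x
  have h1 : f = ((c : ℂ) ^ a) • fun x => f (c • x) := funext fun x => hf c hc x
  change fderiv ℝ f x _ = _ * fderiv ℝ f (c • x) _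
  conv_lhs => rw [h1]
  rw [fderiv_const_smul_field, Pi.smul_apply, fderiv_comp_smul]
  simp only [smul_apply, smul_eq_mul, Complex.real_smul]
  ring

theorem IsHomogeneousNeg.sum {a : ℕ} {α : Type*} {t : Finset α} {c : α → ℂ}
    {f : α → (ι → ℝ) → ℂ} (hf : ∀ i ∈ t, IsHomogeneousNeg a (f i)) :
    IsHomogeneousNeg a fun x => ∑ i ∈ t, c i * f i x := by
  intro r hr x
  simp only [Finset.mul_sum]
  refine Finset.sum_congr rfl fun i hi => ?_
  rw [hf i hi r hr x]; ring

theorem IsHomogeneousNeg.waveFun {a : ℕ} {f : (ι → ℝ) → ℂ} (hf : IsHomogeneousNeg a f)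
    (θ : ι → ℂ) : IsHomogeneousNeg (a + 2) (waveFun θ f) :=
  IsHomogeneousNeg.sum fun i _ => (hf.partialDeriv i).partialDeriv i

theorem IsHomogeneousNeg.normalFun {f : (ι → ℝ) → ℂ} (hf : IsHomogeneousNeg 0 f) (s : ι)
    (θ : ι → ℂ) (C : ℕ → ℂ) (j : ℕ) : IsHomogeneousNeg j (normalFun s θ C j f) := by
  refine IsHomogeneousNeg.sum fun k hk => ?_
  have h1 : ∀ k, IsHomogeneousNeg (2 * k) ((LorentzBranching.waveFun θ)^[k] f) := by
    intro k
    induction k with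
    | zero => exact hf
    | succ k ih => rw [Function.iterate_succ_apply']; exact ih.waveFun θ
  have h2 : ∀ p, IsHomogeneousNeg (2 * k + p)
      ((LorentzBranching.partialDeriv s)^[p] ((LorentzBranching.waveFun θ)^[k] f)) := by
    intro p
    induction p with
    | zero => exact h1 k
    | succ p ih => rw [Function.iterate_succ_apply']; exact ih.partialDeriv s
  have h3 := h2 (j - 2 * k)
  have h4 := Finset.mem_range.mp hk
  rwa [show 2 * k + (j - 2 * k) = j by omega] at h3

theorem eulerOp_one_apply (f : SmoothFun ι) (x : ι → ℝ) :
    (eulerOp (fun _ => 1) f).1 x = fderiv ℝ f.1 x x := by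
  have h : (eulerOp (fun _ => 1) f).1 = ∑ i, (coordOp i (derivOp i f)).1 := by
    rw [eulerOp, LinearMap.sum_apply, AddSubmonoidClass.coe_finsetSum]
    simp only [one_smul]
    rfl
  rw [h, Finset.sum_apply]
  have hx := congrArg (fderiv ℝ f.1 x) (pi_eq_sum_univ' x)
  rw [hx, map_sum]
  refine Finset.sum_congr rfl fun i _ => ?_
  rw [map_smul, Complex.real_smul]
  rfl

/-- Euler's relation: the function is constant along the ray through `x`. -/
theorem fderiv_apply_self_eq_zero {f : (ι → ℝ) → ℂ} (hf : IsHomogeneousNeg 0 f) {x : ι → ℝ}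
    (hd : DifferentiableAt ℝ f x) : fderiv ℝ f x x = 0 := by
  have h1 : HasDerivAt (fun c : ℝ => c • x) x 1 := by
    simpa using (hasDerivAt_id (1 : ℝ)).smul_const x
  have hd' : HasFDerivAt f (fderiv ℝ f x) ((1 : ℝ) • x) := by
    rw [one_smul]; exact hd.hasFDerivAt
  have h2 := hd'.comp_hasDerivAt (1 : ℝ) h1
  have h3 : HasDerivAt (f ∘ fun c : ℝ => c • x) 0 1 := by
    refine (hasDerivAt_const (1 : ℝ) (f x)).congr_of_eventuallyEq ?_
    filter_upwards [lt_mem_nhds one_pos] with c hc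
    have := hf c hc x
    rw [pow_zero, one_mul] at this
    exact this.symm
  exact h2.unique h3

theorem eulerOp_one_mul_quadOp (η : ι → ℂ) :
    eulerOp (fun _ => 1) * quadOp η = quadOp η * eulerOp (fun _ => 1) + (2 : ℂ) • quadOp η := by
  have hc : ∀ i, coordOp i * quadOp η = quadOp η * coordOp i := by
    intro i
    simp only [quadOp, Finset.mul_sum, Finset.sum_mul, mul_smul_comm, smul_mul_assoc]
    refine Finset.sum_congr rfl fun k _ => ?_
    rw [← mul_assoc, coordOp_comm i k, mul_assoc, coordOp_comm i k, mul_assoc]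
  have h : ∀ i, (1 : ℂ) • (coordOp i * derivOp i) * quadOp η =
      quadOp η * ((1 : ℂ) • (coordOp i * derivOp i)) + (2 : ℂ) • (η i • (coordOp i * coordOp i)) := by
    intro i
    rw [one_smul, mul_assoc, derivOp_mul_quadOp, mul_add, ← mul_assoc, hc, mul_smul_comm, mul_assoc]
    module
  have h2 : ∑ i, (2 : ℂ) • (η i • (coordOp i * coordOp i)) = (2 : ℂ) • quadOp η := by
    rw [quadOp, Finset.smul_sum]
  rw [eulerOp, Finset.sum_mul, Finset.sum_congr rfl fun i _ => h i, Finset.sum_add_distrib,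
    Finset.mul_sum, h2]

end

/-- The normal direction, the last space-like coordinate. -/
abbrev normalIx (m : ℕ) : Fin (m + 2) ⊕ Unit := .inl (Fin.last (m + 1))

/-- The coefficients of the quadratic form in the directions different from the normal one. -/
def tanSigns (m : ℕ) : Fin (m + 2) ⊕ Unit → ℂ :=
  fun i => if i = normalIx m then 0 else signs (m + 2) i

/-- If `u` were nonzero at a nearby point, the form would vanish on an open set; moving in the time
direction at positive time contradicts this. -/
theorem eventually_eq_zero_of_quadForm_mul {n : ℕ} {u : (Fin n ⊕ Unit → ℝ) → ℂ} (hu : Continuous u)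
    {x₀ : Fin n ⊕ Unit → ℝ} (ht : 0 < x₀ (.inr ()))
    (h : ∀ᶠ x in nhds x₀, (quadForm x : ℂ) * u x = 0) : u =ᶠ[nhds x₀] 0 := by
  have ht' : ∀ᶠ x in nhds x₀, 0 < x (.inr ()) :=
    (isOpen_lt continuous_const (continuous_apply _)).mem_nhds ht
  filter_upwards [h.eventually_nhds, ht'] with x hx hxt
  by_contra hne
  have h1 : ∀ᶠ y in nhds x, u y ≠ 0 := (isOpen_ne.preimage hu).mem_nhds hne
  have h2 : ∀ᶠ y in nhds x, quadForm y = 0 := by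
    filter_upwards [hx, h1] with y hy hy'
    exact_mod_cast (mul_eq_zero.mp hy).resolve_right hy'
  set e : Fin n ⊕ Unit → ℝ := Pi.single (.inr ()) 1
  have h3 : Filter.Tendsto (fun ε : ℝ => x + ε • e) (nhdsWithin 0 (Set.Ioi 0)) (nhds x) := by
    have : Continuous fun ε : ℝ => x + ε • e := by fun_prop
    have h4 := this.tendsto 0
    rw [zero_smul, add_zero] at h4
    exact h4.mono_left nhdsWithin_le_nhds
  obtain ⟨ε, hε, hε0⟩ := ((h3.eventually h2).and self_mem_nhdsWithin).exists
  have hε0' : (0 : ℝ) < ε := hε0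
  have h5 := h2.self_of_nhds
  rw [quadForm] at h5 hε
  simp only [e, Pi.add_apply, Pi.smul_apply, ne_eq, reduceCtorEq, not_false_eq_true,
    Pi.single_eq_of_ne, smul_eq_mul, mul_zero, add_zero, Pi.single_eq_same, mul_one] at hε
  nlinarith

/-- On homogeneous functions of degree zero, the combination of normal derivatives depends, at the
points of the cone on the hyperplane, only on the values on the cone. -/
theorem normalFun_eq_of_eqOn_cone {m j : ℕ} (hm : Odd m)
    {Φ₁ Φ₂ : (Fin (m + 2) ⊕ Unit → ℝ) → ℂ} {Ω : Set (Fin (m + 2) ⊕ Unit → ℝ)} (hΩ : IsOpen Ω)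
    (h1 : ContDiffOn ℝ ∞ Φ₁ Ω) (h2 : ContDiffOn ℝ ∞ Φ₂ Ω) (hom1 : IsHomogeneousNeg 0 Φ₁)
    (hom2 : IsHomogeneousNeg 0 Φ₂)
    (heq : ∀ x ∈ Ω, quadForm x = 0 → 0 < x (.inr ()) → Φ₁ x = Φ₂ x)
    {x₀ : Fin (m + 2) ⊕ Unit → ℝ} (hx₀ : x₀ ∈ Ω) (hq : quadForm x₀ = 0) (ht : 0 < x₀ (.inr ()))
    (hs : x₀ (normalIx m) = 0) :
    normalFun (normalIx m) (tanSigns m) (diffCoeff m j) j Φ₁ x₀ =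
      normalFun (normalIx m) (tanSigns m) (diffCoeff m j) j Φ₂ x₀ := by
  obtain ⟨f, hf, hf0⟩ := exists_smoothFun_eventuallyEq hΩ (h1.sub h2) hx₀
  obtain ⟨f₁, hf₁, -⟩ := exists_smoothFun_eventuallyEq hΩ h1 hx₀
  obtain ⟨f₂, hf₂, -⟩ := exists_smoothFun_eventuallyEq hΩ h2 hx₀
  -- The cut-off difference of the two functions still vanishes on the whole forward cone, so it is
  -- divisible by the quadratic form near `x₀`.
  obtain ⟨g, hg⟩ := exists_eq_quadOp f (fun x hx hx' => hf0 x fun hxΩ =>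
    sub_eq_zero.mpr (heq x hxΩ hx hx')) hq ht
  rw [(normalFun_congr _ _ _ _ hf₁).symm.self_of_nhds, (normalFun_congr _ _ _ _ hf₂).symm.self_of_nhds,
    ← sub_eq_zero]
  set φ : SmoothFun (Fin (m + 2) ⊕ Unit) →ₗ[ℂ] ℂ :=
    (LinearMap.proj x₀).comp (SmoothFun (Fin (m + 2) ⊕ Unit)).subtype
  have hφ : ∀ f, φ f = f.1 x₀ := fun f => rfl
  have e1 : normalFun (normalIx m) (tanSigns m) (diffCoeff m j) j f₁.1 x₀ -
      normalFun (normalIx m) (tanSigns m) (diffCoeff m j) j f₂.1 x₀ =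
      normalFun (normalIx m) (tanSigns m) (diffCoeff m j) j (f₁ - f₂).1 x₀ := by
    simp only [normalFun_coe, ← hφ, map_sub, mul_sub, Finset.sum_sub_distrib]
  have e2 : (f₁ - f₂).1 =ᶠ[nhds x₀] (quadOp (signs (m + 2)) g).1 := by
    filter_upwards [hf, hf₁, hf₂, hg] with x a1 a2 a3 a4
    rw [← a4, a1]
    change f₁.1 x - f₂.1 x = _
    rw [a2, a3]
  rw [e1, (normalFun_congr _ _ _ _ e2).self_of_nhds, normalFun_coe]
  refine sum_diffCoeff_eq_zero hm (signs_mul_signs _) rfl (by simp) φ (fun f => ?_) (fun f => ?_) g ?_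
  · rw [hφ, quadOp_apply, hq]; simp
  · rw [hφ, coordOp_apply, hs]; simp
  · set u := eulerOp (fun _ => 1) g + (2 : ℂ) • g
    -- The product of the form with `g` is homogeneous of degree zero near `x₀`, hence killed by the
    -- Euler operator. Commuting that operator past the form gives the form times `E g + 2 g`, and
    -- the form can be cancelled: `g` has degree `-2`.
    have hu : u.1 =ᶠ[nhds x₀] 0 := by
      refine eventually_eq_zero_of_quadForm_mul (contDiff_smoothFun u).continuous ht ?_
      have h3 : quadOp (signs (m + 2)) u = eulerOp (fun _ => 1) (quadOp (signs (m + 2)) g) := by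
        have h4 := LinearMap.congr_fun (eulerOp_one_mul_quadOp (signs (m + 2))) g
        rw [Module.End.mul_apply] at h4
        rw [h4, map_add, map_smul]
        rfl
      filter_upwards [hg.eventually_nhds, hf.eventually_nhds, hΩ.mem_nhds hx₀] with x b1 b2 b3
      rw [← quadOp_apply, h3, eulerOp_one_apply]
      have b4 : (quadOp (signs (m + 2)) g).1 =ᶠ[nhds x] fun y => Φ₁ y - Φ₂ y := by
        filter_upwards [b1, b2] with y c1 c2
        rw [← c1, c2]
      rw [b4.fderiv_eq]
      refine fderiv_apply_self_eq_zero (fun c hc y => ?_) ?_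
      · rw [hom1 c hc y, hom2 c hc y]; ring
      · exact ((h1.sub h2).differentiableOn (by simp)).differentiableAt (hΩ.mem_nhds b3)
    intro a b
    rw [hφ, derivOp_pow_mul_waveOp_pow_coe]
    have h5 := iterate_eventuallyEq (fun _ _ => partialDeriv_congr (normalIx m)) a
      (iterate_eventuallyEq (fun _ _ => waveFun_congr (tanSigns m)) b hu)
    have h6 := h5.self_of_nhds
    have h7 : ((partialDeriv (normalIx m))^[a] ((waveFun (tanSigns m))^[b] 0)) x₀ = 0 := by
      have := congrFun (derivOp_pow_mul_waveOp_pow_coe (normalIx m) (tanSigns m) a b 0) x₀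
      rw [map_zero] at this
      exact this.symm
    exact h6.trans h7

/-! ### Linear changes of variables -/

section
variable {ι : Type*} [Fintype ι] [DecidableEq ι]

theorem contDiff_mulVec (G : Matrix ι ι ℝ) : ContDiff ℝ ∞ fun x : ι → ℝ => G *ᵥ x :=
  (Matrix.toLin' G).toContinuousLinearMap.contDiff

/-- The pull-back by a linear map, on smooth functions. -/
def mulVecOp (G : Matrix ι ι ℝ) : Module.End ℂ (SmoothFun ι) where
  toFun f := ⟨fun x => f.1 (G *ᵥ x), (contDiff_smoothFun f).comp (contDiff_mulVec G)⟩
  map_add' _ _ := rfl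
  map_smul' _ _ := rfl

theorem derivOp_mul_mulVecOp (G : Matrix ι ι ℝ) (a : ι) :
    derivOp a * mulVecOp G = ∑ b, (G b a : ℂ) • (mulVecOp G * derivOp b) := by
  ext f x
  have h1 : ((∑ b, (G b a : ℂ) • (mulVecOp G * derivOp b) : Module.End ℂ (SmoothFun ι)) f).1 =
      ∑ b, (G b a : ℂ) • (mulVecOp G (derivOp b f)).1 := by
    rw [LinearMap.sum_apply, AddSubmonoidClass.coe_finsetSum]
    rfl
  rw [h1, Finset.sum_apply]
  have h2 : HasFDerivAt (fun y : ι → ℝ => G *ᵥ y) (Matrix.toLin' G).toContinuousLinearMap x :=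
    (Matrix.toLin' G).toContinuousLinearMap.hasFDerivAt
  have h3 := ((differentiable_smoothFun f (G *ᵥ x)).hasFDerivAt.comp x h2).fderiv
  change fderiv ℝ (f.1 ∘ fun y => G *ᵥ y) x (Pi.single a 1) = _
  rw [h3, ContinuousLinearMap.comp_apply]
  have h4 : (Matrix.toLin' G).toContinuousLinearMap (Pi.single a 1) = fun b => G b a := by
    ext b
    simp
  rw [h4, pi_eq_sum_univ' (fun b => G b a), map_sum]
  refine Finset.sum_congr rfl fun b _ => ?_
  rw [map_smul, Complex.real_smul]
  rfl

theorem waveOp_mul_mulVecOp {G : Matrix ι ι ℝ} {θ : ι → ℂ}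
    (hG : ∀ b c, ∑ a, θ a * (G b a * G c a) = if b = c then θ b else 0) :
    waveOp θ * mulVecOp G = mulVecOp G * waveOp θ := by
  have h : ∀ a, θ a • (derivOp a * derivOp a) * mulVecOp G =
      ∑ b, ∑ c, (θ a * (G b a * G c a)) • (mulVecOp G * (derivOp c * derivOp b)) := by
    intro a
    rw [smul_mul_assoc, mul_assoc, derivOp_mul_mulVecOp, Finset.mul_sum, Finset.smul_sum]
    refine Finset.sum_congr rfl fun b _ => ?_
    rw [mul_smul_comm, ← mul_assoc, derivOp_mul_mulVecOp, Finset.sum_mul, Finset.smul_sum,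
      Finset.smul_sum]
    refine Finset.sum_congr rfl fun c _ => ?_
    rw [smul_mul_assoc, smul_smul, smul_smul, mul_assoc, mul_assoc]
  rw [waveOp, Finset.sum_mul, Finset.sum_congr rfl fun a _ => h a, Finset.sum_comm, Finset.mul_sum]
  refine Finset.sum_congr rfl fun b _ => ?_
  rw [Finset.sum_comm]
  simp only [← Finset.sum_smul, hG, ite_smul, zero_smul, Finset.sum_ite_eq, Finset.mem_univ,
    if_true, mul_smul_comm]

/-- The matrix fixes the normal basis vector and preserves the dual form with coefficients `θ`, so
its pullback commutes with both differential operators. -/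
theorem normalFun_comp_mulVec {G : Matrix ι ι ℝ} {θ : ι → ℂ} {s : ι}
    (hG : ∀ b c, ∑ a, θ a * (G b a * G c a) = if b = c then θ b else 0)
    (hs : ∀ b, G b s = if b = s then 1 else 0) (C : ℕ → ℂ) (j : ℕ) {f : (ι → ℝ) → ℂ}
    {u : Set (ι → ℝ)} (hu : IsOpen u) (hf : ContDiffOn ℝ ∞ f u) {x : ι → ℝ} (hx : G *ᵥ x ∈ u) :
    normalFun s θ C j (fun y => f (G *ᵥ y)) x = normalFun s θ C j f (G *ᵥ x) := by
  obtain ⟨g, hg, -⟩ := exists_smoothFun_eventuallyEq hu hf hx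
  have h1 : (mulVecOp G g).1 =ᶠ[nhds x] fun y => f (G *ᵥ y) :=
    (contDiff_mulVec G).continuous.continuousAt.eventually hg
  rw [← (normalFun_congr s θ C j hg).self_of_nhds, ← (normalFun_congr s θ C j h1).self_of_nhds,
    normalFun_coe, normalFun_coe]
  refine Finset.sum_congr rfl fun k _ => ?_
  have h2 : derivOp s * mulVecOp G = mulVecOp G * derivOp s := by
    rw [derivOp_mul_mulVecOp, Finset.sum_eq_single s (fun b _ hb => by simp [hs, hb]) (by simp)]
    simp [hs]
  have h3 : Commute (derivOp s ^ (j - 2 * k) * waveOp θ ^ k) (mulVecOp G) :=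
    Commute.mul_left (Commute.pow_left h2 _) (Commute.pow_left (waveOp_mul_mulVecOp hG) _)
  have h4 := LinearMap.congr_fun h3.eq g
  rw [Module.End.mul_apply] at h4
  rw [h4]
  rfl

theorem normalFun_add (s : ι) (θ : ι → ℂ) (C : ℕ → ℂ) (j : ℕ) {f g : (ι → ℝ) → ℂ}
    {u : Set (ι → ℝ)} (hu : IsOpen u) (hf : ContDiffOn ℝ ∞ f u) (hg : ContDiffOn ℝ ∞ g u)
    {x : ι → ℝ} (hx : x ∈ u) :
    normalFun s θ C j (f + g) x = normalFun s θ C j f x + normalFun s θ C j g x := by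
  obtain ⟨f', hf', -⟩ := exists_smoothFun_eventuallyEq hu hf hx
  obtain ⟨g', hg', -⟩ := exists_smoothFun_eventuallyEq hu hg hx
  have h1 : (f' + g').1 =ᶠ[nhds x] f + g := hf'.add hg'
  rw [← (normalFun_congr s θ C j hf').self_of_nhds, ← (normalFun_congr s θ C j hg').self_of_nhds,
    ← (normalFun_congr s θ C j h1).self_of_nhds, normalFun_coe, normalFun_coe, normalFun_coe,
    ← Finset.sum_add_distrib]
  refine Finset.sum_congr rfl fun k _ => ?_
  rw [map_add, ← mul_add]
  rfl

theorem normalFun_smul (s : ι) (θ : ι → ℂ) (C : ℕ → ℂ) (j : ℕ) {f : (ι → ℝ) → ℂ}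
    {u : Set (ι → ℝ)} (hu : IsOpen u) (hf : ContDiffOn ℝ ∞ f u) (c : ℂ)
    {x : ι → ℝ} (hx : x ∈ u) :
    normalFun s θ C j (c • f) x = c * normalFun s θ C j f x := by
  obtain ⟨f', hf', -⟩ := exists_smoothFun_eventuallyEq hu hf hx
  have h1 : (c • f').1 =ᶠ[nhds x] c • f := hf'.const_smul c
  rw [← (normalFun_congr s θ C j hf').self_of_nhds,
    ← (normalFun_congr s θ C j h1).self_of_nhds, normalFun_coe, normalFun_coe, Finset.mul_sum]
  refine Finset.sum_congr rfl fun k _ => ?_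
  rw [map_smul, mul_left_comm]
  rfl

end

/-! ### The forward cone -/

/-- The point of the forward cone above `u`. -/
def conePoint {N : ℕ} (u : EuclideanSpace ℝ (Fin (N + 1))) : Fin (N + 1) ⊕ Unit → ℝ :=
  Sum.elim (fun i => u i) fun _ => 1

/-- The space-like part. -/
noncomputable def spacePart {N : ℕ} (X : Fin (N + 1) ⊕ Unit → ℝ) : EuclideanSpace ℝ (Fin (N + 1)) :=
  WithLp.toLp 2 fun i => X (.inl i)

theorem contDiff_spacePart {N : ℕ} : ContDiff ℝ ∞ (spacePart : (Fin (N + 1) ⊕ Unit → ℝ) → _) := by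
  rw [contDiff_euclidean]
  exact fun i => contDiff_apply ℝ ℝ (Sum.inl i)

theorem spacePart_smul_conePoint {N : ℕ} (c : ℝ) (u : EuclideanSpace ℝ (Fin (N + 1))) :
    spacePart (c • conePoint u) = c • u := by
  ext i; rfl

theorem quadForm_smul_conePoint {N : ℕ} (c : ℝ) (u : Sph N) :
    quadForm (c • conePoint u.1) = 0 := by
  have := sum_sq_sphere u
  simp only [quadForm, conePoint, Pi.smul_apply, Sum.elim_inl, Sum.elim_inr, smul_eq_mul, mul_pow,
    ← Finset.mul_sum, this]
  ring

theorem exists_eq_smul_conePoint {N : ℕ} {X : Fin (N + 1) ⊕ Unit → ℝ} (hq : quadForm X = 0)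
    (ht : 0 < X (.inr ())) : ∃ u : Sph N, X = X (.inr ()) • conePoint u.1 := by
  set τ := X (.inr ())
  refine ⟨⟨τ⁻¹ • spacePart X, ?_⟩, ?_⟩
  · rw [mem_sphere_zero_iff_norm, ← sq_eq_sq₀ (norm_nonneg _) zero_le_one, norm_smul, mul_pow,
      EuclideanSpace.norm_sq_eq]
    have h1 : ∑ i, ‖spacePart X i‖ ^ 2 = τ ^ 2 := by
      simp only [spacePart, Real.norm_eq_abs, sq_abs]
      rw [quadForm] at hq
      linarith
    rw [h1, norm_inv, Real.norm_of_nonneg ht.le]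
    field_simp
  · ext i
    rcases i with i | i
    · simp [conePoint, spacePart, ht.ne']
    · simp [conePoint, τ]

/-- The extension of a function on the sphere to a function homogeneous of degree zero. -/
noncomputable def coneExt {N : ℕ} (F : Sph N → ℂ) (X : Fin (N + 1) ⊕ Unit → ℝ) : ℂ :=
  radialExt F (spacePart X)

theorem coneExt_smul_conePoint {N : ℕ} (F : Sph N → ℂ) {c : ℝ} (hc : 0 < c) (u : Sph N) :
    coneExt F (c • conePoint u.1) = F u := by
  rw [coneExt, spacePart_smul_conePoint, radialExt_smul F hc]

theorem isHomogeneousNeg_coneExt {N : ℕ} (F : Sph N → ℂ) : IsHomogeneousNeg 0 (coneExt F) := by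
  intro c hc X
  have h : spacePart (c • X) = c • spacePart X := by ext i; rfl
  rw [pow_zero, one_mul, coneExt, coneExt, h, radialExt_pos_smul F hc]

theorem isOpen_spacePart_ne {N : ℕ} : IsOpen {X : Fin (N + 1) ⊕ Unit → ℝ | spacePart X ≠ 0} :=
  isOpen_ne.preimage contDiff_spacePart.continuous

theorem contDiffOn_coneExt {N : ℕ} (F : SmoothSphere N) :
    ContDiffOn ℝ ∞ (coneExt F.1) {X | spacePart X ≠ 0} := fun X hX =>
  ((contDiffAt_radialExt F hX).comp X contDiff_spacePart.contDiffAt).contDiffWithinAt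

theorem spacePart_ne_of_cone {N : ℕ} {X : Fin (N + 1) ⊕ Unit → ℝ} (hq : quadForm X = 0)
    (ht : 0 < X (.inr ())) : spacePart X ≠ 0 := by
  intro h
  have h1 : ∀ i, X (.inl i) = 0 := fun i => congrArg (fun y => y i) h
  simp only [quadForm, h1] at hq
  have : 0 < X (.inr ()) ^ 2 := by positivity
  simp at hq
  exact ht.ne' hq

/-- The inclusion of the hyperplane fixed by the reflection in the normal direction. -/
def spread {n : ℕ} (v : Fin n ⊕ Unit → ℝ) : Fin (n + 1) ⊕ Unit → ℝ :=
  Sum.elim v (fun _ : Unit => 0) ∘ (insertCoord n).symm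

theorem spread_castSucc {n : ℕ} (v : Fin n ⊕ Unit → ℝ) (i : Fin n) :
    spread v (.inl i.castSucc) = v (.inl i) := by
  simp [spread, insertCoord]

theorem spread_last {n : ℕ} (v : Fin n ⊕ Unit → ℝ) : spread v (.inl (Fin.last n)) = 0 := by
  simp [spread, insertCoord]

theorem spread_inr {n : ℕ} (v : Fin n ⊕ Unit → ℝ) : spread v (.inr ()) = v (.inr ()) := by
  simp [spread, insertCoord]

theorem spread_smul {n : ℕ} (c : ℝ) (v : Fin n ⊕ Unit → ℝ) : spread (c • v) = c • spread v := by
  ext i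
  simp only [spread, Function.comp, Pi.smul_apply]
  rcases (insertCoord n).symm i with k | k <;> simp

theorem quadForm_spread {n : ℕ} (v : Fin n ⊕ Unit → ℝ) : quadForm (spread v) = quadForm v := by
  simp only [quadForm, Fin.sum_univ_castSucc, spread_castSucc, spread_last, spread_inr]
  ring

theorem extendMatrix_mulVec_spread {n : ℕ} (g : Matrix (Fin n ⊕ Unit) (Fin n ⊕ Unit) ℝ)
    (v : Fin n ⊕ Unit → ℝ) : extendMatrix g *ᵥ spread v = spread (g *ᵥ v) := by
  rw [extendMatrix, Matrix.reindex_apply, spread, Matrix.submatrix_mulVec_equiv]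
  simp only [Equiv.symm_symm, Function.comp_assoc, Equiv.symm_comp_self, Function.comp_id]
  rw [Matrix.fromBlocks_mulVec, spread]
  congr 1
  congr 1
  · ext i; simp
  · ext i; simp

theorem contDiff_spread_conePoint {N : ℕ} :
    ContDiff ℝ ∞ fun u : EuclideanSpace ℝ (Fin (N + 1)) => spread (conePoint u) := by
  rw [contDiff_pi]
  rintro (i | i)
  · refine Fin.lastCases ?_ (fun i => ?_) i
    · simp only [spread_last]; exact contDiff_const
    · simp only [spread_castSucc, conePoint, Sum.elim_inl]; fun_prop
  · simp only [conePoint]; exact contDiff_const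

theorem mulVec_conePoint {N : ℕ} (g : SO0 (N + 1)) (u : Sph N) :
    g.1.1 *ᵥ conePoint u.1 = den g u.1 • conePoint (moebius g u).1 := by
  have hd := (den_pos g u).ne'
  change lift g u.1 = _
  ext i
  rcases i with i | i
  · simp [conePoint, moebius, num, hd]
  · simp [conePoint, den]

theorem extendMatrix_normalIx {m : ℕ} (g : Matrix (Fin (m + 1) ⊕ Unit) (Fin (m + 1) ⊕ Unit) ℝ)
    (b : Fin (m + 2) ⊕ Unit) :
    extendMatrix g b (normalIx m) = if b = normalIx m then 1 else 0 := by
  rcases b with b | b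
  · refine Fin.lastCases ?_ (fun b => ?_) b <;>
      simp [extendMatrix, insertCoord, normalIx, Fin.castSucc_ne_last]
  · simp [extendMatrix, insertCoord, normalIx]

/-- The extended matrix satisfies `G J Gᵀ = J`, and its normal column is the normal basis vector;
subtracting the normal contribution leaves the tangential form. -/
theorem sum_tanSigns_extendMatrix {m : ℕ} (g : SO0 (m + 1)) (b c : Fin (m + 2) ⊕ Unit) :
    ∑ a, tanSigns m a * (extendMatrix g.1.1 b a * extendMatrix g.1.1 c a) =
      if b = c then tanSigns m b else 0 := by
  have hG := (incl (m + 1) g).2.1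
  have h1 := congrFun (congrFun (mul_form_transpose hG) b) c
  have hs := extendMatrix_normalIx g.1.1
  have h2 : ∑ a, signs (m + 2) a * (extendMatrix g.1.1 b a * extendMatrix g.1.1 c a) =
      if b = c then signs (m + 2) b else 0 := by
    change (extendMatrix g.1.1 * form (m + 2) * (extendMatrix g.1.1)ᵀ) b c = form (m + 2) b c at h1
    have h3 := congrArg (fun r : ℝ => (r : ℂ)) h1
    rw [form, LieAlgebra.Orthogonal.indefiniteDiagonal, Matrix.mul_apply] at h3
    simp only [Matrix.mul_diagonal, Matrix.transpose_apply, Matrix.diagonal_apply] at h3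
    push_cast at h3
    have h4 : ∀ a, ((Sum.elim (fun _ : Fin (m + 2) => (1 : ℝ)) (fun _ : Unit => -1) a : ℝ) : ℂ) =
        signs (m + 2) a := by
      rintro (a | a) <;> simp [signs]
    simp only [h4] at h3
    rw [show (if b = c then signs (m + 2) b else 0) =
      (((if b = c then (Sum.elim (fun _ : Fin (m + 2) => (1 : ℝ)) (fun _ : Unit => -1) b : ℝ)
        else 0 : ℝ)) : ℂ) by split_ifs <;> simp [← h4], ← h3]
    exact Finset.sum_congr rfl fun a _ => by ring
  have h5 : ∀ a, tanSigns m a = signs (m + 2) a - if a = normalIx m then 1 else 0 := by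
    intro a
    rw [tanSigns]
    split_ifs with h
    · rw [h]; simp [signs]
    · simp
  simp only [h5, sub_mul, Finset.sum_sub_distrib, h2, ite_mul, one_mul, zero_mul,
    Finset.sum_ite_eq', Finset.mem_univ, if_true, hs]
  by_cases hbc : b = c
  · subst hbc; by_cases hb : b = normalIx m <;> simp [hb]
  · by_cases hb : b = normalIx m
    · have : c ≠ normalIx m := fun h => hbc (hb.trans h.symm)
      simp [hbc, this]
    · simp [hbc, hb]

/-! ### The intertwining differential operator on the spheres -/

theorem spread_conePoint_mem {m : ℕ} (u : Sph m) :
    quadForm (spread (conePoint u.1)) = 0 ∧ 0 < spread (conePoint u.1) (.inr ()) ∧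
      spread (conePoint u.1) (normalIx m) = 0 := by
  refine ⟨?_, ?_, spread_last _⟩
  · rw [quadForm_spread]
    simpa using quadForm_smul_conePoint 1 u
  · rw [spread_inr]; exact one_pos

theorem spacePart_spread_ne {m : ℕ} (u : Sph m) :
    spacePart (N := m + 1) (spread (conePoint u.1)) ≠ 0 :=
  spacePart_ne_of_cone (spread_conePoint_mem u).1 (spread_conePoint_mem u).2.1

/-- The operator `∑ C_k ∂_s^(j-2k) □^k` applied to the homogeneous extension and restricted to the
equator. -/
noncomputable def sphereDiffOp (m j : ℕ) : SmoothSphere (m + 1) →ₗ[ℂ] SmoothSphere m where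
  toFun F := ⟨fun u => normalFun (normalIx m) (tanSigns m) (diffCoeff m j) j (coneExt F.1)
      (spread (conePoint u.1)), by
    intro u
    have h1 : ContDiffAt ℝ ∞ (normalFun (normalIx m) (tanSigns m) (diffCoeff m j) j (coneExt F.1))
        (spread (conePoint u.1)) :=
      (contDiffOn_normalFun _ _ _ _ isOpen_spacePart_ne (contDiffOn_coneExt F)).contDiffAt
        (isOpen_spacePart_ne.mem_nhds (spacePart_spread_ne u))
    have h2 := h1.comp u.1 contDiff_spread_conePoint.contDiffAt
    exact h2.contMDiffAt.comp u (contMDiff_coe_sphere u)⟩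
  map_add' F G := by
    apply Subtype.ext; funext u
    have h : coneExt (F + G).1 = coneExt F.1 + coneExt G.1 := by
      funext X
      simp only [coneExt, radialExt, Pi.add_apply]
      split_ifs
      · simp
      · rfl
    exact (congrArg (fun f => normalFun (normalIx m) (tanSigns m) (diffCoeff m j) j f
      (spread (conePoint u.1))) h).trans (normalFun_add _ _ _ _ isOpen_spacePart_ne
        (contDiffOn_coneExt F) (contDiffOn_coneExt G) (spacePart_spread_ne u))
  map_smul' c F := by
    apply Subtype.ext; funext u
    have h : coneExt (c • F).1 = c • coneExt F.1 := by
      funext X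
      simp only [coneExt, radialExt, Pi.smul_apply]
      split_ifs
      · simp
      · rfl
    exact (congrArg (fun f => normalFun (normalIx m) (tanSigns m) (diffCoeff m j) j f
      (spread (conePoint u.1))) h).trans (normalFun_smul _ _ _ _ isOpen_spacePart_ne
        (contDiffOn_coneExt F) c (spacePart_spread_ne u))

theorem sphereDiffOp_apply {m j : ℕ} (F : SmoothSphere (m + 1)) (u : Sph m) :
    (sphereDiffOp m j F).1 u = normalFun (normalIx m) (tanSigns m) (diffCoeff m j) j (coneExt F.1)
      (spread (conePoint u.1)) := rfl

/-- At weight zero no factor appears, so on the cone the action is composition with the linear map.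
Off the cone the two extensions may differ, which is why `normalFun_eq_of_eqOn_cone` is needed. -/
theorem coneExt_principalSeries_zero {N : ℕ} (h : SO0 (N + 1)) (F : SmoothSphere N)
    {X : Fin (N + 1) ⊕ Unit → ℝ} (hq : quadForm X = 0) (ht : 0 < X (.inr ())) :
    coneExt (principalSeries N 0 h F).1 X = coneExt F.1 (h⁻¹.1.1 *ᵥ X) := by
  obtain ⟨u, hu⟩ := exists_eq_smul_conePoint hq ht
  rw [hu, coneExt_smul_conePoint _ ht, Matrix.mulVec_smul, mulVec_conePoint, smul_smul,
    coneExt_smul_conePoint _ (mul_pos ht (den_pos _ _))]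
  change ((|den h⁻¹ u.1| ^ (-0 : ℝ) : ℝ) : ℂ) * _ = _
  simp

theorem sphereDiffOp_principalSeries {m j : ℕ} (hm : Odd m) (h : SO0 (m + 1))
    (F : SmoothSphere (m + 1)) :
    sphereDiffOp m j (principalSeries (m + 1) 0 (incl (m + 1) h) F) =
      principalSeries m (0 + j) h (sphereDiffOp m j F) := by
  apply Subtype.ext; funext u
  rw [sphereDiffOp_apply]
  set G := extendMatrix h⁻¹.1.1
  have hG : (incl (m + 1) h)⁻¹.1.1 = G := by
    rw [← map_inv]; rfl
  obtain ⟨hq, ht, hs⟩ := spread_conePoint_mem u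
  have hGu : G *ᵥ spread (conePoint u.1) =
      den h⁻¹ u.1 • spread (conePoint (moebius h⁻¹ u).1) := by
    rw [extendMatrix_mulVec_spread, mulVec_conePoint, spread_smul]
  have hd := den_pos h⁻¹ u
  have hGm : spacePart (N := m + 1) (G *ᵥ spread (conePoint u.1)) ≠ 0 := by
    rw [hGu]
    intro h0
    have h1 : spacePart (N := m + 1) (den h⁻¹ u.1 • spread (conePoint (moebius h⁻¹ u).1)) =
      den h⁻¹ u.1 • spacePart (N := m + 1) (spread (conePoint (moebius h⁻¹ u).1)) := rfl
    rw [h1, smul_eq_zero] at h0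
    exact h0.elim hd.ne' (spacePart_spread_ne _)
  have hGc := contDiff_mulVec G
  have e1 := normalFun_eq_of_eqOn_cone (j := j) hm
    (Ω := {X | spacePart X ≠ 0} ∩ (fun X => G *ᵥ X) ⁻¹' {X | spacePart X ≠ 0})
    (Φ₁ := coneExt (principalSeries (m + 1) 0 (incl (m + 1) h) F).1)
    (Φ₂ := fun X => coneExt F.1 (G *ᵥ X))
    (isOpen_spacePart_ne.inter (isOpen_spacePart_ne.preimage hGc.continuous))
    ((contDiffOn_coneExt _).mono Set.inter_subset_left)
    (((contDiffOn_coneExt F).comp hGc.contDiffOn fun _ hX => hX).mono Set.inter_subset_right)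
    (isHomogeneousNeg_coneExt _)
    (fun c hc X => by
      beta_reduce; rw [Matrix.mulVec_smul]; exact isHomogeneousNeg_coneExt F.1 c hc _)
    (fun X _ hX hX' => by rw [coneExt_principalSeries_zero _ _ hX hX', hG])
    ⟨spacePart_spread_ne u, hGm⟩ hq ht hs
  rw [e1, normalFun_comp_mulVec (sum_tanSigns_extendMatrix h⁻¹) (extendMatrix_normalIx _) _ _
    isOpen_spacePart_ne (contDiffOn_coneExt F) hGm, hGu]
  -- Homogeneity of degree `-j` turns the passage back to time one into the factor `den ^ (-j)` of
  -- `π_j`.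
  have e2 := (isHomogeneousNeg_coneExt F.1).normalFun (normalIx m) (tanSigns m) (diffCoeff m j) j
    (den h⁻¹ u.1) hd (spread (conePoint (moebius h⁻¹ u).1))
  change _ = ((|den h⁻¹ u.1| ^ (-(0 + j : ℝ)) : ℝ) : ℂ) * normalFun (normalIx m) (tanSigns m)
    (diffCoeff m j) j (coneExt F.1) (spread (conePoint (moebius h⁻¹ u).1))
  rw [e2, zero_add, Real.rpow_neg (abs_nonneg _), Real.rpow_natCast, abs_of_pos hd]
  have : (den h⁻¹ u.1 : ℂ) ≠ 0 := by exact_mod_cast hd.ne'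
  push_cast
  field_simp

/-! ### The expression in the non-compact picture -/

/-- The height above the omitted generator of the cone. -/
def coneHeight {N : ℕ} (X : Fin (N + 1) ⊕ Unit → ℝ) : ℝ := X (.inl 0) + X (.inr ())

/-- The affine coordinates of the generator through a point. -/
noncomputable def coneChart {N : ℕ} (X : Fin (N + 1) ⊕ Unit → ℝ) : EuclideanSpace ℝ (Fin N) :=
  WithLp.toLp 2 fun i => X (.inl i.succ) / coneHeight X

/-- The function homogeneous of degree `-a` which is `f` in the affine chart. -/
noncomputable def chartLift {N : ℕ} (a : ℕ) (f : EuclideanSpace ℝ (Fin N) → ℂ)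
    (X : Fin (N + 1) ⊕ Unit → ℝ) : ℂ :=
  ((coneHeight X : ℂ) ^ a)⁻¹ * f (coneChart X)

theorem contDiff_coneHeight {N : ℕ} :
    ContDiff ℝ ∞ (coneHeight : (Fin (N + 1) ⊕ Unit → ℝ) → ℝ) :=
  (contDiff_apply ℝ ℝ _).add (contDiff_apply ℝ ℝ _)

theorem isOpen_coneHeight_ne {N : ℕ} : IsOpen {X : Fin (N + 1) ⊕ Unit → ℝ | coneHeight X ≠ 0} :=
  isOpen_ne.preimage contDiff_coneHeight.continuous

theorem contDiffAt_coneChart {N : ℕ} {X : Fin (N + 1) ⊕ Unit → ℝ} (hX : coneHeight X ≠ 0) :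
    ContDiffAt ℝ ∞ coneChart X := by
  rw [contDiffAt_euclidean]
  intro i
  exact (contDiff_apply ℝ ℝ (Sum.inl i.succ)).contDiffAt.div contDiff_coneHeight.contDiffAt hX

theorem contDiffAt_chartLift {N : ℕ} (a : ℕ) {f : EuclideanSpace ℝ (Fin N) → ℂ}
    (hf : ContDiff ℝ ∞ f) {X : Fin (N + 1) ⊕ Unit → ℝ} (hX : coneHeight X ≠ 0) :
    ContDiffAt ℝ ∞ (chartLift a f) X := by
  have h1 : ContDiffAt ℝ ∞ (fun X : Fin (N + 1) ⊕ Unit → ℝ => ((coneHeight X : ℂ) ^ a)⁻¹) X :=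
    ((Complex.ofRealCLM.contDiff.comp contDiff_coneHeight).pow a).contDiffAt.inv
      (pow_ne_zero _ (Complex.ofReal_ne_zero.mpr hX))
  exact h1.mul (hf.contDiffAt.comp X (contDiffAt_coneChart hX))

theorem contDiffOn_chartLift {N : ℕ} (a : ℕ) {f : EuclideanSpace ℝ (Fin N) → ℂ}
    (hf : ContDiff ℝ ∞ f) : ContDiffOn ℝ ∞ (chartLift a f) {X | coneHeight X ≠ 0} :=
  fun _ hX => (contDiffAt_chartLift a hf hX).contDiffWithinAt

theorem contDiff_pderiv {N : ℕ} (i : Fin N) {f : EuclideanSpace ℝ (Fin N) → ℂ}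
    (hf : ContDiff ℝ ∞ f) : ContDiff ℝ ∞ (pderiv i f) :=
  (hf.fderiv_right (m := ∞) (by simp)).clm_apply contDiff_const

theorem contDiff_tangentialLaplacian {m : ℕ} {f : EuclideanSpace ℝ (Fin (m + 1)) → ℂ}
    (hf : ContDiff ℝ ∞ f) : ContDiff ℝ ∞ (tangentialLaplacian f) :=
  ContDiff.sum fun _ _ => contDiff_pderiv _ (contDiff_pderiv _ hf)

theorem partialDeriv_eq_deriv {ι : Type*} [Fintype ι] [DecidableEq ι] {i : ι} {f : (ι → ℝ) → ℂ}
    {x : ι → ℝ} (hf : DifferentiableAt ℝ f x) :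
    partialDeriv i f x = deriv (fun t : ℝ => f (x + t • Pi.single i 1)) 0 :=
  hf.lineDeriv_eq_fderiv.symm

theorem partialDeriv_chartLift {N : ℕ} (a : ℕ) (i : Fin N) {f : EuclideanSpace ℝ (Fin N) → ℂ}
    (hf : ContDiff ℝ ∞ f) {X : Fin (N + 1) ⊕ Unit → ℝ} (hX : coneHeight X ≠ 0) :
    partialDeriv (.inl i.succ) (chartLift a f) X = chartLift (a + 1) (pderiv i f) X := by
  rw [partialDeriv_eq_deriv ((contDiffAt_chartLift a hf hX).differentiableAt (by simp))]
  have h1 : ∀ t : ℝ, coneHeight (X + t • Pi.single (Sum.inl i.succ) 1) = coneHeight X := by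
    intro t
    simp [coneHeight]
  have h2 : ∀ t : ℝ, coneChart (X + t • Pi.single (Sum.inl i.succ) 1) =
      coneChart X + (t * (coneHeight X)⁻¹) • EuclideanSpace.single i 1 := by
    intro t
    ext k
    simp only [coneChart, h1]
    by_cases hk : k = i
    · subst hk; simp; field_simp
    · simp [hk]
  have h3 : (fun t : ℝ => chartLift a f (X + t • Pi.single (Sum.inl i.succ) 1)) =
      fun t => ((coneHeight X : ℂ) ^ a)⁻¹ *
        f (coneChart X + (t * (coneHeight X)⁻¹) • EuclideanSpace.single i 1) := by
    funext t
    rw [chartLift, h1, h2]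
  rw [h3]
  have h4 : HasDerivAt (fun t : ℝ => coneChart X + (t * (coneHeight X)⁻¹) •
      (EuclideanSpace.single i (1 : ℝ))) ((coneHeight X)⁻¹ • EuclideanSpace.single i (1 : ℝ)) 0 := by
    have := (((hasDerivAt_id (0 : ℝ)).mul_const (coneHeight X)⁻¹).smul_const
      (EuclideanSpace.single i (1 : ℝ))).const_add (coneChart X)
    simpa using this
  have h5 : HasFDerivAt f (fderiv ℝ f (coneChart X)) (coneChart X + ((0 : ℝ) * (coneHeight X)⁻¹) •
      (EuclideanSpace.single i (1 : ℝ))) := by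
    rw [zero_mul, zero_smul, add_zero]
    exact (hf.differentiable (by simp) _).hasFDerivAt
  have h6 := (h5.comp_hasDerivAt (0 : ℝ) h4).const_mul ((coneHeight X : ℂ) ^ a)⁻¹
  refine h6.deriv.trans ?_
  rw [map_smul, Complex.real_smul, chartLift, pderiv, pow_succ, mul_inv]
  push_cast
  ring

/-- The direction of the omitted generator of the cone. -/
def axis (N : ℕ) : Fin (N + 1) ⊕ Unit → ℝ := Pi.single (.inl 0) 1 - Pi.single (.inr ()) 1

theorem partialDeriv_translate {ι : Type*} [Fintype ι] [DecidableEq ι] {i : ι} {g : (ι → ℝ) → ℂ}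
    {a : ι → ℝ} (hg : ∀ (t : ℝ) x, g (x + t • a) = g x) (t : ℝ) (x : ι → ℝ) :
    partialDeriv i g (x + t • a) = partialDeriv i g x := by
  have h : g = fun x => g (x + t • a) := funext fun x => (hg t x).symm
  change fderiv ℝ g (x + t • a) _ = fderiv ℝ g x _
  conv_rhs => rw [h, fderiv_comp_add_right]

theorem partialDeriv_zero_eq {N : ℕ} {g : (Fin (N + 1) ⊕ Unit → ℝ) → ℂ}
    (hg : ∀ (t : ℝ) x, g (x + t • axis N) = g x) {x : Fin (N + 1) ⊕ Unit → ℝ}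
    (hd : DifferentiableAt ℝ g x) :
    partialDeriv (.inl 0) g x = partialDeriv (.inr ()) g x := by
  have h1 : fderiv ℝ g x (axis N) = 0 := by
    rw [← hd.lineDeriv_eq_fderiv, lineDeriv]
    simp only [hg, deriv_const]
  rw [axis, map_sub, sub_eq_zero] at h1
  exact h1

theorem chartLift_translate {N : ℕ} (a : ℕ) (f : EuclideanSpace ℝ (Fin N) → ℂ) (t : ℝ)
    (X : Fin (N + 1) ⊕ Unit → ℝ) : chartLift a f (X + t • axis N) = chartLift a f X := by
  have h1 : coneHeight (X + t • axis N) = coneHeight X := by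
    simp [coneHeight, axis]
    ring
  have h2 : coneChart (X + t • axis N) = coneChart X := by
    ext i
    simp only [coneChart, h1]
    simp [axis]
  rw [chartLift, chartLift, h1, h2]

theorem partialDeriv_sq_chartLift {N : ℕ} (a : ℕ) {f : EuclideanSpace ℝ (Fin N) → ℂ}
    (hf : ContDiff ℝ ∞ f) {X : Fin (N + 1) ⊕ Unit → ℝ} (hX : coneHeight X ≠ 0) :
    partialDeriv (.inl 0) (partialDeriv (.inl 0) (chartLift a f)) X =
      partialDeriv (.inr ()) (partialDeriv (.inr ()) (chartLift a f)) X := by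
  have h1 : partialDeriv (.inl 0) (chartLift a f) =ᶠ[nhds X]
      partialDeriv (.inr ()) (chartLift a f) := by
    filter_upwards [isOpen_coneHeight_ne.mem_nhds hX] with Y hY
    exact partialDeriv_zero_eq (chartLift_translate a f)
      ((contDiffAt_chartLift a hf hY).differentiableAt (by simp))
  rw [(partialDeriv_congr (.inl 0) h1).self_of_nhds]
  refine partialDeriv_zero_eq (partialDeriv_translate (chartLift_translate a f)) ?_
  exact ((contDiffOn_partialDeriv _ isOpen_coneHeight_ne
    (contDiffOn_chartLift a hf)).differentiableOn (by simp)).differentiableAt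
      (isOpen_coneHeight_ne.mem_nhds hX)

/-- The lift is constant along the null direction `axis`, so the second derivatives in the
coordinate `0` and in time coincide and cancel. The normal direction has coefficient zero, and each
remaining derivative lowers the degree by one. -/
theorem waveFun_chartLift {m : ℕ} (a : ℕ) {f : EuclideanSpace ℝ (Fin (m + 1)) → ℂ}
    (hf : ContDiff ℝ ∞ f) {X : Fin (m + 2) ⊕ Unit → ℝ} (hX : coneHeight X ≠ 0) :
    waveFun (tanSigns m) (chartLift a f) X = chartLift (a + 2) (tangentialLaplacian f) X := by
  have h1 : ∀ i : Fin (m + 1), partialDeriv (.inl i.succ) (partialDeriv (.inl i.succ)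
      (chartLift a f)) X = chartLift (a + 2) (pderiv i (pderiv i f)) X := by
    intro i
    have h2 : partialDeriv (.inl i.succ) (chartLift a f) =ᶠ[nhds X]
        chartLift (a + 1) (pderiv i f) := by
      filter_upwards [isOpen_coneHeight_ne.mem_nhds hX] with Y hY
      exact partialDeriv_chartLift a i hf hY
    rw [(partialDeriv_congr _ h2).self_of_nhds, partialDeriv_chartLift _ i (contDiff_pderiv i hf) hX]
  have t0 : tanSigns m (.inl 0) = 1 := by
    simp [tanSigns, signs, Fin.ext_iff]
  have t1 : tanSigns m (.inr ()) = -1 := by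
    simp [tanSigns, signs]
  have t2 : tanSigns m (.inl (Fin.last m).succ) = 0 := by
    simp [tanSigns]
  have t3 : ∀ i : Fin m, tanSigns m (.inl i.castSucc.succ) = 1 := by
    intro i
    have : ¬ (i.castSucc.succ = Fin.last (m + 1)) := by
      simp [Fin.ext_iff, i.2.ne]
    simp [tanSigns, signs, this]
  rw [waveFun, Fintype.sum_sum_type, Fin.sum_univ_succ, Fin.sum_univ_castSucc]
  simp only [h1, t0, t2, t3, Finset.univ_unique, PUnit.default_eq_unit, Finset.sum_singleton, t1,
    one_mul, zero_mul, add_zero, partialDeriv_sq_chartLift a hf hX]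
  rw [chartLift, tangentialLaplacian, Finset.mul_sum]
  simp only [chartLift]
  ring

theorem iterate_chartLift {N : ℕ} {S : (EuclideanSpace ℝ (Fin N) → ℂ) → EuclideanSpace ℝ (Fin N) → ℂ}
    {T : ((Fin (N + 1) ⊕ Unit → ℝ) → ℂ) → (Fin (N + 1) ⊕ Unit → ℝ) → ℂ} {r : ℕ}
    (hS : ∀ f, ContDiff ℝ ∞ f → ContDiff ℝ ∞ (S f))
    (hT : ∀ f g X, f =ᶠ[nhds X] g → T f =ᶠ[nhds X] T g)
    (h : ∀ a f X, ContDiff ℝ ∞ f → coneHeight X ≠ 0 → T (chartLift a f) X = chartLift (a + r) (S f) X)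
    (a k : ℕ) {f : EuclideanSpace ℝ (Fin N) → ℂ} (hf : ContDiff ℝ ∞ f)
    {g : (Fin (N + 1) ⊕ Unit → ℝ) → ℂ} (hg : ∀ X, coneHeight X ≠ 0 → g X = chartLift a f X) :
    ContDiff ℝ ∞ (S^[k] f) ∧
      ∀ X, coneHeight X ≠ 0 → T^[k] g X = chartLift (a + k * r) (S^[k] f) X := by
  induction k with
  | zero => exact ⟨hf, by simpa using hg⟩
  | succ k ih =>
    rw [Function.iterate_succ_apply', Function.iterate_succ_apply']
    refine ⟨hS _ ih.1, fun X hX => ?_⟩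
    have h1 : T^[k] g =ᶠ[nhds X] chartLift (a + k * r) (S^[k] f) := by
      filter_upwards [isOpen_coneHeight_ne.mem_nhds hX] with Y hY
      exact ih.2 Y hY
    rw [(hT _ _ X h1).self_of_nhds, h _ _ _ ih.1 hX, Nat.succ_mul, add_assoc]

/-- At height one the combination of normal derivatives is the normal operator in the chart. -/
theorem normalFun_chartLift {m : ℕ} (C : ℕ → ℂ) (j : ℕ) {f : EuclideanSpace ℝ (Fin (m + 1)) → ℂ}
    (hf : ContDiff ℝ ∞ f) {X : Fin (m + 2) ⊕ Unit → ℝ} (hX : coneHeight X = 1)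
    {y : EuclideanSpace ℝ (Fin m)}
    (hy : coneChart X = WithLp.toLp 2 (Fin.snoc (fun i => y i) 0)) :
    normalFun (normalIx m) (tanSigns m) C j (chartLift 0 f) X = normalOperator C j f y := by
  refine Finset.sum_congr rfl fun k _ => ?_
  obtain ⟨h1, h2⟩ := iterate_chartLift (S := tangentialLaplacian) (T := waveFun (tanSigns m)) (r := 2)
    (fun f => contDiff_tangentialLaplacian) (fun f g X => waveFun_congr _)
    (fun a f X hf hX => waveFun_chartLift a hf hX) 0 k hf (fun X _ => rfl)
  obtain ⟨h3, h4⟩ := iterate_chartLift (S := pderiv (Fin.last m)) (T := partialDeriv (normalIx m))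
    (r := 1) (fun f => contDiff_pderiv _) (fun f g X => partialDeriv_congr _)
    (fun a f X hf hX => partialDeriv_chartLift a (Fin.last m) hf hX) (0 + k * 2) (j - 2 * k) h1 h2
  rw [h4 X (by rw [hX]; exact one_ne_zero), chartLift, hX, hy]
  simp

/-- Both sides have degree zero, so it is enough to compare on the sphere, where the chart is
`stereo`; nonzero height excludes the omitted generator. -/
theorem coneExt_eq_chartLift {N : ℕ} (F : SmoothSphere N) {X : Fin (N + 1) ⊕ Unit → ℝ}
    (hX : coneHeight X ≠ 0) (hq : quadForm X = 0) (ht : 0 < X (.inr ())) :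
    coneExt F.1 X = chartLift 0 (noncompact 0 F) X := by
  obtain ⟨u, hu⟩ := exists_eq_smul_conePoint hq ht
  set τ := X (.inr ())
  have h1 : u.1 0 ≠ -1 := by
    intro h0
    apply hX
    rw [hu]
    simp [coneHeight, conePoint, h0]
  have h3 : 1 + u.1 0 ≠ 0 := fun h => h1 (by linarith)
  have h2 : coneChart X = stereo u.1 := by
    ext i
    rw [hu]
    simp only [coneChart, coneHeight, conePoint, stereo, Pi.smul_apply, Sum.elim_inl, Sum.elim_inr,
      smul_eq_mul]
    have h4 : τ * u.1 0 + τ * 1 ≠ 0 := by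
      rw [← mul_add]; exact mul_ne_zero ht.ne' (by rwa [add_comm])
    rw [div_eq_div_iff h4 h3]
    ring
  rw [chartLift, h2, noncompact, cayley_stereo u h1, hu, coneExt_smul_conePoint _ ht]
  simp

theorem noncompact_sphereDiffOp {m j : ℕ} (hm : Odd m) (F : SmoothSphere (m + 1)) :
    noncompact (0 + j) (sphereDiffOp m j F) =
      normalOperator (diffCoeff m j) j (noncompact 0 F) := by
  funext y
  set u := cayley y
  -- This factor moves the cone point above `cayley y` from time one to height one. Its inverse is
  -- the conformal factor, so homogeneity of degree `-j` reproduces the power in `noncompact`.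
  set c : ℝ := (1 + ‖y‖ ^ 2) / 2
  have hc : 0 < c := by have := one_add_norm_sq_pos y; positivity
  have hu0 : 1 + u.1 0 = c⁻¹ := by rw [one_add_cayley_zero, inv_div]
  set X : Fin (m + 2) ⊕ Unit → ℝ := c • spread (conePoint u.1)
  obtain ⟨hq, ht, hs⟩ := spread_conePoint_mem u
  have hX0 : X = spread (c • conePoint u.1) := (spread_smul _ _).symm
  have hXq : quadForm X = 0 := by rw [hX0, quadForm_spread, quadForm_smul_conePoint]
  have hXt : 0 < X (.inr ()) := mul_pos hc ht
  have hXs : X (normalIx m) = 0 := by rw [hX0]; exact spread_last _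
  have hXh : coneHeight X = 1 := by
    have e1 : X (.inl 0) = c * u.1 0 := by
      rw [hX0]; exact spread_castSucc _ (0 : Fin (m + 1))
    have e2 : X (.inr ()) = c * 1 := by rw [hX0, spread_inr]; rfl
    rw [coneHeight, e1, e2, ← mul_add, add_comm, hu0, mul_inv_cancel₀ hc.ne']
  have hXc : coneChart X = WithLp.toLp 2 (Fin.snoc (fun i => y i) 0) := by
    ext i
    refine Fin.lastCases ?_ (fun i => ?_) i
    · simp only [coneChart, hXh, div_one, Fin.snoc_last, Fin.succ_last]
      exact hXs
    · simp only [coneChart, hXh, div_one, Fin.snoc_castSucc, Fin.succ_castSucc]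
      rw [hX0, spread_castSucc]
      change c * u.1 i.succ = y i
      rw [cayley_succ]
      have := (one_add_norm_sq_pos y).ne'
      simp only [c]
      field_simp
  have hf := contDiff_noncompact 0 F
  have e1 := normalFun_eq_of_eqOn_cone (j := j) hm
    (Ω := {X | spacePart X ≠ 0} ∩ {X | coneHeight X ≠ 0})
    (Φ₁ := coneExt F.1) (Φ₂ := chartLift 0 (noncompact 0 F))
    (isOpen_spacePart_ne.inter isOpen_coneHeight_ne)
    ((contDiffOn_coneExt F).mono Set.inter_subset_left)
    ((contDiffOn_chartLift 0 hf).mono Set.inter_subset_right)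
    (isHomogeneousNeg_coneExt _)
    (fun r hr X => by
      have h1 : coneHeight (r • X) = r * coneHeight X := by simp [coneHeight, mul_add]
      have h2 : coneChart (r • X) = coneChart X := by
        ext i
        simp only [coneChart, h1, Pi.smul_apply, smul_eq_mul]
        rw [mul_div_mul_left _ _ hr.ne']
      simp [chartLift, h2])
    (fun X hX hX' hX'' => coneExt_eq_chartLift F hX.2 hX' hX'')
    ⟨spacePart_ne_of_cone hXq hXt, by change coneHeight X ≠ 0; rw [hXh]; exact one_ne_zero⟩ hXq hXt hXs
  rw [← normalFun_chartLift _ _ hf hXh hXc, ← e1]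
  have e2 := (isHomogeneousNeg_coneExt F.1).normalFun (normalIx m) (tanSigns m) (diffCoeff m j) j
    c hc (spread (conePoint u.1))
  rw [noncompact, sphereDiffOp_apply, e2, ← mul_assoc, zero_add, Real.rpow_natCast]
  have e3 : (2 / (1 + ‖y‖ ^ 2)) = c⁻¹ := by rw [inv_div]
  rw [e3, Complex.ofReal_pow, ← mul_pow, ← Complex.ofReal_mul, inv_mul_cancel₀ hc.ne']
  simp [X]

theorem isIntertwiningDiffOp_sphereDiffOp {m : ℕ} (hm : Odd m) (j : ℕ) :
    IsIntertwiningDiffOp m 0 j (sphereDiffOp m j) where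
  expression := ⟨diffCoeff m j, rfl, noncompact_sphereDiffOp hm⟩
  intertwines := sphereDiffOp_principalSeries hm

/-! ### Splitting off the normal coordinate -/

/-- The measurable equivalence `ℝ^m × ℝ ≃ ℝ^(m+1)`. -/
noncomputable def splitEquiv (m : ℕ) :
    EuclideanSpace ℝ (Fin m) × ℝ ≃ᵐ EuclideanSpace ℝ (Fin (m + 1)) :=
  (((MeasurableEquiv.prodCongr (MeasurableEquiv.toLp 2 (Fin m → ℝ)).symm
    (MeasurableEquiv.refl ℝ)).trans MeasurableEquiv.prodComm).trans
    (MeasurableEquiv.piFinSuccAbove (fun _ => ℝ) (Fin.last m)).symm).trans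
    (MeasurableEquiv.toLp 2 (Fin (m + 1) → ℝ))

theorem splitEquiv_apply {m : ℕ} (p : EuclideanSpace ℝ (Fin m) × ℝ) :
    splitEquiv m p = WithLp.toLp 2 (Fin.snoc (fun i => p.1 i) p.2) := by
  have h : splitEquiv m p = WithLp.toLp 2 (Fin.insertNth (Fin.last m) p.2 (fun i => p.1 i)) := rfl
  rw [h, Fin.insertNth_last']

theorem measurePreserving_splitEquiv (m : ℕ) :
    MeasurePreserving (splitEquiv m) (volume.prod volume) volume :=
  ((((EuclideanSpace.volume_preserving_symm_measurableEquiv_toLp (Fin m)).prod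
    (MeasurePreserving.id volume)).trans Measure.measurePreserving_swap).trans
    (volume_preserving_piFinSuccAbove (fun _ => ℝ) (Fin.last m)).symm).trans
    (PiLp.volume_preserving_toLp (Fin (m + 1)))

/-- The first `m` coordinates. -/
noncomputable def tangentPart {m : ℕ} (ξ : EuclideanSpace ℝ (Fin (m + 1))) :
    EuclideanSpace ℝ (Fin m) := WithLp.toLp 2 fun i => ξ i.castSucc

theorem splitEquiv_last {m : ℕ} (p : EuclideanSpace ℝ (Fin m) × ℝ) :
    splitEquiv m p (Fin.last m) = p.2 := by
  rw [splitEquiv_apply]; simp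

theorem splitEquiv_castSucc {m : ℕ} (p : EuclideanSpace ℝ (Fin m) × ℝ) (i : Fin m) :
    splitEquiv m p i.castSucc = p.1 i := by
  rw [splitEquiv_apply]; simp

theorem tangentPart_splitEquiv {m : ℕ} (p : EuclideanSpace ℝ (Fin m) × ℝ) :
    tangentPart (splitEquiv m p) = p.1 := by
  ext i
  exact splitEquiv_castSucc p i

theorem norm_sq_splitEquiv {m : ℕ} (p : EuclideanSpace ℝ (Fin m) × ℝ) :
    ‖splitEquiv m p‖ ^ 2 = ‖p.1‖ ^ 2 + p.2 ^ 2 := by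
  rw [EuclideanSpace.norm_sq_eq, EuclideanSpace.norm_sq_eq, Fin.sum_univ_castSucc]
  simp only [splitEquiv_last, splitEquiv_castSucc, Real.norm_eq_abs, sq_abs]

theorem lintegral_splitEquiv {m : ℕ} {f : EuclideanSpace ℝ (Fin (m + 1)) → ENNReal}
    (hf : AEMeasurable f) :
    ∫⁻ ξ, f ξ = ∫⁻ η : EuclideanSpace ℝ (Fin m), ∫⁻ t : ℝ, f (splitEquiv m (η, t)) := by
  have h := measurePreserving_splitEquiv m
  rw [← h.lintegral_comp_emb (splitEquiv m).measurableEmbedding]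
  exact lintegral_prod _ (hf.comp_quasiMeasurePreserving h.quasiMeasurePreserving)

theorem quasiMeasurePreserving_tangentPart (m : ℕ) :
    Measure.QuasiMeasurePreserving (tangentPart (m := m)) volume volume := by
  have h1 := (measurePreserving_splitEquiv m).symm.quasiMeasurePreserving
  have h2 : Measure.QuasiMeasurePreserving (Prod.fst : EuclideanSpace ℝ (Fin m) × ℝ → _)
      (volume.prod volume) volume := Measure.quasiMeasurePreserving_fst
  have h3 := h2.comp h1
  have h4 : tangentPart (m := m) = Prod.fst ∘ (splitEquiv m).symm := by
    funext ξ
    have := tangentPart_splitEquiv ((splitEquiv m).symm ξ)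
    rwa [MeasurableEquiv.apply_symm_apply] at this
  rw [h4]
  exact h3

/-! ### The symbol of the differential operator -/

/-- The symbol of the operator, as a function of the norm of the tangential and of the normal
coordinate. -/
noncomputable def radialSymbol (C : ℕ → ℂ) (j : ℕ) (r t : ℝ) : ℂ :=
  ∑ k ∈ Finset.range (j / 2 + 1),
    C k * ((2 * Real.pi * Complex.I * t) ^ (j - 2 * k) * (-(4 * Real.pi ^ 2 * r ^ 2)) ^ k)

theorem radialSymbol_mul (C : ℕ → ℂ) (j : ℕ) (r s : ℝ) :
    radialSymbol C j r (r * s) = (r : ℂ) ^ j * radialSymbol C j 1 s := by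
  rw [radialSymbol, radialSymbol, Finset.mul_sum]
  refine Finset.sum_congr rfl fun k hk => ?_
  have h1 : (r : ℂ) ^ j = r ^ (j - 2 * k) * (r ^ 2) ^ k := by
    rw [← pow_mul, ← pow_add]
    congr 1
    have := Finset.mem_range.mp hk
    omega
  rw [h1, Complex.ofReal_mul, show (2 * Real.pi * Complex.I * ((r : ℂ) * s)) =
    r * (2 * Real.pi * Complex.I * s) by ring, mul_pow,
    show (-(4 * (Real.pi : ℂ) ^ 2 * (r : ℂ) ^ 2)) = r ^ 2 * (-(4 * Real.pi ^ 2 * ((1 : ℝ) : ℂ) ^ 2)) by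
      push_cast; ring, mul_pow]
  ring

theorem continuous_radialSymbol {X : Type*} [TopologicalSpace X] (C : ℕ → ℂ) (j : ℕ) {f g : X → ℝ}
    (hf : Continuous f) (hg : Continuous g) : Continuous fun x => radialSymbol C j (f x) (g x) := by
  unfold radialSymbol
  fun_prop

theorem exists_norm_radialSymbol_le (C : ℕ → ℂ) (j : ℕ) :
    ∃ K : ℝ, 0 ≤ K ∧ ∀ s : ℝ, ‖radialSymbol C j 1 s‖ ^ 2 ≤ K * (1 + s ^ 2) ^ (j : ℝ) := by
  set K₀ : ℝ := ∑ k ∈ Finset.range (j / 2 + 1),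
    ‖C k‖ * ((2 * Real.pi) ^ (j - 2 * k) * (4 * Real.pi ^ 2) ^ k)
  refine ⟨K₀ ^ 2, by positivity, fun s => ?_⟩
  set w := Real.sqrt (1 + s ^ 2)
  have hw2 : w ^ 2 = 1 + s ^ 2 := Real.sq_sqrt (by positivity)
  have hw1 : 1 ≤ w := Real.one_le_sqrt.mpr (by nlinarith [sq_nonneg s])
  have hws : |s| ≤ w := Real.abs_le_sqrt (by linarith)
  have h1 : ‖radialSymbol C j 1 s‖ ≤ K₀ * w ^ j := by
    rw [radialSymbol, Finset.sum_mul]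
    refine (norm_sum_le _ _).trans (Finset.sum_le_sum fun k _ => ?_)
    rw [norm_mul, norm_mul, norm_pow, norm_pow, norm_neg]
    have e1 : ‖(2 * Real.pi * Complex.I * s : ℂ)‖ = 2 * Real.pi * |s| := by
      simp [Real.pi_pos.le]
    have e2 : ‖(4 * Real.pi ^ 2 * ((1 : ℝ) : ℂ) ^ 2 : ℂ)‖ = 4 * Real.pi ^ 2 := by
      simp
    rw [e1, e2, mul_pow, mul_assoc ‖C k‖]
    refine mul_le_mul_of_nonneg_left ?_ (norm_nonneg (C k))
    have e3 : |s| ^ (j - 2 * k) ≤ w ^ j :=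
      (pow_le_pow_left₀ (abs_nonneg s) hws _).trans (pow_le_pow_right₀ hw1 (by omega))
    calc (2 * Real.pi) ^ (j - 2 * k) * |s| ^ (j - 2 * k) * (4 * Real.pi ^ 2) ^ k
        = (2 * Real.pi) ^ (j - 2 * k) * (4 * Real.pi ^ 2) ^ k * |s| ^ (j - 2 * k) := by ring
      _ ≤ _ := mul_le_mul_of_nonneg_left e3 (by positivity)
  calc ‖radialSymbol C j 1 s‖ ^ 2 ≤ (K₀ * w ^ j) ^ 2 := pow_le_pow_left₀ (norm_nonneg _) h1 2
    _ = K₀ ^ 2 * (1 + s ^ 2) ^ (j : ℝ) := by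
      rw [Real.rpow_natCast, ← hw2]; ring

theorem measurable_radialSymbol (C : ℕ → ℂ) (j : ℕ) (r a : ℝ) :
    Measurable fun t : ℝ => ‖radialSymbol C j r t‖ₑ ^ 2 * ENNReal.ofReal ((r ^ 2 + t ^ 2) ^ a) := by
  have hc : Continuous fun t : ℝ => radialSymbol C j r t :=
    continuous_radialSymbol C j continuous_const continuous_id
  have h1 : Measurable fun t : ℝ => ‖radialSymbol C j r t‖ₑ ^ 2 := hc.measurable.enorm.pow_const 2
  have h2 : Measurable fun t : ℝ => (r ^ 2 + t ^ 2) ^ a := by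
    have : Measurable fun t : ℝ => r ^ 2 + t ^ 2 := by fun_prop
    exact this.pow_const a
  exact h1.mul h2.ennreal_ofReal

/-- The integral of the squared symbol along a normal line. -/
noncomputable def symbolMass (m : ℕ) (C : ℕ → ℂ) (j : ℕ) : ENNReal :=
  ∫⁻ s : ℝ, ‖radialSymbol C j 1 s‖ₑ ^ 2 * ENNReal.ofReal ((1 + s ^ 2) ^ (-((m : ℝ) + 1) / 2))

/-- The integrand is `O((1 + s²)^(j - (m+1)/2))`, integrable on the line because `2j < m`. This is
the analytic meaning of the bound on `j`. -/
theorem symbolMass_lt_top {m : ℕ} (C : ℕ → ℂ) {j : ℕ} (hj : 2 * j < m) : symbolMass m C j < ⊤ := by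
  obtain ⟨K, hK, hb⟩ := exists_norm_radialSymbol_le C j
  have hj' : 2 * (j : ℝ) < m := by exact_mod_cast hj
  have h1 : Integrable fun s : ℝ => K * (1 + ‖s‖ ^ 2) ^ (-((m : ℝ) + 1 - 2 * j) / 2) :=
    (integrable_rpow_neg_one_add_norm_sq (by simp; linarith)).const_mul K
  refine lt_of_le_of_lt (lintegral_mono fun s => ?_) h1.lintegral_lt_top
  have hs : 0 < 1 + s ^ 2 := by positivity
  rw [← ofReal_norm, ← ENNReal.ofReal_pow (norm_nonneg _), ← ENNReal.ofReal_mul (by positivity)]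
  refine ENNReal.ofReal_le_ofReal ?_
  rw [Real.norm_eq_abs, sq_abs]
  refine (mul_le_mul_of_nonneg_right (hb s) (by positivity)).trans (le_of_eq ?_)
  rw [mul_assoc, ← Real.rpow_add hs]
  congr 2
  ring

/-- On the line the symbol is a polynomial with leading coefficient `(2πi)^j`, because `C 0 = 1`. -/
theorem symbolMass_ne_zero (m : ℕ) {C : ℕ → ℂ} (hC : C 0 = 1) (j : ℕ) : symbolMass m C j ≠ 0 := by
  intro h0
  have hc : Continuous fun s : ℝ => radialSymbol C j 1 s :=
    continuous_radialSymbol C j continuous_const continuous_id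
  have hmeas := measurable_radialSymbol C j 1 (-((m : ℝ) + 1) / 2)
  rw [one_pow] at hmeas
  rw [symbolMass, lintegral_eq_zero_iff hmeas] at h0
  have h1 : (fun s : ℝ => radialSymbol C j 1 s) =ᵐ[volume] fun _ => 0 := by
    filter_upwards [h0] with s hs
    have h2 : 0 < (1 + s ^ 2) ^ (-((m : ℝ) + 1) / 2) := by positivity
    have h3 := (mul_eq_zero.mp hs).resolve_right (ENNReal.ofReal_pos.mpr h2).ne'
    simpa using h3
  have h2 := (hc.ae_eq_iff_eq volume continuous_const).mp h1
  set p : Polynomial ℂ := ∑ k ∈ Finset.range (j / 2 + 1),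
    Polynomial.C (C k * ((2 * Real.pi * Complex.I) ^ (j - 2 * k) * (-(4 * Real.pi ^ 2)) ^ k)) *
      Polynomial.X ^ (j - 2 * k)
  have h3 : ∀ s : ℝ, p.eval (s : ℂ) = 0 := by
    intro s
    rw [← congrFun h2 s, radialSymbol, Polynomial.eval_finsetSum]
    refine Finset.sum_congr rfl fun k _ => ?_
    simp only [Polynomial.eval_mul, Polynomial.eval_C, Polynomial.eval_pow, Polynomial.eval_X]
    push_cast
    rw [mul_pow _ (s : ℂ)]
    ring
  have h4 : p = 0 := by
    refine Polynomial.eq_zero_of_infinite_isRoot p ?_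
    refine (Set.infinite_range_of_injective Complex.ofReal_injective).mono ?_
    rintro _ ⟨s, rfl⟩
    exact h3 s
  have h5 : p.coeff j = (2 * Real.pi * Complex.I) ^ j := by
    rw [Polynomial.finsetSum_coeff, Finset.sum_eq_single 0]
    · rw [Polynomial.coeff_C_mul_X_pow, if_pos (by simp), hC]
      simp
    · intro k hk hk0
      rw [Polynomial.coeff_C_mul_X_pow, if_neg]
      have := Finset.mem_range.mp hk
      omega
    · simp
  rw [h4, Polynomial.coeff_zero] at h5
  have h6 : (2 * Real.pi * Complex.I : ℂ) ≠ 0 := by simp [Real.pi_ne_zero]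
  exact pow_ne_zero j h6 h5.symm

/-- Substitute `t = r s`. The Jacobian, the squared symbol and the weight contribute the exponents
`1`, `2j` and `-(m+1)`, with sum `-(m - 2j)`. -/
theorem lintegral_radialSymbol (m : ℕ) (C : ℕ → ℂ) (j : ℕ) {r : ℝ} (hr : 0 < r) :
    ∫⁻ t : ℝ, ‖radialSymbol C j r t‖ₑ ^ 2 *
        ENNReal.ofReal ((r ^ 2 + t ^ 2) ^ (-((m : ℝ) + 1) / 2)) =
      ENNReal.ofReal (r ^ (-((m : ℝ) - 2 * j))) * symbolMass m C j := by
  have hmeas := measurable_radialSymbol C j r (-((m : ℝ) + 1) / 2)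
  have h1 := Real.smul_map_volume_mul_left hr.ne'
  conv_lhs => rw [← h1]
  rw [lintegral_smul_measure, lintegral_map hmeas (by fun_prop), abs_of_pos hr, smul_eq_mul,
    symbolMass, ← lintegral_const_mul' _ _ ENNReal.ofReal_ne_top,
    ← lintegral_const_mul' _ _ ENNReal.ofReal_ne_top]
  refine lintegral_congr fun s => ?_
  have hs : 0 < 1 + s ^ 2 := by positivity
  rw [radialSymbol_mul, show r ^ 2 + (r * s) ^ 2 = r ^ 2 * (1 + s ^ 2) by ring,
    Real.mul_rpow (by positivity) hs.le, ← ofReal_norm, ← ofReal_norm,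
    ← ENNReal.ofReal_pow (norm_nonneg _), ← ENNReal.ofReal_pow (norm_nonneg _),
    ← ENNReal.ofReal_mul (by positivity), ← ENNReal.ofReal_mul (by positivity),
    ← ENNReal.ofReal_mul (by positivity), ← ENNReal.ofReal_mul (by positivity)]
  congr 1
  rw [norm_mul, mul_pow, norm_pow, Complex.norm_real, Real.norm_of_nonneg hr.le]
  have e1 : (r ^ 2) ^ (-((m : ℝ) + 1) / 2) = r ^ (-((m : ℝ) + 1)) := by
    rw [← Real.rpow_natCast, ← Real.rpow_mul hr.le]
    congr 1
    push_cast; ring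
  have e2 : r * ((r ^ j) ^ 2 * r ^ (-((m : ℝ) + 1))) = r ^ (-((m : ℝ) - 2 * j)) := by
    rw [← pow_mul, ← Real.rpow_natCast, ← Real.rpow_add hr]
    nth_rewrite 1 [← Real.rpow_one r]
    rw [← Real.rpow_add hr]
    congr 1
    push_cast; ring
  rw [e1, ← e2]
  ring

/-- The conjugate symbol times a function of the tangential variables. -/
noncomputable def symbolMul {m : ℕ} (C : ℕ → ℂ) (j : ℕ) (φ : EuclideanSpace ℝ (Fin m) → ℂ)
    (ξ : EuclideanSpace ℝ (Fin (m + 1))) : ℂ :=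
  (starRingEnd ℂ) (radialSymbol C j ‖tangentPart ξ‖ (ξ (Fin.last m))) * φ (tangentPart ξ)

theorem continuous_tangentPart {m : ℕ} : Continuous (tangentPart (m := m)) := by
  unfold tangentPart; fun_prop

theorem aestronglyMeasurable_symbolMul {m : ℕ} (C : ℕ → ℂ) (j : ℕ)
    {φ : EuclideanSpace ℝ (Fin m) → ℂ} (hφ : AEStronglyMeasurable φ volume) :
    AEStronglyMeasurable (symbolMul C j φ) volume := by
  refine AEStronglyMeasurable.mul ?_
    (hφ.comp_quasiMeasurePreserving (quasiMeasurePreserving_tangentPart m))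
  exact (Complex.continuous_conj.comp (continuous_radialSymbol C j continuous_tangentPart.norm
    (by fun_prop : Continuous fun ξ : EuclideanSpace ℝ (Fin (m + 1)) =>
      ξ (Fin.last m)))).aestronglyMeasurable

/-- Integrating first along the normal lines turns the dual weight of `W_0` into that of `C_j`, up
to a constant. -/
theorem dualEnergy_symbolMul {m : ℕ} (hm : 1 ≤ m) (C : ℕ → ℂ) (j : ℕ)
    {φ : EuclideanSpace ℝ (Fin m) → ℂ} (hφ : AEStronglyMeasurable φ volume) :
    dualEnergy 0 (symbolMul C j φ) = symbolMass m C j * dualEnergy (j : ℝ) φ := by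
  rw [dualEnergy, lintegral_splitEquiv (by
    refine ((aestronglyMeasurable_symbolMul C j hφ).enorm.pow_const 2).mul ?_
    fun_prop), dualEnergy, ← lintegral_const_mul'' _ (by
      refine (hφ.enorm.pow_const 2).mul ?_
      fun_prop)]
  refine lintegral_congr_ae ?_
  filter_upwards [ae_ne_zero hm] with η hη
  have hr : 0 < ‖η‖ := norm_pos_iff.mpr hη
  have h1 : ∀ t : ℝ, ‖symbolMul C j φ (splitEquiv m (η, t))‖ₑ ^ 2 *
      ENNReal.ofReal (‖splitEquiv m (η, t)‖ ^ (-(((m + 1 : ℕ) : ℝ) - 2 * 0))) =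
      ‖φ η‖ₑ ^ 2 * (‖radialSymbol C j ‖η‖ t‖ₑ ^ 2 *
        ENNReal.ofReal ((‖η‖ ^ 2 + t ^ 2) ^ (-((m : ℝ) + 1) / 2))) := by
    intro t
    have e1 : ‖splitEquiv m (η, t)‖ ^ (-(((m + 1 : ℕ) : ℝ) - 2 * 0)) =
        (‖η‖ ^ 2 + t ^ 2) ^ (-((m : ℝ) + 1) / 2) := by
      rw [← norm_sq_splitEquiv (η, t), ← Real.rpow_natCast _ 2, ← Real.rpow_mul (norm_nonneg _)]
      congr 1
      push_cast; ring
    rw [e1, symbolMul, tangentPart_splitEquiv, splitEquiv_last, enorm_mul, mul_pow,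
      ← ofReal_norm ((starRingEnd ℂ) _), RCLike.norm_conj, ofReal_norm]
    ring
  simp only [h1]
  rw [lintegral_const_mul' _ _ (by simp), lintegral_radialSymbol m C j hr]
  ring

/-! ### The isometry defined by the symbol -/

theorem dualElt_congr {N : ℕ} {μ : ℝ} {φ ψ : EuclideanSpace ℝ (Fin N) → ℂ}
    (h : φ =ᵐ[volume] ψ) : dualElt μ φ = dualElt μ ψ := by
  have h1 : dualFun μ φ =ᵐ[weightMeasure N μ] dualFun μ ψ := by
    refine (weight_absolutelyContinuous N μ).ae_eq ?_
    filter_upwards [h] with ξ hξ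
    rw [dualFun, dualFun, hξ]
  by_cases hφ : MemLp (dualFun μ φ) 2 (weightMeasure N μ)
  · have hψ := hφ.ae_eq h1
    rw [dualElt, dualElt, dif_pos hφ, dif_pos hψ]
    exact MemLp.toLp_congr hφ hψ h1
  · have hψ : ¬ MemLp (dualFun μ ψ) 2 (weightMeasure N μ) := fun hψ => hφ (hψ.ae_eq h1.symm)
    rw [dualElt, dualElt, dif_neg hφ, dif_neg hψ]

/-- The density which an element of the weighted space represents. -/
noncomputable def weightFun {N : ℕ} (μ : ℝ) (h : WeightedL2 N μ) (ξ : EuclideanSpace ℝ (Fin N)) : ℂ :=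
  ((‖ξ‖ ^ ((N : ℝ) - 2 * μ) : ℝ) : ℂ) * h ξ

theorem aestronglyMeasurable_weightFun {N : ℕ} (hN : 1 ≤ N) {μ : ℝ} (h : WeightedL2 N μ) :
    AEStronglyMeasurable (weightFun μ h) volume := by
  refine AEStronglyMeasurable.mul ?_
    ((Lp.aestronglyMeasurable h).mono_ac (volume_absolutelyContinuous_weight hN μ))
  exact (by fun_prop : Measurable fun ξ : EuclideanSpace ℝ (Fin N) =>
    ((‖ξ‖ ^ ((N : ℝ) - 2 * μ) : ℝ) : ℂ)).aestronglyMeasurable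

theorem dualFun_weightFun {N : ℕ} (hN : 1 ≤ N) {μ : ℝ} (h : WeightedL2 N μ) :
    dualFun μ (weightFun μ h) =ᵐ[volume] h := by
  filter_upwards [ae_ne_zero hN] with ξ hξ
  have h0 : 0 < ‖ξ‖ := norm_pos_iff.mpr hξ
  rw [dualFun, weightFun, ← mul_assoc, ← Complex.ofReal_mul, ← Real.rpow_add h0, neg_add_cancel,
    Real.rpow_zero, Complex.ofReal_one, one_mul]

theorem dualEnergy_weightFun {N : ℕ} (hN : 1 ≤ N) {μ : ℝ} (h : WeightedL2 N μ) :
    dualEnergy μ (weightFun μ h) = ‖h‖ₑ ^ 2 := by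
  rw [← eLpNorm_sq_weight hN μ (aestronglyMeasurable_weightFun hN h),
    eLpNorm_congr_ae ((weight_absolutelyContinuous N μ).ae_eq (dualFun_weightFun hN h)), ← Lp.enorm_def]

theorem weightFun_dualElt {N : ℕ} (hN : 1 ≤ N) {μ : ℝ} {φ : EuclideanSpace ℝ (Fin N) → ℂ}
    (hφ : AEStronglyMeasurable φ volume) (hE : dualEnergy μ φ < ⊤) :
    weightFun μ (dualElt μ φ) =ᵐ[volume] φ := by
  filter_upwards [ae_ne_zero hN, coeFn_dualElt hN hφ hE] with ξ hξ h1
  have h0 : 0 < ‖ξ‖ := norm_pos_iff.mpr hξ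
  rw [weightFun, h1, dualFun, ← mul_assoc, ← Complex.ofReal_mul, ← Real.rpow_add h0, add_neg_cancel,
    Real.rpow_zero, Complex.ofReal_one, one_mul]

theorem weightFun_add {N : ℕ} (hN : 1 ≤ N) {μ : ℝ} (h k : WeightedL2 N μ) :
    weightFun μ (h + k) =ᵐ[volume] weightFun μ h + weightFun μ k := by
  filter_upwards [(volume_absolutelyContinuous_weight hN μ).ae_eq (Lp.coeFn_add h k)] with ξ h1
  rw [Pi.add_apply, weightFun, weightFun, weightFun, h1, Pi.add_apply, mul_add]

theorem weightFun_smul {N : ℕ} (hN : 1 ≤ N) {μ : ℝ} (c : ℂ) (h : WeightedL2 N μ) :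
    weightFun μ (c • h) =ᵐ[volume] c • weightFun μ h := by
  filter_upwards [(volume_absolutelyContinuous_weight hN μ).ae_eq (Lp.coeFn_smul c h)] with ξ h1
  rw [Pi.smul_apply, weightFun, weightFun, h1, Pi.smul_apply, smul_eq_mul, smul_eq_mul,
    mul_left_comm]

theorem symbolMul_congr {m : ℕ} (C : ℕ → ℂ) (j : ℕ) {φ ψ : EuclideanSpace ℝ (Fin m) → ℂ}
    (h : φ =ᵐ[volume] ψ) : symbolMul C j φ =ᵐ[volume] symbolMul C j ψ := by
  filter_upwards [(quasiMeasurePreserving_tangentPart m).ae_eq_comp h] with ξ hξ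
  simp only [Function.comp_apply] at hξ
  rw [symbolMul, symbolMul, hξ]

theorem dualEnergy_symbolMul_weightFun {m : ℕ} (hm : 1 ≤ m) (C : ℕ → ℂ) {j : ℕ}
    (h : WeightedL2 m (j : ℝ)) :
    dualEnergy 0 (symbolMul C j (weightFun (j : ℝ) h)) = symbolMass m C j * ‖h‖ₑ ^ 2 := by
  rw [dualEnergy_symbolMul hm C j (aestronglyMeasurable_weightFun hm h), dualEnergy_weightFun hm]

theorem dualEnergy_symbolMul_weightFun_lt_top {m : ℕ} (hm : 1 ≤ m) (C : ℕ → ℂ) {j : ℕ}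
    (hj : 2 * j < m) (h : WeightedL2 m (j : ℝ)) :
    dualEnergy 0 (symbolMul C j (weightFun (j : ℝ) h)) < ⊤ := by
  rw [dualEnergy_symbolMul_weightFun hm]
  exact ENNReal.mul_lt_top (symbolMass_lt_top C hj) (ENNReal.pow_lt_top enorm_lt_top)

/-- The adjoint of the differential operator, before normalization. -/
noncomputable def symbolMap {m : ℕ} (hm : 1 ≤ m) (C : ℕ → ℂ) {j : ℕ} (hj : 2 * j < m) :
    WeightedL2 m (j : ℝ) →ₗ[ℂ] WeightedL2 (m + 1) 0 where
  toFun h := dualElt 0 (symbolMul C j (weightFun (j : ℝ) h))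
  map_add' h k := by
    rw [dualElt_congr (symbolMul_congr C j (weightFun_add hm h k)), ← dualElt_add (by omega)
      (aestronglyMeasurable_symbolMul C j (aestronglyMeasurable_weightFun hm h))
      (aestronglyMeasurable_symbolMul C j (aestronglyMeasurable_weightFun hm k))
      (dualEnergy_symbolMul_weightFun_lt_top hm C hj h)
      (dualEnergy_symbolMul_weightFun_lt_top hm C hj k)]
    congr 1
    funext ξ
    exact mul_add _ _ _
  map_smul' c h := by
    rw [dualElt_congr (symbolMul_congr C j (weightFun_smul hm c h)), RingHom.id_apply,
      ← dualElt_smul (by omega)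
      (aestronglyMeasurable_symbolMul C j (aestronglyMeasurable_weightFun hm h))
      (dualEnergy_symbolMul_weightFun_lt_top hm C hj h)]
    congr 1
    funext ξ
    exact mul_left_comm _ _ _

theorem norm_symbolMap {m : ℕ} (hm : 1 ≤ m) (C : ℕ → ℂ) {j : ℕ} (hj : 2 * j < m)
    (h : WeightedL2 m (j : ℝ)) :
    ‖symbolMap hm C hj h‖ = Real.sqrt (symbolMass m C j).toReal * ‖h‖ := by
  have h1 : ‖symbolMap hm C hj h‖ ^ 2 = (symbolMass m C j).toReal * ‖h‖ ^ 2 := by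
    refine (norm_dualElt_sq (by omega)
      (aestronglyMeasurable_symbolMul C j (aestronglyMeasurable_weightFun hm h))
      (dualEnergy_symbolMul_weightFun_lt_top hm C hj h)).trans ?_
    rw [dualEnergy_symbolMul_weightFun hm, ENNReal.toReal_mul, ENNReal.toReal_pow, toReal_enorm]
  rw [← Real.sqrt_sq (norm_nonneg (symbolMap hm C hj h)), h1, Real.sqrt_mul ENNReal.toReal_nonneg,
    Real.sqrt_sq (norm_nonneg _)]

theorem sqrt_symbolMass_pos {m : ℕ} {C : ℕ → ℂ} (hC : C 0 = 1) {j : ℕ} (hj : 2 * j < m) :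
    0 < Real.sqrt (symbolMass m C j).toReal :=
  Real.sqrt_pos.mpr (ENNReal.toReal_pos (symbolMass_ne_zero m hC j) (symbolMass_lt_top C hj).ne)

/-- The normalized isometry. -/
noncomputable def symbolIsometry {m : ℕ} (hm : 1 ≤ m) {C : ℕ → ℂ} (hC : C 0 = 1) {j : ℕ}
    (hj : 2 * j < m) : WeightedL2 m (j : ℝ) →ₗᵢ[ℂ] WeightedL2 (m + 1) 0 where
  toLinearMap := ((Real.sqrt (symbolMass m C j).toReal : ℂ)⁻¹) • symbolMap hm C hj
  norm_map' h := by
    have h0 := sqrt_symbolMass_pos hC hj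
    rw [LinearMap.smul_apply, norm_smul, norm_symbolMap, norm_inv, Complex.norm_real,
      Real.norm_of_nonneg h0.le, inv_mul_cancel_left₀ h0.ne']

/-- The bounded operator which extends the differential operator. -/
noncomputable def symbolAdjoint {m : ℕ} (hm : 1 ≤ m) {C : ℕ → ℂ} (hC : C 0 = 1) {j : ℕ}
    (hj : 2 * j < m) : WeightedL2 (m + 1) 0 →L[ℂ] WeightedL2 m (j : ℝ) :=
  (Real.sqrt (symbolMass m C j).toReal : ℂ) •
    ContinuousLinearMap.adjoint (symbolIsometry hm hC hj).toContinuousLinearMap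

theorem symbolAdjoint_symbolIsometry {m : ℕ} (hm : 1 ≤ m) {C : ℕ → ℂ} (hC : C 0 = 1) {j : ℕ}
    (hj : 2 * j < m) (h : WeightedL2 m (j : ℝ)) :
    symbolAdjoint hm hC hj (symbolIsometry hm hC hj h) =
      (Real.sqrt (symbolMass m C j).toReal : ℂ) • h := by
  have h1 := (ContinuousLinearMap.norm_map_iff_adjoint_comp_self
    (symbolIsometry hm hC hj).toContinuousLinearMap).mp (symbolIsometry hm hC hj).norm_map
  exact congrArg (fun k => (Real.sqrt (symbolMass m C j).toReal : ℂ) • k) (DFunLike.congr_fun h1 h)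

/-- The adjoint of an isometry is a left inverse of it, and the scalar is nonzero. -/
theorem surjective_symbolAdjoint {m : ℕ} (hm : 1 ≤ m) {C : ℕ → ℂ} (hC : C 0 = 1) {j : ℕ}
    (hj : 2 * j < m) : Function.Surjective (symbolAdjoint hm hC hj) := by
  intro h
  have h0 : (Real.sqrt (symbolMass m C j).toReal : ℂ) ≠ 0 :=
    Complex.ofReal_ne_zero.mpr (sqrt_symbolMass_pos hC hj).ne'
  refine ⟨symbolIsometry hm hC hj ((Real.sqrt (symbolMass m C j).toReal : ℂ)⁻¹ • h), ?_⟩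
  rw [symbolAdjoint_symbolIsometry, smul_inv_smul₀ h0]

theorem inner_symbolAdjoint {m : ℕ} (hm : 1 ≤ m) {C : ℕ → ℂ} (hC : C 0 = 1) {j : ℕ}
    (hj : 2 * j < m) (h : WeightedL2 m (j : ℝ)) (g : WeightedL2 (m + 1) 0) :
    inner ℂ h (symbolAdjoint hm hC hj g) = inner ℂ (symbolMap hm C hj h) g := by
  have h0 : (Real.sqrt (symbolMass m C j).toReal : ℂ) ≠ 0 :=
    Complex.ofReal_ne_zero.mpr (sqrt_symbolMass_pos hC hj).ne'
  have h1 : symbolMap hm C hj h =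
      (Real.sqrt (symbolMass m C j).toReal : ℂ) • symbolIsometry hm hC hj h :=
    (smul_inv_smul₀ h0 _).symm
  rw [h1, inner_smul_left, Complex.conj_ofReal]
  change inner ℂ h ((Real.sqrt (symbolMass m C j).toReal : ℂ) •
    ContinuousLinearMap.adjoint (symbolIsometry hm hC hj).toContinuousLinearMap g) = _
  rw [inner_smul_right, ContinuousLinearMap.adjoint_inner_right]
  rfl

/-- The pairing of the extended operator with a test function. -/
theorem integral_symbolAdjoint {m : ℕ} (hm : 1 ≤ m) {C : ℕ → ℂ} (hC : C 0 = 1) {j : ℕ}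
    (hj : 2 * j < m) (g : WeightedL2 (m + 1) 0) {φ : 𝓢(EuclideanSpace ℝ (Fin m), ℂ)}
    (h0 : (0 : EuclideanSpace ℝ (Fin m)) ∉ tsupport φ) :
    let p := fun ξ : EuclideanSpace ℝ (Fin (m + 1)) =>
      radialSymbol C j ‖tangentPart ξ‖ (ξ (Fin.last m)) * φ (tangentPart ξ) * g ξ
    Integrable p ∧ ∫ η, symbolAdjoint hm hC hj g η * φ η = ∫ ξ, p ξ := by
  intro p
  set φ' : EuclideanSpace ℝ (Fin m) → ℂ := fun η => (starRingEnd ℂ) (φ η)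
  have hφ' : AEStronglyMeasurable φ' volume :=
    (Complex.continuous_conj.comp φ.continuous).aestronglyMeasurable
  have hE : dualEnergy (j : ℝ) φ' < ⊤ := by
    have h1 : dualEnergy (j : ℝ) φ' = dualEnergy (j : ℝ) φ := by
      rw [dualEnergy, dualEnergy]
      refine lintegral_congr fun ξ => ?_
      rw [← ofReal_norm, RCLike.norm_conj, ofReal_norm]
    rw [h1]
    exact dualEnergy_lt_top_of_notMem_tsupport _ h0
  have hs : AEStronglyMeasurable (symbolMul C j φ') volume := aestronglyMeasurable_symbolMul C j hφ'
  have hsE : dualEnergy 0 (symbolMul C j φ') < ⊤ := by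
    rw [dualEnergy_symbolMul hm C j hφ']
    exact ENNReal.mul_lt_top (symbolMass_lt_top C hj) hE
  have hp : ∀ ξ, (starRingEnd ℂ) (symbolMul C j φ' ξ) * g ξ = p ξ := by
    intro ξ
    rw [symbolMul, map_mul, Complex.conj_conj, Complex.conj_conj]
  constructor
  · exact (integrable_dual_mul (by omega) hs hsE g).congr (Filter.Eventually.of_forall hp)
  · have h1 := inner_symbolAdjoint hm hC hj (dualElt (j : ℝ) φ') g
    have h2 : symbolMap hm C hj (dualElt (j : ℝ) φ') = dualElt 0 (symbolMul C j φ') :=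
      dualElt_congr (symbolMul_congr C j (weightFun_dualElt hm hφ' hE))
    rw [h2, inner_dualElt (by omega) hs hsE, inner_dualElt hm hφ' hE] at h1
    simp only [hp] at h1
    rw [← h1]
    refine integral_congr_ae (Filter.Eventually.of_forall fun η => ?_)
    simp only [φ', Complex.conj_conj]
    ring

/-! ### Functions of temperate growth -/

/-- The linear part of the conformal coordinate. -/
noncomputable def consMap (N : ℕ) :
    EuclideanSpace ℝ (Fin N) →L[ℝ] EuclideanSpace ℝ (Fin (N + 1)) :=
  LinearMap.toContinuousLinearMap
    { toFun := fun x => WithLp.toLp 2 (Fin.cons 0 fun i => x i)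
      map_add' := fun x y => by
        ext i; refine Fin.cases ?_ (fun i => ?_) i <;> simp
      map_smul' := fun c x => by
        ext i; refine Fin.cases ?_ (fun i => ?_) i <;> simp }

theorem cayley_coe_eq {N : ℕ} (x : EuclideanSpace ℝ (Fin N)) :
    (cayley x).1 = (1 + ‖x‖ ^ 2) ^ (-1 : ℝ) •
      ((2 : ℝ) • (EuclideanSpace.single 0 1 + consMap N x)) - EuclideanSpace.single 0 1 := by
  have h := (one_add_norm_sq_pos x).ne'
  rw [Real.rpow_neg_one]
  ext i
  refine Fin.cases ?_ (fun i => ?_) i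
  · rw [cayley_zero]
    simp [consMap]
    field_simp
    ring
  · rw [cayley_succ]
    simp [consMap]
    field_simp

/-- The coordinate is a power of `1 + ‖x‖²` times an affine map, up to a constant vector. -/
theorem hasTemperateGrowth_cayley {N : ℕ} :
    (fun x : EuclideanSpace ℝ (Fin N) => (cayley x).1).HasTemperateGrowth := by
  have h1 : (fun x : EuclideanSpace ℝ (Fin N) => (2 : ℝ) •
      ((EuclideanSpace.single 0 1 : EuclideanSpace ℝ (Fin (N + 1))) + consMap N x)).HasTemperateGrowth :=
    (Function.HasTemperateGrowth.const (2 : ℝ)).smul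
      ((Function.HasTemperateGrowth.const _).add (consMap N).hasTemperateGrowth)
  have h2 := ((Function.hasTemperateGrowth_one_add_norm_sq_rpow
    (EuclideanSpace ℝ (Fin N)) (-1)).smul h1).sub
    (Function.HasTemperateGrowth.const (EuclideanSpace.single (0 : Fin (N + 1)) (1 : ℝ)))
  rw [funext cayley_coe_eq]
  exact h2

/-- A smooth function with compact support on the ambient space has temperate growth, so composing
with `cayley` gives temperate growth of the non-compact picture of weight zero. -/
theorem exists_hasCompactSupport_extension {N : ℕ} (F : SmoothSphere N) :
    ∃ Ψ : EuclideanSpace ℝ (Fin (N + 1)) → ℂ, ContDiff ℝ ∞ Ψ ∧ HasCompactSupport Ψ ∧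
      ∀ u : Sph N, Ψ u.1 = F.1 u := by
  let b : ContDiffBump (1 : ℝ) := ⟨1 / 4, 1 / 2, by norm_num, by norm_num⟩
  set χ : EuclideanSpace ℝ (Fin (N + 1)) → ℂ := fun x => (b (‖x‖ ^ 2) : ℂ)
  have hχ : ContDiff ℝ ∞ χ :=
    Complex.ofRealCLM.contDiff.comp (b.contDiff.comp (contDiff_norm_sq ℝ))
  have hzero : ∀ x : EuclideanSpace ℝ (Fin (N + 1)), (‖x‖ ^ 2 < 1 / 2 ∨ 2 < ‖x‖) → χ x = 0 := by
    intro x hx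
    have : b (‖x‖ ^ 2) = 0 := by
      refine b.zero_of_le_dist ?_
      change 1 / 2 ≤ dist (‖x‖ ^ 2) 1
      rw [Real.dist_eq]
      rcases hx with hx | hx
      · rw [abs_of_neg (by linarith)]; linarith
      · rw [abs_of_pos (by nlinarith)]; nlinarith
    simp [χ, this]
  refine ⟨fun x => χ x * radialExt F.1 x, ?_, ?_, ?_⟩
  · rw [contDiff_iff_contDiffAt]
    intro x
    by_cases hx : x = 0
    · have h1 : ∀ᶠ y in nhds x, ‖y‖ ^ 2 < 1 / 2 := by
        refine (continuous_norm.pow 2).continuousAt.eventually (Iio_mem_nhds ?_)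
        simp [hx]
      refine (contDiffAt_const (c := (0 : ℂ))).congr_of_eventuallyEq ?_
      filter_upwards [h1] with y hy
      rw [hzero y (Or.inl hy), zero_mul]
    · exact hχ.contDiffAt.mul (contDiffAt_radialExt F hx)
  · refine HasCompactSupport.of_support_subset_isCompact
      (isCompact_closedBall (0 : EuclideanSpace ℝ (Fin (N + 1))) 2) fun x hx => ?_
    rw [mem_closedBall_zero_iff]
    by_contra h
    exact hx (by simp only [hzero x (Or.inr (not_le.mp h)), zero_mul])
  · intro u
    have h1 : ‖u.1‖ = 1 := mem_sphere_zero_iff_norm.mp u.2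
    have h2 : χ u.1 = 1 := by
      have : b 1 = 1 := b.one_of_mem_closedBall (by simp [b.rIn_pos.le])
      simp [χ, h1, this]
    beta_reduce
    rw [h2, one_mul, radialExt_coe]

theorem hasTemperateGrowth_noncompact_zero {N : ℕ} (F : SmoothSphere N) :
    (noncompact 0 F).HasTemperateGrowth := by
  obtain ⟨Ψ, h1, h2, h3⟩ := exists_hasCompactSupport_extension F
  have h4 : noncompact 0 F = Ψ ∘ fun x => (cayley x).1 := by
    funext x
    rw [noncompact, Function.comp_apply, h3]
    simp
  rw [h4]
  exact (h2.hasTemperateGrowth h1).comp hasTemperateGrowth_cayley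

theorem hasTemperateGrowth_pderiv {N : ℕ} {f : EuclideanSpace ℝ (Fin N) → ℂ}
    (hf : f.HasTemperateGrowth) (i : Fin N) : (pderiv i f).HasTemperateGrowth := by
  have h1 : (fderiv ℝ f).HasTemperateGrowth := by
    refine ⟨hf.1.fderiv_right (m := ∞) (by simp), fun n => ?_⟩
    obtain ⟨k, C, h⟩ := hf.2 (n + 1)
    exact ⟨k, C, fun x => by rw [norm_iteratedFDeriv_fderiv]; exact h x⟩
  exact (ContinuousLinearMap.apply ℝ ℂ (EuclideanSpace.single i (1 : ℝ))).hasTemperateGrowth.comp h1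

theorem hasTemperateGrowth_tangentialLaplacian {m : ℕ} {f : EuclideanSpace ℝ (Fin (m + 1)) → ℂ}
    (hf : f.HasTemperateGrowth) : (tangentialLaplacian f).HasTemperateGrowth :=
  Function.HasTemperateGrowth.sum fun i _ =>
    hasTemperateGrowth_pderiv (hasTemperateGrowth_pderiv hf i.castSucc) i.castSucc

theorem exists_norm_le_of_hasTemperateGrowth {N : ℕ} {f : EuclideanSpace ℝ (Fin N) → ℂ}
    (hf : f.HasTemperateGrowth) : ∃ (k : ℕ) (K : ℝ), 0 ≤ K ∧ ∀ x, ‖f x‖ ≤ K * (1 + ‖x‖ ^ 2) ^ k := by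
  obtain ⟨k, C, hC, h⟩ := hf.norm_iteratedFDeriv_le_uniform 0
  refine ⟨k, C * 2 ^ k, by positivity, fun x => ?_⟩
  have h1 := h 0 le_rfl x
  rw [norm_iteratedFDeriv_zero] at h1
  have h2 : (1 + ‖x‖) ^ k ≤ (2 * (1 + ‖x‖ ^ 2)) ^ k :=
    pow_le_pow_left₀ (by positivity) (by nlinarith [sq_nonneg (‖x‖ - 1 / 2)]) k
  rw [mul_pow] at h2
  calc ‖f x‖ ≤ C * (1 + ‖x‖) ^ k := h1
    _ ≤ C * (2 ^ k * (1 + ‖x‖ ^ 2) ^ k) := mul_le_mul_of_nonneg_left h2 hC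
    _ = _ := by ring

/-! ### Fourier multipliers on the test functions -/

section
variable {N : ℕ}

theorem hasTemperateGrowth_coord (i : Fin N) :
    (fun ξ : EuclideanSpace ℝ (Fin N) => (ξ i : ℂ)).HasTemperateGrowth :=
  Function.Complex.hasTemperateGrowth_ofReal.comp
    (EuclideanSpace.proj i : EuclideanSpace ℝ (Fin N) →L[ℝ] ℝ).hasTemperateGrowth

/-- Multiplication by `2 π i ξ_i`. -/
noncomputable def coordMul (i : Fin N) : Module.End ℂ 𝓢(EuclideanSpace ℝ (Fin N), ℂ) :=
  ((2 * Real.pi * Complex.I : ℂ) •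
    SchwartzMap.smulLeftCLM ℂ (fun ξ : EuclideanSpace ℝ (Fin N) => (ξ i : ℂ))).toLinearMap

theorem coordMul_apply (i : Fin N) (χ : 𝓢(EuclideanSpace ℝ (Fin N), ℂ))
    (ξ : EuclideanSpace ℝ (Fin N)) : coordMul i χ ξ = 2 * Real.pi * Complex.I * ξ i * χ ξ := by
  change (2 * Real.pi * Complex.I : ℂ) * SchwartzMap.smulLeftCLM ℂ
    (fun ξ : EuclideanSpace ℝ (Fin N) => (ξ i : ℂ)) χ ξ = _
  rw [SchwartzMap.smulLeftCLM_apply_apply (hasTemperateGrowth_coord i), smul_eq_mul]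
  ring

theorem integrable_temperate_mul {f : EuclideanSpace ℝ (Fin N) → ℂ} (hf : f.HasTemperateGrowth)
    (χ : 𝓢(EuclideanSpace ℝ (Fin N), ℂ)) : Integrable fun x => f x * χ x := by
  refine (SchwartzMap.smulLeftCLM ℂ f χ).integrable.congr (Filter.Eventually.of_forall fun x => ?_)
  exact SchwartzMap.smulLeftCLM_apply_apply hf χ x

theorem fderiv_fourier_apply (i : Fin N) (χ : 𝓢(EuclideanSpace ℝ (Fin N), ℂ))
    (x : EuclideanSpace ℝ (Fin N)) :
    fderiv ℝ (𝓕 χ : 𝓢(EuclideanSpace ℝ (Fin N), ℂ)) x (EuclideanSpace.single i 1) = -(𝓕 (coordMul i χ)) x := by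
  have h1 := SchwartzMap.lineDerivOp_fourier_eq χ (EuclideanSpace.single i (1 : ℝ))
  have h2 : (-(2 * Real.pi * Complex.I : ℂ)) • SchwartzMap.smulLeftCLM ℂ
      (fun ξ : EuclideanSpace ℝ (Fin N) => inner ℝ ξ (EuclideanSpace.single i (1 : ℝ))) χ =
      -(coordMul i χ) := by
    ext ξ
    have h3 : (fun ξ : EuclideanSpace ℝ (Fin N) =>
        inner ℝ ξ (EuclideanSpace.single i (1 : ℝ))).HasTemperateGrowth :=
      Function.hasTemperateGrowth_inner_left _
    have h4 : inner ℝ ξ (EuclideanSpace.single i (1 : ℝ)) = ξ i := by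
      rw [EuclideanSpace.inner_single_right]; simp
    rw [smul_apply, SchwartzMap.smulLeftCLM_apply_apply h3, neg_apply,
      coordMul_apply, h4, Complex.real_smul, smul_eq_mul]
    ring
  rw [h2, FourierTransform.fourier_neg] at h1
  rw [← SchwartzMap.lineDerivOp_apply_eq_fderiv, h1, neg_apply]

/-- Integration by parts; its sign cancels the sign in the derivative of a Fourier transform. -/
theorem integral_mul_fourier_coordMul {f : EuclideanSpace ℝ (Fin N) → ℂ}
    (hf : f.HasTemperateGrowth) (i : Fin N) (χ : 𝓢(EuclideanSpace ℝ (Fin N), ℂ)) :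
    ∫ x, f x * (𝓕 (coordMul i χ)) x = ∫ x, pderiv i f x * (𝓕 χ) x := by
  have h1 := integral_mul_fderiv_eq_neg_fderiv_mul_of_integrable (μ := volume) (f := f) 
    (g := (𝓕 χ : 𝓢(EuclideanSpace ℝ (Fin N), ℂ)))
    (v := EuclideanSpace.single i (1 : ℝ))
    (integrable_temperate_mul (hasTemperateGrowth_pderiv hf i) (𝓕 χ))
    (by
      simp only [fderiv_fourier_apply, mul_neg]
      exact (integrable_temperate_mul hf _).neg)
    (integrable_temperate_mul hf _)
    (fun x _ => (hf.1.differentiable (by simp)).differentiableAt)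
    (fun x _ => (SchwartzMap.differentiable _).differentiableAt)
  simp only [fderiv_fourier_apply, mul_neg, integral_neg, neg_inj] at h1
  exact h1

end

section
variable {m : ℕ}

/-- Multiplication by `-4 π² |η|²`. -/
noncomputable def tangentialMul : Module.End ℂ 𝓢(EuclideanSpace ℝ (Fin (m + 1)), ℂ) :=
  ∑ i : Fin m, coordMul i.castSucc * coordMul i.castSucc

theorem tangentialMul_apply (χ : 𝓢(EuclideanSpace ℝ (Fin (m + 1)), ℂ))
    (ξ : EuclideanSpace ℝ (Fin (m + 1))) :
    tangentialMul χ ξ = -(4 * Real.pi ^ 2 * (‖tangentPart ξ‖ : ℂ) ^ 2) * χ ξ := by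
  have h1 : (‖tangentPart ξ‖ : ℂ) ^ 2 = ∑ i : Fin m, (ξ i.castSucc : ℂ) ^ 2 := by
    have h2 : ‖tangentPart ξ‖ ^ 2 = ∑ i : Fin m, ξ i.castSucc ^ 2 := by
      rw [EuclideanSpace.norm_sq_eq]
      simp [tangentPart]
    exact_mod_cast congrArg (fun r : ℝ => (r : ℂ)) h2
  rw [h1, tangentialMul, LinearMap.sum_apply, sum_apply, Finset.mul_sum,
    ← Finset.sum_neg_distrib, Finset.sum_mul]
  refine Finset.sum_congr rfl fun i _ => ?_
  rw [Module.End.mul_apply, coordMul_apply, coordMul_apply]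
  linear_combination (4 * Real.pi ^ 2 * (ξ i.castSucc : ℂ) ^ 2 * χ ξ) * Complex.I_sq

theorem fourier_sum {N : ℕ} {α : Type*} (t : Finset α) (g : α → 𝓢(EuclideanSpace ℝ (Fin N), ℂ)) :
    𝓕 (∑ a ∈ t, g a) = ∑ a ∈ t, 𝓕 (g a) :=
  map_sum (FourierTransform.fourierCLM ℂ 𝓢(EuclideanSpace ℝ (Fin N), ℂ)) g t

theorem integral_mul_fourier_tangentialMul {f : EuclideanSpace ℝ (Fin (m + 1)) → ℂ}
    (hf : f.HasTemperateGrowth) (χ : 𝓢(EuclideanSpace ℝ (Fin (m + 1)), ℂ)) :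
    ∫ x, f x * (𝓕 (tangentialMul χ)) x = ∫ x, tangentialLaplacian f x * (𝓕 χ) x := by
  rw [tangentialMul, LinearMap.sum_apply, fourier_sum]
  simp only [sum_apply, Finset.mul_sum, tangentialLaplacian, Finset.sum_mul]
  rw [integral_finsetSum _ fun i _ => integrable_temperate_mul hf _,
    integral_finsetSum _ fun i _ => integrable_temperate_mul
      (hasTemperateGrowth_pderiv (hasTemperateGrowth_pderiv hf i.castSucc) i.castSucc) _]
  refine Finset.sum_congr rfl fun i _ => ?_
  rw [Module.End.mul_apply, integral_mul_fourier_coordMul hf,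
    integral_mul_fourier_coordMul (hasTemperateGrowth_pderiv hf _)]

theorem integral_mul_fourier_pow {N : ℕ} {T : Module.End ℂ 𝓢(EuclideanSpace ℝ (Fin N), ℂ)}
    {S : (EuclideanSpace ℝ (Fin N) → ℂ) → EuclideanSpace ℝ (Fin N) → ℂ}
    (hS : ∀ f, f.HasTemperateGrowth → (S f).HasTemperateGrowth)
    (h : ∀ f, f.HasTemperateGrowth → ∀ χ, ∫ x, f x * (𝓕 (T χ)) x = ∫ x, S f x * (𝓕 χ) x)
    (p : ℕ) {f : EuclideanSpace ℝ (Fin N) → ℂ} (hf : f.HasTemperateGrowth)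
    (χ : 𝓢(EuclideanSpace ℝ (Fin N), ℂ)) :
    (S^[p] f).HasTemperateGrowth ∧
      ∫ x, f x * (𝓕 ((T ^ p) χ)) x = ∫ x, S^[p] f x * (𝓕 χ) x := by
  induction p generalizing χ with
  | zero => exact ⟨hf, rfl⟩
  | succ p ih =>
    rw [Function.iterate_succ_apply', pow_succ, Module.End.mul_apply]
    exact ⟨hS _ (ih χ).1, by rw [(ih (T χ)).2, h _ (ih χ).1]⟩

/-- The differential operator before restriction to the hyperplane. -/
noncomputable def diffOp (C : ℕ → ℂ) (j : ℕ) (f : EuclideanSpace ℝ (Fin (m + 1)) → ℂ) :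
    EuclideanSpace ℝ (Fin (m + 1)) → ℂ := fun x =>
  ∑ k ∈ Finset.range (j / 2 + 1),
    C k * ((pderiv (Fin.last m))^[j - 2 * k] (tangentialLaplacian^[k] f)) x

/-- Multiplication by the symbol. -/
noncomputable def symbolOp (C : ℕ → ℂ) (j : ℕ) :
    Module.End ℂ 𝓢(EuclideanSpace ℝ (Fin (m + 1)), ℂ) :=
  ∑ k ∈ Finset.range (j / 2 + 1),
    C k • (tangentialMul ^ k * coordMul (Fin.last m) ^ (j - 2 * k))

theorem pow_apply_of_apply {N : ℕ} {T : Module.End ℂ 𝓢(EuclideanSpace ℝ (Fin N), ℂ)}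
    {s : EuclideanSpace ℝ (Fin N) → ℂ} (h : ∀ χ ξ, T χ ξ = s ξ * χ ξ) (p : ℕ)
    (χ : 𝓢(EuclideanSpace ℝ (Fin N), ℂ)) (ξ : EuclideanSpace ℝ (Fin N)) :
    (T ^ p) χ ξ = s ξ ^ p * χ ξ := by
  induction p with
  | zero => simp
  | succ p ih => rw [pow_succ', Module.End.mul_apply, h, ih]; ring

theorem symbolOp_apply (C : ℕ → ℂ) (j : ℕ) (χ : 𝓢(EuclideanSpace ℝ (Fin (m + 1)), ℂ))
    (ξ : EuclideanSpace ℝ (Fin (m + 1))) :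
    symbolOp C j χ ξ = radialSymbol C j ‖tangentPart ξ‖ (ξ (Fin.last m)) * χ ξ := by
  rw [symbolOp, LinearMap.sum_apply, sum_apply, radialSymbol, Finset.sum_mul]
  refine Finset.sum_congr rfl fun k _ => ?_
  rw [LinearMap.smul_apply, smul_apply, Module.End.mul_apply,
    pow_apply_of_apply tangentialMul_apply, pow_apply_of_apply (coordMul_apply (Fin.last m)),
    smul_eq_mul]
  ring

theorem hasTemperateGrowth_diffOp (C : ℕ → ℂ) (j : ℕ) {f : EuclideanSpace ℝ (Fin (m + 1)) → ℂ}
    (hf : f.HasTemperateGrowth) : (diffOp C j f).HasTemperateGrowth := by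
  refine Function.HasTemperateGrowth.sum fun k _ => (Function.HasTemperateGrowth.const _).mul ?_
  exact (integral_mul_fourier_pow (fun f hf => hasTemperateGrowth_pderiv hf (Fin.last m))
    (fun f hf χ => integral_mul_fourier_coordMul hf _ χ) _
    (integral_mul_fourier_pow (fun f hf => hasTemperateGrowth_tangentialLaplacian hf)
      (fun f hf χ => integral_mul_fourier_tangentialMul hf χ) k hf 0).1 0).1

theorem integral_mul_fourier_symbolOp (C : ℕ → ℂ) (j : ℕ)
    {f : EuclideanSpace ℝ (Fin (m + 1)) → ℂ} (hf : f.HasTemperateGrowth)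
    (χ : 𝓢(EuclideanSpace ℝ (Fin (m + 1)), ℂ)) :
    ∫ x, f x * (𝓕 (symbolOp C j χ)) x = ∫ x, diffOp C j f x * (𝓕 χ) x := by
  have h1 := fun k χ => integral_mul_fourier_pow (f := f)
    (fun f hf => hasTemperateGrowth_tangentialLaplacian hf)
    (fun f hf χ => integral_mul_fourier_tangentialMul hf χ) k hf χ
  have h2 := fun k p χ => integral_mul_fourier_pow
    (fun f hf => hasTemperateGrowth_pderiv hf (Fin.last m))
    (fun f hf χ => integral_mul_fourier_coordMul hf _ χ) p (h1 k 0).1 χ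
  have h3 : ∀ (c : ℂ) (θ : 𝓢(EuclideanSpace ℝ (Fin (m + 1)), ℂ)) x,
      (𝓕 (c • θ)) x = c * (𝓕 θ) x := fun c θ x => by
    rw [FourierTransform.fourier_smul]; rfl
  rw [symbolOp, LinearMap.sum_apply, fourier_sum]
  simp only [sum_apply, LinearMap.smul_apply, h3, Finset.mul_sum, diffOp,
    Finset.sum_mul]
  rw [integral_finsetSum _ fun k _ => ?_, integral_finsetSum _ fun k _ => ?_]
  · refine Finset.sum_congr rfl fun k _ => ?_
    simp only [mul_left_comm (f _), mul_assoc (C k), integral_const_mul]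
    rw [Module.End.mul_apply, (h1 k _).2, (h2 k _ χ).2]
  · simp only [mul_assoc]
    exact (integrable_temperate_mul (h2 k _ χ).1 _).const_mul _
  · simp only [mul_left_comm (f _)]
    exact (integrable_temperate_mul hf _).const_mul _

end

/-! ### Restriction to the hyperplane by concentration -/

theorem continuous_splitEquiv {m : ℕ} : Continuous (splitEquiv m) := by
  have h : (splitEquiv m : EuclideanSpace ℝ (Fin m) × ℝ → EuclideanSpace ℝ (Fin (m + 1))) =
      fun p => WithLp.toLp 2 (Fin.snoc (fun i => p.1 i) p.2) := funext splitEquiv_apply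
  rw [h]
  refine (PiLp.continuous_toLp 2 _).comp (continuous_pi fun i => ?_)
  refine Fin.lastCases ?_ (fun i => ?_) i
  · simp only [Fin.snoc_last]; exact continuous_snd
  · simp only [Fin.snoc_castSucc]; fun_prop

theorem inner_splitEquiv {m : ℕ} (p q : EuclideanSpace ℝ (Fin m) × ℝ) :
    inner ℝ (splitEquiv m p) (splitEquiv m q) = inner ℝ p.1 q.1 + p.2 * q.2 := by
  rw [PiLp.inner_apply, PiLp.inner_apply, Fin.sum_univ_castSucc]
  simp only [splitEquiv_last, splitEquiv_castSucc]
  congr 1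
  simp [mul_comm]

theorem integral_splitEquiv {m : ℕ} (f : EuclideanSpace ℝ (Fin (m + 1)) → ℂ) :
    ∫ ξ, f ξ = ∫ p : EuclideanSpace ℝ (Fin m) × ℝ, f (splitEquiv m p) :=
  ((measurePreserving_splitEquiv m).integral_comp (splitEquiv m).measurableEmbedding f).symm

theorem fourier_tensor {m : ℕ} (u : EuclideanSpace ℝ (Fin m) → ℂ) (v : ℝ → ℂ)
    (q : EuclideanSpace ℝ (Fin m) × ℝ) :
    𝓕 (fun ξ : EuclideanSpace ℝ (Fin (m + 1)) => u (tangentPart ξ) * v (ξ (Fin.last m)))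
      (splitEquiv m q) = 𝓕 u q.1 * 𝓕 v q.2 := by
  rw [Real.fourier_eq', Real.fourier_eq', Real.fourier_eq', integral_splitEquiv, ← integral_prod_mul]
  refine integral_congr_ae (Filter.Eventually.of_forall fun p => ?_)
  have h : inner ℝ p.2 q.2 = p.2 * q.2 := by simp [mul_comm]
  simp only [inner_splitEquiv, tangentPart_splitEquiv, splitEquiv_last, h, smul_eq_mul]
  rw [show (((-2 * Real.pi * (inner ℝ p.1 q.1 + p.2 * q.2) : ℝ) : ℂ) * Complex.I) =
    ((-2 * Real.pi * inner ℝ p.1 q.1 : ℝ) : ℂ) * Complex.I +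
    ((-2 * Real.pi * (p.2 * q.2) : ℝ) : ℂ) * Complex.I by push_cast; ring, Complex.exp_add]
  ring

theorem fourier_comp_mul_left (v : ℝ → ℂ) {a : ℝ} (ha : 0 < a) (σ : ℝ) :
    (a : ℂ) * 𝓕 (fun t => v (a * t)) (a * σ) = 𝓕 v σ := by
  rw [Real.fourier_eq', Real.fourier_eq']
  have h := Measure.integral_comp_mul_left
    (fun t : ℝ => Complex.exp (((-2 * Real.pi * inner ℝ t σ : ℝ) : ℂ) * Complex.I) • v t) a
  rw [abs_of_pos (inv_pos.mpr ha)] at h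
  have h2 : (fun t : ℝ => Complex.exp (((-2 * Real.pi * inner ℝ t (a * σ) : ℝ) : ℂ) * Complex.I) •
      v (a * t)) = fun t : ℝ => Complex.exp (((-2 * Real.pi * inner ℝ (a * t) σ : ℝ) : ℂ) *
        Complex.I) • v (a * t) := by
    funext t
    have : inner ℝ t (a * σ) = inner ℝ (a * t) σ := by simp; ring
    rw [this]
  rw [h2, h, Complex.real_smul, ← mul_assoc, ← Complex.ofReal_mul, mul_inv_cancel₀ ha.ne',
    Complex.ofReal_one, one_mul]

theorem integrable_one_add_norm_sq_pow_mul {V : Type*} [NormedAddCommGroup V]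
    [InnerProductSpace ℝ V] [FiniteDimensional ℝ V] [MeasurableSpace V] [BorelSpace V] (k : ℕ)
    (χ : 𝓢(V, ℂ)) : Integrable fun x => (1 + ‖x‖ ^ 2) ^ k * ‖χ x‖ := by
  have hg : (fun x : V => (1 + ‖x‖ ^ 2) ^ k).HasTemperateGrowth := by
    have h := Function.hasTemperateGrowth_one_add_norm_sq_rpow V k
    simpa only [Real.rpow_natCast] using h
  refine (SchwartzMap.smulLeftCLM ℂ (fun x : V => (1 + ‖x‖ ^ 2) ^ k) χ).integrable.norm.congr
    (Filter.Eventually.of_forall fun x => ?_)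
  simp only
  rw [SchwartzMap.smulLeftCLM_apply_apply hg, norm_smul, Real.norm_of_nonneg (by positivity)]

/-- A smooth cutoff on the line. -/
noncomputable def lineBump : ContDiffBump (0 : ℝ) := ⟨1, 2, one_pos, one_lt_two⟩

theorem hasCompactSupport_lineBump : HasCompactSupport fun t : ℝ => (lineBump t : ℂ) :=
  lineBump.hasCompactSupport.comp_left (g := Complex.ofReal) rfl

/-- The cutoff as a test function. -/
noncomputable def lineCutoff : 𝓢(ℝ, ℂ) :=
  hasCompactSupport_lineBump.toSchwartzMap (Complex.ofRealCLM.contDiff.comp lineBump.contDiff)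

theorem lineCutoff_apply (t : ℝ) : lineCutoff t = lineBump t := rfl

theorem norm_lineCutoff_le (t : ℝ) : ‖lineCutoff t‖ ≤ 1 := by
  rw [lineCutoff_apply, Complex.norm_real, Real.norm_of_nonneg lineBump.nonneg]
  exact lineBump.le_one

theorem lineCutoff_zero : lineCutoff 0 = 1 := by
  rw [lineCutoff_apply, lineBump.one_of_mem_closedBall (by simp [lineBump])]
  simp

/-- Fourier inversion at `0`, where the cutoff equals one. This normalizes the approximate identity
used to restrict to the hyperplane. -/
theorem integral_fourier_lineCutoff : ∫ σ, (𝓕 lineCutoff) σ = 1 := by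
  have h1 : 𝓕⁻ (𝓕 lineCutoff) = lineCutoff := FourierTransform.fourierInv_fourier_eq _
  have h2 := congrArg (fun θ : 𝓢(ℝ, ℂ) => θ 0) h1
  simp only [SchwartzMap.fourierInv_coe, lineCutoff_zero] at h2
  rw [Real.fourierInv_eq'] at h2
  simpa using h2

section
variable {m : ℕ}

theorem contDiff_tangentPart : ContDiff ℝ ∞ (tangentPart (m := m)) := by
  rw [contDiff_euclidean]
  intro i
  simp only [tangentPart]
  fun_prop

theorem hasCompactSupport_tensor {φ : 𝓢(EuclideanSpace ℝ (Fin m), ℂ)} (hφ : HasCompactSupport φ)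
    {a : ℝ} (ha : 0 < a) : HasCompactSupport fun ξ : EuclideanSpace ℝ (Fin (m + 1)) =>
      φ (tangentPart ξ) * lineCutoff (a * ξ (Fin.last m)) := by
  refine HasCompactSupport.of_support_subset_isCompact
    ((hφ.isCompact.prod (isCompact_closedBall (0 : ℝ) (2 / a))).image continuous_splitEquiv)
    fun ξ hξ => ?_
  obtain ⟨p, rfl⟩ := (splitEquiv m).surjective ξ
  rw [Function.mem_support, tangentPart_splitEquiv, splitEquiv_last] at hξ
  refine ⟨p, ⟨subset_tsupport _ (left_ne_zero_of_mul hξ), ?_⟩, rfl⟩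
  by_contra h
  rw [mem_closedBall_zero_iff, Real.norm_eq_abs, not_le, div_lt_iff₀' ha] at h
  refine right_ne_zero_of_mul hξ ?_
  rw [lineCutoff_apply, lineBump.zero_of_le_dist, Complex.ofReal_zero]
  rw [dist_zero_right, Real.norm_eq_abs, abs_mul, abs_of_pos ha]
  exact h.le

/-- A test function on the hyperplane times a cutoff in the normal variable. -/
noncomputable def tensorCutoff {φ : 𝓢(EuclideanSpace ℝ (Fin m), ℂ)} (hφ : HasCompactSupport φ)
    {a : ℝ} (ha : 0 < a) : 𝓢(EuclideanSpace ℝ (Fin (m + 1)), ℂ) :=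
  (hasCompactSupport_tensor hφ ha).toSchwartzMap (by
    refine ((φ.smooth ⊤).comp contDiff_tangentPart).mul ((lineCutoff.smooth ⊤).comp ?_)
    fun_prop)

theorem tensorCutoff_apply {φ : 𝓢(EuclideanSpace ℝ (Fin m), ℂ)} (hφ : HasCompactSupport φ)
    {a : ℝ} (ha : 0 < a) (ξ : EuclideanSpace ℝ (Fin (m + 1))) :
    tensorCutoff hφ ha ξ = φ (tangentPart ξ) * lineCutoff (a * ξ (Fin.last m)) := rfl

/-- Since `φ` vanishes near the origin of the hyperplane, the product vanishes near the origin
although the normal cutoff equals one there. Hence the Fourier transform off the origin may be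
tested on it. -/
theorem notMem_tsupport_symbolOp {φ : 𝓢(EuclideanSpace ℝ (Fin m), ℂ)} (hφ : HasCompactSupport φ)
    (h0 : (0 : EuclideanSpace ℝ (Fin m)) ∉ tsupport φ) {a : ℝ} (ha : 0 < a) (C : ℕ → ℂ) (j : ℕ) :
    (0 : EuclideanSpace ℝ (Fin (m + 1))) ∉ tsupport (symbolOp C j (tensorCutoff hφ ha)) := by
  rw [notMem_tsupport_iff_eventuallyEq] at h0 ⊢
  have h1 : Filter.Tendsto (tangentPart (m := m)) (nhds 0) (nhds 0) := by
    have := (continuous_tangentPart (m := m)).tendsto 0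
    rwa [show tangentPart (0 : EuclideanSpace ℝ (Fin (m + 1))) = 0 by ext i; rfl] at this
  filter_upwards [h1.eventually h0] with ξ hξ
  rw [symbolOp_apply, tensorCutoff_apply, hξ]
  simp

theorem fourier_tensorCutoff {φ : 𝓢(EuclideanSpace ℝ (Fin m), ℂ)} (hφ : HasCompactSupport φ)
    {a : ℝ} (ha : 0 < a) (y : EuclideanSpace ℝ (Fin m)) (σ : ℝ) :
    (a : ℂ) * (𝓕 (tensorCutoff hφ ha)) (splitEquiv m (y, a * σ)) =
      (𝓕 φ) y * (𝓕 lineCutoff) σ := by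
  have h1 := fourier_tensor φ (fun t => lineCutoff (a * t)) (y, a * σ)
  have h2 := fourier_comp_mul_left lineCutoff ha σ
  rw [SchwartzMap.fourier_coe, SchwartzMap.fourier_coe, SchwartzMap.fourier_coe, ← h2]
  rw [show (⇑(tensorCutoff hφ ha) : EuclideanSpace ℝ (Fin (m + 1)) → ℂ) =
    fun ξ => φ (tangentPart ξ) * lineCutoff (a * ξ (Fin.last m)) from rfl, h1]
  ring

/-- For `a ≤ 1` the polynomial growth at the contracted point is bounded by a product of powers in
the two variables, which the Schwartz factors absorb uniformly in `a`. -/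
theorem exists_integrable_bound {Q : EuclideanSpace ℝ (Fin (m + 1)) → ℂ}
    (hQ : Q.HasTemperateGrowth) (φ : 𝓢(EuclideanSpace ℝ (Fin m), ℂ)) :
    ∃ B : EuclideanSpace ℝ (Fin m) × ℝ → ℝ, Integrable B (volume.prod volume) ∧
      ∀ a : ℝ, 0 ≤ a → a ≤ 1 → ∀ p, ‖Q (splitEquiv m (p.1, a * p.2)) *
        ((𝓕 φ) p.1 * (𝓕 lineCutoff) p.2)‖ ≤ B p := by
  obtain ⟨k, K, hK, hb⟩ := exists_norm_le_of_hasTemperateGrowth hQ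
  refine ⟨fun p => K * (((1 + ‖p.1‖ ^ 2) ^ k * ‖(𝓕 φ) p.1‖) *
    ((1 + ‖p.2‖ ^ 2) ^ k * ‖(𝓕 lineCutoff) p.2‖)), ?_, fun a h0 h1 p => ?_⟩
  · exact ((integrable_one_add_norm_sq_pow_mul k (𝓕 φ)).mul_prod
      (integrable_one_add_norm_sq_pow_mul k (𝓕 lineCutoff))).const_mul K
  · have h2 := hb (splitEquiv m (p.1, a * p.2))
    rw [norm_sq_splitEquiv] at h2
    have h3 : 1 + (‖p.1‖ ^ 2 + (a * p.2) ^ 2) ≤ (1 + ‖p.1‖ ^ 2) * (1 + ‖p.2‖ ^ 2) := by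
      have e1 : (a * p.2) ^ 2 ≤ p.2 ^ 2 := by
        rw [mul_pow]
        exact mul_le_of_le_one_left (sq_nonneg _) (pow_le_one₀ h0 h1)
      rw [Real.norm_eq_abs p.2, sq_abs]
      nlinarith [mul_nonneg (sq_nonneg ‖p.1‖) (sq_nonneg p.2)]
    have h4 := pow_le_pow_left₀ (by positivity) h3 k
    rw [mul_pow (1 + ‖p.1‖ ^ 2)] at h4
    rw [norm_mul, norm_mul]
    calc ‖Q (splitEquiv m (p.1, a * p.2))‖ * (‖(𝓕 φ) p.1‖ * ‖(𝓕 lineCutoff) p.2‖)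
        ≤ (K * ((1 + ‖p.1‖ ^ 2) ^ k * (1 + ‖p.2‖ ^ 2) ^ k)) *
          (‖(𝓕 φ) p.1‖ * ‖(𝓕 lineCutoff) p.2‖) :=
          mul_le_mul_of_nonneg_right (h2.trans (mul_le_mul_of_nonneg_left h4 hK)) (by positivity)
      _ = _ := by ring

theorem continuous_concentrated {Q : EuclideanSpace ℝ (Fin (m + 1)) → ℂ}
    (hQ : Q.HasTemperateGrowth) (φ : 𝓢(EuclideanSpace ℝ (Fin m), ℂ)) (a : ℝ) :
    Continuous fun p : EuclideanSpace ℝ (Fin m) × ℝ => Q (splitEquiv m (p.1, a * p.2)) *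
        ((𝓕 φ) p.1 * (𝓕 lineCutoff) p.2) := by
  refine (hQ.1.continuous.comp (continuous_splitEquiv.comp ?_)).mul
    (((SchwartzMap.continuous _).comp continuous_fst).mul
      ((SchwartzMap.continuous _).comp continuous_snd))
  fun_prop

theorem integral_mul_fourier_tensorCutoff {Q : EuclideanSpace ℝ (Fin (m + 1)) → ℂ}
    (hQ : Q.HasTemperateGrowth) {φ : 𝓢(EuclideanSpace ℝ (Fin m), ℂ)} (hφ : HasCompactSupport φ)
    {a : ℝ} (ha : 0 < a) (ha1 : a ≤ 1) :
    ∫ x, Q x * (𝓕 (tensorCutoff hφ ha)) x =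
      ∫ p : EuclideanSpace ℝ (Fin m) × ℝ, Q (splitEquiv m (p.1, a * p.2)) *
        ((𝓕 φ) p.1 * (𝓕 lineCutoff) p.2) := by
  have h1 := integrable_temperate_mul hQ (𝓕 (tensorCutoff hφ ha))
  have h2 : Integrable (fun p : EuclideanSpace ℝ (Fin m) × ℝ => Q (splitEquiv m p) *
      (𝓕 (tensorCutoff hφ ha)) (splitEquiv m p)) (volume.prod volume) :=
    (measurePreserving_splitEquiv m).integrable_comp_of_integrable h1
  obtain ⟨B, hB, hb⟩ := exists_integrable_bound hQ φ
  have h3 : Integrable (fun p : EuclideanSpace ℝ (Fin m) × ℝ => Q (splitEquiv m (p.1, a * p.2)) *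
        ((𝓕 φ) p.1 * (𝓕 lineCutoff) p.2)) (volume.prod volume) :=
    hB.mono' (continuous_concentrated hQ φ a).aestronglyMeasurable
      (Filter.Eventually.of_forall (hb a ha.le ha1))
  rw [integral_splitEquiv, Measure.volume_eq_prod, integral_prod _ h2, integral_prod _ h3]
  refine integral_congr_ae (Filter.Eventually.of_forall fun y => ?_)
  simp only
  have h4 := Measure.integral_comp_mul_left
    (fun s : ℝ => Q (splitEquiv m (y, s)) * (𝓕 (tensorCutoff hφ ha)) (splitEquiv m (y, s))) a
  rw [abs_of_pos (inv_pos.mpr ha)] at h4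
  simp only [← fourier_tensorCutoff hφ ha, mul_left_comm _ (a : ℂ), integral_const_mul, h4]
  rw [Complex.real_smul, ← mul_assoc, ← Complex.ofReal_mul, mul_inv_cancel₀ ha.ne',
    Complex.ofReal_one, one_mul]

/-- Widening the cutoff in the normal frequency concentrates its transform on the hyperplane, with
total mass one. -/
theorem tendsto_integral_concentrated {Q : EuclideanSpace ℝ (Fin (m + 1)) → ℂ}
    (hQ : Q.HasTemperateGrowth) (φ : 𝓢(EuclideanSpace ℝ (Fin m), ℂ)) :
    Filter.Tendsto (fun n : ℕ => ∫ p : EuclideanSpace ℝ (Fin m) × ℝ,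
      Q (splitEquiv m (p.1, (1 / ((n : ℝ) + 1)) * p.2)) * ((𝓕 φ) p.1 * (𝓕 lineCutoff) p.2))
      Filter.atTop (nhds (∫ y, Q (splitEquiv m (y, 0)) * (𝓕 φ) y)) := by
  obtain ⟨B, hB, hb⟩ := exists_integrable_bound hQ φ
  have h1 : ∫ y, Q (splitEquiv m (y, 0)) * (𝓕 φ) y =
      ∫ p : EuclideanSpace ℝ (Fin m) × ℝ, Q (splitEquiv m (p.1, 0)) *
        ((𝓕 φ) p.1 * (𝓕 lineCutoff) p.2) := by
    simp only [← mul_assoc]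
    have e1 := integral_prod_mul (μ := volume) (ν := volume)
      (fun y : EuclideanSpace ℝ (Fin m) => Q (splitEquiv m (y, 0)) * (𝓕 φ) y)
      (fun σ : ℝ => (𝓕 lineCutoff) σ)
    rw [integral_fourier_lineCutoff, mul_one] at e1
    exact e1.symm
  rw [h1]
  have ht : Filter.Tendsto (fun n : ℕ => 1 / ((n : ℝ) + 1)) Filter.atTop (nhds 0) :=
    tendsto_one_div_add_atTop_nhds_zero_nat
  refine tendsto_integral_of_dominated_convergence B
    (fun n => (continuous_concentrated hQ φ _).aestronglyMeasurable) hB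
    (fun n => Filter.Eventually.of_forall (hb _ (by positivity) ?_))
    (Filter.Eventually.of_forall fun p => ?_)
  · rw [div_le_one (by positivity)]
    have : (0 : ℝ) ≤ n := Nat.cast_nonneg n
    linarith
  · refine Filter.Tendsto.mul_const _ ?_
    have hc : Continuous fun a : ℝ => Q (splitEquiv m (p.1, a * p.2)) :=
      hQ.1.continuous.comp (continuous_splitEquiv.comp (by fun_prop))
    have h2 := (hc.tendsto 0).comp ht
    rw [zero_mul] at h2
    exact h2

/-- The restriction of the derivatives of a function to the hyperplane, in terms of its Fourier
transform off the origin. -/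
theorem integral_normalOperator_mul_fourier {f : EuclideanSpace ℝ (Fin (m + 1)) → ℂ}
    (hf : f.HasTemperateGrowth) {g : EuclideanSpace ℝ (Fin (m + 1)) → ℂ}
    (hfg : IsFourierTransformOffZero f g) (C : ℕ → ℂ) (j : ℕ)
    {φ : 𝓢(EuclideanSpace ℝ (Fin m), ℂ)} (hφ : HasCompactSupport φ)
    (h0 : (0 : EuclideanSpace ℝ (Fin m)) ∉ tsupport φ)
    (hp : Integrable fun ξ : EuclideanSpace ℝ (Fin (m + 1)) =>
      radialSymbol C j ‖tangentPart ξ‖ (ξ (Fin.last m)) * φ (tangentPart ξ) * g ξ) :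
    ∫ y, normalOperator C j f y * (𝓕 φ) y =
      ∫ ξ, radialSymbol C j ‖tangentPart ξ‖ (ξ (Fin.last m)) * φ (tangentPart ξ) * g ξ := by
  set p := fun ξ : EuclideanSpace ℝ (Fin (m + 1)) =>
      radialSymbol C j ‖tangentPart ξ‖ (ξ (Fin.last m)) * φ (tangentPart ξ) * g ξ
  have hQ := hasTemperateGrowth_diffOp C j hf
  have h1 := tendsto_integral_concentrated hQ φ
  -- The same quantity on the Fourier side: the differential operator becomes the symbol, and the
  -- test function is supported off the origin, so `𝓕 f` may be replaced by `g`.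
  have h2 : ∀ n : ℕ, ∫ q : EuclideanSpace ℝ (Fin m) × ℝ,
      diffOp C j f (splitEquiv m (q.1, (1 / ((n : ℝ) + 1)) * q.2)) *
        ((𝓕 φ) q.1 * (𝓕 lineCutoff) q.2) =
      ∫ ξ, lineCutoff ((1 / ((n : ℝ) + 1)) * ξ (Fin.last m)) * p ξ := by
    intro n
    have ha : (0 : ℝ) < 1 / ((n : ℝ) + 1) := by positivity
    have ha1 : 1 / ((n : ℝ) + 1) ≤ 1 := by
      rw [div_le_one (by positivity)]
      have : (0 : ℝ) ≤ n := Nat.cast_nonneg n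
      linarith
    rw [← integral_mul_fourier_tensorCutoff hQ hφ ha ha1, ← integral_mul_fourier_symbolOp C j hf,
      hfg _ (notMem_tsupport_symbolOp hφ h0 ha C j)]
    refine integral_congr_ae (Filter.Eventually.of_forall fun ξ => ?_)
    simp only [symbolOp_apply, tensorCutoff_apply, p]
    ring
  have ht : Filter.Tendsto (fun n : ℕ => 1 / ((n : ℝ) + 1)) Filter.atTop (nhds 0) :=
    tendsto_one_div_add_atTop_nhds_zero_nat
  -- The cutoff is bounded by one and tends to one pointwise, so integrability of `p` gives the
  -- limit.
  have h3 : Filter.Tendsto (fun n : ℕ => ∫ ξ,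
      lineCutoff ((1 / ((n : ℝ) + 1)) * ξ (Fin.last m)) * p ξ) Filter.atTop (nhds (∫ ξ, p ξ)) := by
    refine tendsto_integral_of_dominated_convergence (fun ξ => ‖p ξ‖) (fun n => ?_) hp.norm
      (fun n => Filter.Eventually.of_forall fun ξ => ?_) (Filter.Eventually.of_forall fun ξ => ?_)
    · refine AEStronglyMeasurable.mul ?_ hp.aestronglyMeasurable
      refine (lineCutoff.continuous.comp ?_).aestronglyMeasurable
      fun_prop
    · rw [norm_mul]
      exact mul_le_of_le_one_left (norm_nonneg _) (norm_lineCutoff_le _)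
    · have hc : Continuous fun a : ℝ => lineCutoff (a * ξ (Fin.last m)) * p ξ :=
        (lineCutoff.continuous.comp (by fun_prop)).mul continuous_const
      have h4 := (hc.tendsto 0).comp ht
      rw [zero_mul, lineCutoff_zero, one_mul] at h4
      exact h4
  simp only [h2] at h1
  rw [← tendsto_nhds_unique h1 h3]
  refine integral_congr_ae (Filter.Eventually.of_forall fun y => ?_)
  simp only [splitEquiv_apply]
  rfl

end

/-! ### The branching operator -/

theorem integrable_mul_schwartz {N : ℕ} (hN : 1 ≤ N) {μ : ℝ} (k : WeightedL2 N μ)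
    {φ : 𝓢(EuclideanSpace ℝ (Fin N), ℂ)} (h0 : (0 : EuclideanSpace ℝ (Fin N)) ∉ tsupport φ) :
    Integrable fun ξ => k ξ * φ ξ := by
  have hE : dualEnergy μ (fun ξ => (starRingEnd ℂ) (φ ξ)) < ⊤ := by
    refine lt_of_eq_of_lt ?_ (dualEnergy_lt_top_of_notMem_tsupport μ h0)
    refine lintegral_congr fun ξ => ?_
    rw [← ofReal_norm, RCLike.norm_conj, ofReal_norm]
  refine (integrable_dual_mul hN
    (Complex.continuous_conj.comp φ.continuous).aestronglyMeasurable hE k).congr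
    (Filter.Eventually.of_forall fun ξ => ?_)
  simp only [Function.comp_apply, Complex.conj_conj]
  exact mul_comm _ _

section
variable {m j : ℕ} {ι₀ : SmoothSphere (m + 1) →ₗ[ℂ] WeightedL2 (m + 1) 0}
  {U₀ : SO0 (m + 2) →* (WeightedL2 (m + 1) 0 ≃ₗᵢ[ℂ] WeightedL2 (m + 1) 0)}
  {ι₁ : SmoothSphere m →ₗ[ℂ] WeightedL2 m (j : ℝ)}
  {U₁ : SO0 (m + 1) →* (WeightedL2 m (j : ℝ) ≃ₗᵢ[ℂ] WeightedL2 m (j : ℝ))}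
  {D : SmoothSphere (m + 1) →ₗ[ℂ] SmoothSphere m}

/-- Both elements have the same integrals against compactly supported test functions off the origin.
Only the expression of `D` is used; the intertwining property enters in the equivariance. -/
theorem symbolAdjoint_apply (hm : 1 ≤ m) {C : ℕ → ℂ} (hC : C 0 = 1) (hj : 2 * j < m)
    (H₀ : IsUnitaryCompletion (m + 1) 0 ι₀ U₀) (H₁ : IsUnitaryCompletion m j ι₁ U₁)
    (hD : ∀ F, noncompact (0 + j) (D F) = normalOperator C j (noncompact 0 F))
    (F : SmoothSphere (m + 1)) : symbolAdjoint hm hC hj (ι₀ F) = ι₁ (D F) := by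
  rw [← sub_eq_zero]
  refine eq_zero_of_integral_eq_zero hm _ fun φ hφ h0 => ?_
  obtain ⟨hp, h1⟩ := integral_symbolAdjoint hm hC hj (ι₀ F) h0
  have h2 := integral_normalOperator_mul_fourier (hasTemperateGrowth_noncompact_zero F)
    (H₀.fourier F) C j hφ h0 hp
  have h3 := H₁.fourier (D F) φ h0
  have h4 := hD F
  rw [zero_add] at h4
  rw [h4, h2, ← h1] at h3
  calc ∫ ξ, (symbolAdjoint hm hC hj (ι₀ F) - ι₁ (D F) : WeightedL2 m (j : ℝ)) ξ * φ ξ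
      = ∫ ξ, (symbolAdjoint hm hC hj (ι₀ F) ξ * φ ξ - ι₁ (D F) ξ * φ ξ) := by
        refine integral_congr_ae ?_
        filter_upwards [(volume_absolutelyContinuous_weight hm (j : ℝ)).ae_eq
          (Lp.coeFn_sub (symbolAdjoint hm hC hj (ι₀ F)) (ι₁ (D F)))] with ξ hξ
        rw [hξ, Pi.sub_apply, sub_mul]
    _ = 0 := by
        rw [integral_sub (integrable_mul_schwartz hm _ h0) (integrable_mul_schwartz hm _ h0), h3,
          sub_self]

theorem symbolAdjoint_equivariant (hm : 1 ≤ m) {C : ℕ → ℂ} (hC : C 0 = 1) (hj : 2 * j < m)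
    (H₀ : IsUnitaryCompletion (m + 1) 0 ι₀ U₀) (H₁ : IsUnitaryCompletion m j ι₁ U₁)
    (hD : ∀ F, noncompact (0 + j) (D F) = normalOperator C j (noncompact 0 F))
    (hDh : ∀ (h : SO0 (m + 1)) F, D (principalSeries (m + 1) 0 (incl (m + 1) h) F) =
      principalSeries m (0 + j) h (D F)) (h : SO0 (m + 1)) (v : WeightedL2 (m + 1) 0) :
    symbolAdjoint hm hC hj (U₀ (incl (m + 1) h) v) = U₁ h (symbolAdjoint hm hC hj v) := by
  have h1 : (fun v => symbolAdjoint hm hC hj (U₀ (incl (m + 1) h) v)) =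
      fun v => U₁ h (symbolAdjoint hm hC hj v) := by
    refine H₀.dense.equalizer
      ((symbolAdjoint hm hC hj).continuous.comp (U₀ (incl (m + 1) h)).continuous)
      ((U₁ h).continuous.comp (symbolAdjoint hm hC hj).continuous) (funext fun F => ?_)
    have h2 := hDh h F
    rw [zero_add] at h2
    simp only [Function.comp_apply]
    rw [H₀.extends_action, symbolAdjoint_apply hm hC hj H₀ H₁ hD,
      symbolAdjoint_apply hm hC hj H₀ H₁ hD, H₁.extends_action, h2]
  exact congrFun h1 v

/-- Take adjoints in the equivariance of `symbolAdjoint`; both representations act by unitary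
operators. -/
theorem symbolIsometry_equivariant (hm : 1 ≤ m) {C : ℕ → ℂ} (hC : C 0 = 1) (hj : 2 * j < m)
    {h : SO0 (m + 1)}
    (hT : ∀ v, symbolAdjoint hm hC hj (U₀ (incl (m + 1) h) v) = U₁ h (symbolAdjoint hm hC hj v))
    (v : WeightedL2 m (j : ℝ)) :
    symbolIsometry hm hC hj (U₁ h v) = U₀ (incl (m + 1) h) (symbolIsometry hm hC hj v) := by
  have h1 : symbolMap hm C hj (U₁ h v) = U₀ (incl (m + 1) h) (symbolMap hm C hj v) := by
    refine ext_inner_right ℂ fun w => ?_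
    obtain ⟨w, rfl⟩ := (U₀ (incl (m + 1) h)).surjective w
    rw [← inner_symbolAdjoint hm hC hj, hT, LinearIsometryEquiv.inner_map_map,
      LinearIsometryEquiv.inner_map_map, inner_symbolAdjoint]
  have h2 : ∀ v, symbolIsometry hm hC hj v =
      ((Real.sqrt (symbolMass m C j).toReal : ℂ)⁻¹) • symbolMap hm C hj v := fun _ => rfl
  rw [h2, h2, h1, map_smul]

end

end LorentzBranching

/-- Write `m = n - 2`, so that `H = SO₀(n,1)` acts on `S^(n-1) = S^(m+1)` and
`H₁ = SO₀(n-1,1)` acts on `S^(n-2) = S^m`. -/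
theorem theorem6p4 (n m : ℕ) (hnm : n = m + 2) (hn : 2 < n) (hodd : Odd n)
    (j : ℕ) (hj : 1 ≤ j) (hjn : (j : ℝ) < ((n : ℝ) - 2) / 2) :
    -- the unitary representation `W₀` of `H`, completing `C^∞(S)` modulo the constants
    (∃ ι₀ U₀, LorentzBranching.IsUnitaryCompletion (m + 1) 0 ι₀ U₀ ∧
      LinearMap.ker ι₀ = LorentzBranching.constants (m + 1)) ∧
    -- the complementary series `C_j` of `H₁`
    (∃ ι₁ U₁, LorentzBranching.IsUnitaryCompletion m j ι₁ U₁ ∧ Function.Injective ι₁) ∧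
    -- the intertwining differential operator `D_{0,j}`
    (∃ D, LorentzBranching.IsIntertwiningDiffOp m 0 j D) ∧
    ∀ ι₀ U₀ ι₁ U₁ D, LorentzBranching.IsUnitaryCompletion (m + 1) 0 ι₀ U₀ →
      LorentzBranching.IsUnitaryCompletion m j ι₁ U₁ →
      LorentzBranching.IsIntertwiningDiffOp m 0 j D →
      -- `D_{0,j}` extends to a bounded `H₁`-equivariant operator from `W₀` onto `C_j`
      (∃ T : LorentzBranching.WeightedL2 (m + 1) 0 →L[ℂ] LorentzBranching.WeightedL2 m j,
        (∀ F, T (ι₀ F) = ι₁ (D F)) ∧ Function.Surjective T ∧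
        ∀ h v, T (U₀ (LorentzBranching.incl (m + 1) h) v) = U₁ h (T v)) ∧
      -- `C_j` is unitarily equivalent to a closed subrepresentation of `W₀` restricted to `H₁`
      ∃ S : LorentzBranching.WeightedL2 m j →ₗᵢ[ℂ] LorentzBranching.WeightedL2 (m + 1) 0,
        ∀ h v, S (U₁ h v) = U₀ (LorentzBranching.incl (m + 1) h) (S v) := by

  subst hnm
  have hm : Odd m := by
    rcases hodd with ⟨r, hr⟩
    exact ⟨r - 1, by omega⟩
  have hj2 : 2 * (j : ℝ) < m := by push_cast at hjn; linarith
  have hj' : 2 * j < m := by exact_mod_cast hj2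
  have hm1 : 1 ≤ m := by omega
  have hj0 : (1 : ℝ) ≤ j := by exact_mod_cast hj
  have H₀ : LorentzBranching.IsComplementary (m + 1) 0 :=
    ⟨by omega, le_rfl, by push_cast; positivity⟩
  -- The dimension condition `2 ≤ m` comes from `1 ≤ j` and `2 * j < m`.
  have H₁ : LorentzBranching.IsComplementary m j :=
    ⟨by omega, by positivity, by linarith⟩
  refine ⟨?_, ?_, ?_, ?_⟩
  · obtain ⟨U, hU⟩ := LorentzBranching.exists_isUnitaryCompletion H₀
    exact ⟨_, U, hU, LorentzBranching.ker_completion H₀⟩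
  · obtain ⟨U, hU⟩ := LorentzBranching.exists_isUnitaryCompletion H₁
    exact ⟨_, U, hU, LorentzBranching.injective_completion H₁ (by linarith)⟩
  · exact ⟨_, LorentzBranching.isIntertwiningDiffOp_sphereDiffOp hm j⟩
  · intro ι₀ U₀ ι₁ U₁ D h₀ h₁ hD
    obtain ⟨C, hC, hexp⟩ := hD.expression
    have hT := LorentzBranching.symbolAdjoint_equivariant hm1 hC hj' h₀ h₁ hexp hD.intertwines
    exact ⟨⟨LorentzBranching.symbolAdjoint hm1 hC hj',
      LorentzBranching.symbolAdjoint_apply hm1 hC hj' h₀ h₁ hexp,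
      LorentzBranching.surjective_symbolAdjoint hm1 hC hj', hT⟩,
      LorentzBranching.symbolIsometry hm1 hC hj', fun h v =>
        LorentzBranching.symbolIsometry_equivariant hm1 hC hj' (hT h) v⟩
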